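/- **Notation.** Let $\Lambda$ be the ring of symmetric functions over $\mathbb Q(q,t)$ (inverse limit of graded rings), with $\langle p_\lambda,p_\mu\rangle_{q,t}=\delta_{\lambda\mu}\prod_r r^{m_r}m_r!\prod_i\frac{1-q^{\lambda_i}}{1-t^{\lambda_i}}$, $m_r$ being the number of parts of $\lambda$ equal to $r$. Let $P_\lambda=P_\lambda(x;q,t)$ be the Macdonald functions: $P_\lambda-m_\lambda$ is a combination of the monomial functions $m_\mu$ with $\mu<\lambda$ in the dominance order, and $\langle P_\lambda,P_\mu\rangle_{q,t}=0$ for $\lambda\ne\mu$. Put $M_\mu(q,t)=h_\mu(q,t)P_\mu$ with $h_\mu(q,t)=\prod_{s\in\mu}(1-q^{a(s)}t^{\ell(s)+1})$ ($a,\ell$ the arm and leg lengths). Let $S_\lambda(x;t)$ be the dual basis of the Schur functions $s_\lambda$ for $\langle\,,\rangle_{0,t}$, let $S_\lambda(x;q,t)$ be the dual basis of $S_\lambda(x;t)$ for $\langle\,,\rangle_{q,t}$, and define $K_{\lambda\mu}(q,t)\in\mathbb Q(q,t)$ by $M_\mu(x;q,t)=\sum_\lambda K_{\lambda\mu}(q,t)S_\lambda(x;t)$.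 Let $a_n$ ($n\in\mathbb Z\setminus\{0\}$) satisfy $[a_n,a_m]=n\frac{1-q^{|n|}}{1-t^{|n|}}\delta_{n+m,0}$, let $|0\rangle$ and $\langle 0|$ be the vacuum and its dual, $a_n|0\rangle=0=\langle0|a_{-n}$ for $n>0$, $\langle0|0\rangle=1$, and $\mathcal F=\mathbb Q(q,t)[a_{-1},a_{-2},\dots]|0\rangle$, $\mathcal F^*=\langle0|\mathbb Q(q,t)[a_1,a_2,\dots]$. For $f\in\Lambda$ let $|f\rangle\in\mathcal F$ and $\langle f|\in\mathcal F^*$ be determined by $\langle 0|\exp\big(\sum_{n\ge1}\frac{1-t^n}{1-q^n}\frac{a_n}{n}p_n\big)|f\rangle=f=\langle f|\exp\big(\sum_{n\ge1}\frac{1-t^n}{1-q^n}\frac{a_{-n}}{n}p_n\big)|0\rangle$. For real $0<q,t<1$, where $P_\lambda$ denotes the Macdonald function over $\mathbb R$ at these parameters, put $(a;q)_\infty=\prod_{k\ge0}(1-aq^k)$, $\overline x=(1/x_1,1/x_2,\dots)$, $$\Delta(x;q,t)=\prod_{i\ne j}\frac{(x_i/x_j;q)_\infty}{(tx_i/x_j;q)_\infty},\qquad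 \Pi(x,y;q,t)=\prod_{i,j}\frac{(tx_iy_j;q)_\infty}{(x_iy_j;q)_\infty},$$ $$\langle f,g\rangle'_{n;q,t}=\frac1{n!}\oint\prod_{j=1}^n\frac{dx_j}{2\pi i x_j}\,f(\overline x)g(x)\Delta(x;q,t)\quad(|x_j|=1).$$ Every partition is uniquely $\nu=(s_N^{r_N})+\cdots+(s_1^{r_1})$ with $r_N>\dots>r_1\ge1$, $s_a\ge1$ ($N=0$ and $r_0=0$ if $\nu=\varnothing$). With $\nu^{(a)}=(s_a^{r_a})+\cdots+(s_1^{r_1})$ put $$C^+_\nu(q,t)=\prod_{a=1}^N\frac{\langle P_{\nu^{(a)}},P_{\nu^{(a)}}\rangle_{q,t}}{r_a!\,\langle P_{\nu^{(a)}},P_{\nu^{(a)}}\rangle'_{r_a;q,t}},\qquad C^-_\nu(q,t)=\frac{C^+_\nu(q,t)}{\langle P_\nu,P_\nu\rangle_{q,t}},$$ and, for $x^N=(x^N_1,\dots,x^N_{r_N})$, $$G_\nu(x^N;q,t)=\Delta(x^N;q,t)\prod_{j=1}^{r_N}(x_j^N)^{s_N}\oint\prod_{a=1}^{N-1}\prod_{j=1}^{r_a}\frac{dx^a_j}{2\pi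 i x^a_j}(x^a_j)^{s_a}\cdot\prod_{a=1}^{N-1}\Pi(x^{a+1},\overline{x^a};q,t)\,\Delta(x^a;q,t),$$ ($G_\varnothing=1$), $F^+_\nu(x;q,t)=C^+_\nu(q,t)\,G_\nu(x;q,t)$ and $F^-_{\nu}(x;q,t)=C^-_{\nu'}(t,q)\,G_{\nu'}(x;t,q)$, where $\nu'$ is the conjugate of $\nu$. Here $F^+_\nu$ has $\ell(\nu)$ variables and $F^-_\nu$ has $\ell(\nu')=\nu_1$ variables. The contours are circles $|x^a_j|=R_a$ with $R_1>R_2>\dots>R_N>0$ (for the decomposition of $\nu$, respectively of $\nu'$). **Theorem 3.10.** Let $\lambda,\mu$ be partitions. Then in $\mathbb Q(q,t)$ $$K_{\lambda\mu}(q,t)=\langle S_\lambda(q,t)|M_\mu(q,t)\rangle .$$ Moreover, for all real $0<q<1$ and $0<t<1$ the rational function $K_{\lambda\mu}$ is regular at $(q,t)$, and its value there is $$K_{\lambda\mu}(q,t)=h_\mu(q,t)\oint\prod_{j=1}^{\ell(\lambda)}\frac{dx_j}{2\pi i x_j}x_j^{-\lambda_j}\prod_{j=1}^{\ell(\mu)}\frac{dy_j}{2\pi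 i y_j}\prod_{i<j}(1-x_j/x_i)\prod_{i,j}\frac1{(x_i/y_j;q)_\infty}\,F^+_\mu(y;q,t)$$ $$=h_\mu(q,t)\oint\prod_{j=1}^{\ell(\lambda)}\frac{dx_j}{2\pi i x_j}x_j^{-\lambda_j}\prod_{j=1}^{\mu_1}\frac{dy_j}{2\pi i y_j}\prod_{i<j}(1-x_j/x_i)\prod_{i,j}(-x_i/y_j;t)_\infty\,F^-_\mu(y;q,t).$$ The $y_j$ run over the innermost circle $|y_j|=R_N$ of the respective family of contours, and the $x_j$ over a circle $|x_j|=\rho$ with $\rho>0$, where in the first integral $\rho<R_N$; the identities hold for every such choice of radii. -/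

import Mathlib

open scoped Classical

noncomputable section

namespace Macdonald

/-! ### Partitions, as Young diagrams -/

/-- `lam ≥ mu` in the natural (dominance) order: `|lam| = |mu|` and
`lam_1 + ⋯ + lam_r ≥ mu_1 + ⋯ + mu_r` for all `r`. -/
def Dominates (lam mu : YoungDiagram) : Prop :=
  lam.card = mu.card ∧
    ∀ r : ℕ, ∑ i ∈ Finset.range r, mu.rowLen i ≤ ∑ i ∈ Finset.range r, lam.rowLen i

/-- The partition `(s_a^{r_a}) + ⋯ + (s_1^{r_1})`, i.e. the diagram whose row `i` (counted from 0)
has length `∑_{1 ≤ b ≤ a, i < r_b} s_b`. -/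
def rectSum (r s : ℕ → ℕ) (a : ℕ) : YoungDiagram where
  cells := ((Finset.range (∑ b ∈ Finset.Icc 1 a, r b)) ×ˢ
      (Finset.range (∑ b ∈ Finset.Icc 1 a, s b))).filter
    fun c => c.2 < ∑ b ∈ Finset.Icc 1 a, if c.1 < r b then s b else 0
  isLowerSet := by
    rintro ⟨i, j⟩ ⟨i', j'⟩ ⟨hi, hj⟩ h
    simp only [Finset.coe_filter, Finset.mem_product, Finset.mem_range, Set.mem_ofPred_eq] at h ⊢
    simp only at hi hj
    refine ⟨⟨lt_of_le_of_lt hi h.1.1, lt_of_le_of_lt hj h.1.2⟩, ?_⟩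
    refine lt_of_le_of_lt hj (lt_of_lt_of_le h.2 (Finset.sum_le_sum fun b _ => ?_))
    split_ifs with h1 h2
    · exact le_rfl
    · exact absurd (lt_of_le_of_lt hi h1) h2
    · exact Nat.zero_le _
    · exact le_rfl

/-- The bounding box in the definition of `rectSum` is no restriction. -/
theorem mem_rectSum (r s : ℕ → ℕ) (a i j : ℕ) :
    (i, j) ∈ rectSum r s a ↔ j < ∑ b ∈ Finset.Icc 1 a, if i < r b then s b else 0 := by
  rw [← YoungDiagram.mem_cells]
  simp only [rectSum, Finset.mem_filter, Finset.mem_product, Finset.mem_range,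
    and_iff_right_iff_imp]
  intro h
  refine ⟨?_, lt_of_lt_of_le h (Finset.sum_le_sum fun b _ => by split_ifs <;> simp)⟩
  by_contra hc
  have h0 : ∑ b ∈ Finset.Icc 1 a, (if i < r b then s b else 0) = 0 := by
    refine Finset.sum_eq_zero fun b hb => if_neg ?_
    have := Finset.single_le_sum (f := r) (fun _ _ => Nat.zero_le _) hb
    omega
  omega

/-- `mu = (s_M^{r_M}) + ⋯ + (s_1^{r_1})` with `r_M > ⋯ > r_1 ≥ 1` and all `s_a ≥ 1`: the
decomposition of a diagram into rectangles. The value `r 0` is fixed to be `0`, so that `r M` is the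
number of parts also when `mu` is empty, where `M = 0`. -/
def IsRectDecomposition (mu : YoungDiagram) (M : ℕ) (r s : ℕ → ℕ) : Prop :=
  r 0 = 0 ∧ (∀ a < M, r a < r (a + 1)) ∧ (∀ a, 1 ≤ a → a ≤ M → 1 ≤ s a) ∧ mu = rectSum r s M

section Algebra

variable {k : Type*} [Field k]

/-- `h_mu(q,t) = ∏_{c ∈ mu} (1 - q^{a(c)} t^{ℓ(c)+1})` with arm length `a` and leg length `ℓ`. -/
def hookFactor (q t : k) (mu : YoungDiagram) : k :=
  ∏ c ∈ mu.cells, (1 - q ^ (mu.rowLen c.1 - (c.2 + 1)) * t ^ (mu.colLen c.2 - (c.1 + 1) + 1))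

/-- `z_mu(q,t) = ∏_r r^{m_r} m_r! · ∏_i (1 - q^{mu_i}) / (1 - t^{mu_i})`. -/
def zFactor (q t : k) (mu : YoungDiagram) : k :=
  (∏ r ∈ mu.rowLens.toFinset,
      (r : k) ^ (mu.rowLens.count r) * ((mu.rowLens.count r).factorial : k)) *
    (mu.rowLens.map fun r => (1 - q ^ r) / (1 - t ^ r)).prod

/-! ### The ring of symmetric functions -/

variable (k) in
/-- The ring `Λ_k` of symmetric functions in infinitely many variables: the formal power series in
`x_0, x_1, …` that are invariant under permutations of the variables and have bounded degree
(this is the inverse limit of the rings of symmetric polynomials as graded rings). -/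
def SymFun : Subalgebra k (MvPowerSeries ℕ k) where
  carrier := {f | (∀ e : Equiv.Perm ℕ, MvPowerSeries.renameEquiv k e f = f) ∧
    ∃ N : ℕ, ∀ d : ℕ →₀ ℕ, N < d.degree → MvPowerSeries.coeff d f = 0}
  mul_mem' := by
    rintro f g ⟨hf, N, hN⟩ ⟨hg, M, hM⟩
    refine ⟨fun e => by rw [map_mul, hf, hg], N + M, fun d hd => ?_⟩
    rw [MvPowerSeries.coeff_mul]
    refine Finset.sum_eq_zero fun p hp => ?_
    have hdeg : p.1.degree + p.2.degree = d.degree := by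
      rw [← Finset.HasAntidiagonal.mem_antidiagonal.mp hp, map_add]
    rcases lt_or_ge N p.1.degree with h | h
    · rw [hN _ h, zero_mul]
    · rw [hM _ (by omega), mul_zero]
  add_mem' := by
    rintro f g ⟨hf, N, hN⟩ ⟨hg, M, hM⟩
    refine ⟨fun e => by rw [map_add, hf, hg], N + M, fun d hd => ?_⟩
    rw [map_add, hN _ (by omega), hM _ (by omega), add_zero]
  algebraMap_mem' := by
    intro c
    refine ⟨fun e => AlgEquiv.commutes _ _, 0, fun d hd => ?_⟩
    rw [MvPowerSeries.algebraMap_apply, MvPowerSeries.coeff_C, if_neg]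
    rintro rfl
    simp at hd

/-- A power series whose coefficients do not change when the variables are permuted and vanish in
large degree, as a symmetric function. -/
def SymFun.ofCoeff (c : (ℕ →₀ ℕ) → k)
    (hc : ∀ (e : Equiv.Perm ℕ) (d : ℕ →₀ ℕ), c (d.embDomain e.toEmbedding) = c d)
    (hb : ∃ N : ℕ, ∀ d : ℕ →₀ ℕ, N < d.degree → c d = 0) : SymFun k :=
  ⟨(c : MvPowerSeries ℕ k), by
    refine ⟨fun e => ?_, hb⟩
    let f : MvPowerSeries ℕ k := c
    ext d
    obtain ⟨d', rfl⟩ : ∃ d' : ℕ →₀ ℕ, d = d'.embDomain e.toEmbedding := by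
      refine ⟨d.embDomain e.symm.toEmbedding, ?_⟩
      ext i
      obtain ⟨j, rfl⟩ := e.surjective i
      rw [← Equiv.coe_toEmbedding, Finsupp.embDomain_apply_self]
      have h := Finsupp.embDomain_apply_self e.symm.toEmbedding d (e j)
      simpa using h.symm
    exact (MvPowerSeries.coeff_embDomain_rename e.toEmbedding f d').trans (hc e d').symm⟩

/-- The monomial symmetric function `m_mu`: the sum of the distinct monomials whose nonzero
exponents are the parts of `mu`. -/
def monomialSymm (mu : YoungDiagram) : SymFun k :=
  SymFun.ofCoeff (fun d => if d.support.val.map d = (mu.rowLens : Multiset ℕ) then 1 else 0)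
    (fun e d => by
      have : (d.embDomain e.toEmbedding).support.val.map (d.embDomain e.toEmbedding)
          = d.support.val.map d := by
        rw [Finsupp.support_embDomain, Finset.map_val, Multiset.map_map]
        exact Multiset.map_congr rfl fun i _ => Finsupp.embDomain_apply_self _ _ _
      rw [this])
    ⟨mu.rowLens.sum, fun d hd => if_neg fun h => by
      have h' := congrArg Multiset.sum h
      rw [Multiset.sum_coe] at h'
      have : d.degree = (d.support.val.map d).sum := rfl
      omega⟩

/-- The power sum `p_r = ∑_i x_i^r` (used for `r ≥ 1`). -/
def powerSum (r : ℕ) : SymFun k :=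
  SymFun.ofCoeff (fun d => if ∃ i, d = Finsupp.single i r then 1 else 0)
    (fun e d => by
      refine if_congr ⟨?_, ?_⟩ rfl rfl
      · rintro ⟨i, hi⟩
        obtain ⟨j, rfl⟩ := e.surjective i
        refine ⟨j, Finsupp.embDomain_injective e.toEmbedding ?_⟩
        rw [hi, Finsupp.embDomain_single]; rfl
      · rintro ⟨i, rfl⟩
        exact ⟨e i, by rw [Finsupp.embDomain_single]; rfl⟩)
    ⟨r, fun d hd => if_neg fun ⟨i, hi⟩ => by
      rw [hi, Finsupp.degree_single] at hd
      exact lt_irrefl _ hd⟩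

/-- The complete symmetric function `h_r`, the sum of all monomials of degree `r`;
it is `0` for `r < 0`. -/
def completeSymm (r : ℤ) : SymFun k :=
  SymFun.ofCoeff (fun d => if (d.degree : ℤ) = r then 1 else 0)
    (fun e d => by
      have : (d.embDomain e.toEmbedding).degree = d.degree := by
        rw [Finsupp.degree_apply, Finsupp.degree_apply, Finsupp.support_embDomain, Finset.sum_map]
        exact Finset.sum_congr rfl fun i _ => Finsupp.embDomain_apply_self _ _ _
      rw [this])
    ⟨r.toNat, fun d hd => if_neg fun h => by omega⟩

/-- `p_mu = p_{mu_1} p_{mu_2} ⋯`. -/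
def powerSumProd (mu : YoungDiagram) : SymFun k := (mu.rowLens.map powerSum).prod

/-- The Schur function `s_lam = det (h_{lam_i - i + j})`. -/
def schur (lam : YoungDiagram) : SymFun k :=
  Matrix.det (Matrix.of fun i j : Fin (lam.colLen 0) =>
    (completeSymm ((lam.rowLen i : ℤ) - (i : ℤ) + (j : ℤ)) : SymFun k))

/-- The scalar product `⟨ , ⟩_{q,t}`: the bilinear form on `Λ_k` with
`⟨p_lam, p_mu⟩ = δ_{lam,mu} z_lam(q,t)` (unique when `k` has characteristic zero, since the `p_lam`
are then a basis of `Λ_k`). -/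
def scalarProduct (q t : k) : LinearMap.BilinForm k (SymFun k) :=
  Classical.epsilon fun B : LinearMap.BilinForm k (SymFun k) =>
    ∀ lam mu : YoungDiagram,
      B (powerSumProd lam) (powerSumProd mu) = if lam = mu then zFactor q t lam else 0

/-! ### Macdonald functions, dual bases, Kostka coefficients -/

/-- The two properties that characterize the family of Macdonald functions. -/
def IsMacdonaldFamily (q t : k) (P : YoungDiagram → SymFun k) : Prop :=
  (∀ lam, P lam - monomialSymm lam ∈
    Submodule.span k (monomialSymm '' {mu | Dominates lam mu ∧ mu ≠ lam})) ∧
  ∀ lam mu, lam ≠ mu → scalarProduct q t (P lam) (P mu) = 0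

/-- The Macdonald functions `P_lam(x;q,t)`. -/
def macdonaldP (q t : k) : YoungDiagram → SymFun k :=
  Classical.epsilon (IsMacdonaldFamily q t)

/-- `M_mu(x;q,t) = h_mu(q,t) P_mu(x;q,t)`. -/
def macdonaldM (q t : k) (mu : YoungDiagram) : SymFun k :=
  hookFactor q t mu • macdonaldP q t mu

/-- The family dual to `v` with respect to the bilinear form `B`. -/
def dualFamily (B : LinearMap.BilinForm k (SymFun k)) (v : YoungDiagram → SymFun k) :
    YoungDiagram → SymFun k :=
  Classical.epsilon fun w : YoungDiagram → SymFun k =>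
    ∀ lam mu, B (w lam) (v mu) = if lam = mu then 1 else 0

/-- `S_lam(x;t)`, the dual base of the Schur functions with respect to `⟨ , ⟩_{0,t}`. -/
def bigSchur (t : k) : YoungDiagram → SymFun k :=
  dualFamily (scalarProduct 0 t) schur

/-- `S_lam(x;q,t)`, the dual base of `S_lam(x;t)` with respect to `⟨ , ⟩_{q,t}`. -/
def bigSchurQT (q t : k) : YoungDiagram → SymFun k :=
  dualFamily (scalarProduct q t) (bigSchur t)

/-- The coefficients `K_{lam mu}(q,t)` in `M_mu(x;q,t) = ∑_lam K_{lam mu}(q,t) S_lam(x;t)`. -/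
def kostka (q t : k) (lam mu : YoungDiagram) : k :=
  (Classical.epsilon fun c : YoungDiagram →₀ k =>
    macdonaldM q t mu = c.sum fun nu a => a • bigSchur t nu) lam

/-! ### The boson Fock space

The vector space of states is `k[a_{-1}, a_{-2}, …]|0⟩`; the variable `X n` stands for `a_{-n}`. -/

variable (k) in
/-- The Fock space. -/
abbrev Fock : Type _ := MvPolynomial ℕ+ k

variable (k) in
/-- The vacuum vector `|0⟩`. -/
def vacuum : Fock k := 1

variable (k) in
/-- The dual vacuum `⟨0|`. -/
def vacuumDual : Fock k →ₗ[k] k := MvPolynomial.lcoeff k 0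

/-- The operator `a_{-n}`, `n ≥ 1`. -/
def creation (n : ℕ+) : Module.End k (Fock k) := LinearMap.mulLeft k (MvPolynomial.X n)

/-- The operator `a_n`, `n ≥ 1`. -/
def annihilation (q t : k) (n : ℕ+) : Module.End k (Fock k) :=
  ((n : k) * ((1 - q ^ (n : ℕ)) / (1 - t ^ (n : ℕ)))) •
    (MvPolynomial.pderiv (R := k) n).toLinearMap

/-- The oscillators satisfy `[a_n, a_{-m}] = n (1 - q^n) / (1 - t^n) δ_{n,m}`. -/
theorem commutator_annihilation_creation (q t : k) (n m : ℕ+) :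
    annihilation q t n * creation m - creation m * annihilation q t n =
      if n = m then
        ((n : k) * ((1 - q ^ (n : ℕ)) / (1 - t ^ (n : ℕ)))) • (1 : Module.End k (Fock k))
      else 0 := by
  refine LinearMap.ext fun f => ?_
  by_cases h : n = m
  · subst h
    simp [annihilation, creation, Module.End.mul_apply, smul_add]
  · simp [annihilation, creation, Module.End.mul_apply, h, MvPolynomial.pderiv_X,
      Ne.symm h]

/-- The monomial `∏_n A_n^{d_n}` in a commuting family of operators. -/
def opMonomial (A : ℕ+ → Module.End k (Fock k)) (d : ℕ+ →₀ ℕ) : Module.End k (Fock k) :=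
  ((d.support.sort (· ≤ ·)).map fun n => A n ^ d n).prod

/-- A polynomial in a commuting family of operators. -/
def opPoly (A : ℕ+ → Module.End k (Fock k)) (f : MvPolynomial ℕ+ k) : Module.End k (Fock k) :=
  ∑ d ∈ f.support, f.coeff d • opMonomial A d

variable (k) in
/-- The coefficient and power sum part of the terms of
`exp (∑_n (1-t^n)/(1-q^n) (a_{±n}/n) p_n) = ∑_d ∏_n ((1-t^n)/((1-q^n) n))^{d_n} / d_n! · a^d p^d`;
here `d` runs over the finitely supported exponents. -/
def expTerm (q t : k) (d : ℕ+ →₀ ℕ) : SymFun k :=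
  (d.prod fun n m => ((1 - t ^ (n : ℕ)) / ((1 - q ^ (n : ℕ)) * (n : k))) ^ m / (m.factorial : k)) •
    d.prod fun n m => powerSum (n : ℕ) ^ m

/-- `ι(|f⟩) = ⟨0| C(x) |f⟩` with `C(x) = exp (∑_n (1-t^n)/(1-q^n) (a_n/n) p_n)`. -/
def iota (q t : k) (v : Fock k) : SymFun k :=
  ∑ᶠ d : ℕ+ →₀ ℕ, vacuumDual k (opMonomial (annihilation q t) d v) • expTerm k q t d

/-- `ι^*(⟨f|) = ⟨f| C^*(x) |0⟩` with `C^*(x) = exp (∑_n (1-t^n)/(1-q^n) (a_{-n}/n) p_n)`. -/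
def iotaStar (q t : k) (phi : Fock k →ₗ[k] k) : SymFun k :=
  ∑ᶠ d : ℕ+ →₀ ℕ, phi (opMonomial creation d (vacuum k)) • expTerm k q t d

variable (k) in
/-- The dual Fock space `⟨0| k[a_1, a_2, …]`. -/
def DualFock (q t : k) : Set (Fock k →ₗ[k] k) :=
  Set.range fun f : MvPolynomial ℕ+ k => vacuumDual k ∘ₗ opPoly (annihilation q t) f

/-- The vector `|f⟩` with `ι(|f⟩) = f`. -/
def ket (q t : k) (f : SymFun k) : Fock k :=
  Classical.epsilon fun v : Fock k => iota q t v = f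

/-- The dual vector `⟨f|` with `ι^*(⟨f|) = f`. -/
def bra (q t : k) (f : SymFun k) : Fock k →ₗ[k] k :=
  Classical.epsilon fun phi : Fock k →ₗ[k] k => phi ∈ DualFock k q t ∧ iotaStar q t phi = f

/-- `⟨f|g⟩`. -/
def bracket (q t : k) (f g : SymFun k) : k := bra q t f (ket q t g)

end Algebra

/-! ### The field of rational functions in two indeterminates -/

/-- The field `ℚ(q,t)`. -/
abbrev Qqt : Type := FractionRing (MvPolynomial (Fin 2) ℚ)

/-- The indeterminate `q`. -/
def qInd : Qqt := algebraMap (MvPolynomial (Fin 2) ℚ) Qqt (MvPolynomial.X 0)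

/-- The indeterminate `t`. -/
def tInd : Qqt := algebraMap (MvPolynomial (Fin 2) ℚ) Qqt (MvPolynomial.X 1)

/-- The rational function `f` is regular at the point `(q,t)` and takes the value `v` there. -/
def HasValueAt (f : Qqt) (q t v : ℂ) : Prop :=
  ∃ num den : MvPolynomial (Fin 2) ℚ,
    MvPolynomial.aeval ![q, t] den ≠ 0 ∧
    f = algebraMap _ Qqt num / algebraMap _ Qqt den ∧
    v = MvPolynomial.aeval ![q, t] num / MvPolynomial.aeval ![q, t] den

/-! ### Contour integrals -/

/-- `∮ ∏_j dx_j / (2πi x_j) · f(x)`, every `x_j` running over the circle `|x_j| = R`. -/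
def torusMean (n : ℕ) (R : ℝ) (f : (Fin n → ℂ) → ℂ) : ℂ :=
  torusIntegral (fun x => (∏ j, 1 / (2 * (Real.pi : ℂ) * Complex.I * x j)) * f x)
    0 (fun _ => R)

/-- `(a;q)_∞ = ∏_{k ≥ 0} (1 - a q^k)`. -/
def qPoch (a q : ℂ) : ℂ := ∏' m : ℕ, (1 - a * q ^ m)

/-- `Δ(x;q,t) = ∏_{i ≠ j} (x_i/x_j;q)_∞ / (t x_i/x_j;q)_∞`. -/
def weight (q t : ℂ) {n : ℕ} (x : Fin n → ℂ) : ℂ :=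
  ∏ i, ∏ j ∈ Finset.univ.filter (fun j => j ≠ i),
    qPoch (x i / x j) q / qPoch (t * x i / x j) q

/-- `Π(x,y;q,t) = ∏_{i,j} (t x_i y_j;q)_∞ / (x_i y_j;q)_∞`. -/
def cauchyKernel (q t : ℂ) {n m : ℕ} (x : Fin n → ℂ) (y : Fin m → ℂ) : ℂ :=
  ∏ i, ∏ j, qPoch (t * x i * y j) q / qPoch (x i * y j) q

/-- The value `f(x_1, …, x_n, 0, 0, …)` of a symmetric function with real coefficients at a complex
point (a finite sum). -/
def evalFin (f : SymFun ℝ) {n : ℕ} (x : Fin n → ℂ) : ℂ :=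
  ∑ᶠ d : Fin n →₀ ℕ,
    ((MvPowerSeries.coeff d (MvPowerSeries.killCompl Fin.valEmbedding (f : MvPowerSeries ℕ ℝ)) :
      ℝ) : ℂ) * ∏ i, x i ^ d i

/-- `⟨f,g⟩'_{n;q,t} = (1/n!) ∮ ∏_j dx_j/(2πi x_j) f(1/x) g(x) Δ(x;q,t)` over the unit torus. -/
def scalarProductFin (n : ℕ) (q t : ℝ) (f g : SymFun ℝ) : ℂ :=
  1 / (n.factorial : ℂ) *
    torusMean n 1 fun x => evalFin f (fun i => (x i)⁻¹) * evalFin g x * weight q t x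

/-- `C^+_lam(q,t) = ∏_a ⟨P_{lam^(a)}, P_{lam^(a)}⟩_{q,t} / (r_a! ⟨P_{lam^(a)}, P_{lam^(a)}⟩'_{r_a;q,t})`
for `lam = (s_M^{r_M}) + ⋯ + (s_1^{r_1})` and `lam^(a) = (s_a^{r_a}) + ⋯ + (s_1^{r_1})`. -/
def cPlus (q t : ℝ) (r s : ℕ → ℕ) (M : ℕ) : ℂ :=
  ∏ a ∈ Finset.Icc 1 M,
    ((scalarProduct q t (macdonaldP q t (rectSum r s a)) (macdonaldP q t (rectSum r s a)) : ℝ) : ℂ) /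
      (((r a).factorial : ℂ) *
        scalarProductFin (r a) q t (macdonaldP q t (rectSum r s a))
          (macdonaldP q t (rectSum r s a)))

/-- `C^-_lam(q,t) = C^+_lam(q,t) / ⟨P_lam, P_lam⟩_{q,t}`. -/
def cMinus (q t : ℝ) (r s : ℕ → ℕ) (M : ℕ) : ℂ :=
  cPlus q t r s M /
    ((scalarProduct q t (macdonaldP q t (rectSum r s M)) (macdonaldP q t (rectSum r s M)) : ℝ) : ℂ)

/-- The iterated integral over the layers `x^1, …, x^a`, as a function of `x = x^{a+1}`:
`∮ ∏_{b ≤ a} ∏_j dx^b_j/(2πi x^b_j) (x^b_j)^{s_b} · ∏_{b ≤ a} Π(x^{b+1}, 1/x^b;q,t) Δ(x^b;q,t)`,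
the layer `x^b` having `r_b` variables on the circle of radius `R_b`. -/
def layers (q t : ℂ) (r s : ℕ → ℕ) (R : ℕ → ℝ) : ℕ → {n : ℕ} → (Fin n → ℂ) → ℂ
  | 0, _, _ => 1
  | a + 1, _, x => torusMean (r (a + 1)) (R (a + 1)) fun y =>
      (∏ j, y j ^ s (a + 1)) * cauchyKernel q t x (fun j => (y j)⁻¹) * weight q t y *
        layers q t r s R a y

/-- `F^+_lam(y;q,t)` for `lam = (s_M^{r_M}) + ⋯ + (s_1^{r_1})`, in the `r_M` variables `y = x^M`. -/
def FPlus (q t : ℝ) (r s : ℕ → ℕ) (R : ℕ → ℝ) (M : ℕ) (y : Fin (r M) → ℂ) : ℂ :=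
  cPlus q t r s M * weight q t y * (∏ j, y j ^ s M) * layers q t r s R (M - 1) y

/-- `F^-_{lam'}(y;q,t)` for the conjugate `lam'` of `lam = (s_M^{r_M}) + ⋯ + (s_1^{r_1})`, in the
`r_M` variables `y = x^M`; the roles of `q` and `t` are interchanged. -/
def FMinus (q t : ℝ) (r s : ℕ → ℕ) (R : ℕ → ℝ) (M : ℕ) (y : Fin (r M) → ℂ) : ℂ :=
  cMinus t q r s M * weight t q y * (∏ j, y j ^ s M) * layers t q r s R (M - 1) y

/-- The contours of the successive layers are nested circles, `R_1 > R_2 > ⋯ > R_M > 0`. -/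
def NestedRadii (M : ℕ) (R : ℕ → ℝ) : Prop :=
  (∀ a ≤ M, 0 < R a) ∧ ∀ a, 1 ≤ a → a < M → R (a + 1) < R a

/-- `∏_j x_j^{-lam_j} · ∏_{i<j} (1 - x_j/x_i)`. -/
def schurFactor (lam : YoungDiagram) (x : Fin (lam.colLen 0) → ℂ) : ℂ :=
  (∏ j, x j ^ (-(lam.rowLen j : ℤ))) *
    ∏ i, ∏ j ∈ Finset.univ.filter (fun j => i < j), (1 - x j / x i)

end Macdonald

end

/-! ### Diagrams, exponents and the monomial basis -/

namespace Macdonald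

/-! ### Young diagrams and exponents -/

/-! The algebraic half is duality of bases. Symmetric functions in characteristic zero are
polynomials in the power sums (`toSymFun`), and in these coordinates every scalar product in play is
a diagonal form `pairing`, determined by one weight for each `p_n`. The Fock space is the same
polynomial ring with `a_{-n}` in place of `p_n`, and the exponentials in `iota` and `iotaStar` carry
exactly the inverse norms of the monomials. Hence the bracket is `⟨ , ⟩_{q,t}`
(`bracket_eq_scalarProduct`), and pairing `M_mu` with the dual basis of `S_lam(x;t)` reads off the
coefficient `K_{lam mu}`.

For the integrals, pairing with a product of coefficients of `exp (∑ w_n p_n z^n / n)` extracts a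
monomial coefficient after a rescaling of the `p_n` (`pairing_expProd`). With the Jacobi-Trudi
determinant this gives `K_{lam mu} = h_mu L_lam(P_mu with p_n replaced by p_n / (1 - t^n))`, where
`L_lam` is the coefficient of `x^lam` in `f ∏_{i<j} (1 - x_j/x_i)`. The contour integral in `x`
against `schurFactor` is `L_lam` (`torusMean_schurFactor`), so what remains is to produce the
rescaled `P_mu` by the integrals in the other variables.

The Macdonald function is constructed as `macFun`: `m_lam` minus its orthogonal projection to the
span of the lower `m_mu`. Its coefficients come from inverting a Gram matrix, which for real `0 < q,
t < 1` is positive definite; hence they are regular there. Orthogonality for incomparable partitions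
comes from the Macdonald operator `opE`, which is self-adjoint and triangular with generically
distinct eigenvalues. At particular real parameters eigenvalues may coincide, so orthogonality is
specialized from the generic field.

The same operator is self-adjoint for the torus product: in `n` variables it is a combination of the
shifts `x_i ↦ q x_i`, and each shift is undone by moving one contour (`torusMean_shift`,
`torusForm_opE`). So the `P_lam` are orthogonal on the torus too, and the functionals `⟨·, P_lam⟩'`
and `⟨·, P_lam⟩` are proportional (`torusProduct_macFun_right`). Expanding a kernel `∏ (b
x_i/y_j;q)_∞ / (a x_i/y_j;q)_∞` by the `q`-binomial theorem, one finds that integrating it against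
`P_lam` returns `P_lam` in the variables `x`, rescaled, times the ratio of the two norms
(`torusMean_kernel`).

With `Π` as kernel the rescaling is trivial, so integration only changes the number of variables;
multiplication by `(x_1 ⋯ x_n)^s` adds `s` columns of length `n` (`ev_macFun_add_columns`).
Alternating the two steps builds `P_mu` one rectangle at a time, and `C^+` cancels the norm ratios
(`layers_eq`, `prod_pow_mul_layers`). A last integration against `1 / (x_i/y_j;q)_∞` produces `p_n ↦
p_n / (1 - t^n)`. The second formula runs the construction for `mu'` with `q` and `t` exchanged, and
the kernel `(-x_i/y_j;t)_∞` brings it back through the duality `scale_dualWeight_macFun`; the norm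
in that duality is the one divided out in `C^-`. -/

theorem diagram_ext {lam mu : YoungDiagram} (h : ∀ i, lam.rowLen i = mu.rowLen i) : lam = mu := by
  ext ⟨i, j⟩
  rw [YoungDiagram.mem_cells, YoungDiagram.mem_cells, YoungDiagram.mem_iff_lt_rowLen,
    YoungDiagram.mem_iff_lt_rowLen, h i]

theorem rowLen_eq_zero_iff (lam : YoungDiagram) (i : ℕ) : lam.rowLen i = 0 ↔ lam.colLen 0 ≤ i := by
  rw [← not_iff_not, not_le, ← YoungDiagram.mem_iff_lt_colLen, YoungDiagram.mem_iff_lt_rowLen]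
  omega

/-- The row lengths of a diagram, as an exponent. -/
noncomputable def expo (lam : YoungDiagram) : ℕ →₀ ℕ :=
  Finsupp.onFinset (Finset.range (lam.colLen 0)) lam.rowLen fun i hi => by
    rw [Finset.mem_range]
    by_contra hc
    exact hi ((rowLen_eq_zero_iff lam i).mpr (not_lt.mp hc))

@[simp]
theorem expo_apply (lam : YoungDiagram) (i : ℕ) : expo lam i = lam.rowLen i := rfl

theorem support_expo (lam : YoungDiagram) : (expo lam).support = Finset.range (lam.colLen 0) := by
  ext i
  rw [Finsupp.mem_support_iff, Finset.mem_range, expo_apply, ne_eq, rowLen_eq_zero_iff, not_le]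

/-- The multiset of the nonzero values of an exponent. -/
noncomputable def parts {σ : Type*} (d : σ →₀ ℕ) : Multiset ℕ := d.support.val.map d

theorem parts_expo (lam : YoungDiagram) : parts (expo lam) = (lam.rowLens : Multiset ℕ) := by
  rw [parts, support_expo]
  rfl

theorem sum_parts {σ : Type*} (d : σ →₀ ℕ) : (parts d).sum = d.degree := rfl

theorem card_parts {σ : Type*} (d : σ →₀ ℕ) : (parts d).card = d.support.card := by
  simp [parts]

theorem pos_of_mem_parts {σ : Type*} {d : σ →₀ ℕ} {x : ℕ} (hx : x ∈ parts d) : 0 < x := by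
  obtain ⟨i, hi, rfl⟩ := Multiset.mem_map.mp hx
  exact Nat.pos_of_ne_zero (Finsupp.mem_support_iff.mp hi)

theorem card_eq_sum_rowLens (lam : YoungDiagram) : lam.card = lam.rowLens.sum := by
  have h : lam.cells = (Finset.range (lam.colLen 0)).biUnion fun i => lam.row i := by
    ext ⟨i, j⟩
    simp only [Finset.mem_biUnion, Finset.mem_range, YoungDiagram.mem_row_iff,
      YoungDiagram.mem_cells]
    constructor
    · intro h
      refine ⟨i, ?_, h, rfl⟩
      exact YoungDiagram.mem_iff_lt_colLen.mp (lam.up_left_mem le_rfl (Nat.zero_le j) h)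
    · rintro ⟨_, _, h, _⟩
      exact h
  rw [YoungDiagram.card, h, Finset.card_biUnion]
  · rw [YoungDiagram.rowLens, ← Multiset.sum_coe, ← Multiset.map_coe]
    exact Finset.sum_congr rfl fun i _ => (lam.rowLen_eq_card).symm
  · intro i _ j _ hij
    refine Finset.disjoint_left.mpr fun c hc hc' => hij ?_
    rw [← (YoungDiagram.mem_row_iff.mp hc).2, ← (YoungDiagram.mem_row_iff.mp hc').2]

theorem degree_expo (lam : YoungDiagram) : (expo lam).degree = lam.card := by
  rw [← sum_parts, parts_expo, card_eq_sum_rowLens, Multiset.sum_coe]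

theorem sum_range_rowLen (lam : YoungDiagram) {n : ℕ} (hn : lam.colLen 0 ≤ n) :
    ∑ i ∈ Finset.range n, lam.rowLen i = lam.card := by
  rw [← degree_expo, Finsupp.degree_apply, support_expo]
  refine (Finset.sum_subset (Finset.range_subset_range.mpr hn) fun i _ hi => ?_).symm
  rw [Finset.mem_range, not_lt] at hi
  exact (rowLen_eq_zero_iff lam i).mpr hi

theorem colLen_zero_le_card (lam : YoungDiagram) : lam.colLen 0 ≤ lam.card := by
  rw [YoungDiagram.colLen_eq_card]
  exact Finset.card_le_card (Finset.filter_subset _ _)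

theorem rowLens_coe_injective {lam mu : YoungDiagram}
    (h : (lam.rowLens : Multiset ℕ) = (mu.rowLens : Multiset ℕ)) : lam = mu := by
  have h1 : lam.rowLens = mu.rowLens :=
    List.Perm.eq_of_pairwise' lam.rowLens_sorted.pairwise mu.rowLens_sorted.pairwise
      (Multiset.coe_eq_coe.mp h)
  refine (YoungDiagram.equivListRowLens).injective (Subtype.ext h1)

theorem exists_diagram_of_multiset (s : Multiset ℕ) (hs : ∀ x ∈ s, 0 < x) :
    ∃ lam : YoungDiagram, (lam.rowLens : Multiset ℕ) = s := by
  have hpos : ∀ x ∈ s.sort (· ≥ ·), 0 < x := fun x hx => hs x ((Multiset.mem_sort (· ≥ ·)).mp hx)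
  refine ⟨YoungDiagram.ofRowLens (s.sort (· ≥ ·)) ?_, ?_⟩
  · exact (Multiset.pairwise_sort s (· ≥ ·)).sortedGE
  · rw [YoungDiagram.rowLens_ofRowLens_eq_self hpos, Multiset.sort_eq]

theorem exists_diagram_of_parts {σ : Type*} (d : σ →₀ ℕ) :
    ∃ lam : YoungDiagram, parts (expo lam) = parts d := by
  obtain ⟨lam, h⟩ := exists_diagram_of_multiset (parts d) fun x hx => pos_of_mem_parts hx
  exact ⟨lam, by rw [parts_expo, h]⟩

/-- Each fibre over a nonzero value is finite, of size the multiplicity of that value among the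
parts. -/
theorem card_fiber_eq {σ : Type*} {d e : σ →₀ ℕ} (h : parts d = parts e) {v : ℕ} (hv : v ≠ 0) :
    Nonempty ({i // d i = v} ≃ {i // e i = v}) := by
  have key : ∀ f : σ →₀ ℕ, ∃ s : Finset σ, (∀ i, i ∈ s ↔ f i = v) ∧
      s.card = Multiset.count v (parts f) := by
    intro f
    refine ⟨f.support.filter fun i => v = f i, fun i => ?_, ?_⟩
    · simp only [Finset.mem_filter, Finsupp.mem_support_iff]
      constructor
      · rintro ⟨-, h⟩; exact h.symm
      · rintro rfl; exact ⟨hv, rfl⟩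
    · rw [parts, Multiset.count_map]; rfl
  obtain ⟨s, hs, hs'⟩ := key d
  obtain ⟨r, hr, hr'⟩ := key e
  have hc : s.card = r.card := by rw [hs', hr', h]
  exact ⟨((Equiv.subtypeEquivRight hs).symm.trans (Finset.equivOfCardEq hc)).trans
    (Equiv.subtypeEquivRight hr)⟩

/-- The fibres of `d` and `e` over nonzero values have equal sizes, and over zero both are countably
infinite because the supports are finite; bijections of the fibres glue to a permutation of `ℕ`. -/
theorem exists_perm_of_parts_eq {d e : ℕ →₀ ℕ} (h : parts d = parts e) :
    ∃ g : Equiv.Perm ℕ, e = d.embDomain g.toEmbedding := by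
  have inf : ∀ f : ℕ →₀ ℕ, Infinite {i // f i = 0} := by
    intro f
    have : (f.support : Set ℕ)ᶜ.Infinite := f.support.finite_toSet.infinite_compl
    have h2 : {i | f i = 0} = (f.support : Set ℕ)ᶜ := by
      ext i; simp
    rw [← h2] at this
    exact this.to_subtype
  have fib : ∀ v, Nonempty ({i // d i = v} ≃ {i // e i = v}) := by
    intro v
    rcases eq_or_ne v 0 with rfl | hv
    · have := inf d
      have := inf e
      exact nonempty_equiv_of_countable
    · exact card_fiber_eq h hv
  let F := fun v => Classical.choice (fib v)
  refine ⟨Equiv.ofFiberEquiv F, ?_⟩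
  ext i
  obtain ⟨j, rfl⟩ := (Equiv.ofFiberEquiv F).surjective i
  rw [← Equiv.coe_toEmbedding, Finsupp.embDomain_apply_self, Equiv.coe_toEmbedding]
  exact Equiv.ofFiberEquiv_map F j

theorem parts_embDomain {σ τ : Type*} (g : σ ↪ τ) (d : σ →₀ ℕ) :
    parts (d.embDomain g) = parts d := by
  rw [parts, Finsupp.support_embDomain, Finset.map_val, Multiset.map_map]
  exact Multiset.map_congr rfl fun i _ => Finsupp.embDomain_apply_self _ _ _

/-- A diagram with at most `n` cells fits into the `n × n` square. -/
theorem finite_card_eq (n : ℕ) : {lam : YoungDiagram | lam.card ≤ n}.Finite := by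
  have hinj : Function.Injective YoungDiagram.cells := fun a b h => by
    ext c; rw [h]
  refine Set.Finite.of_finite_image (f := YoungDiagram.cells) ?_ hinj.injOn
  refine ((Finset.range n ×ˢ Finset.range n).powerset.finite_toSet).subset ?_
  rintro _ ⟨lam, hlam, rfl⟩
  simp only [Set.mem_ofPred_eq] at hlam
  simp only [Finset.coe_powerset, Set.mem_preimage, Set.mem_powerset_iff]
  rintro ⟨i, j⟩ hc
  have hc' : (i, j) ∈ lam := hc
  have h1 : i < lam.colLen 0 :=
    YoungDiagram.mem_iff_lt_colLen.mp (lam.up_left_mem le_rfl (Nat.zero_le j) hc')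
  have h2 : j < lam.transpose.colLen 0 := by
    rw [YoungDiagram.colLen_transpose]
    exact YoungDiagram.mem_iff_lt_rowLen.mp (lam.up_left_mem (Nat.zero_le i) le_rfl hc')
  have h3 := colLen_zero_le_card lam
  have h4 := colLen_zero_le_card lam.transpose
  have h5 : lam.transpose.card = lam.card := by
    simp [YoungDiagram.card, YoungDiagram.transpose]
  simp only [Finset.coe_product, Finset.coe_range, Set.mem_prod, Set.mem_Iio]
  omega

theorem card_transpose (lam : YoungDiagram) : lam.transpose.card = lam.card := by
  simp [YoungDiagram.card, YoungDiagram.transpose]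

/-! ### Coefficients of symmetric functions -/

section

variable {k : Type*} [Field k]

theorem coeff_embDomain_perm (f : SymFun k) (g : Equiv.Perm ℕ) (d : ℕ →₀ ℕ) :
    MvPowerSeries.coeff (d.embDomain g.toEmbedding) (f : MvPowerSeries ℕ k) =
      MvPowerSeries.coeff d (f : MvPowerSeries ℕ k) := by
  have h := f.2.1 g
  conv_lhs => rw [← h]
  exact MvPowerSeries.coeff_embDomain_rename g.toEmbedding (f : MvPowerSeries ℕ k) d

/-- The coefficient of a monomial in a symmetric function. -/
noncomputable def scoeff (d : ℕ →₀ ℕ) : SymFun k →ₗ[k] k :=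
  (MvPowerSeries.coeff d).comp (SymFun k).val.toLinearMap

theorem scoeff_apply (d : ℕ →₀ ℕ) (f : SymFun k) :
    scoeff d f = MvPowerSeries.coeff d (f : MvPowerSeries ℕ k) := rfl

theorem scoeff_eq_of_parts {d e : ℕ →₀ ℕ} (h : parts d = parts e) (f : SymFun k) :
    scoeff d f = scoeff e f := by
  obtain ⟨g, rfl⟩ := exists_perm_of_parts_eq h
  exact (coeff_embDomain_perm f g d).symm

/-- By symmetry a coefficient depends only on the multiset of exponents, and every such multiset
comes from a diagram. -/
theorem symFun_ext {f g : SymFun k} (h : ∀ lam, scoeff (expo lam) f = scoeff (expo lam) g) :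
    f = g := by
  apply Subtype.ext
  ext d
  obtain ⟨lam, hl⟩ := exists_diagram_of_parts d
  rw [← scoeff_apply, ← scoeff_apply, ← scoeff_eq_of_parts hl, ← scoeff_eq_of_parts hl, h]

theorem scoeff_ofCoeff (c : (ℕ →₀ ℕ) → k) (hc hb) (d : ℕ →₀ ℕ) :
    scoeff d (SymFun.ofCoeff c hc hb) = c d := rfl

theorem scoeff_monomialSymm (d : ℕ →₀ ℕ) (lam : YoungDiagram) :
    scoeff d (monomialSymm lam : SymFun k) = if parts d = parts (expo lam) then 1 else 0 := by
  rw [parts_expo]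
  exact scoeff_ofCoeff _ _ _ _

theorem parts_expo_inj {lam mu : YoungDiagram} :
    parts (expo lam) = parts (expo mu) ↔ lam = mu := by
  rw [parts_expo, parts_expo]
  exact ⟨rowLens_coe_injective, fun h => by rw [h]⟩

theorem scoeff_expo_monomialSymm (lam mu : YoungDiagram) :
    scoeff (expo lam) (monomialSymm mu : SymFun k) = if lam = mu then 1 else 0 := by
  rw [scoeff_monomialSymm]
  exact if_congr parts_expo_inj rfl rfl

theorem scoeff_expo_finite (f : SymFun k) : {lam | scoeff (expo lam) f ≠ 0}.Finite := by
  obtain ⟨N, hN⟩ := f.2.2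
  refine (finite_card_eq N).subset fun lam hlam => ?_
  by_contra hc
  refine hlam (hN _ ?_)
  rw [degree_expo]
  simpa using hc

/-- The monomial symmetric functions as a basis. -/
noncomputable def monomialBasis : Module.Basis YoungDiagram k (SymFun k) :=
  Module.Basis.ofRepr
    { toFun := fun f => Finsupp.ofSupportFinite (fun lam => scoeff (expo lam) f)
        (scoeff_expo_finite f)
      map_add' := fun f g => by ext lam; exact map_add (scoeff (expo lam)) f g
      map_smul' := fun c f => by ext lam; exact map_smul (scoeff (expo lam)) c f
      invFun := fun c => c.sum fun lam a => a • monomialSymm lam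
      left_inv := fun f => by
        refine symFun_ext fun lam => ?_
        simp only [Finsupp.sum, map_sum]
        simp only [map_smul, scoeff_expo_monomialSymm, smul_eq_mul, mul_ite, mul_one, mul_zero]
        rw [Finset.sum_ite_eq]
        simp only [Finsupp.mem_support_iff, ite_not]
        split_ifs with h
        · exact h.symm
        · rfl
      right_inv := fun c => by
        ext lam
        change scoeff (expo lam) (c.sum fun lam a => a • monomialSymm lam) = c lam
        rw [Finsupp.sum, map_sum]
        simp only [map_smul, scoeff_expo_monomialSymm, smul_eq_mul, mul_ite, mul_one, mul_zero]
        rw [Finset.sum_ite_eq]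
        simp only [Finsupp.mem_support_iff, ite_not]
        split_ifs with h
        · exact h.symm
        · rfl }

theorem monomialBasis_repr (f : SymFun k) (lam : YoungDiagram) :
    monomialBasis.repr f lam = scoeff (expo lam) f := rfl

theorem monomialBasis_apply (lam : YoungDiagram) :
    (monomialBasis lam : SymFun k) = monomialSymm lam := by
  rw [Module.Basis.apply_eq_iff]
  ext mu
  rw [monomialBasis_repr, scoeff_expo_monomialSymm, Finsupp.single_apply]
  exact if_congr eq_comm rfl rfl

/-- Only the splittings of `d` with first part `r e_i` contribute. Positivity of `r` makes `i`
recoverable from `r e_i`; the set `s` may exceed the support, the extra terms being zero. -/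
theorem scoeff_powerSum_mul (r : ℕ) (f : SymFun k) (d : ℕ →₀ ℕ) (s : Finset ℕ)
    (hs : d.support ⊆ s) (hr : 0 < r) :
    scoeff d (powerSum r * f) =
      ∑ i ∈ s, if r ≤ d i then scoeff (d - Finsupp.single i r) f else 0 := by
  have e1 : scoeff d (powerSum r * f) = ∑ p ∈ Finset.HasAntidiagonal.antidiagonal d,
      (if ∃ i, p.1 = Finsupp.single i r then 1 else 0) * scoeff p.2 f :=
    MvPowerSeries.coeff_mul ..
  rw [e1, ← Finset.sum_filter]
  simp only [ite_mul, one_mul, zero_mul]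
  rw [← Finset.sum_filter]
  symm
  refine Finset.sum_bij (fun i _ => (Finsupp.single i r, d - Finsupp.single i r)) ?_ ?_ ?_ ?_
  · intro i hi
    rw [Finset.mem_filter] at hi
    refine Finset.mem_filter.mpr ⟨Finset.HasAntidiagonal.mem_antidiagonal.mpr ?_, i, rfl⟩
    exact add_tsub_cancel_of_le (Finsupp.single_le_iff.mpr hi.2)
  · intro i _ j _ h
    have := (Finsupp.single_eq_single_iff ..).mp (Prod.ext_iff.mp h).1
    omega
  · rintro ⟨a, b⟩ hp
    obtain ⟨h1, i, h2⟩ := Finset.mem_filter.mp hp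
    have h3 := Finset.HasAntidiagonal.mem_antidiagonal.mp h1
    simp only at h2 h3
    subst h2
    have h4 : r ≤ d i := by rw [← h3]; simp
    refine ⟨i, Finset.mem_filter.mpr ⟨hs ?_, h4⟩, ?_⟩
    · rw [Finsupp.mem_support_iff]; omega
    · rw [← h3]; simp
  · intro i _; rfl

end

end Macdonald


/-! ### Power sums as a basis, and the scalar products as diagonal forms -/

namespace Macdonald

/-! ### Triangular families -/

section Triangular

variable {k V ι : Type*} [Field k] [AddCommGroup V] [Module k V]

/-- Injectivity: at an index of maximal rank in the support of `x`, no other term of the image can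
contribute, so the coordinate there is nonzero. Surjectivity: strong induction on the rank solves
for `b i` in terms of `v i` and lower basis vectors. -/
theorem triangular_bijective (b : Module.Basis ι k V) (v : ι → V) (rank : ι → ℕ)
    (hd : ∀ i, b.repr (v i) i ≠ 0)
    (ht : ∀ i j, b.repr (v i) j ≠ 0 → j = i ∨ rank j < rank i) :
    Function.Bijective (b.constr k v) := by
  constructor
  · refine (injective_iff_map_eq_zero _).mpr fun x hx => ?_
    by_contra hne
    have hs : (b.repr x).support.Nonempty := by
      rw [Finsupp.support_nonempty_iff]
      simpa using hne
    obtain ⟨i, hi, hmax⟩ := Finset.exists_max_image _ rank hs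
    have h1 : b.repr (b.constr k v x) i = b.repr x i * b.repr (v i) i := by
      rw [b.constr_apply, Finsupp.sum, map_sum, Finsupp.finsetSum_apply,
        Finset.sum_eq_single_of_mem i hi]
      · simp
      · intro j hj hji
        rw [map_smul, Finsupp.smul_apply, smul_eq_mul]
        by_contra hc
        rcases ht j i (right_ne_zero_of_mul hc) with h | h
        · exact hji h.symm
        · exact absurd (hmax j hj) (not_le.mpr h)
    have h2 : b.constr k v x = 0 := hx
    rw [h2, map_zero, Finsupp.zero_apply, eq_comm] at h1
    exact mul_ne_zero (Finsupp.mem_support_iff.mp hi) (hd i) h1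
  · rw [← LinearMap.range_eq_top, eq_top_iff, ← b.span_eq, Submodule.span_le]
    rintro _ ⟨i, rfl⟩
    induction hn : rank i using Nat.strong_induction_on generalizing i with
    | _ n ih =>
      have h1 : v i = b.repr (v i) i • b i +
          ∑ j ∈ (b.repr (v i)).support.erase i, b.repr (v i) j • b j := by
        rw [Finset.add_sum_erase _ (fun j => b.repr (v i) j • b j)
          (Finsupp.mem_support_iff.mpr (hd i))]
        exact (b.linearCombination_repr (v i)).symm
      have h2 : b i = (b.repr (v i) i)⁻¹ • (v i -
          ∑ j ∈ (b.repr (v i)).support.erase i, b.repr (v i) j • b j) := by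
        rw [eq_inv_smul_iff₀ (hd i), eq_sub_iff_add_eq]
        exact h1.symm
      rw [h2]
      refine Submodule.smul_mem _ _ (Submodule.sub_mem _ ⟨b i, b.constr_basis k v i⟩
        (Submodule.sum_mem _ fun j hj => Submodule.smul_mem _ _ ?_))
      obtain ⟨hji, hj⟩ := Finset.mem_erase.mp hj
      rcases ht i j (Finsupp.mem_support_iff.mp hj) with h | h
      · exact absurd h hji
      · exact ih (rank j) (hn ▸ h) j rfl

/-- A family that is triangular with respect to a basis is a basis. -/
noncomputable def triangularBasis (b : Module.Basis ι k V) (v : ι → V) (rank : ι → ℕ)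
    (hd : ∀ i, b.repr (v i) i ≠ 0)
    (ht : ∀ i j, b.repr (v i) j ≠ 0 → j = i ∨ rank j < rank i) : Module.Basis ι k V :=
  b.map (LinearEquiv.ofBijective _ (triangular_bijective b v rank hd ht))

theorem triangularBasis_apply (b : Module.Basis ι k V) (v : ι → V) (rank : ι → ℕ) (hd) (ht)
    (i : ι) : triangularBasis b v rank hd ht i = v i := by
  simp [triangularBasis]

end Triangular

/-! ### Multiplicities of parts -/

/-- The multiplicities of the parts of a diagram. -/
noncomputable def mults (lam : YoungDiagram) : ℕ+ →₀ ℕ :=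
  (Multiset.toFinsupp (lam.rowLens : Multiset ℕ)).comapDomain PNat.val PNat.coe_injective.injOn

theorem mults_apply (lam : YoungDiagram) (n : ℕ+) : mults lam n = lam.rowLens.count (n : ℕ) := by
  simp [mults]

theorem prod_mults {M : Type*} [CommMonoid M] (lam : YoungDiagram) (H : ℕ → ℕ → M)  :
    ((mults lam).prod fun n m => H n m) =
      ∏ r ∈ lam.rowLens.toFinset, H r (lam.rowLens.count r) := by
  refine Finset.prod_bij (fun n _ => (n : ℕ)) ?_ ?_ ?_ ?_
  · intro n hn
    rw [Finsupp.mem_support_iff, mults_apply] at hn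
    rw [List.mem_toFinset]
    exact List.count_pos_iff.mp (Nat.pos_of_ne_zero hn)
  · intro n _ m _ h
    exact PNat.coe_injective h
  · intro r hr
    rw [List.mem_toFinset] at hr
    obtain ⟨n, rfl⟩ : ∃ n : ℕ+, (n : ℕ) = r := ⟨⟨r, lam.pos_of_mem_rowLens r hr⟩, rfl⟩
    refine ⟨n, ?_, rfl⟩
    rw [Finsupp.mem_support_iff, mults_apply]
    exact (List.count_pos_iff.mpr hr).ne'
  · intro n _
    rw [mults_apply]

theorem mults_surjective : Function.Surjective mults := by
  intro d
  obtain ⟨lam, hl⟩ := exists_diagram_of_multiset ((Finsupp.toMultiset d).map PNat.val) (by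
    intro x hx
    obtain ⟨n, -, rfl⟩ := Multiset.mem_map.mp hx
    exact n.pos)
  refine ⟨lam, ?_⟩
  ext n
  rw [mults_apply, ← Multiset.coe_count, hl, Multiset.count_map_eq_count' _ _ PNat.coe_injective,
    Finsupp.count_toMultiset]

theorem mults_injective : Function.Injective mults := by
  intro lam mu h
  refine rowLens_coe_injective ?_
  ext r
  rw [Multiset.coe_count, Multiset.coe_count]
  rcases Nat.eq_zero_or_pos r with rfl | hr
  · rw [List.count_eq_zero_of_not_mem, List.count_eq_zero_of_not_mem]
    · exact fun h => absurd (mu.pos_of_mem_rowLens 0 h) (lt_irrefl _)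
    · exact fun h => absurd (lam.pos_of_mem_rowLens 0 h) (lt_irrefl _)
  · obtain ⟨n, rfl⟩ : ∃ n : ℕ+, (n : ℕ) = r := ⟨⟨r, hr⟩, rfl⟩
    have := DFunLike.congr_fun h n
    rwa [mults_apply, mults_apply] at this

section

variable {k : Type*} [Field k]

/-! ### Power sums generate -/

variable (k) in
/-- The map from polynomials in the power sums to symmetric functions. -/
noncomputable def toSymFunHom : Fock k →ₐ[k] SymFun k :=
  MvPolynomial.aeval fun n : ℕ+ => powerSum (n : ℕ)

theorem toSymFunHom_monomial (lam : YoungDiagram) :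
    toSymFunHom k (MvPolynomial.monomial (mults lam) 1) = powerSumProd lam := by
  rw [toSymFunHom, MvPolynomial.aeval_monomial, map_one, one_mul,
    prod_mults lam (fun n m => (powerSum n : SymFun k) ^ m), powerSumProd,
    ← Finset.prod_list_map_count]

theorem parts_eq_cons {σ : Type*} (d : σ →₀ ℕ) {i : σ} (hi : i ∈ d.support) :
    parts d = d i ::ₘ parts (d.erase i) := by
  rw [parts, parts, Finsupp.support_erase, ← Finset.insert_erase hi, Finset.insert_val,
    Multiset.ndinsert_of_notMem (by simp [d.support.nodup.notMem_erase]), Multiset.map_cons, Finset.erase_insert (by simp)]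
  congr 1
  refine Multiset.map_congr rfl fun j hj => (Finsupp.erase_ne ?_).symm
  exact (Finset.mem_erase.mp hj).1

/-- The coefficient counts the ways to distribute the entries of `L` over the variables so that the
exponents are `d`. If no two entries share a variable then the parts of `d` are `L`; otherwise `d`
has fewer nonzero exponents than `L` has entries. That it is a natural number rules out cancellation
in characteristic zero. -/
theorem scoeff_powerSum_list (L : List ℕ) (hL : ∀ r ∈ L, 0 < r) (d : ℕ →₀ ℕ) :
    ∃ N : ℕ, scoeff d ((L.map powerSum).prod : SymFun k) = N ∧ (parts d = L → N ≠ 0) ∧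
      (N ≠ 0 → d.support.card < L.length ∨ parts d = L) := by
  induction L generalizing d with
  | nil =>
    refine ⟨if d = 0 then 1 else 0, ?_, ?_, ?_⟩
    · simp only [List.map_nil, List.prod_nil]
      rw [scoeff_apply]
      simp [MvPowerSeries.coeff_one]
    · intro h
      rw [if_pos]
      · exact one_ne_zero
      · have := congrArg Multiset.card h
        rw [card_parts] at this
        simpa using this
    · intro h
      right
      by_cases hd : d = 0
      · subst hd; rfl
      · simp [hd] at h
  | cons r L ih =>
    have hr : 0 < r := hL r (by simp)
    choose N hN1 hN2 hN3 using ih fun x hx => hL x (List.mem_cons_of_mem _ hx)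
    refine ⟨∑ i ∈ d.support, if r ≤ d i then N (d - Finsupp.single i r) else 0, ?_, ?_, ?_⟩
    · rw [List.map_cons, List.prod_cons, scoeff_powerSum_mul r _ d d.support subset_rfl hr]
      push_cast
      refine Finset.sum_congr rfl fun i _ => ?_
      split_ifs
      · exact hN1 _
      · rfl
    · intro h
      have hmem : r ∈ parts d := by rw [h]; simp
      obtain ⟨i, hi, hir⟩ := Multiset.mem_map.mp hmem
      have hi' : i ∈ d.support := hi
      have he : d - Finsupp.single i r = d.erase i := by
        ext j
        rcases eq_or_ne j i with rfl | hj
        · simp [hir]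
        · simp [hj]
      intro h0
      have h1 := Finset.sum_eq_zero_iff.mp h0 i hi'
      rw [if_pos hir.ge, he] at h1
      refine hN2 _ ?_ h1
      rw [parts_eq_cons d hi', hir] at h
      exact (Multiset.cons_inj_right r).mp h
    · intro h
      obtain ⟨i, hi, hne⟩ := Finset.exists_ne_zero_of_sum_ne_zero h
      have hri : r ≤ d i := by
        by_contra hc
        exact hne (if_neg hc)
      rw [if_pos hri] at hne
      -- If `r` fills the exponent of `x_i`, that variable disappears from the support; if not, the
      -- support is unchanged and `r` shares its variable with another entry, so the support is
      -- strictly smaller than the list.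
      rcases hri.eq_or_lt with heq | hlt
      · have he : d - Finsupp.single i r = d.erase i := by
          ext j
          rcases eq_or_ne j i with rfl | hj
          · simp [heq]
          · simp [hj]
        rw [he] at hne
        have hc : d.support.card = (d.erase i).support.card + 1 := by
          rw [Finsupp.support_erase, Finset.card_erase_add_one hi]
        rcases hN3 _ hne with h1 | h1
        · left
          rw [List.length_cons]; omega
        · right
          rw [parts_eq_cons d hi, h1, ← heq]
          rfl
      · left
        have hs : (d - Finsupp.single i r).support = d.support := by
          ext j
          simp only [Finsupp.mem_support_iff, Finsupp.coe_tsub, Pi.sub_apply, Finsupp.single_apply]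
          split_ifs with h1
          · subst h1; omega
          · simp
        have hle : d.support.card ≤ L.length := by
          rcases hN3 _ hne with h1 | h1
          · rw [hs] at h1; exact h1.le
          · have := congrArg Multiset.card h1
            rw [card_parts, hs] at this
            simpa using this.le
        rw [List.length_cons]; omega

variable [CharZero k]

theorem powerSumProd_triangular_diag (lam : YoungDiagram) :
    (monomialBasis (k := k)).repr (powerSumProd lam) lam ≠ 0 := by
  obtain ⟨N, h1, h2, -⟩ := scoeff_powerSum_list (k := k) lam.rowLens lam.pos_of_mem_rowLens
    (expo lam)
  rw [monomialBasis_repr, powerSumProd, h1]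
  exact Nat.cast_ne_zero.mpr (h2 (parts_expo lam))

theorem powerSumProd_triangular (lam mu : YoungDiagram)
    (h : (monomialBasis (k := k)).repr (powerSumProd lam) mu ≠ 0) :
    mu = lam ∨ mu.colLen 0 < lam.colLen 0 := by
  obtain ⟨N, h1, -, h3⟩ := scoeff_powerSum_list (k := k) lam.rowLens lam.pos_of_mem_rowLens
    (expo mu)
  rw [monomialBasis_repr, powerSumProd, h1] at h
  rcases h3 (Nat.cast_ne_zero.mp h) with h4 | h4
  · right
    rwa [support_expo, Finset.card_range, YoungDiagram.length_rowLens] at h4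
  · left
    rw [← parts_expo] at h4
    exact parts_expo_inj.mp h4

variable (k) in
/-- The products of power sums as a basis. -/
noncomputable def powerBasis : Module.Basis YoungDiagram k (SymFun k) :=
  triangularBasis monomialBasis powerSumProd (fun lam => lam.colLen 0)
    powerSumProd_triangular_diag powerSumProd_triangular

theorem powerBasis_apply (lam : YoungDiagram) : powerBasis k lam = powerSumProd lam :=
  triangularBasis_apply ..

/-- It carries the basis of monomials to the basis of products of power sums, the bijection of
indices being `mults`. -/
theorem toSymFunHom_bijective : Function.Bijective (toSymFunHom k) := by
  let e : YoungDiagram ≃ (ℕ+ →₀ ℕ) := Equiv.ofBijective mults ⟨mults_injective, mults_surjective⟩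
  let b := (MvPolynomial.basisMonomials ℕ+ k).reindex e.symm
  have h : (toSymFunHom k).toLinearMap = (b.equiv (powerBasis k) (Equiv.refl _)).toLinearMap := by
    refine b.ext fun lam => ?_
    have : b lam = MvPolynomial.monomial (mults lam) 1 := by simp [b]; rfl
    rw [LinearEquiv.coe_coe, Module.Basis.equiv_apply, this, Equiv.refl_apply, powerBasis_apply]
    exact toSymFunHom_monomial lam
  have h2 : (toSymFunHom k : Fock k → SymFun k) = b.equiv (powerBasis k) (Equiv.refl _) := by
    ext1 x
    exact DFunLike.congr_fun h x
  rw [h2]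
  exact (b.equiv (powerBasis k) (Equiv.refl _)).bijective

variable (k) in
/-- Symmetric functions are polynomials in the power sums. -/
noncomputable def toSymFun : Fock k ≃ₐ[k] SymFun k :=
  AlgEquiv.ofBijective (toSymFunHom k) toSymFunHom_bijective

theorem toSymFun_X (n : ℕ+) : toSymFun k (MvPolynomial.X n) = powerSum (n : ℕ) := by
  change toSymFunHom k (MvPolynomial.X n) = _
  rw [toSymFunHom, MvPolynomial.aeval_X]

theorem toSymFun_monomial (lam : YoungDiagram) :
    toSymFun k (MvPolynomial.monomial (mults lam) 1) = powerSumProd lam :=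
  toSymFunHom_monomial lam

end

/-! ### The scalar products -/

section

variable {k : Type*} [Field k]

/-- `∏_n (n ζ_n)^{d_n} d_n!` -/
noncomputable def zWeight (zeta : ℕ → k) (d : ℕ+ →₀ ℕ) : k :=
  d.prod fun n m => ((n : k) * zeta n) ^ m * (m.factorial : k)

/-- The bilinear form on polynomials in the `p_n` for which monomials are orthogonal,
with norms `zWeight`. -/
noncomputable def pairing (zeta : ℕ → k) : LinearMap.BilinForm k (Fock k) :=
  (MvPolynomial.basisMonomials ℕ+ k).constr k fun d => zWeight zeta d • MvPolynomial.lcoeff k d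

theorem pairing_monomial (zeta : ℕ → k) (d : ℕ+ →₀ ℕ) (f : Fock k) :
    pairing zeta (MvPolynomial.monomial d 1) f = zWeight zeta d * f.coeff d := by
  have h : (MvPolynomial.monomial d 1 : Fock k) = MvPolynomial.basisMonomials ℕ+ k d := by simp
  rw [pairing, h, Module.Basis.constr_basis]
  rfl

/-- The freedom in `s` allows two pairings with different first arguments to be summed over one
common index set. -/
theorem pairing_eq_sum (zeta : ℕ → k) (f g : Fock k) (s : Finset (ℕ+ →₀ ℕ)) (hs : f.support ⊆ s) :
    pairing zeta f g = ∑ d ∈ s, zWeight zeta d * (f.coeff d * g.coeff d) := by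
  conv_lhs => rw [← MvPolynomial.support_sum_monomial_coeff f]
  rw [map_sum, LinearMap.sum_apply]
  refine (Finset.sum_congr rfl fun d _ => ?_).trans (Finset.sum_subset hs fun d _ hd => ?_)
  · rw [← mul_one (f.coeff d), ← smul_eq_mul, ← MvPolynomial.smul_monomial, map_smul,
      LinearMap.smul_apply, pairing_monomial, smul_eq_mul, smul_eq_mul]
    ring
  · rw [MvPolynomial.notMem_support_iff.mp hd]; ring

theorem pairing_comm (zeta : ℕ → k) (f g : Fock k) : pairing zeta f g = pairing zeta g f := by
  rw [pairing_eq_sum zeta f g (f.support ∪ g.support) Finset.subset_union_left,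
    pairing_eq_sum zeta g f (f.support ∪ g.support) Finset.subset_union_right]
  exact Finset.sum_congr rfl fun d _ => by ring

theorem zWeight_ne_zero [CharZero k] {zeta : ℕ → k} (h : ∀ n, 0 < n → zeta n ≠ 0)
    (d : ℕ+ →₀ ℕ) : zWeight zeta d ≠ 0 :=
  Finset.prod_ne_zero_iff.mpr fun n _ => mul_ne_zero
    (pow_ne_zero _ (mul_ne_zero (Nat.cast_ne_zero.mpr n.ne_zero) (h n n.pos)))
    (Nat.cast_ne_zero.mpr (Nat.factorial_ne_zero _))

/-- `(1 - q^n) / (1 - t^n)` -/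
def zetaQT (q t : k) (n : ℕ) : k := (1 - q ^ n) / (1 - t ^ n)

theorem zFactor_eq (q t : k) (lam : YoungDiagram) :
    zFactor q t lam = zWeight (zetaQT q t) (mults lam) := by
  rw [zFactor, zWeight,
    prod_mults lam (fun n m => ((n : k) * zetaQT q t n) ^ m * (m.factorial : k)),
    Finset.prod_list_map_count, ← Finset.prod_mul_distrib]
  refine Finset.prod_congr rfl fun r _ => ?_
  rw [zetaQT, mul_pow]
  ring

variable [CharZero k]

/-- The chosen form has the defining property because the diagonal form `pairing`, transported
through `toSymFun`, is an example of one. -/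
theorem scalarProduct_spec (q t : k) (lam mu : YoungDiagram) :
    scalarProduct q t (powerSumProd lam) (powerSumProd mu) =
      if lam = mu then zFactor q t lam else 0 := by
  have h : ∃ B : LinearMap.BilinForm k (SymFun k), ∀ lam mu : YoungDiagram,
      B (powerSumProd lam) (powerSumProd mu) = if lam = mu then zFactor q t lam else 0 := by
    refine ⟨(pairing (zetaQT q t)).compl₁₂ (toSymFun k).symm.toLinearMap
      (toSymFun k).symm.toLinearMap, fun lam mu => ?_⟩
    rw [LinearMap.compl₁₂_apply]
    simp only [AlgEquiv.toLinearMap_apply, ← toSymFun_monomial, AlgEquiv.symm_apply_apply]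
    rw [pairing_monomial, MvPolynomial.coeff_monomial, zFactor_eq, mul_ite, mul_one, mul_zero]
    exact if_congr (mults_injective.eq_iff.trans eq_comm) rfl rfl
  exact Classical.epsilon_spec h lam mu

theorem scalarProduct_toSymFun (q t : k) (f g : Fock k) :
    scalarProduct q t (toSymFun k f) (toSymFun k g) = pairing (zetaQT q t) f g := by
  have h : (scalarProduct q t).compl₁₂ (toSymFun k).toLinearMap (toSymFun k).toLinearMap =
      pairing (zetaQT q t) := by
    refine (MvPolynomial.basisMonomials ℕ+ k).ext fun d =>
      (MvPolynomial.basisMonomials ℕ+ k).ext fun e => ?_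
    obtain ⟨lam, rfl⟩ := mults_surjective d
    obtain ⟨mu, rfl⟩ := mults_surjective e
    rw [LinearMap.compl₁₂_apply]
    simp only [MvPolynomial.coe_basisMonomials, AlgEquiv.toLinearMap_apply, toSymFun_monomial]
    rw [scalarProduct_spec, pairing_monomial, MvPolynomial.coeff_monomial, zFactor_eq, mul_ite,
      mul_one, mul_zero]
    exact if_congr (eq_comm.trans mults_injective.eq_iff.symm) rfl rfl
  exact LinearMap.congr_fun₂ h f g

theorem scalarProduct_eq (q t : k) (f g : SymFun k) :
    scalarProduct q t f g = pairing (zetaQT q t) ((toSymFun k).symm f) ((toSymFun k).symm g) := by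
  rw [← scalarProduct_toSymFun, AlgEquiv.apply_symm_apply, AlgEquiv.apply_symm_apply]

end

end Macdonald


/-! ### The bracket of the Fock space is the scalar product -/

namespace Macdonald

/-! ### The Fock space -/

section

variable {k : Type*} [Field k]

theorem coeff_annihilation (q t : k) (n : ℕ+) (v : Fock k) (e : ℕ+ →₀ ℕ) :
    (annihilation q t n v).coeff e =
      (n : k) * zetaQT q t n * ((e n + 1 : ℕ) : k) * v.coeff (e + Finsupp.single n 1) := by
  rw [annihilation, LinearMap.smul_apply, MvPolynomial.coeff_smul, smul_eq_mul, zetaQT]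
  have h : (MvPolynomial.pderiv n v).coeff e =
      v.coeff (e + Finsupp.single n 1) * ((e n : k) + 1) := MvPolynomial.coeff_pderiv v e
  have h2 : ((MvPolynomial.pderiv n).toLinearMap v) = MvPolynomial.pderiv n v := rfl
  rw [h2, h]
  push_cast
  ring

/-- The assumption `e n = 0` makes the successive derivative factors multiply up to exactly `m!`. -/
theorem coeff_annihilation_pow (q t : k) (n : ℕ+) (m : ℕ) (v : Fock k) (e : ℕ+ →₀ ℕ)
    (he : e n = 0) :
    ((annihilation q t n ^ m) v).coeff e =
      ((n : k) * zetaQT q t n) ^ m * (m.factorial : k) * v.coeff (e + Finsupp.single n m) := by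
  induction m generalizing v with
  | zero => simp
  | succ m ih =>
    rw [pow_succ, Module.End.mul_apply, ih, coeff_annihilation, add_assoc, ← Finsupp.single_add]
    simp only [Finsupp.add_apply, he, Finsupp.single_eq_same, zero_add]
    rw [Nat.factorial_succ]
    push_cast
    ring

theorem coeff_annihilation_list (q t : k) (d : ℕ+ →₀ ℕ) (l : List ℕ+) (hl : l.Nodup) (v : Fock k)
    (e : ℕ+ →₀ ℕ) (he : ∀ n ∈ l, e n = 0) :
    (((l.map fun n => annihilation q t n ^ d n).prod) v).coeff e =
      (l.map fun n : ℕ+ => ((n : k) * zetaQT q t n) ^ d n * ((d n).factorial : k)).prod *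
        v.coeff (e + (l.map fun n => Finsupp.single n (d n)).sum) := by
  induction l generalizing e with
  | nil => simp
  | cons n l ih =>
    obtain ⟨hn, hl⟩ := List.nodup_cons.mp hl
    rw [List.map_cons, List.prod_cons, Module.End.mul_apply,
      coeff_annihilation_pow _ _ _ _ _ _ (he n (by simp)), ih hl, List.map_cons, List.prod_cons,
      List.map_cons, List.sum_cons]
    · rw [← add_assoc]; ring
    · intro m hm
      have : m ≠ n := fun h => hn (h ▸ hm)
      rw [Finsupp.add_apply, he m (List.mem_cons_of_mem _ hm), Finsupp.single_apply,
        if_neg this.symm, add_zero]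

theorem prod_map_sort {M : Type*} [CommMonoid M] (s : Finset ℕ+) (H : ℕ+ → M) :
    ((s.sort (· ≤ ·)).map H).prod = ∏ n ∈ s, H n := by
  rw [← Multiset.prod_coe, ← Multiset.map_coe, Finset.sort_eq]
  rfl

/-- The vacuum expectation keeps the constant term, and differentiating `a_{-}^d` down to a constant
yields its norm `z_d`. -/
theorem vacuumDual_opMonomial (q t : k) (d : ℕ+ →₀ ℕ) (v : Fock k) :
    vacuumDual k (opMonomial (annihilation q t) d v) = zWeight (zetaQT q t) d * v.coeff d := by
  have h : vacuumDual k (opMonomial (annihilation q t) d v) =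
      (opMonomial (annihilation q t) d v).coeff 0 := rfl
  rw [h, opMonomial, coeff_annihilation_list q t d _ (Finset.sort_nodup _ _) v 0 fun _ _ => rfl,
    prod_map_sort, zero_add]
  have h2 : (List.map (fun n => Finsupp.single n (d n)) (d.support.sort (· ≤ ·))).sum = d := by
    have h3 := prod_map_sort (M := Multiplicative (ℕ+ →₀ ℕ)) d.support
      fun n => Multiplicative.ofAdd (Finsupp.single n (d n))
    have h4 : (List.map (fun n => Finsupp.single n (d n)) (d.support.sort (· ≤ ·))).sum =
      ∑ n ∈ d.support, Finsupp.single n (d n) := h3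
    rw [h4]
    exact d.sum_single
  rw [h2]
  rfl

theorem opMonomial_creation (d : ℕ+ →₀ ℕ) :
    opMonomial creation d (vacuum k) = MvPolynomial.monomial d 1 := by
  have h : ∀ l : List ℕ+, ((l.map fun n => creation (k := k) n ^ d n).prod) (vacuum k) =
      (l.map fun n => (MvPolynomial.X n : Fock k) ^ d n).prod := by
    intro l
    induction l with
    | nil => simp [vacuum]
    | cons n l ih =>
      rw [List.map_cons, List.prod_cons, Module.End.mul_apply, ih, List.map_cons, List.prod_cons,
        creation, LinearMap.pow_mulLeft, LinearMap.mulLeft_apply]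
  rw [opMonomial, h, prod_map_sort, MvPolynomial.monomial_eq]
  simp [Finsupp.prod]

theorem vacuumDual_opPoly (q t : k) (f v : Fock k) :
    (vacuumDual k ∘ₗ opPoly (annihilation q t) f) v = pairing (zetaQT q t) f v := by
  rw [LinearMap.comp_apply, opPoly, LinearMap.sum_apply, map_sum,
    pairing_eq_sum _ f v f.support subset_rfl]
  refine Finset.sum_congr rfl fun d _ => ?_
  rw [LinearMap.smul_apply, map_smul, vacuumDual_opMonomial, smul_eq_mul]
  ring

variable [CharZero k]

/-- The coefficients of the exponential are the inverse norms of the monomials in the power sums;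
this is what makes `iota` and `iotaStar` mere changes of notation. -/
theorem expTerm_eq (q t : k) (d : ℕ+ →₀ ℕ) :
    expTerm k q t d = (zWeight (zetaQT q t) d)⁻¹ • toSymFun k (MvPolynomial.monomial d 1) := by
  rw [expTerm]
  congr 1
  · rw [zWeight, Finsupp.prod, Finsupp.prod, ← Finset.prod_inv_distrib]
    refine Finset.prod_congr rfl fun n _ => ?_
    rw [zetaQT, mul_inv, ← inv_pow, mul_inv, inv_div, div_eq_mul_inv, div_eq_mul_inv,
      div_eq_mul_inv, mul_inv]
    ring
  · change _ = toSymFunHom k _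
    rw [toSymFunHom, MvPolynomial.aeval_monomial, map_one, one_mul]

theorem finsum_coeff_smul (f : Fock k) :
    ∑ᶠ d, f.coeff d • toSymFun k (MvPolynomial.monomial d 1) = toSymFun k f := by
  rw [finsum_eq_sum_of_support_subset (s := f.support)]
  · conv_rhs => rw [← MvPolynomial.support_sum_monomial_coeff f, map_sum]
    refine Finset.sum_congr rfl fun d _ => ?_
    rw [← map_smul, MvPolynomial.smul_monomial, smul_eq_mul, mul_one]
  · intro d hd
    rw [Finset.mem_coe, MvPolynomial.mem_support_iff]
    intro h
    exact hd (by simp [h])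

variable {q t : k}

/-- The norm `z_d` from the vacuum expectation cancels the `z_d⁻¹` in the exponential, leaving the
identification of `a_{-n}` with `p_n`. -/
theorem iota_eq (hz : ∀ n, 0 < n → zetaQT q t n ≠ 0) (v : Fock k) : iota q t v = toSymFun k v := by
  rw [iota, ← finsum_coeff_smul]
  refine finsum_congr fun d => ?_
  rw [vacuumDual_opMonomial, expTerm_eq, smul_smul, mul_right_comm,
    mul_inv_cancel₀ (zWeight_ne_zero hz d), one_mul]

theorem iotaStar_eq (hz : ∀ n, 0 < n → zetaQT q t n ≠ 0) (f : Fock k) :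
    iotaStar q t (pairing (zetaQT q t) f) = toSymFun k f := by
  rw [iotaStar, ← finsum_coeff_smul]
  refine finsum_congr fun d => ?_
  rw [opMonomial_creation, pairing_comm, pairing_monomial, expTerm_eq, smul_smul, mul_right_comm,
    mul_inv_cancel₀ (zWeight_ne_zero hz d), one_mul]

/-- Under the identification of `a_{-n}` with `p_n`, the ket of `g` is `g` and the bra of `f` is
pairing with `f`. -/
theorem bracket_eq_scalarProduct (hz : ∀ n, 0 < n → zetaQT q t n ≠ 0) (f g : SymFun k) : bracket q t f g = scalarProduct q t f g := by
  have h1 : ket q t g = (toSymFun k).symm g := by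
    have h : iota q t (ket q t g) = g :=
      Classical.epsilon_spec (p := fun v : Fock k => iota q t v = g)
        ⟨(toSymFun k).symm g, by rw [iota_eq hz, AlgEquiv.apply_symm_apply]⟩
    rw [iota_eq hz] at h
    exact (AlgEquiv.symm_apply_eq _).mpr h.symm |>.symm
  have hrange : ∀ u : Fock k, vacuumDual k ∘ₗ opPoly (annihilation q t) u =
      pairing (zetaQT q t) u := fun u => LinearMap.ext fun v => vacuumDual_opPoly q t u v
  have h2 : bra q t f = pairing (zetaQT q t) ((toSymFun k).symm f) := by
    have h : bra q t f ∈ DualFock k q t ∧ iotaStar q t (bra q t f) = f :=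
      Classical.epsilon_spec
        (p := fun phi : Fock k →ₗ[k] k => phi ∈ DualFock k q t ∧ iotaStar q t phi = f)
        ⟨pairing (zetaQT q t) ((toSymFun k).symm f), ⟨(toSymFun k).symm f, hrange _⟩, by
          rw [iotaStar_eq hz, AlgEquiv.apply_symm_apply]⟩
    -- Membership in the dual Fock space is essential here: an arbitrary functional may be nonzero
    -- on infinitely many monomials, and then the finite sum in `iotaStar` takes its default value.
    obtain ⟨⟨u, hu⟩, h4⟩ := h
    simp only [hrange] at hu
    rw [← hu, iotaStar_eq hz] at h4
    rw [← hu, ← h4, AlgEquiv.symm_apply_apply]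
  rw [bracket, h1, h2, scalarProduct_eq]

end

end Macdonald


/-! ### Exponential families and their reproducing property -/

namespace Macdonald

section

variable {k : Type*} [Field k]

/-! ### Exponential families -/

/-- The degree of a monomial in the power sums. -/
noncomputable def wt : (ℕ+ →₀ ℕ) →+ ℕ := Finsupp.weight fun n : ℕ+ => (n : ℕ)

theorem wt_single (n : ℕ+) (m : ℕ) : wt (Finsupp.single n m) = m * n := by
  simp [wt, Finsupp.weight_single]

theorem wt_eq_sum (d : ℕ+ →₀ ℕ) (s : Finset ℕ+) (hs : d.support ⊆ s) :
    wt d = ∑ n ∈ s, d n * (n : ℕ) := by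
  rw [wt, Finsupp.weight_apply, Finsupp.sum_of_support_subset _ hs]
  · simp
  · simp

theorem wt_mults (lam : YoungDiagram) : wt (mults lam) = lam.card := by
  rw [card_eq_sum_rowLens, wt_eq_sum _ _ subset_rfl, Finset.sum_list_count]
  exact prod_mults (M := Multiplicative ℕ) lam fun n m => Multiplicative.ofAdd (m * n)

theorem finite_wt_eq (m : ℕ) : {d | wt d = m}.Finite := by
  refine ((finite_card_eq m).image mults).subset fun d hd => ?_
  obtain ⟨lam, rfl⟩ := mults_surjective d
  have h : wt (mults lam) = m := hd
  exact ⟨lam, (wt_mults lam ▸ h).le, rfl⟩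

/-- Stated with the old factor at `n` on the left, so that no division is needed. -/
theorem prod_add_single {M : Type*} [CommMonoid M] (d : ℕ+ →₀ ℕ) (n : ℕ+) (H : ℕ+ → ℕ → M)
    (hH : ∀ n, H n 0 = 1) :
    (d + Finsupp.single n 1).prod H * H n (d n) = d.prod H * H n (d n + 1) := by
  have hs1 : (d + Finsupp.single n 1).support ⊆ insert n (d.support.erase n) := by
    intro j hj
    rw [Finsupp.mem_support_iff, Finsupp.add_apply] at hj
    rw [Finset.mem_insert, Finset.mem_erase, Finsupp.mem_support_iff]
    by_contra hc
    push Not at hc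
    rw [hc.2 hc.1, Finsupp.single_apply, if_neg (Ne.symm hc.1)] at hj
    exact hj rfl
  have hs2 : d.support ⊆ insert n (d.support.erase n) := by
    intro j hj
    rw [Finset.mem_insert, Finset.mem_erase]
    tauto
  rw [Finsupp.prod_of_support_subset _ hs1 H fun n _ => hH n,
    Finsupp.prod_of_support_subset _ hs2 H fun n _ => hH n, Finset.prod_insert (by simp),
    Finset.prod_insert (by simp)]
  have : ∏ j ∈ d.support.erase n, H j ((d + Finsupp.single n 1 : ℕ+ →₀ ℕ) j) =
      ∏ j ∈ d.support.erase n, H j (d j) := by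
    refine Finset.prod_congr rfl fun j hj => ?_
    rw [Finsupp.add_apply, Finsupp.single_apply, if_neg (Ne.symm (Finset.mem_erase.mp hj).1),
      add_zero]
  rw [this, Finsupp.add_apply, Finsupp.single_eq_same]
  exact (mul_right_comm _ _ _).trans (by rw [mul_comm (H n (d n + 1)), mul_right_comm,
    mul_comm (H n (d n))])

/-- The coefficient of a monomial in `exp (∑_n w_n p_n / n)`. -/
noncomputable def expCoeff (w : ℕ → k) (d : ℕ+ →₀ ℕ) : k :=
  d.prod fun n m => (w n / (n : k)) ^ m / (m.factorial : k)

/-- The part of degree `m` of `exp (∑_n w_n p_n / n)`. -/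
noncomputable def expFam (w : ℕ → k) (m : ℕ) : Fock k :=
  ∑ d ∈ (finite_wt_eq m).toFinset, MvPolynomial.monomial d (expCoeff w d)

theorem coeff_expFam (w : ℕ → k) (m : ℕ) (d : ℕ+ →₀ ℕ) :
    (expFam w m).coeff d = if wt d = m then expCoeff w d else 0 := by
  rw [expFam, MvPolynomial.coeff_sum]
  simp only [MvPolynomial.coeff_monomial]
  rw [Finset.sum_ite_eq']
  simp

theorem expFam_zero (w : ℕ → k) : expFam w 0 = 1 := by
  ext d
  rw [coeff_expFam, MvPolynomial.coeff_one]
  by_cases h : d = 0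
  · subst h
    simp [expCoeff]
  · rw [if_neg (Ne.symm h), if_neg]
    intro h0
    refine h ?_
    ext n
    rw [wt_eq_sum d d.support subset_rfl, Finset.sum_eq_zero_iff] at h0
    by_contra hc
    have := h0 n (Finsupp.mem_support_iff.mpr hc)
    rcases Nat.mul_eq_zero.mp this with h1 | h1
    · exact hc h1
    · exact n.ne_zero h1

theorem coeff_zero_expFam (w : ℕ → k) {m : ℕ} (hm : m ≠ 0) : (expFam w m).coeff 0 = 0 := by
  rw [coeff_expFam, map_zero, if_neg hm.symm]

/-- The substitution `p_n ↦ u_n p_n`. -/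
noncomputable def scale (u : ℕ → k) : Fock k →ₐ[k] Fock k :=
  MvPolynomial.aeval fun n : ℕ+ => u n • MvPolynomial.X n

theorem scale_X (u : ℕ → k) (n : ℕ+) :
    scale u (MvPolynomial.X n) = u n • MvPolynomial.X n := MvPolynomial.aeval_X _ _

theorem coeff_scale (u : ℕ → k) (f : Fock k) (d : ℕ+ →₀ ℕ) :
    (scale u f).coeff d = (d.prod fun n m => u n ^ m) * f.coeff d := by
  induction f using MvPolynomial.induction_on' with
  | monomial e a =>
    have h : scale u (MvPolynomial.monomial e a) =
        MvPolynomial.monomial e (a * e.prod fun n m => u n ^ m) := by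
      rw [scale, MvPolynomial.aeval_monomial, MvPolynomial.algebraMap_eq, MvPolynomial.monomial_eq,
        map_mul, mul_assoc]
      congr 1
      simp only [Finsupp.prod, map_prod, ← Finset.prod_mul_distrib,
        MvPolynomial.smul_eq_C_mul, map_pow, mul_pow]
    rw [h, MvPolynomial.coeff_monomial, MvPolynomial.coeff_monomial]
    split_ifs with h1
    · subst h1; ring
    · ring
  | add p q hp hq => rw [map_add, MvPolynomial.coeff_add, hp, hq, MvPolynomial.coeff_add]; ring

theorem pairing_congr {zeta zeta' : ℕ → k} (h : ∀ n, 0 < n → zeta n = zeta' n) (f g : Fock k) :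
    pairing zeta f g = pairing zeta' f g := by
  rw [pairing_eq_sum _ _ _ _ subset_rfl, pairing_eq_sum _ _ _ _ subset_rfl]
  refine Finset.sum_congr rfl fun d _ => ?_
  congr 1
  exact Finset.prod_congr rfl fun n _ => by simp only [h n n.pos]

/-- The products `∏_i g_{a_i}` in an exponential family. -/
noncomputable def expProd (w : ℕ → k) (a : ℕ →₀ ℕ) : Fock k := a.prod fun _ m => expFam w m

theorem expProd_eq (w : ℕ → k) (a : ℕ →₀ ℕ) (s : Finset ℕ) (hs : a.support ⊆ s) :
    expProd w a = ∏ i ∈ s, expFam w (a i) :=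
  Finsupp.prod_of_support_subset _ hs _ fun _ _ => expFam_zero w

theorem pderiv_prod {ι : Type*} [DecidableEq ι] (n : ℕ+) (s : Finset ι) (f : ι → Fock k) :
    MvPolynomial.pderiv n (∏ i ∈ s, f i) =
      ∑ i ∈ s, MvPolynomial.pderiv n (f i) * ∏ j ∈ s.erase i, f j := by
  induction s using Finset.induction_on with
  | empty => simp
  | insert a s ha ih =>
    rw [Finset.prod_insert ha, Derivation.leibniz, ih, Finset.sum_insert ha,
      Finset.erase_insert ha, smul_eq_mul, smul_eq_mul, add_comm, Finset.mul_sum,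
      mul_comm (∏ i ∈ s, f i)]
    congr 1
    refine Finset.sum_congr rfl fun i hi => ?_
    have hia : i ≠ a := fun h => ha (h ▸ hi)
    rw [Finset.erase_insert_of_ne hia.symm, Finset.prod_insert (by simp [ha])]
    ring

theorem scale_scale (u v : ℕ → k) (f : Fock k) : scale u (scale v f) = scale (u * v) f := by
  ext d
  rw [coeff_scale, coeff_scale, coeff_scale, ← mul_assoc]
  congr 1
  simp [Finsupp.prod, ← Finset.prod_mul_distrib, mul_pow]

theorem scale_congr {u v : ℕ → k} (h : ∀ n, 0 < n → u n = v n) (f : Fock k) :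
    scale u f = scale v f := by
  ext d
  rw [coeff_scale, coeff_scale]
  congr 1
  exact Finset.prod_congr rfl fun n _ => congrArg (· ^ d n) (h n n.pos)

theorem scale_one (f : Fock k) : scale 1 f = f := by
  ext d
  rw [coeff_scale]
  simp [Finsupp.prod]

/-- Rescaling the variables multiplies each monomial, so on a diagonal form it can be absorbed into
the weights. -/
theorem pairing_scale (zeta u : ℕ → k) (f g : Fock k) :
    pairing zeta (scale u f) g = pairing (zeta * u) f g := by
  have hsub : (scale u f).support ⊆ f.support := by
    intro d hd
    rw [MvPolynomial.mem_support_iff, coeff_scale] at hd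
    exact MvPolynomial.mem_support_iff.mpr (right_ne_zero_of_mul hd)
  rw [pairing_eq_sum _ _ _ _ hsub, pairing_eq_sum _ _ _ _ subset_rfl]
  refine Finset.sum_congr rfl fun d _ => ?_
  rw [coeff_scale, zWeight, zWeight, ← mul_assoc, ← mul_assoc, ← mul_assoc, Finsupp.prod,
    Finsupp.prod, Finsupp.prod, ← Finset.prod_mul_distrib]
  congr 2
  refine Finset.prod_congr rfl fun n _ => ?_
  simp only [Pi.mul_apply, mul_pow]
  ring

variable [CharZero k]

/-- Coefficientwise form of `n ∂/∂p_n exp (∑ w_r p_r / r) = w_n exp (∑ w_r p_r / r)`. -/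
theorem expCoeff_add_single (w : ℕ → k) (d : ℕ+ →₀ ℕ) (n : ℕ+) :
    (n : k) * ((d n : k) + 1) * expCoeff w (d + Finsupp.single n 1) = w n * expCoeff w d := by
  have h := prod_add_single d n (fun n m => (w n / (n : k)) ^ m / (m.factorial : k)) (by simp)
  change expCoeff w _ * _ = expCoeff w _ * _ at h
  have hn : (n : k) ≠ 0 := Nat.cast_ne_zero.mpr n.ne_zero
  have hf : ((d n).factorial : k) ≠ 0 := Nat.cast_ne_zero.mpr (Nat.factorial_ne_zero _)
  have hd : (d n : k) + 1 ≠ 0 := by exact_mod_cast Nat.succ_ne_zero (d n)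
  -- The other case cancels a power of `w n / n`.
  by_cases hw : w n = 0
  · have h1 : expCoeff w (d + Finsupp.single n 1) = 0 := by
      refine Finset.prod_eq_zero (i := n) ?_ ?_
      · simp
      · simp [hw]
    rw [h1, hw]; ring
  · rw [Nat.factorial_succ] at h
    push_cast at h
    rw [pow_succ] at h
    have hw' : (w n / (n : k)) ^ d n ≠ 0 := pow_ne_zero _ (div_ne_zero hw hn)
    field_simp at h
    linear_combination h

/-- Differentiating `exp (∑ w_r p_r z^r / r)` in `p_n` brings down `w_n z^n / n`; this is the
coefficient of `z^m`. -/
theorem pderiv_expFam (w : ℕ → k) (n : ℕ+) (m : ℕ) :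
    (n : k) • MvPolynomial.pderiv n (expFam w m) =
      if (n : ℕ) ≤ m then w n • expFam w (m - n) else 0 := by
  ext d
  rw [MvPolynomial.coeff_smul, MvPolynomial.coeff_pderiv, coeff_expFam, map_add, wt_single, one_mul]
  split_ifs with h1 h2 h2
  · rw [MvPolynomial.coeff_smul, coeff_expFam, if_pos (by omega), smul_eq_mul, smul_eq_mul,
      ← expCoeff_add_single]
    ring
  · omega
  · rw [MvPolynomial.coeff_smul, coeff_expFam, if_neg (by omega)]; simp
  · simp

/-- The Euler operator `∑ n p_n ∂/∂p_n` multiplies the part of weight `m` by `m`; apply it to the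
exponential family. -/
theorem expFam_newton (w : ℕ → k) (m : ℕ) :
    (m : k) • expFam w m = ∑ r ∈ Finset.range m,
      w (r + 1) • (MvPolynomial.X r.succPNat * expFam w (m - (r + 1))) := by
  have key : ∀ r ∈ Finset.range m,
      w (r + 1) • (MvPolynomial.X r.succPNat * expFam w (m - (r + 1))) =
      MvPolynomial.X r.succPNat * ((r.succPNat : k) • MvPolynomial.pderiv r.succPNat (expFam w m)) := by
    intro r hr
    rw [Finset.mem_range] at hr
    rw [pderiv_expFam, if_pos (by simpa using hr)]
    simp
  rw [Finset.sum_congr rfl key]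
  ext d
  rw [MvPolynomial.coeff_sum, MvPolynomial.coeff_smul, coeff_expFam]
  have key2 : ∀ r : ℕ, (MvPolynomial.X r.succPNat * ((r.succPNat : k) •
      MvPolynomial.pderiv r.succPNat (expFam w m))).coeff d =
      ((d r.succPNat * (r + 1) : ℕ) : k) * (expFam w m).coeff d := by
    intro r
    rw [MvPolynomial.coeff_X_mul']
    split_ifs with h
    · rw [MvPolynomial.coeff_smul, MvPolynomial.coeff_pderiv]
      have h1 : 1 ≤ d r.succPNat := Nat.one_le_iff_ne_zero.mpr (Finsupp.mem_support_iff.mp h)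
      rw [tsub_add_cancel_of_le (Finsupp.single_le_iff.mpr h1)]
      simp only [Nat.succPNat_coe, Nat.succ_eq_add_one, Finsupp.coe_tsub, Pi.sub_apply,
        Finsupp.single_eq_same, smul_eq_mul]
      push_cast [h1]
      ring
    · rw [Finsupp.notMem_support_iff.mp h]; simp
  simp only [key2, coeff_expFam]
  split_ifs with h
  · rw [← Finset.sum_mul, ← Nat.cast_sum, smul_eq_mul]
    congr 2
    -- Every index `n` occurring in `d` satisfies `n ≤ wt d = m`, so the range over `r + 1 ≤ m` sees
    -- the whole support.
    have hsub : d.support ⊆ (Finset.range m).map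
        ⟨Nat.succPNat, Nat.succPNat_injective⟩ := by
      intro n hn
      rw [Finset.mem_map]
      refine ⟨n.natPred, ?_, by simp⟩
      rw [Finset.mem_range]
      have h1 := wt_eq_sum d d.support subset_rfl
      have h2 : d n * (n : ℕ) ≤ wt d := by
        rw [h1]
        exact Finset.single_le_sum (f := fun n : ℕ+ => d n * (n : ℕ)) (fun _ _ => Nat.zero_le _) hn
      have h3 : 1 ≤ d n := Nat.one_le_iff_ne_zero.mpr (Finsupp.mem_support_iff.mp hn)
      have h4 : n.natPred + 1 = n := n.natPred_add_one
      nlinarith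
    exact (((Finset.sum_map _ _ _).symm.trans (wt_eq_sum d _ hsub).symm).trans h).symm
  · simp

/-- Behind this is the factorization `exp (∑ w_r p_r z^r / r) = ∏_i ∑_m c_m (x_i z)^m`, the sequence
`c` being the solution of Newton's recursion for one variable. It is proved by induction on the
degree from Newton's recursion for the whole family. -/
theorem scoeff_expFam (w c : ℕ → k) (hc0 : c 0 = 1)
    (hc : ∀ m : ℕ, (m : k) * c m = ∑ r ∈ Finset.range m, w (r + 1) * c (m - (r + 1))) (m : ℕ)
    (a : ℕ →₀ ℕ) :
    scoeff a (toSymFun k (expFam w m)) = if a.degree = m then a.prod fun _ j => c j else 0 := by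
  induction m using Nat.strong_induction_on generalizing a with
  | _ m ih =>
    rcases Nat.eq_zero_or_pos m with rfl | hm
    · rw [expFam_zero, map_one, scoeff_apply]
      by_cases ha : a = 0
      · subst ha; simp
      · have h1 : a.degree ≠ 0 := fun h => ha ((Finsupp.degree_eq_zero_iff a).mp h)
        rw [if_neg h1]
        simp [MvPowerSeries.coeff_one, ha]
    · have hm' : (m : k) ≠ 0 := Nat.cast_ne_zero.mpr hm.ne'
      refine mul_left_cancel₀ hm' ?_
      rw [← smul_eq_mul, ← map_smul, ← map_smul, expFam_newton, map_sum, map_sum]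
      have key : ∀ r ∈ Finset.range m, scoeff a (toSymFun k
          (w (r + 1) • (MvPolynomial.X r.succPNat * expFam w (m - (r + 1))))) =
          ∑ i ∈ a.support, if a.degree = m then
            (if r + 1 ≤ a i then w (r + 1) * c (a i - (r + 1)) else 0) *
              ∏ j ∈ a.support.erase i, c (a j) else 0 := by
        intro r hr
        rw [Finset.mem_range] at hr
        have hX : toSymFun k (MvPolynomial.X r.succPNat) = powerSum (r + 1) := toSymFun_X _
        rw [map_smul, map_smul, map_mul, hX,
          scoeff_powerSum_mul (r + 1) _ a a.support subset_rfl (by omega), smul_eq_mul,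
          Finset.mul_sum]
        refine Finset.sum_congr rfl fun i hi => ?_
        by_cases hr2 : r + 1 ≤ a i
        · rw [if_pos hr2, if_pos hr2, ih _ (by omega)]
          have hdeg : (a - Finsupp.single i (r + 1)).degree + (r + 1) = a.degree := by
            conv_rhs => rw [← tsub_add_cancel_of_le (Finsupp.single_le_iff.mpr hr2)]
            rw [map_add, Finsupp.degree_single]
          by_cases hd : a.degree = m
          · rw [if_pos hd, if_pos (by omega), Finsupp.prod_of_support_subset (s := a.support)]
            · rw [← Finset.mul_prod_erase _ _ hi]
              simp only [Finsupp.coe_tsub, Pi.sub_apply, Finsupp.single_eq_same]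
              rw [mul_assoc]
              congr 2
              refine Finset.prod_congr rfl fun j hj => ?_
              rw [Finsupp.single_apply, if_neg (Ne.symm (Finset.mem_erase.mp hj).1), tsub_zero]
            · intro j hj
              rw [Finsupp.mem_support_iff] at hj ⊢
              intro h0
              simp [h0] at hj
            · intro _ _; exact hc0
          · rw [if_neg hd, if_neg (by omega), mul_zero]
        · simp [hr2]
      rw [Finset.sum_congr rfl key, Finset.sum_comm]
      by_cases hd : a.degree = m
      · simp only [if_pos hd]
        have key2 : ∀ i ∈ a.support, (∑ r ∈ Finset.range m,
            (if r + 1 ≤ a i then w (r + 1) * c (a i - (r + 1)) else 0) *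
              ∏ j ∈ a.support.erase i, c (a j)) = (a i : k) * a.prod fun _ j => c j := by
          intro i hi
          have hle : a i ≤ m := hd ▸ Finsupp.le_degree i a
          rw [← Finset.sum_mul, Finsupp.prod, ← Finset.mul_prod_erase _ _ hi, ← mul_assoc, hc]
          congr 1
          rw [← Finset.sum_filter]
          refine Finset.sum_congr ?_ fun _ _ => rfl
          ext r
          simp only [Finset.mem_filter, Finset.mem_range]
          omega
        rw [Finset.sum_congr rfl key2, ← Finset.sum_mul, ← Nat.cast_sum]
        congr 2
      · simp [hd]

theorem toSymFun_expFam_one (m : ℕ) : toSymFun k (expFam 1 m) = completeSymm (m : ℤ) := by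
  refine symFun_ext fun lam => ?_
  rw [scoeff_expFam 1 1 rfl (fun m : ℕ => by simp), completeSymm, scoeff_ofCoeff]
  refine if_congr (by norm_cast) ?_ rfl
  simp [Finsupp.prod]

/-! ### Reproducing property -/

theorem zWeight_add_single (zeta : ℕ → k) (d : ℕ+ →₀ ℕ) (n : ℕ+) (hz : zeta n ≠ 0) :
    zWeight zeta (d + Finsupp.single n 1) =
      (n : k) * zeta n * ((d n : k) + 1) * zWeight zeta d := by
  have h := prod_add_single d n (fun n m => ((n : k) * zeta n) ^ m * (m.factorial : k)) (by simp)
  change zWeight zeta _ * _ = zWeight zeta _ * _ at h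
  have hn : (n : k) * zeta n ≠ 0 := mul_ne_zero (Nat.cast_ne_zero.mpr n.ne_zero) hz
  have hf : ((d n).factorial : k) ≠ 0 := Nat.cast_ne_zero.mpr (Nat.factorial_ne_zero _)
  refine mul_right_cancel₀ (mul_ne_zero (pow_ne_zero (d n) hn) hf) ?_
  rw [h, Nat.factorial_succ]
  push_cast
  ring

/-- The adjoint of multiplication by `p_n` is `n ζ_n ∂/∂p_n`. -/
theorem pairing_X_mul (zeta : ℕ → k) (hz : ∀ n, 0 < n → zeta n ≠ 0) (n : ℕ+) (f g : Fock k) :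
    pairing zeta (MvPolynomial.X n * f) g =
      pairing zeta f (((n : k) * zeta n) • MvPolynomial.pderiv n g) := by
  induction f using MvPolynomial.induction_on' with
  | monomial d a =>
    have ha : MvPolynomial.monomial d a = a • (MvPolynomial.monomial d 1 : Fock k) := by
      rw [MvPolynomial.smul_monomial, smul_eq_mul, mul_one]
    have h1 : pairing zeta (MvPolynomial.X n * MvPolynomial.monomial d 1) g =
        pairing zeta (MvPolynomial.monomial d 1)
          (((n : k) * zeta n) • MvPolynomial.pderiv n g) := by
      rw [MvPolynomial.X, MvPolynomial.monomial_mul, one_mul, pairing_monomial, pairing_monomial,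
        add_comm, zWeight_add_single zeta d n (hz n n.pos), MvPolynomial.coeff_smul,
        MvPolynomial.coeff_pderiv, smul_eq_mul]
      ring
    rw [ha, mul_smul_comm, LinearMap.map_smul₂, LinearMap.map_smul₂, h1]
  | add p q hp hq => rw [mul_add, map_add, LinearMap.add_apply, hp, hq, map_add,
      LinearMap.add_apply]

theorem pderiv_expProd (w : ℕ → k) (n : ℕ+) (a : ℕ →₀ ℕ) :
    (n : k) • MvPolynomial.pderiv n (expProd w a) = ∑ i ∈ a.support,
      if (n : ℕ) ≤ a i then w n • expProd w (a - Finsupp.single i (n : ℕ)) else 0 := by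
  rw [expProd_eq w a a.support subset_rfl, pderiv_prod, Finset.smul_sum]
  refine Finset.sum_congr rfl fun i hi => ?_
  rw [← smul_mul_assoc, pderiv_expFam, ite_mul, zero_mul]
  refine if_congr Iff.rfl ?_ rfl
  rw [expProd_eq w _ a.support, ← Finset.mul_prod_erase _ _ hi, smul_mul_assoc]
  · congr 2
    · simp
    · refine Finset.prod_congr rfl fun j hj => ?_
      rw [Finsupp.coe_tsub, Pi.sub_apply, Finsupp.single_apply,
        if_neg (Ne.symm (Finset.mem_erase.mp hj).1), tsub_zero]
  · intro j hj
    rw [Finsupp.mem_support_iff] at hj ⊢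
    intro h0
    simp [h0] at hj

/-- Reproducing property, by induction on `f`. Moving a factor `p_n` of `f` to the other side turns
it into `n ζ_n ∂/∂p_n`, which lowers one exponent of the product by `n` at the cost of `ζ_n w_n`;
multiplication by the power sum `p_n` acts on coefficients in the same way. -/
theorem pairing_expProd (zeta w : ℕ → k) (hz : ∀ n, 0 < n → zeta n ≠ 0) (a : ℕ →₀ ℕ) (f : Fock k) :
    pairing zeta (expProd w a) f = scoeff a (toSymFun k (scale (zeta * w) f)) := by
  induction f using MvPolynomial.induction_on generalizing a with
  | C c =>
    have h1 : (MvPolynomial.C c : Fock k) = c • MvPolynomial.monomial 0 1 := by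
      rw [MvPolynomial.smul_monomial, smul_eq_mul, mul_one]; rfl
    have h2 : scale (zeta * w) (MvPolynomial.C c : Fock k) = algebraMap k (Fock k) c :=
      (scale (zeta * w)).commutes c
    have h3 : (expProd w a).coeff 0 = if a = 0 then 1 else 0 := by
      rw [← MvPolynomial.constantCoeff_eq, expProd, Finsupp.prod, map_prod]
      split_ifs with h
      · subst h; simp
      · obtain ⟨i, hi⟩ := Finsupp.support_nonempty_iff.mpr h
        exact Finset.prod_eq_zero hi (coeff_zero_expFam w (Finsupp.mem_support_iff.mp hi))
    rw [h2, AlgEquiv.commutes, pairing_comm, h1, map_smul, LinearMap.smul_apply, pairing_monomial,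
      h3, scoeff_apply, zWeight, Finsupp.prod_zero_index, one_mul, smul_eq_mul]
    change _ = MvPowerSeries.coeff a (algebraMap k (MvPowerSeries ℕ k) c)
    rw [MvPowerSeries.algebraMap_apply, MvPowerSeries.coeff_C]
    simp
  | add p q hp hq => simp only [map_add, hp, hq]
  | mul_X p n hp =>
    have h1 : pairing zeta (expProd w a) (p * MvPolynomial.X n) =
        zeta n * pairing zeta ((n : k) • MvPolynomial.pderiv n (expProd w a)) p := by
      rw [pairing_comm, mul_comm, pairing_X_mul zeta hz, pairing_comm, mul_comm (n : k), mul_smul,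
        LinearMap.map_smul₂, smul_eq_mul]
    have h2 : scale (zeta * w) (p * MvPolynomial.X n) =
        (zeta n * w n) • (MvPolynomial.X n * scale (zeta * w) p) := by
      rw [map_mul, scale_X, mul_comm, smul_mul_assoc]; rfl
    rw [h1, pderiv_expProd, h2, map_smul, map_smul, map_mul, toSymFun_X,
      scoeff_powerSum_mul _ _ a a.support subset_rfl n.pos, map_sum,
      LinearMap.sum_apply, smul_eq_mul, mul_assoc, Finset.mul_sum _ _ (w n)]
    congr 1
    refine Finset.sum_congr rfl fun i _ => ?_
    split_ifs
    · rw [LinearMap.map_smul₂, hp, smul_eq_mul]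
    · simp

end

end Macdonald


/-! ### Schur functions, dual bases, and an algebraic formula for the Kostka functions -/

namespace Macdonald

/-! ### Schur functions -/

/-- The exponent on the first `n` variables with the given values. -/
noncomputable def finExp {n : ℕ} (a : Fin n → ℕ) : ℕ →₀ ℕ :=
  (Finsupp.equivFunOnFinite.symm a).embDomain Fin.valEmbedding

theorem finExp_apply {n : ℕ} (a : Fin n → ℕ) (i : Fin n) : finExp a i = a i := by
  have := Finsupp.embDomain_apply_self Fin.valEmbedding (Finsupp.equivFunOnFinite.symm a) i
  simpa [finExp] using this

theorem finExp_of_le {n : ℕ} (a : Fin n → ℕ) {j : ℕ} (hj : n ≤ j) : finExp a j = 0 := by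
  refine Finsupp.embDomain_of_notMem_range _ _ _ ?_
  rintro ⟨i, rfl⟩
  exact absurd hj (not_le.mpr i.2)

theorem expo_eq_finExp {n : ℕ} (lam : YoungDiagram) (h : lam.colLen 0 ≤ n) :
    expo lam = finExp fun i : Fin n => lam.rowLen i := by
  ext j
  rcases lt_or_ge j n with hj | hj
  · exact (finExp_apply (fun i : Fin n => lam.rowLen i) ⟨j, hj⟩).symm
  · rw [finExp_of_le _ hj, expo_apply, rowLen_eq_zero_iff]
    exact h.trans hj

theorem sum_map_parts_finExp {n : ℕ} (a : Fin n → ℕ) (F : ℕ → ℕ) (hF : F 0 = 0) :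
    ((parts (finExp a)).map F).sum = ∑ i, F (a i) := by
  rw [finExp, parts_embDomain, parts, Multiset.map_map]
  refine Finset.sum_subset (Finset.subset_univ _) fun i _ hi => ?_
  rw [Finsupp.notMem_support_iff] at hi
  exact (congrArg F hi).trans hF

theorem degree_finExp {n : ℕ} (a : Fin n → ℕ) : (finExp a).degree = ∑ i, a i := by
  have := sum_map_parts_finExp a id rfl
  rwa [Multiset.map_id, sum_parts] at this

/-- The sum of the squares of the parts. -/
noncomputable def sqNorm (d : ℕ →₀ ℕ) : ℕ := ((parts d).map (· ^ 2)).sum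

section

variable {k : Type*} [Field k]

theorem expProd_finExp (w : ℕ → k) {n : ℕ} (a : Fin n → ℕ) :
    expProd w (finExp a) = ∏ i, expFam w (a i) := by
  rw [expProd, finExp, Finsupp.prod_embDomain, Finsupp.prod_fintype _ _ fun _ => expFam_zero w]
  rfl

/-- The members of an exponential family, indexed by integers. -/
noncomputable def expInt (w : ℕ → k) (r : ℤ) : Fock k := if 0 ≤ r then expFam w r.toNat else 0

/-- The Jacobi-Trudi determinants in an exponential family. -/
noncomputable def schurPoly (w : ℕ → k) (lam : YoungDiagram) : Fock k :=
  Matrix.det (Matrix.of fun i j : Fin (lam.colLen 0) =>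
    expInt w ((lam.rowLen i : ℤ) - (i : ℤ) + (j : ℤ)))

/-- The exponents in the expansion of a Jacobi-Trudi determinant. -/
def schurExp (lam : YoungDiagram) (g : Equiv.Perm (Fin (lam.colLen 0)))
    (i : Fin (lam.colLen 0)) : ℤ :=
  (lam.rowLen i : ℤ) - (i : ℤ) + (g i : ℤ)

/-- The coefficient of `x^lam` in `f ∏_{i<j} (1 - x_j/x_i)`. -/
noncomputable def schurFunctional (lam : YoungDiagram) : SymFun k →ₗ[k] k :=
  ∑ g : Equiv.Perm (Fin (lam.colLen 0)), Equiv.Perm.sign g •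
    if ∀ i, 0 ≤ schurExp lam g i then scoeff (finExp fun i => (schurExp lam g i).toNat) else 0

theorem schurFunctional_apply (lam : YoungDiagram) (f : SymFun k) :
    schurFunctional lam f = ∑ g : Equiv.Perm (Fin (lam.colLen 0)), Equiv.Perm.sign g •
      if ∀ i, 0 ≤ schurExp lam g i then scoeff (finExp fun i => (schurExp lam g i).toNat) f
      else 0 := by
  rw [schurFunctional, LinearMap.sum_apply]
  refine Finset.sum_congr rfl fun g _ => ?_
  rw [LinearMap.smul_apply]
  split_ifs <;> simp

theorem schurExp_one (lam : YoungDiagram) (i : Fin (lam.colLen 0)) :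
    schurExp lam 1 i = lam.rowLen i := by
  simp [schurExp]

theorem sum_schurExp (lam : YoungDiagram) (g : Equiv.Perm (Fin (lam.colLen 0))) :
    ∑ i, schurExp lam g i = ∑ i : Fin (lam.colLen 0), (lam.rowLen i : ℤ) := by
  simp only [schurExp, Finset.sum_add_distrib, Finset.sum_sub_distrib]
  have := Equiv.sum_comp g fun i : Fin (lam.colLen 0) => (i : ℤ)
  rw [this]; ring

/-- Expand the squares: the difference is `2 ∑ lam_i (g(i) - i) + ∑ (g(i) - i)^2`. The first sum is
nonnegative by the rearrangement inequality, and the second is positive unless `g` is the identity.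
-/
theorem sum_sq_schurExp (lam : YoungDiagram) (g : Equiv.Perm (Fin (lam.colLen 0))) (hg : g ≠ 1) :
    ∑ i : Fin (lam.colLen 0), (lam.rowLen i : ℤ) ^ 2 < ∑ i, schurExp lam g i ^ 2 := by
  have h1 : ∑ i : Fin (lam.colLen 0), (lam.rowLen i : ℤ) * (i : ℤ) ≤
      ∑ i : Fin (lam.colLen 0), (lam.rowLen i : ℤ) * (g i : ℤ) := by
    -- Row lengths decrease while `i` increases, so the identity permutation minimizes the sum of
    -- products.
    refine Antivary.sum_mul_le_sum_mul_comp_perm (f := fun i : Fin (lam.colLen 0) =>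
      (lam.rowLen i : ℤ)) (g := fun i : Fin (lam.colLen 0) => (i : ℤ)) ?_
    intro i j hij
    have : (i : ℕ) ≤ j := by
      simp only [Nat.cast_lt] at hij
      exact hij.le
    exact Nat.cast_le.mpr (lam.rowLen_anti _ _ this)
  obtain ⟨i, hi⟩ : ∃ i, g i ≠ i := by
    by_contra hc
    push Not at hc
    exact hg (Equiv.ext hc)
  have h2 : (0 : ℤ) < ∑ i : Fin (lam.colLen 0), ((g i : ℤ) - (i : ℤ)) ^ 2 := by
    refine Finset.sum_pos' (fun i _ => sq_nonneg _) ⟨i, Finset.mem_univ _, ?_⟩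
    refine (sq_nonneg _).lt_of_ne' (pow_ne_zero 2 (sub_ne_zero.mpr fun h => hi ?_))
    exact Fin.ext (by exact_mod_cast h)
  have h3 : ∑ i, schurExp lam g i ^ 2 = ∑ i : Fin (lam.colLen 0), (lam.rowLen i : ℤ) ^ 2 +
      2 * (∑ i : Fin (lam.colLen 0), (lam.rowLen i : ℤ) * (g i : ℤ) -
        ∑ i : Fin (lam.colLen 0), (lam.rowLen i : ℤ) * (i : ℤ)) +
      ∑ i : Fin (lam.colLen 0), ((g i : ℤ) - (i : ℤ)) ^ 2 := by
    rw [← Finset.sum_sub_distrib, Finset.mul_sum, ← Finset.sum_add_distrib,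
      ← Finset.sum_add_distrib]
    refine Finset.sum_congr rfl fun i _ => ?_
    rw [schurExp]; ring
  rw [h3]
  linarith

theorem sqNorm_expo (lam : YoungDiagram) :
    sqNorm (expo lam) = ∑ i : Fin (lam.colLen 0), lam.rowLen i ^ 2 := by
  rw [sqNorm, expo_eq_finExp lam le_rfl]
  exact sum_map_parts_finExp _ (· ^ 2) rfl

theorem sqNorm_lt_of_schurExp (lam : YoungDiagram) (g : Equiv.Perm (Fin (lam.colLen 0)))
    (hg : g ≠ 1) (h0 : ∀ i, 0 ≤ schurExp lam g i) :
    sqNorm (expo lam) < sqNorm (finExp fun i => (schurExp lam g i).toNat) := by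
  rw [sqNorm_expo, sqNorm, sum_map_parts_finExp _ (· ^ 2) rfl]
  have h := sum_sq_schurExp lam g hg
  have h2 : ∑ i, schurExp lam g i ^ 2 = ((∑ i, (schurExp lam g i).toNat ^ 2 : ℕ) : ℤ) := by
    push_cast
    refine Finset.sum_congr rfl fun i _ => ?_
    rw [Int.toNat_of_nonneg (h0 i)]
  rw [h2] at h
  exact_mod_cast h

theorem schurFunctional_monomialSymm_self (lam : YoungDiagram) :
    schurFunctional lam (monomialSymm lam : SymFun k) = 1 := by
  rw [schurFunctional_apply, Finset.sum_eq_single 1]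
  · simp only [schurExp_one, Nat.cast_nonneg, implies_true, if_true, Int.toNat_natCast,
      Equiv.Perm.sign_one, one_smul]
    rw [← expo_eq_finExp lam le_rfl, scoeff_expo_monomialSymm, if_pos rfl]
  · intro g _ hg
    split_ifs with h0
    · rw [scoeff_monomialSymm, if_neg, smul_zero]
      intro h
      have := sqNorm_lt_of_schurExp lam g hg h0
      rw [sqNorm, sqNorm, h] at this
      exact lt_irrefl _ this
    · rw [smul_zero]
  · simp

/-- The exponents `lam_i - i + g(i)` have total `|lam|` and, for `g ≠ 1`, a larger sum of squares
than `lam`. So the functionals are unitriangular on the monomial functions, ranked by the sum of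
squares of the parts. -/
theorem schurFunctional_monomialSymm_ne_zero {lam mu : YoungDiagram}
    (h : schurFunctional lam (monomialSymm mu : SymFun k) ≠ 0) :
    lam.card = mu.card ∧ (lam = mu ∨ sqNorm (expo lam) < sqNorm (expo mu)) := by
  rw [schurFunctional_apply] at h
  obtain ⟨g, -, hg⟩ := Finset.exists_ne_zero_of_sum_ne_zero h
  have hg' := right_ne_zero_of_smul hg
  split_ifs at hg' with h0
  · rw [scoeff_monomialSymm] at hg'
    have hp : parts (finExp fun i => (schurExp lam g i).toNat) = parts (expo mu) := by
      by_contra hc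
      exact hg' (if_neg hc)
    have hsum := sum_schurExp lam g
    have h2 : ∑ i, schurExp lam g i = ((∑ i, (schurExp lam g i).toNat : ℕ) : ℤ) := by
      push_cast
      refine Finset.sum_congr rfl fun i _ => ?_
      rw [Int.toNat_of_nonneg (h0 i)]
    rw [h2, ← degree_finExp, ← sum_parts, hp, sum_parts, degree_expo] at hsum
    have h3 : lam.card = ∑ i : Fin (lam.colLen 0), lam.rowLen i := by
      rw [← degree_expo, expo_eq_finExp lam le_rfl, degree_finExp]
    refine ⟨by rw [h3]; exact_mod_cast hsum.symm, ?_⟩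
    rcases eq_or_ne g 1 with rfl | hne
    · left
      simp only [schurExp_one, Int.toNat_natCast] at hp
      rw [← expo_eq_finExp lam le_rfl] at hp
      exact parts_expo_inj.mp hp
    · right
      have := sqNorm_lt_of_schurExp lam g hne h0
      rwa [sqNorm, sqNorm, hp] at this
  · exact absurd rfl hg'

/-- The map taking `m_mu` to `∑_lam L_lam(m_mu) m_lam`, with `L_lam` the functional
`schurFunctional lam`. -/
noncomputable def schurTransformAux (mu : YoungDiagram) : SymFun k :=
  ∑ lam ∈ (finite_card_eq mu.card).toFinset,
    schurFunctional lam (monomialSymm mu : SymFun k) • monomialSymm lam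

theorem repr_schurTransformAux (lam mu : YoungDiagram) :
    monomialBasis.repr (schurTransformAux mu : SymFun k) lam =
      schurFunctional lam (monomialSymm mu : SymFun k) := by
  rw [schurTransformAux, map_sum, Finsupp.finsetSum_apply]
  simp only [← monomialBasis_apply, map_smul, Module.Basis.repr_self, Finsupp.smul_apply,
    Finsupp.single_apply, smul_eq_mul, mul_ite, mul_one, mul_zero]
  rw [Finset.sum_ite_eq']
  split_ifs with h
  · rfl
  · by_contra hc
    rw [monomialBasis_apply] at hc
    refine h ((Set.Finite.mem_toFinset _).mpr ?_)
    exact (schurFunctional_monomialSymm_ne_zero (Ne.symm hc)).1.le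

/-- The linear automorphism with coordinates `schurFunctional lam`. -/
noncomputable def schurTransform : SymFun k ≃ₗ[k] SymFun k :=
  LinearEquiv.ofBijective _ (triangular_bijective (monomialBasis (k := k)) schurTransformAux
    (fun lam => sqNorm (expo lam))
    (fun lam => by
      rw [repr_schurTransformAux, schurFunctional_monomialSymm_self]; exact one_ne_zero)
    (fun mu lam h => by
      rw [repr_schurTransformAux] at h
      exact (schurFunctional_monomialSymm_ne_zero h).2))

theorem scoeff_schurTransform (lam : YoungDiagram) (f : SymFun k) :
    scoeff (expo lam) (schurTransform f) = schurFunctional lam f := by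
  have h : (scoeff (expo lam)).comp (schurTransform (k := k)).toLinearMap =
      schurFunctional lam := by
    refine monomialBasis.ext fun mu => ?_
    rw [LinearMap.comp_apply, LinearEquiv.coe_coe]
    have h2 : schurTransform (monomialBasis mu : SymFun k) = schurTransformAux mu :=
      monomialBasis.constr_basis k schurTransformAux mu
    rw [h2, ← monomialBasis_repr, repr_schurTransformAux, monomialBasis_apply]
  exact LinearMap.congr_fun h f

/-- These functionals are the coordinates of the automorphism `schurTransform`, so together they
separate points. -/
theorem schurFunctional_ext {f g : SymFun k}
    (h : ∀ lam, schurFunctional lam f = schurFunctional lam g) : f = g := by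
  refine schurTransform.injective (symFun_ext fun lam => ?_)
  rw [scoeff_schurTransform, scoeff_schurTransform, h]

theorem schurFunctional_symm (lam mu : YoungDiagram) :
    schurFunctional lam (schurTransform.symm (monomialSymm mu : SymFun k)) =
      if lam = mu then 1 else 0 := by
  rw [← scoeff_schurTransform, LinearEquiv.apply_symm_apply, scoeff_expo_monomialSymm]

/-- `1 / (1 - t^n)` -/
def zetaT (t : k) (n : ℕ) : k := (1 - t ^ n)⁻¹

theorem zetaQT_zero (t : k) {n : ℕ} (hn : 0 < n) : zetaQT 0 t n = zetaT t n := by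
  rw [zetaQT, zetaT, zero_pow hn.ne', sub_zero, one_div]

variable [CharZero k]

theorem toSymFun_expInt_one (r : ℤ) : toSymFun k (expInt 1 r) = completeSymm r := by
  rw [expInt]
  split_ifs with h
  · rw [toSymFun_expFam_one, Int.toNat_of_nonneg h]
  · rw [map_zero]
    refine symFun_ext fun lam => ?_
    rw [map_zero, completeSymm, scoeff_ofCoeff, if_neg]
    omega

theorem toSymFun_schurPoly_one (lam : YoungDiagram) :
    toSymFun k (schurPoly 1 lam) = schur lam := by
  rw [schurPoly, schur, AlgEquiv.map_det]
  refine congrArg Matrix.det (Matrix.ext fun i j => ?_)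
  exact toSymFun_expInt_one (k := k) _

/-- Each term of the determinant is a product in an exponential family, to which `pairing_expProd`
applies; terms with a negative index vanish on both sides. -/
theorem pairing_schurPoly (zeta w : ℕ → k) (hz : ∀ n, 0 < n → zeta n ≠ 0) (lam : YoungDiagram)
    (f : Fock k) : pairing zeta (schurPoly w lam) f =
      schurFunctional lam (toSymFun k (scale (zeta * w) f)) := by
  rw [schurPoly, ← Matrix.det_transpose, Matrix.det_apply, map_sum, LinearMap.sum_apply,
    schurFunctional_apply]
  refine Finset.sum_congr rfl fun g _ => ?_
  have h1 : ∏ i, (Matrix.of fun i j : Fin (lam.colLen 0) =>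
      expInt w ((lam.rowLen i : ℤ) - (i : ℤ) + (j : ℤ))).transpose (g i) i =
      if ∀ i, 0 ≤ schurExp lam g i then expProd w (finExp fun i => (schurExp lam g i).toNat)
      else 0 := by
    split_ifs with h0
    · rw [expProd_finExp]
      refine Finset.prod_congr rfl fun i _ => ?_
      exact if_pos (h0 i)
    · push Not at h0
      obtain ⟨i, hi⟩ := h0
      exact Finset.prod_eq_zero (Finset.mem_univ i) (if_neg (not_le.mpr hi))
  rw [h1, Units.smul_def, Units.smul_def, map_zsmul, LinearMap.smul_apply]
  congr 1
  split_ifs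
  · exact pairing_expProd zeta w hz _ f
  · simp

/-! ### Dual bases and Kostka coefficients -/

variable {q t : k}

theorem scalarProduct_schur (ht : ∀ n, 0 < n → t ^ n ≠ 1) (f : SymFun k) (lam : YoungDiagram) :
    scalarProduct 0 t f (schur lam) =
      schurFunctional lam (toSymFun k (scale (zetaT t) ((toSymFun k).symm f))) := by
  rw [scalarProduct_eq, ← toSymFun_schurPoly_one, AlgEquiv.symm_apply_apply, pairing_comm,
    pairing_congr (zeta' := zetaT t) (fun n hn => zetaQT_zero t hn),
    pairing_schurPoly, mul_one]
  exact fun n hn => inv_ne_zero (sub_ne_zero.mpr (ht n hn).symm)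

/-- A dual family exists: pull `m_lam` back through `schurTransform` and undo the rescaling of the
`p_n` by `1 / (1 - t^n)`. -/
theorem bigSchur_spec (ht : ∀ n, 0 < n → t ^ n ≠ 1) (lam mu : YoungDiagram) :
    scalarProduct 0 t (bigSchur t lam) (schur mu) = if lam = mu then 1 else 0 := by
  have h : ∃ w : YoungDiagram → SymFun k,
      ∀ lam mu, scalarProduct 0 t (w lam) (schur mu) = if lam = mu then 1 else 0 := by
    refine ⟨fun lam => toSymFun k (scale (zetaT t)⁻¹ ((toSymFun k).symm
      (schurTransform.symm (monomialSymm lam)))), fun lam mu => ?_⟩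
    rw [scalarProduct_schur ht, AlgEquiv.symm_apply_apply, scale_scale,
      scale_congr (v := 1), scale_one, AlgEquiv.apply_symm_apply, schurFunctional_symm]
    · exact if_congr eq_comm rfl rfl
    · intro n hn
      exact mul_inv_cancel₀ (inv_ne_zero (sub_ne_zero.mpr (ht n hn).symm))
  exact Classical.epsilon_spec h lam mu

/-- The coefficients must be the products with Schur functions. They have finite support because
they are the monomial coordinates of a single symmetric function; equality follows because pairing
with all Schur functions is injective. -/
theorem eq_sum_bigSchur (ht : ∀ n, 0 < n → t ^ n ≠ 1) (f : SymFun k) :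
    ∃ c : YoungDiagram →₀ k, f = c.sum fun nu a => a • bigSchur t nu := by
  let c : YoungDiagram →₀ k := monomialBasis.repr
    (schurTransform (toSymFun k (scale (zetaT t) ((toSymFun k).symm f))))
  have hc : ∀ lam, c lam = scalarProduct 0 t f (schur lam) := fun lam => by
    rw [scalarProduct_schur ht, ← scoeff_schurTransform, ← monomialBasis_repr]
  have hz : ∀ n, 0 < n → zetaT t n ≠ 0 := fun n hn =>
    inv_ne_zero (sub_ne_zero.mpr (ht n hn).symm)
  refine ⟨c, ?_⟩
  have h1 : ∀ lam, scalarProduct 0 t f (schur lam) =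
      scalarProduct 0 t (c.sum fun nu a => a • bigSchur t nu) (schur lam) := by
    intro lam
    rw [← hc, Finsupp.sum, map_sum, LinearMap.sum_apply]
    simp only [LinearMap.map_smul₂, bigSchur_spec ht, smul_eq_mul, mul_ite, mul_one, mul_zero]
    rw [Finset.sum_ite_eq']
    split_ifs with h
    · rfl
    · exact Finsupp.notMem_support_iff.mp h
  have h2 : toSymFun k (scale (zetaT t) ((toSymFun k).symm f)) = toSymFun k (scale (zetaT t)
      ((toSymFun k).symm (c.sum fun nu a => a • bigSchur t nu))) := by
    refine schurFunctional_ext fun lam => ?_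
    rw [← scalarProduct_schur ht, ← scalarProduct_schur ht, h1]
  have h3 := congrArg (scale (zetaT t)⁻¹) ((toSymFun k).injective h2)
  rw [scale_scale, scale_scale, scale_congr (v := 1), scale_one, scale_congr (v := 1),
    scale_one] at h3
  · exact (toSymFun k).symm.injective h3
  · exact fun n hn => inv_mul_cancel₀ (hz n hn)
  · exact fun n hn => inv_mul_cancel₀ (hz n hn)

/-- Existence of an expansion is enough to know that the chosen coefficients give one; duality
recovers them later. -/
theorem macdonaldM_eq_sum (ht : ∀ n, 0 < n → t ^ n ≠ 1) (mu : YoungDiagram) :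
    ∃ c : YoungDiagram →₀ k, (∀ lam, kostka q t lam mu = c lam) ∧
      macdonaldM q t mu = c.sum fun nu a => a • bigSchur t nu :=
  ⟨_, fun _ => rfl, Classical.epsilon_spec
    (p := fun c : YoungDiagram →₀ k => macdonaldM q t mu = c.sum fun nu a => a • bigSchur t nu)
    (eq_sum_bigSchur ht _)⟩

theorem kostka_eq_scalarProduct (ht : ∀ n, 0 < n → t ^ n ≠ 1) (lam mu : YoungDiagram) :
    kostka q t lam mu = scalarProduct 0 t (macdonaldM q t mu) (schur lam) := by
  obtain ⟨c, hc, h⟩ := macdonaldM_eq_sum (q := q) ht mu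
  rw [hc, h, Finsupp.sum, map_sum, LinearMap.sum_apply]
  simp only [LinearMap.map_smul₂, bigSchur_spec ht, smul_eq_mul, mul_ite, mul_one, mul_zero]
  rw [Finset.sum_ite_eq']
  split_ifs with h
  · rfl
  · exact Finsupp.notMem_support_iff.mp h

/-- A dual family exists: the Jacobi-Trudi determinants with weights `1 / (1 - q^n)`. Multiplied by
`(1 - q^n)/(1 - t^n)` these weights become `1 / (1 - t^n)`, so pairing with them for `q,t` is
pairing with `schur` for `0,t`. -/
theorem bigSchurQT_spec (hq : ∀ n, 0 < n → q ^ n ≠ 1) (ht : ∀ n, 0 < n → t ^ n ≠ 1)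
    (lam mu : YoungDiagram) :
    scalarProduct q t (bigSchurQT q t lam) (bigSchur t mu) = if lam = mu then 1 else 0 := by
  have h : ∃ w : YoungDiagram → SymFun k,
      ∀ lam mu, scalarProduct q t (w lam) (bigSchur t mu) = if lam = mu then 1 else 0 := by
    refine ⟨fun lam => toSymFun k (schurPoly (zetaT q) lam), fun lam mu => ?_⟩
    rw [scalarProduct_eq, AlgEquiv.symm_apply_apply, pairing_schurPoly,
      scale_congr (v := zetaT t), ← scalarProduct_schur ht, bigSchur_spec ht]
    · exact if_congr eq_comm rfl rfl
    · intro n hn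
      rw [Pi.mul_apply, zetaQT, zetaT, zetaT, div_mul_eq_mul_div,
        mul_inv_cancel₀ (sub_ne_zero.mpr (hq n hn).symm), one_div]
    · exact fun n hn => div_ne_zero (sub_ne_zero.mpr (hq n hn).symm)
        (sub_ne_zero.mpr (ht n hn).symm)
  exact Classical.epsilon_spec h lam mu

theorem kostka_eq_bracket (hq : ∀ n, 0 < n → q ^ n ≠ 1) (ht : ∀ n, 0 < n → t ^ n ≠ 1)
    (lam mu : YoungDiagram) :
    kostka q t lam mu = bracket q t (bigSchurQT q t lam) (macdonaldM q t mu) := by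
  rw [bracket_eq_scalarProduct]
  · obtain ⟨c, hc, h⟩ := macdonaldM_eq_sum (q := q) ht mu
    rw [hc, h, Finsupp.sum, map_sum]
    simp only [map_smul, bigSchurQT_spec hq ht, smul_eq_mul, mul_ite, mul_one, mul_zero]
    rw [Finset.sum_ite_eq]
    split_ifs with h
    · rfl
    · exact Finsupp.notMem_support_iff.mp h
  · exact fun n hn => div_ne_zero (sub_ne_zero.mpr (hq n hn).symm)
      (sub_ne_zero.mpr (ht n hn).symm)

end

/-- Setting both indeterminates to zero would give `0 = 1`. -/
theorem algebraicIndependent_generic (i : Fin 2) (n : ℕ) (hn : 0 < n) :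
    (algebraMap (MvPolynomial (Fin 2) ℚ) Qqt (MvPolynomial.X i)) ^ n ≠ 1 := by
  intro h
  rw [← map_pow, ← map_one (algebraMap (MvPolynomial (Fin 2) ℚ) Qqt)] at h
  have h2 := IsFractionRing.injective (MvPolynomial (Fin 2) ℚ) Qqt h
  have h3 := congrArg (MvPolynomial.eval fun _ => (0 : ℚ)) h2
  simp [hn.ne'] at h3

end Macdonald


/-! ### The `q`-binomial series and the Macdonald operator -/

namespace Macdonald

/-! ### The `q`-binomial coefficients -/

section

variable {k : Type*} [Field k]

/-- The coefficients of `(b z; q)_∞ / (a z; q)_∞`. -/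
def qBinom (a b q : k) (m : ℕ) : k := ∏ i ∈ Finset.range m, (a - b * q ^ i) / (1 - q ^ (i + 1))

/-- The weights with `exp (∑_r w_r z^r / r) = (b z; q)_∞ / (a z; q)_∞`. -/
def qWeight (a b q : k) (r : ℕ) : k := (a ^ r - b ^ r) / (1 - q ^ r)

theorem qBinom_zero (a b q : k) : qBinom a b q 0 = 1 := rfl

theorem qBinom_succ (a b q : k) (m : ℕ) (hq : q ^ (m + 1) ≠ 1) :
    qBinom a b q (m + 1) * (1 - q ^ (m + 1)) = (a - b * q ^ m) * qBinom a b q m := by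
  rw [qBinom, Finset.prod_range_succ, mul_assoc, div_mul_cancel₀ _ (sub_ne_zero.mpr hq.symm),
    mul_comm]
  rfl

-- With `F = ∑ qBinom z^m`, `W = ∑ qWeight z^m` and `D = z d/dz`, the claim is `D F = F W`. The
-- series `F` satisfies `(1 - az) F(z) = (1 - bz) F(qz)`; differentiating this and using the
-- difference equation of `W` shows that `N = D F - F W` satisfies `(1 - az) N(z) = (1 - bz) N(qz)`.
-- As `N` has no constant term and no power `q^(m+1)` is `1`, all its coefficients vanish.
open PowerSeries in
theorem qBinom_newton (a b q : k) (hq : ∀ m : ℕ, q ^ (m + 1) ≠ 1) (m : ℕ) :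
    (m : k) * qBinom a b q m =
      ∑ r ∈ Finset.range m, qWeight a b q (r + 1) * qBinom a b q (m - (r + 1)) := by
  let F : k⟦X⟧ := PowerSeries.mk (qBinom a b q)
  let W : k⟦X⟧ := PowerSeries.mk (qWeight a b q)
  let R : k⟦X⟧ →+* k⟦X⟧ := PowerSeries.rescale q
  let D : k⟦X⟧ → k⟦X⟧ := fun f => PowerSeries.mk fun m => (m : k) * coeff m f
  have D_mul_X : ∀ (f : k⟦X⟧), D (f * X) = D f * X + f * X := by
    intro f
    ext m
    cases m with
    | zero => simp [D]
    | succ m => simp [D, coeff_succ_mul_X]; ring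
  have D_add : ∀ f g : k⟦X⟧, D (f - g) = D f - D g := by
    intro f g; ext m; simp [D]; ring
  have D_C : ∀ (c : k) (f : k⟦X⟧), D (C c * f) = C c * D f := by
    intro c f; ext m; simp [D]; ring
  have RD : ∀ f : k⟦X⟧, R (D f) = D (R f) := by
    intro f; ext m; simp [D, R, coeff_rescale]; ring
  have RX : R X = C q * X := by simp [R, rescale_X]
  have hF : F - C a * (F * X) = R F - C b * (R F * X) := by
    ext m
    cases m with
    | zero =>
      have h0 : coeff 0 (R F) = coeff 0 F := by simp only [R, coeff_rescale, pow_zero, one_mul]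
      simpa using h0.symm
    | succ m =>
      have := qBinom_succ a b q m (hq m)
      simp only [F, R, map_sub, coeff_C_mul, coeff_succ_mul_X, coeff_rescale, coeff_mk]
      linear_combination this
  have hW : (W - R W) * ((1 - C a * X) * (1 - C b * X)) = (C a - C b) * X := by
    have h1 : W - R W = PowerSeries.mk fun m => a ^ m - b ^ m := by
      ext m
      simp only [W, R, map_sub, coeff_rescale, coeff_mk, qWeight]
      cases m with
      | zero => simp
      | succ m =>
        have := sub_ne_zero.mpr (hq m).symm
        field_simp
    have h2 : ∀ c : k, (PowerSeries.mk fun m => c ^ m) * (1 - C c * X) = 1 := by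
      intro c
      rw [mul_sub, mul_one, ← mul_assoc, mul_comm _ (C c), mul_assoc]
      ext m
      cases m with
      | zero => simp
      | succ m => simp [coeff_one, pow_succ, mul_comm]
    have h3 : (PowerSeries.mk fun m => a ^ m - b ^ m) =
        (PowerSeries.mk fun m => a ^ m) - PowerSeries.mk fun m => b ^ m := by
      ext m; simp
    rw [h1, h3]
    linear_combination (1 - C b * X) * h2 a - (1 - C a * X) * h2 b
  have hD : D F - C a * (D F * X + F * X) = D (R F) - C b * (D (R F) * X + R F * X) := by
    have := congrArg D hF
    rwa [D_add, D_add, D_C, D_C, D_mul_X, D_mul_X] at this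
  let N : k⟦X⟧ := D F - F * W
  have hN : N * (1 - C a * X) = (1 - C b * X) * R N := by
    have hne : (1 - C b * X : k⟦X⟧) ≠ 0 := by
      intro h
      have := congrArg (coeff 0) h
      simp at this
    refine mul_right_cancel₀ hne ?_
    simp only [N, map_sub, map_mul, RD]
    linear_combination (1 - C b * X) * hD - F * hW - (1 - C b * X) * (R W) * hF + C b * X * hF
  have hN0 : ∀ m, coeff m N = 0 := by
    intro m
    induction m with
    | zero => simp [N, D, F, W, qWeight]
    | succ m ih =>
      have h := congrArg (coeff (m + 1)) hN
      -- Once coefficient `m` vanishes, coefficient `m + 1` of the functional equation reads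
      -- `N_{m+1} = q^(m+1) N_{m+1}`.
      rw [show N * (1 - C a * X) = N - C a * (N * X) by ring,
        show (1 - C b * X) * R N = R N - C b * (R N * X) by ring, map_sub (coeff (m + 1)) N,
        map_sub (coeff (m + 1)) (R N), coeff_C_mul, coeff_C_mul, coeff_succ_mul_X, coeff_succ_mul_X, ih] at h
      simp only [R, coeff_rescale, ih] at h
      have h2 : (1 - q ^ (m + 1)) * coeff (m + 1) N = 0 := by linear_combination h
      exact (mul_eq_zero.mp h2).resolve_left (sub_ne_zero.mpr (hq m).symm)
  have h := hN0 m
  simp only [N, map_sub, D, coeff_mk] at h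
  rw [sub_eq_zero, mul_comm F W, coeff_mul, Finset.Nat.sum_antidiagonal_eq_sum_range_succ_mk,
    Finset.sum_range_succ'] at h
  simp only [F, W, coeff_mk, qWeight, pow_zero, sub_self, zero_div, zero_mul, add_zero] at h
  exact h

/-! ### Evaluation in finitely many variables -/

variable {S : Type*} [CommRing S] [Algebra k S] {n : ℕ}

/-- Evaluation of a symmetric function at finitely many points. -/
noncomputable def ev (x : Fin n → S) : Fock k →ₐ[k] S :=
  MvPolynomial.aeval fun r : ℕ+ => ∑ j, x j ^ (r : ℕ)

theorem ev_X (x : Fin n → S) (r : ℕ+) :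
    ev (k := k) x (MvPolynomial.X r) = ∑ j, x j ^ (r : ℕ) := MvPolynomial.aeval_X _ _

theorem ev_map {T : Type*} [CommRing T] [Algebra k T] (φ : S →ₐ[k] T) (x : Fin n → S)
    (f : Fock k) : φ (ev x f) = ev (fun i => φ (x i)) f := by
  have h : φ.comp (ev x) = ev fun i => φ (x i) := by
    refine MvPolynomial.algHom_ext fun r => ?_
    rw [AlgHom.comp_apply, ev_X, ev_X, map_sum]
    simp
  exact DFunLike.congr_fun h f

variable (k n) in
/-- Restriction of a symmetric function to `n` variables. -/
noncomputable def restr : Fock k →ₐ[k] MvPolynomial (Fin n) k := ev MvPolynomial.X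

theorem ev_eq_aeval (x : Fin n → S) (f : Fock k) :
    ev x f = MvPolynomial.aeval x (restr k n f) := by
  rw [restr, ev_map]
  simp

variable [CharZero k]

/-- Both sides are algebra homomorphisms in `f`, so it suffices to compare them on power sums. -/
theorem coe_restr (f : Fock k) : (restr k n f : MvPowerSeries (Fin n) k) =
    MvPowerSeries.killCompl Fin.valEmbedding (toSymFun k f : MvPowerSeries ℕ k) := by
  have h : (MvPolynomial.coeToMvPowerSeries.algHom k).comp (restr k n) =
      ((MvPowerSeries.killCompl Fin.valEmbedding).comp (SymFun k).val).comp
        (toSymFun k : Fock k →ₐ[k] SymFun k) := by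
    refine MvPolynomial.algHom_ext fun r => ?_
    rw [AlgHom.comp_apply, restr, ev_X, AlgHom.comp_apply, AlgHom.comp_apply, AlgEquiv.coe_toAlgHom,
      toSymFun_X]
    ext d
    have e1 : MvPowerSeries.coeff d (MvPowerSeries.killCompl Fin.valEmbedding
        ((SymFun k).val (powerSum (r : ℕ)))) =
        if ∃ i, d.embDomain Fin.valEmbedding = Finsupp.single i (r : ℕ) then (1 : k) else 0 := by
      rw [MvPowerSeries.coeff_killCompl]; rfl
    rw [e1, MvPolynomial.coeToMvPowerSeries.algHom_apply, Algebra.algebraMap_self, MvPowerSeries.map_id,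
      RingHom.id_apply,
      MvPolynomial.coeff_coe, MvPolynomial.coeff_sum]
    simp only [MvPolynomial.coeff_X_pow]
    by_cases h : ∃ j, Finsupp.single j (r : ℕ) = d
    · obtain ⟨j, rfl⟩ := h
      rw [if_pos ⟨j, by rw [Finsupp.embDomain_single]; rfl⟩, Finset.sum_eq_single j]
      · rw [if_pos rfl]
      · intro i _ hij
        rw [if_neg]
        intro h
        have := (Finsupp.single_eq_single_iff ..).mp h
        have := r.ne_zero
        tauto
      · simp
    · rw [Finset.sum_eq_zero, if_neg]
      · rintro ⟨i, hi⟩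
        have hmem : i ∈ (d.embDomain Fin.valEmbedding).support := by
          rw [hi]; simp [r.ne_zero]
        rw [Finsupp.support_embDomain, Finset.mem_map] at hmem
        obtain ⟨j, -, rfl⟩ := hmem
        refine h ⟨j, Finsupp.embDomain_injective Fin.valEmbedding ?_⟩
        rw [hi, Finsupp.embDomain_single]
      · intro j _
        rw [if_neg fun h' => h ⟨j, h'⟩]
  exact DFunLike.congr_fun h f

theorem coeff_restr (f : Fock k) (d : Fin n →₀ ℕ) :
    (restr k n f).coeff d = scoeff (d.embDomain Fin.valEmbedding) (toSymFun k f) := by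
  rw [← MvPolynomial.coeff_coe, coe_restr, MvPowerSeries.coeff_killCompl]
  rfl

theorem restr_expFam (w c : ℕ → k) (hc0 : c 0 = 1)
    (hc : ∀ m : ℕ, (m : k) * c m = ∑ r ∈ Finset.range m, w (r + 1) * c (m - (r + 1))) (m : ℕ) :
    restr k n (expFam w m) = ∑ d ∈ Finset.finsuppAntidiag Finset.univ m,
      MvPolynomial.monomial d (∏ i, c (d i)) := by
  ext d
  rw [coeff_restr, scoeff_expFam w c hc0 hc, MvPolynomial.coeff_sum]
  simp only [MvPolynomial.coeff_monomial]
  rw [Finset.sum_ite_eq', Finsupp.prod_embDomain, Finsupp.prod_fintype _ _ fun _ => hc0]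
  refine if_congr ?_ rfl rfl
  rw [Finset.mem_finsuppAntidiag]
  simp only [Finset.subset_univ, and_true]
  rw [← sum_parts, parts_embDomain, sum_parts, Finsupp.degree_eq_sum]

/-- The generating function of an exponential family factors over the variables. -/
theorem ev_expFam (w c : ℕ → k) (hc0 : c 0 = 1)
    (hc : ∀ m : ℕ, (m : k) * c m = ∑ r ∈ Finset.range m, w (r + 1) * c (m - (r + 1))) (m : ℕ)
    (x : Fin n → S) :
    ev x (expFam w m) = PowerSeries.coeff m
      (∏ j, PowerSeries.mk fun a => algebraMap k S (c a) * x j ^ a) := by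
  rw [ev_eq_aeval, restr_expFam w c hc0 hc, PowerSeries.coeff_prod, map_sum]
  refine Finset.sum_congr rfl fun d _ => ?_
  rw [MvPolynomial.aeval_monomial, map_prod, Finsupp.prod_fintype _ _ fun _ => pow_zero _,
    ← Finset.prod_mul_distrib]
  simp

end

/-! ### The Macdonald operator -/

section

variable {k : Type*} [Field k]

/-- The substitution `p_n ↦ p_n + (q^n - 1) w^n`. -/
noncomputable def shiftHom (q : k) : Fock k →ₐ[k] Polynomial (Fock k) :=
  MvPolynomial.aeval fun n : ℕ+ => Polynomial.C (MvPolynomial.X n) +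
    Polynomial.C (MvPolynomial.C (q ^ (n : ℕ) - 1)) * Polynomial.X ^ (n : ℕ)

/-- The weights `1 - t^{-n}`. -/
def macWeight (t : k) (n : ℕ) : k := 1 - t⁻¹ ^ n

/-- The Macdonald operator on symmetric functions. -/
noncomputable def opE (q t : k) : Fock k →ₗ[k] Fock k :=
  (Polynomial.lsum fun m => LinearMap.mulLeft k (expFam (macWeight t) m)) ∘ₗ
    (shiftHom q).toLinearMap

theorem opE_eq_sum (q t : k) (f : Fock k) {N : ℕ} (hN : (shiftHom q f).natDegree < N) :
    opE q t f = ∑ m ∈ Finset.range N, expFam (macWeight t) m * (shiftHom q f).coeff m := by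
  rw [opE, LinearMap.comp_apply, Polynomial.lsum_apply, AlgHom.toLinearMap_apply,
    Polynomial.sum_over_range' _ (fun _ => by simp) N hN]
  rfl

theorem shiftHom_X (q : k) (n : ℕ+) : shiftHom q (MvPolynomial.X n) =
    Polynomial.C (MvPolynomial.X n) +
    Polynomial.C (MvPolynomial.C (q ^ (n : ℕ) - 1)) * Polynomial.X ^ (n : ℕ) :=
  MvPolynomial.aeval_X _ _

variable [CharZero k]

/-- The shift `p_n ↦ p_n + (q^n - 1) w^n` is adjoint to multiplication by the generating series with
weights `1 - t^{-n}`: the adjoint `n ζ_n ∂/∂p_n` of `p_n` multiplies that series by `ζ_n (1 -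
t^{-n}) = (q^n - 1) t^{-n}` at degree `n`. The powers `t^{-n}` add up to `t^{-m}`. -/
theorem pairing_shiftHom (q t : k) (ht0 : t ≠ 0) (hq : ∀ n, 0 < n → q ^ n ≠ 1)
    (ht : ∀ n, 0 < n → t ^ n ≠ 1) (f g : Fock k) (m : ℕ) :
    pairing (zetaQT q t) ((shiftHom q f).coeff m) g =
      t ^ m * pairing (zetaQT q t) f (expFam (macWeight t) m * g) := by
  have hz : ∀ n, 0 < n → zetaQT q t n ≠ 0 := fun n hn =>
    div_ne_zero (sub_ne_zero.mpr (hq n hn).symm) (sub_ne_zero.mpr (ht n hn).symm)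
  induction f using MvPolynomial.induction_on generalizing m g with
  | C c =>
    have h1 : shiftHom q (MvPolynomial.C c) = Polynomial.C (MvPolynomial.C c) :=
      (shiftHom q).commutes c
    have h2 : (MvPolynomial.C c : Fock k) = c • MvPolynomial.monomial 0 1 := by
      rw [MvPolynomial.smul_monomial, smul_eq_mul, mul_one]; rfl
    rw [h1, Polynomial.coeff_C]
    split_ifs with h
    · subst h; rw [pow_zero, one_mul, expFam_zero, one_mul]
    · rw [map_zero, LinearMap.zero_apply, h2, LinearMap.map_smul₂, pairing_monomial]
      have : (expFam (macWeight t) m * g).coeff 0 = 0 := by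
        rw [← MvPolynomial.constantCoeff_eq, map_mul, MvPolynomial.constantCoeff_eq,
          coeff_zero_expFam _ h, zero_mul]
      rw [this]; simp
  | add p p' hp hp' =>
    rw [map_add, Polynomial.coeff_add, map_add, LinearMap.add_apply, hp, hp', map_add,
      LinearMap.add_apply, mul_add]
  | mul_X p n hp =>
    have h1 : (shiftHom q (p * MvPolynomial.X n)).coeff m =
        MvPolynomial.X n * (shiftHom q p).coeff m +
        if (n : ℕ) ≤ m then (q ^ (n : ℕ) - 1) • (shiftHom q p).coeff (m - n) else 0 := by
      rw [map_mul, shiftHom_X, mul_add, Polynomial.coeff_add, Polynomial.coeff_mul_C, ← mul_assoc,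
        Polynomial.coeff_mul_X_pow', mul_comm ((shiftHom q p).coeff m)]
      congr 1
      refine if_congr Iff.rfl ?_ rfl
      rw [Polynomial.coeff_mul_C, mul_comm, MvPolynomial.smul_eq_C_mul]
    have h2 : ((n : k) * zetaQT q t n) •
        MvPolynomial.pderiv n (expFam (macWeight t) m * g) =
        expFam (macWeight t) m * (((n : k) * zetaQT q t n) • MvPolynomial.pderiv n g) +
        if (n : ℕ) ≤ m then
          ((q ^ (n : ℕ) - 1) * t⁻¹ ^ (n : ℕ)) • (expFam (macWeight t) (m - n) * g) else 0 := by
      rw [Derivation.leibniz, smul_add, smul_eq_mul, smul_eq_mul, mul_smul_comm]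
      congr 1
      rw [← mul_smul_comm, mul_comm (n : k), mul_smul, pderiv_expFam]
      split_ifs
      · rw [smul_smul, mul_smul_comm, mul_comm g]
        congr 1
        rw [zetaQT, macWeight]
        have h3 := sub_ne_zero.mpr (ht n n.pos).symm
        have h4 : t ^ (n : ℕ) ≠ 0 := pow_ne_zero _ ht0
        rw [inv_pow]
        field_simp
        ring
      · simp
    rw [h1, map_add, LinearMap.add_apply, pairing_X_mul _ hz, hp, mul_comm p, pairing_X_mul _ hz,
      h2, map_add, mul_add]
    congr 1
    split_ifs with h
    · rw [LinearMap.map_smul₂, hp, map_smul, smul_eq_mul, smul_eq_mul, inv_pow]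
      have h4 : t ^ m = t ^ (m - n) * t ^ (n : ℕ) := by rw [← pow_add, Nat.sub_add_cancel h]
      have h5 : t ^ (n : ℕ) ≠ 0 := pow_ne_zero _ ht0
      rw [h4]
      field_simp
    · simp

/-- By the adjunction, `⟨E f, g⟩ = ∑_m t^{-m} ⟨g_m, f_m⟩`, where `f_m` and `g_m` are the
coefficients of the shifted functions; this is symmetric in `f` and `g`. -/
theorem pairing_opE (q t : k) (ht0 : t ≠ 0) (hq : ∀ n, 0 < n → q ^ n ≠ 1)
    (ht : ∀ n, 0 < n → t ^ n ≠ 1) (f g : Fock k) :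
    pairing (zetaQT q t) (opE q t f) g = pairing (zetaQT q t) f (opE q t g) := by
  have key : ∀ (f g : Fock k) (N : ℕ), (shiftHom q f).natDegree < N →
      pairing (zetaQT q t) (opE q t f) g = ∑ m ∈ Finset.range N,
        (t ^ m)⁻¹ * pairing (zetaQT q t) ((shiftHom q g).coeff m) ((shiftHom q f).coeff m) := by
    intro f g N hN
    rw [opE_eq_sum q t f hN, map_sum, LinearMap.sum_apply]
    refine Finset.sum_congr rfl fun m _ => ?_
    rw [pairing_shiftHom q t ht0 hq ht, ← mul_assoc, inv_mul_cancel₀ (pow_ne_zero _ ht0), one_mul,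
      pairing_comm]
  rw [key f g (max (shiftHom q f).natDegree (shiftHom q g).natDegree + 1) (by omega), pairing_comm,
    key g f (max (shiftHom q f).natDegree (shiftHom q g).natDegree + 1) (by omega)]
  exact Finset.sum_congr rfl fun m _ => by rw [pairing_comm]

/-! ### The operator in finitely many variables -/

variable {K : Type*} [Field K] [Algebra k K] {n : ℕ}

/-- The coefficients of the Macdonald operator in `n` variables. -/
def macCoeff (t : K) (x : Fin n → K) (i : Fin n) : K :=
  ∏ j ∈ Finset.univ.erase i, (t * x i - x j) / (x i - x j)

/-- Partial fractions of `∏ (t - x_j z) / (1 - x_j z)`, with denominators cleared. -/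
theorem macCoeff_polynomial (t : K) (x : Fin n → K) (hx : Function.Injective x)
    (hx0 : ∀ i, x i ≠ 0) :
    ∏ j, (Polynomial.C t - Polynomial.C (x j) * Polynomial.X) =
      ∏ j, (1 - Polynomial.C (x j) * Polynomial.X) + Polynomial.C (t - 1) *
        ∑ i, Polynomial.C (macCoeff t x i) *
          ∏ j ∈ Finset.univ.erase i, (1 - Polynomial.C (x j) * Polynomial.X) := by
  have hlin : ∀ (c : K) (j : Fin n), Polynomial.C c - Polynomial.C (x j) * Polynomial.X =
      Polynomial.C (-x j) * Polynomial.X + Polynomial.C c := by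
    intro c j
    rw [map_neg]; ring
  have hne : ∀ c, ∏ j, (Polynomial.C c - Polynomial.C (x j) * Polynomial.X) ≠ 0 := by
    intro c
    refine Finset.prod_ne_zero_iff.mpr fun j _ => ?_
    rw [hlin]
    intro h
    have := Polynomial.degree_linear (b := c) (neg_ne_zero.mpr (hx0 j))
    rw [h] at this
    simp at this
  have hdeg : ∀ c, (∏ j, (Polynomial.C c - Polynomial.C (x j) * Polynomial.X)).degree =
      (n : WithBot ℕ) := by
    intro c
    rw [Polynomial.degree_prod]
    simp only [hlin, Polynomial.degree_linear (neg_ne_zero.mpr (hx0 _))]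
    simp
  have hlead : ∀ c, (∏ j, (Polynomial.C c - Polynomial.C (x j) * Polynomial.X)).leadingCoeff =
      ∏ j, -x j := by
    intro c
    rw [Polynomial.leadingCoeff_prod]
    exact Finset.prod_congr rfl fun j _ => by
      rw [hlin, Polynomial.leadingCoeff_linear (neg_ne_zero.mpr (hx0 _))]
  rw [← sub_eq_iff_eq_add']
  -- The leading coefficients of the two products cancel, so both sides have degree below `n`; they
  -- are compared at the `n` points `1/x_i`, where only the term of index `i` survives.
  refine Polynomial.eq_of_degrees_lt_of_eval_index_eq (v := fun i => (x i)⁻¹)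
    (s := Finset.univ) (fun i _ j _ h => hx (inv_injective h)) ?_ ?_ ?_
  · have h := Polynomial.degree_sub_lt_left ((hdeg t).trans (hdeg 1).symm) (hne t)
      ((hlead t).trans (hlead 1).symm)
    rw [hdeg] at h
    simpa using h
  · rcases Nat.eq_zero_or_pos n with rfl | hn
    · simp
    refine lt_of_le_of_lt (b := ((n - 1 : ℕ) : WithBot ℕ)) ?_ ?_
    · rw [Finset.mul_sum]
      refine (Polynomial.degree_sum_le _ _).trans (Finset.sup_le fun i _ => ?_)
      rw [← mul_assoc, ← map_mul]
      refine (Polynomial.degree_mul_le _ _).trans ?_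
      refine (add_le_add_left Polynomial.degree_C_le _).trans ?_
      rw [zero_add]
      refine (Polynomial.degree_prod_le _ _).trans ?_
      refine (Finset.sum_le_card_nsmul _ _ 1 fun j _ => ?_).trans ?_
      · have := hlin 1 j
        rw [map_one] at this
        rw [this]
        have h2 := Polynomial.degree_linear_le (a := -x j) (b := (1 : K))
        rwa [map_one] at h2
      · rw [Finset.card_erase_of_mem (Finset.mem_univ _), Finset.card_univ, Fintype.card_fin]
        simp
    · simp only [Finset.card_univ, Fintype.card_fin]
      exact_mod_cast Nat.sub_lt hn one_pos
  · intro i _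
    rw [Polynomial.eval_sub, Polynomial.eval_prod, Polynomial.eval_prod, Polynomial.eval_mul,
      Polynomial.eval_finsetSum]
    simp only [Polynomial.eval_sub, Polynomial.eval_C, Polynomial.eval_mul, Polynomial.eval_X,
      Polynomial.eval_one, Polynomial.eval_prod]
    rw [Finset.prod_eq_zero (s := Finset.univ) (f := fun j => 1 - x j * (x i)⁻¹)
      (Finset.mem_univ i) (by rw [mul_inv_cancel₀ (hx0 i), sub_self]), sub_zero,
      Finset.sum_eq_single i, ← Finset.mul_prod_erase _ _ (Finset.mem_univ i),
      mul_inv_cancel₀ (hx0 i), macCoeff, ← Finset.prod_mul_distrib]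
    · congr 1
      refine Finset.prod_congr rfl fun j hj => ?_
      have h1 : x i - x j ≠ 0 :=
        sub_ne_zero.mpr fun h => (Finset.mem_erase.mp hj).1 (hx h).symm
      have h2 := hx0 i
      field_simp
    · intro l _ hl
      rw [Finset.prod_eq_zero (i := i), mul_zero]
      · exact Finset.mem_erase.mpr ⟨hl.symm, Finset.mem_univ _⟩
      · rw [mul_inv_cancel₀ (hx0 i), sub_self]
    · simp

/-- The generating function with weights `1 - t^{-r}` is `∏ (1 - x_j z/t)/(1 - x_j z)`; times `t^n`
it is expanded in partial fractions, and each `1/(1 - x_i z)` is a geometric series. -/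
theorem ev_macWeight (t : k) (ht0 : t ≠ 0) (x : Fin n → K) (hx : Function.Injective x)
    (hx0 : ∀ i, x i ≠ 0) (m : ℕ) :
    algebraMap k K t ^ n * ev x (expFam (macWeight t) m) = (if m = 0 then 1 else 0) +
      (algebraMap k K t - 1) * ∑ i, macCoeff (algebraMap k K t) x i * x i ^ m := by
  have hq0 : ∀ m : ℕ, (0 : k) ^ (m + 1) ≠ 1 := fun m => by simp
  -- At `q = 0` the denominators `1 - q^r` are `1` for `r ≥ 1`, so the `q`-binomial machinery
  -- applies.
  have hw : expFam (macWeight t) m = expFam (qWeight 1 t⁻¹ 0) m := by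
    have : ∀ d : ℕ+ →₀ ℕ, expCoeff (macWeight t) d = expCoeff (qWeight 1 t⁻¹ 0) d := by
      intro d
      refine Finset.prod_congr rfl fun r _ => ?_
      simp [macWeight, qWeight, zero_pow r.ne_zero]
    rw [expFam, expFam]
    simp only [this]
  rw [hw, ev_expFam _ _ (qBinom_zero 1 t⁻¹ 0) (qBinom_newton 1 t⁻¹ 0 hq0)]
  set T := algebraMap k K t with hT
  have hT0 : T ≠ 0 := (map_ne_zero _).mpr ht0
  let U : Fin n → PowerSeries K := fun j =>
    PowerSeries.mk fun a => algebraMap k K (qBinom 1 t⁻¹ 0 a) * x j ^ a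
  have hU : ∀ j, PowerSeries.C T * U j * (1 - PowerSeries.C (x j) * PowerSeries.X) =
      PowerSeries.C T - PowerSeries.C (x j) * PowerSeries.X := by
    intro j
    rw [mul_assoc, mul_sub, mul_one, ← mul_assoc (U j), mul_comm (U j), mul_assoc]
    ext m
    rcases m with _ | m
    · simp [U, qBinom_zero]
    · have h := qBinom_succ 1 t⁻¹ 0 m (hq0 m)
      simp only [U, PowerSeries.coeff_C_mul, map_sub, PowerSeries.coeff_succ_mul_X,
        PowerSeries.coeff_mk]
      rcases m with _ | m
      · simp only [qBinom_zero, zero_add, pow_one, pow_zero, sub_zero, mul_one] at h ⊢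
        rw [h, map_sub, map_one, map_inv₀, ← hT, PowerSeries.coeff_C]
        simp
        field_simp
        ring
      · have h2 : qBinom 1 t⁻¹ 0 (m + 1 + 1) = qBinom 1 t⁻¹ 0 (m + 1) := by simpa using h
        rw [h2, PowerSeries.coeff_C, PowerSeries.coeff_C, if_neg (by omega), if_neg (by omega)]
        ring
  have hG : ∀ i, (PowerSeries.mk fun m => x i ^ m) * (1 - PowerSeries.C (x i) * PowerSeries.X) =
      1 := by
    intro i
    rw [mul_sub, mul_one, ← mul_assoc, mul_comm _ (PowerSeries.C (x i)), mul_assoc]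
    ext m
    cases m with
    | zero => simp
    | succ m => simp [PowerSeries.coeff_one, pow_succ, mul_comm]
  have main : PowerSeries.C T ^ n * ∏ j, U j = 1 + PowerSeries.C (T - 1) *
      ∑ i, PowerSeries.C (macCoeff T x i) * PowerSeries.mk fun m => x i ^ m := by
    have hne : ∏ j, (1 - PowerSeries.C (x j) * PowerSeries.X) ≠ 0 := by
      refine Finset.prod_ne_zero_iff.mpr fun j _ h => ?_
      have := congrArg (PowerSeries.coeff 0) h
      simp at this
    refine mul_right_cancel₀ hne ?_
    have h1 : PowerSeries.C T ^ n * ∏ j, U j = ∏ j, (PowerSeries.C T * U j) := by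
      rw [Finset.prod_mul_distrib]; simp
    rw [h1, ← Finset.prod_mul_distrib]
    simp only [hU]
    have h2 := congrArg (fun p : Polynomial K => (p : PowerSeries K))
      (macCoeff_polynomial T x hx hx0)
    have hcoe : ∀ p : Polynomial K, (p : PowerSeries K) = Polynomial.coeToPowerSeries.ringHom p :=
      fun _ => rfl
    simp only [hcoe, map_prod, map_add, map_sub, map_mul, map_sum, map_one] at h2
    simp only [Polynomial.coeToPowerSeries.ringHom_apply, Polynomial.coe_C, Polynomial.coe_X] at h2
    rw [h2, add_mul, one_mul, map_sub, map_one, mul_assoc, Finset.sum_mul]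
    congr 2
    refine Finset.sum_congr rfl fun i _ => ?_
    rw [mul_assoc, ← Finset.mul_prod_erase _ _ (Finset.mem_univ i), ← mul_assoc (PowerSeries.mk _),
      hG, one_mul]
  have h := congrArg (PowerSeries.coeff m) main
  rw [← map_pow, PowerSeries.coeff_C_mul, map_add, PowerSeries.coeff_C_mul, map_sum,
    PowerSeries.coeff_one] at h
  simp only [PowerSeries.coeff_C_mul, PowerSeries.coeff_mk] at h
  exact h

/-- At `w = x_i` the shift replaces `x_i^n` by `(q x_i)^n` inside every power sum. -/
theorem ev_shiftHom (q : k) (x : Fin n → K) (i : Fin n) (f : Fock k) :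
    Polynomial.eval₂ (ev x : Fock k →ₐ[k] K).toRingHom (x i) (shiftHom q f) =
      ev (Function.update x i (algebraMap k K q * x i)) f := by
  let φ : Fock k →+* K := (Polynomial.eval₂RingHom (ev x : Fock k →ₐ[k] K).toRingHom (x i)).comp
    (shiftHom q).toRingHom
  have h : φ = (ev (Function.update x i (algebraMap k K q * x i)) : Fock k →ₐ[k] K).toRingHom := by
    refine MvPolynomial.ringHom_ext (fun c => ?_) fun r => ?_
    · have h1 : shiftHom q (MvPolynomial.C c) = Polynomial.C (MvPolynomial.C c) :=
        (shiftHom q).commutes c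
      change Polynomial.eval₂ _ _ (shiftHom q (MvPolynomial.C c)) = ev _ (MvPolynomial.C c)
      rw [h1, Polynomial.eval₂_C]
      exact ((ev x).commutes c).trans ((ev _).commutes c).symm
    · change Polynomial.eval₂ _ _ (shiftHom q (MvPolynomial.X r)) = ev _ (MvPolynomial.X r)
      rw [shiftHom_X, Polynomial.eval₂_add, Polynomial.eval₂_C, Polynomial.eval₂_mul,
        Polynomial.eval₂_C, Polynomial.eval₂_pow, Polynomial.eval₂_X, ev_X]
      have h1 : (ev x : Fock k →ₐ[k] K).toRingHom (MvPolynomial.X r) = ∑ j, x j ^ (r : ℕ) :=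
        ev_X x r
      have h2 : (ev x : Fock k →ₐ[k] K).toRingHom (MvPolynomial.C (q ^ (r : ℕ) - 1)) =
          algebraMap k K q ^ (r : ℕ) - 1 := by
        refine ((ev x).commutes (q ^ (r : ℕ) - 1)).trans ?_
        simp
      rw [h1, h2, ← Finset.add_sum_erase _ _ (Finset.mem_univ i),
        ← Finset.add_sum_erase _ _ (Finset.mem_univ i), Function.update_self, mul_pow]
      have h3 : ∑ j ∈ Finset.univ.erase i,
          Function.update x i (algebraMap k K q * x i) j ^ (r : ℕ) =
          ∑ j ∈ Finset.univ.erase i, x j ^ (r : ℕ) :=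
        Finset.sum_congr rfl fun j hj => by
          rw [Function.update_of_ne (Finset.mem_erase.mp hj).1]
      rw [h3]; ring
  exact RingHom.congr_fun h f

/-- In `n` variables `t^n E = 1 + (t - 1) D`, with `D` Macdonald's `q`-difference operator: the
partial fractions replace the series variable by `x_i`, and there the shift of the power sums is
`x_i ↦ q x_i`. -/
theorem ev_opE (q t : k) (ht0 : t ≠ 0) (x : Fin n → K) (hx : Function.Injective x)
    (hx0 : ∀ i, x i ≠ 0) (f : Fock k) :
    algebraMap k K t ^ n * ev x (opE q t f) = ev x f + (algebraMap k K t - 1) *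
      ∑ i, macCoeff (algebraMap k K t) x i *
        ev (Function.update x i (algebraMap k K q * x i)) f := by
  have hf0 : (shiftHom q f).coeff 0 = f := by
    have h : (Polynomial.constantCoeff (R := Fock k)).comp (shiftHom q).toRingHom =
        RingHom.id (Fock k) := by
      refine MvPolynomial.ringHom_ext (fun c => ?_) fun r => ?_
      · have h1 : shiftHom q (MvPolynomial.C c) = Polynomial.C (MvPolynomial.C c) :=
          (shiftHom q).commutes c
        change Polynomial.constantCoeff (shiftHom q (MvPolynomial.C c)) = _
        rw [h1]
        simp
      · change Polynomial.constantCoeff (shiftHom q (MvPolynomial.X r)) = _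
        rw [shiftHom_X]
        simp only [map_add, map_mul, map_pow, Polynomial.constantCoeff_apply,
          Polynomial.coeff_X_zero, zero_pow r.ne_zero, mul_zero, add_zero, Polynomial.coeff_C_zero]
        rfl
    exact RingHom.congr_fun h f
  rw [opE_eq_sum q t f (Nat.lt_succ_self _), map_sum, Finset.mul_sum]
  have key : ∀ m ∈ Finset.range ((shiftHom q f).natDegree + 1), algebraMap k K t ^ n *
      ev x (expFam (macWeight t) m * (shiftHom q f).coeff m) =
      (if m = 0 then ev x f else 0) + (algebraMap k K t - 1) *
        ∑ i, macCoeff (algebraMap k K t) x i * (ev x ((shiftHom q f).coeff m) * x i ^ m) := by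
    intro m _
    rw [map_mul, ← mul_assoc, ev_macWeight t ht0 x hx hx0, add_mul, ite_mul, one_mul, zero_mul,
      mul_assoc, Finset.sum_mul]
    congr 1
    · split_ifs with h
      · subst h; rw [hf0]
      · rfl
    · congr 1
      exact Finset.sum_congr rfl fun i _ => by ring
  rw [Finset.sum_congr rfl key, Finset.sum_add_distrib, Finset.sum_ite_eq' _ 0, if_pos (by simp),
    ← Finset.mul_sum, Finset.sum_comm]
  congr 2
  refine Finset.sum_congr rfl fun i _ => ?_
  rw [← Finset.mul_sum, ← ev_shiftHom, Polynomial.eval₂_eq_sum_range]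
  rfl

end

end Macdonald


/-! ### The dominance order and leading exponents of polynomials -/

namespace Macdonald

/-! ### The dominance order -/

theorem Dominates.refl (lam : YoungDiagram) : Dominates lam lam := ⟨rfl, fun _ => le_rfl⟩

theorem Dominates.trans {lam mu nu : YoungDiagram} (h : Dominates lam mu) (h' : Dominates mu nu) :
    Dominates lam nu := ⟨h.1.trans h'.1, fun r => (h'.2 r).trans (h.2 r)⟩

theorem Dominates.antisymm {lam mu : YoungDiagram} (h : Dominates lam mu) (h' : Dominates mu lam) :
    lam = mu := by
  have hs : ∀ r, ∑ i ∈ Finset.range r, lam.rowLen i = ∑ i ∈ Finset.range r, mu.rowLen i :=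
    fun r => le_antisymm (h'.2 r) (h.2 r)
  refine diagram_ext fun i => ?_
  have h1 := hs (i + 1)
  rw [Finset.sum_range_succ, Finset.sum_range_succ, hs i] at h1
  omega

theorem Dominates.colLen_le {lam mu : YoungDiagram} (h : Dominates lam mu) :
    lam.colLen 0 ≤ mu.colLen 0 := by
  rw [← rowLen_eq_zero_iff]
  have h1 := h.2 (mu.colLen 0)
  have h2 := sum_range_rowLen lam
    (show lam.colLen 0 ≤ max (lam.colLen 0) (mu.colLen 0 + 1) from le_max_left _ _)
  have h3 : ∑ i ∈ Finset.range (mu.colLen 0 + 1), lam.rowLen i ≤ lam.card := by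
    rw [← h2]
    exact Finset.sum_le_sum_of_subset (Finset.range_subset_range.mpr (le_max_right _ _))
  rw [sum_range_rowLen mu le_rfl, ← h.1] at h1
  rw [Finset.sum_range_succ] at h3
  omega

theorem finite_dominates (lam : YoungDiagram) : {mu | Dominates lam mu}.Finite :=
  (finite_card_eq lam.card).subset fun _ h => h.1.ge

/-- Induction along the dominance order. -/
theorem dominates_induction {p : YoungDiagram → Prop}
    (h : ∀ lam, (∀ mu, Dominates lam mu → mu ≠ lam → p mu) → p lam) (lam : YoungDiagram) : p lam := by
  -- The induction is on the number of diagrams dominated by `lam`, which drops strictly below a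
  -- smaller diagram.
  have key : ∀ (N : ℕ) (lam : YoungDiagram), (finite_dominates lam).toFinset.card ≤ N → p lam := by
    intro N
    induction N with
    | zero =>
      intro lam hl
      rw [Nat.le_zero, Finset.card_eq_zero] at hl
      have : lam ∈ (finite_dominates lam).toFinset := by simpa using Dominates.refl lam
      rw [hl] at this
      simp at this
    | succ N ih =>
      intro lam hl
      refine h lam fun mu hmu hne => ih mu ?_
      refine Nat.le_of_lt_succ (lt_of_lt_of_le (Finset.card_lt_card ?_) hl)
      refine Finset.ssubset_iff_subset_ne.mpr ⟨fun nu hnu => ?_, fun he => ?_⟩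
      · simp only [Set.Finite.mem_toFinset, Set.mem_ofPred_eq] at hnu ⊢
        exact hmu.trans hnu
      · have : lam ∈ (finite_dominates lam).toFinset := by simpa using Dominates.refl lam
        rw [← he] at this
        simp only [Set.Finite.mem_toFinset, Set.mem_ofPred_eq] at this
        exact hne (this.antisymm hmu)
  exact key _ lam le_rfl

/-- The largest element of a set with `c` other elements is at least `c`, so its term is at most `f
c`; induct by removing it. -/
theorem sum_le_sum_range_of_antitone {f : ℕ → ℕ} (hf : Antitone f) (s : Finset ℕ) {r : ℕ}
    (hr : s.card ≤ r) : ∑ i ∈ s, f i ≤ ∑ i ∈ Finset.range r, f i := by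
  refine le_trans ?_ (Finset.sum_le_sum_of_subset (Finset.range_subset_range.mpr hr))
  clear hr r
  induction s using Finset.induction_on_max with
  | empty => simp
  | insert a s hs ih =>
    have ha : a ∉ s := fun h => lt_irrefl _ (hs a h)
    rw [Finset.sum_insert ha, Finset.card_insert_of_notMem ha, Finset.sum_range_succ, add_comm]
    refine add_le_add ih (hf ?_)
    have : s ⊆ Finset.range a := fun b hb => Finset.mem_range.mpr (hs b hb)
    simpa using Finset.card_le_card this

theorem antitone_rowLen (lam : YoungDiagram) : Antitone lam.rowLen :=
  fun i j h => lam.rowLen_anti i j h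

/-! ### Partial sums of exponents -/

section

variable {n : ℕ}

/-- The sum of the first `r` entries. -/
def psum (r : ℕ) (d : Fin n →₀ ℕ) : ℕ := ∑ i : Fin n, if (i : ℕ) < r then d i else 0

theorem psum_add (r : ℕ) (d e : Fin n →₀ ℕ) : psum r (d + e) = psum r d + psum r e := by
  rw [psum, psum, psum, ← Finset.sum_add_distrib]
  refine Finset.sum_congr rfl fun i _ => ?_
  split_ifs <;> simp

theorem psum_succ (d : Fin n →₀ ℕ) (i : Fin n) : psum (i + 1) d = psum i d + d i := by
  rw [psum, psum, ← Finset.add_sum_erase _ _ (Finset.mem_univ i),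
    ← Finset.add_sum_erase _ (fun j : Fin n => if (j : ℕ) < i then d j else 0) (Finset.mem_univ i),
    if_pos (Nat.lt_succ_self _), if_neg (lt_irrefl _), zero_add, add_comm]
  congr 1
  refine Finset.sum_congr rfl fun j hj => ?_
  have := (Finset.mem_erase.mp hj).1
  have : (j : ℕ) ≠ i := fun h => this (Fin.ext h)
  exact if_congr (by omega) rfl rfl

theorem psum_ext {d e : Fin n →₀ ℕ} (h : ∀ r, psum r d = psum r e) : d = e := by
  ext i
  have h1 := h (i + 1)
  rw [psum_succ, psum_succ, h] at h1
  omega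

theorem psum_eq_sum_range (d : Fin n →₀ ℕ) (f : ℕ → ℕ) (hd : ∀ i : Fin n, d i = f i) (r : ℕ) :
    psum r d = ∑ i ∈ Finset.range (min r n), f i := by
  have h1 : psum r d = ∑ i : Fin n, if (i : ℕ) < r then f i else 0 :=
    Finset.sum_congr rfl fun i _ => by rw [hd]
  rw [h1, Fin.sum_univ_eq_sum_range (fun i => if i < r then f i else 0), ← Finset.sum_filter]
  refine Finset.sum_congr ?_ fun _ _ => rfl
  ext i
  simp only [Finset.mem_filter, Finset.mem_range]
  omega

/-- The exponents of a polynomial are bounded by `D` in the dominance order. -/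
def Bounded {k : Type*} [CommSemiring k] (p : MvPolynomial (Fin n) k) (D : Fin n →₀ ℕ) : Prop :=
  ∀ d, p.coeff d ≠ 0 → (∀ r, psum r d ≤ psum r D) ∧ psum n d = psum n D

variable {k : Type*} [Field k]

theorem Bounded.add {p p' : MvPolynomial (Fin n) k} {D : Fin n →₀ ℕ} (h : Bounded p D)
    (h' : Bounded p' D) : Bounded (p + p') D := by
  intro d hd
  by_cases h0 : p.coeff d = 0
  · refine h' d fun h1 => hd ?_
    rw [MvPolynomial.coeff_add, h0, h1, add_zero]
  · exact h d h0

theorem Bounded.zero (D : Fin n →₀ ℕ) : Bounded (0 : MvPolynomial (Fin n) k) D :=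
  fun d hd => absurd (MvPolynomial.coeff_zero d) hd

theorem Bounded.sum {ι : Type*} (s : Finset ι) {p : ι → MvPolynomial (Fin n) k} {D : Fin n →₀ ℕ}
    (h : ∀ i ∈ s, Bounded (p i) D) : Bounded (∑ i ∈ s, p i) D := by
  induction s using Finset.induction_on with
  | empty => exact Bounded.zero D
  | insert i s hi ih =>
    rw [Finset.sum_insert hi]
    exact (h i (Finset.mem_insert_self _ _)).add
      (ih fun j hj => h j (Finset.mem_insert_of_mem hj))

theorem Bounded.smul {p : MvPolynomial (Fin n) k} {D : Fin n →₀ ℕ} (h : Bounded p D) (c : k) :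
    Bounded (c • p) D := by
  intro d hd
  refine h d fun h0 => hd ?_
  rw [MvPolynomial.coeff_smul, h0, smul_zero]

theorem Bounded.mul {p p' : MvPolynomial (Fin n) k} {D D' : Fin n →₀ ℕ} (h : Bounded p D)
    (h' : Bounded p' D') : Bounded (p * p') (D + D') := by
  intro d hd
  rw [MvPolynomial.coeff_mul] at hd
  obtain ⟨x, hx, hne⟩ := Finset.exists_ne_zero_of_sum_ne_zero hd
  rw [Finset.HasAntidiagonal.mem_antidiagonal] at hx
  have h1 := h x.1 (left_ne_zero_of_mul hne)
  have h2 := h' x.2 (right_ne_zero_of_mul hne)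
  rw [← hx]
  refine ⟨fun r => ?_, ?_⟩
  · rw [psum_add, psum_add]
    exact add_le_add (h1.1 r) (h2.1 r)
  · rw [psum_add, psum_add, h1.2, h2.2]

/-- Partial sums add under multiplication, so only the product of the two extreme exponents reaches
the bound for every partial sum. -/
theorem Bounded.coeff_mul {p p' : MvPolynomial (Fin n) k} {D D' : Fin n →₀ ℕ} (h : Bounded p D)
    (h' : Bounded p' D') : (p * p').coeff (D + D') = p.coeff D * p'.coeff D' := by
  rw [MvPolynomial.coeff_mul, Finset.sum_eq_single (D, D')]
  · rintro ⟨d, d'⟩ hx hne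
    rw [Finset.HasAntidiagonal.mem_antidiagonal] at hx
    by_contra h0
    have h1 := h d (left_ne_zero_of_mul h0)
    have h2 := h' d' (right_ne_zero_of_mul h0)
    refine hne ?_
    have h3 : ∀ r, psum r d = psum r D ∧ psum r d' = psum r D' := by
      intro r
      have h4 := congrArg (psum r) hx
      simp only [psum_add] at h4
      have := h1.1 r
      have := h2.1 r
      omega
    rw [psum_ext fun r => (h3 r).1, psum_ext fun r => (h3 r).2]
  · intro hx
    exact (hx (by simp)).elim

theorem Bounded.prod {ι : Type*} (s : Finset ι) {p : ι → MvPolynomial (Fin n) k}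
    {D : ι → Fin n →₀ ℕ} (h : ∀ i ∈ s, Bounded (p i) (D i)) :
    Bounded (∏ i ∈ s, p i) (∑ i ∈ s, D i) ∧
      (∏ i ∈ s, p i).coeff (∑ i ∈ s, D i) = ∏ i ∈ s, (p i).coeff (D i) := by
  induction s using Finset.induction_on with
  | empty =>
    refine ⟨fun d hd => ?_, by simp⟩
    rw [Finset.prod_empty, MvPolynomial.coeff_one] at hd
    have : d = 0 := by by_contra hc; exact hd (if_neg fun h => hc h.symm)
    rw [this]; simp
  | insert i s hi ih =>
    have h1 := h i (Finset.mem_insert_self _ _)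
    have h2 := ih fun j hj => h j (Finset.mem_insert_of_mem hj)
    rw [Finset.prod_insert hi, Finset.sum_insert hi, Finset.prod_insert hi, ← h2.2]
    exact ⟨h1.mul h2.1, h1.coeff_mul h2.1⟩

/-- The grading of polynomials by the degree in the first `r` variables. -/
noncomputable def gradeHom (r : ℕ) :
    MvPolynomial (Fin n) k →ₐ[k] Polynomial (MvPolynomial (Fin n) k) :=
  MvPolynomial.aeval fun i =>
    Polynomial.C (MvPolynomial.X i) * Polynomial.X ^ (if (i : ℕ) < r then 1 else 0)

theorem gradeHom_monomial (r : ℕ) (d : Fin n →₀ ℕ) (c : k) :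
    gradeHom r (MvPolynomial.monomial d c) =
      Polynomial.C (MvPolynomial.monomial d c) * Polynomial.X ^ psum r d := by
  rw [gradeHom, MvPolynomial.aeval_monomial, MvPolynomial.monomial_eq,
    Finsupp.prod_fintype _ _ fun _ => pow_zero _, Finsupp.prod_fintype _ _ fun _ => pow_zero _]
  have h1 : algebraMap k (Polynomial (MvPolynomial (Fin n) k)) c =
    Polynomial.C (MvPolynomial.C c) := rfl
  rw [h1]
  simp only [mul_pow, Finset.prod_mul_distrib, map_mul, map_prod, map_pow]
  rw [mul_assoc]
  congr 2
  rw [show psum r d = ∑ i : Fin n, if (i : ℕ) < r then d i else 0 from rfl,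
    ← Finset.prod_pow_eq_pow_sum]
  refine Finset.prod_congr rfl fun i _ => ?_
  rw [← pow_mul]
  split_ifs <;> simp

theorem coeff_coeff_gradeHom (r : ℕ) (p : MvPolynomial (Fin n) k) (m : ℕ) (d : Fin n →₀ ℕ) :
    ((gradeHom r p).coeff m).coeff d = if psum r d = m then p.coeff d else 0 := by
  induction p using MvPolynomial.induction_on' with
  | monomial e c =>
    rw [gradeHom_monomial, Polynomial.coeff_C_mul, Polynomial.coeff_X_pow,
      MvPolynomial.coeff_monomial]
    by_cases h : e = d
    · subst h
      by_cases h2 : m = psum r e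
      · simp [h2]
      · rw [if_neg h2, if_neg (fun h => h2 h.symm), mul_zero, MvPolynomial.coeff_zero]
    · split_ifs <;> simp_all
  | add p p' hp hp' =>
    rw [map_add, Polynomial.coeff_add, MvPolynomial.coeff_add, hp, hp', MvPolynomial.coeff_add]
    split_ifs <;> simp

theorem natDegree_gradeHom_le (r : ℕ) (p : MvPolynomial (Fin n) k) (N : ℕ)
    (h : ∀ d, p.coeff d ≠ 0 → psum r d ≤ N) : (gradeHom r p).natDegree ≤ N := by
  rw [Polynomial.natDegree_le_iff_coeff_eq_zero]
  intro m hm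
  ext d
  rw [coeff_coeff_gradeHom, MvPolynomial.coeff_zero]
  split_ifs with h1
  · by_contra h2
    have := h d h2
    omega
  · rfl

theorem coeff_gradeHom_ne_zero (r : ℕ) (p : MvPolynomial (Fin n) k) (d : Fin n →₀ ℕ)
    (h : p.coeff d ≠ 0) : (gradeHom r p).coeff (psum r d) ≠ 0 := by
  intro h0
  have := coeff_coeff_gradeHom r p (psum r d) d
  rw [h0, if_pos rfl, MvPolynomial.coeff_zero] at this
  exact h this.symm

theorem gradeHom_ne_zero (r : ℕ) {p : MvPolynomial (Fin n) k} (hp : p ≠ 0) : gradeHom r p ≠ 0 := by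
  obtain ⟨d, hd⟩ := MvPolynomial.ne_zero_iff.mp hp
  intro h
  refine coeff_gradeHom_ne_zero r p d hd ?_
  rw [h, Polynomial.coeff_zero]

/-- Division by a polynomial with a known leading exponent. -/
theorem Bounded.of_mul {v g : MvPolynomial (Fin n) k} {D E : Fin n →₀ ℕ} (hD : v.coeff D ≠ 0) (h : Bounded (v * g) (D + E)) : Bounded g E := by
  have hv0 : v ≠ 0 := fun h => hD (by rw [h, MvPolynomial.coeff_zero])
  intro d hd
  have hg0 : g ≠ 0 := fun h => hd (by rw [h, MvPolynomial.coeff_zero])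
  have hle : ∀ r, psum r d ≤ psum r E := by
    intro r
    -- Over a domain the degree in the first `r` variables is additive. That of `v` is at least the
    -- `r`-th partial sum of `D`, so what remains for `g` is at most that of `E`.
    have h1 := natDegree_gradeHom_le r (v * g) _ fun e he => (h e he).1 r
    rw [map_mul, Polynomial.natDegree_mul (gradeHom_ne_zero r hv0) (gradeHom_ne_zero r hg0),
      psum_add] at h1
    have h2 := Polynomial.le_natDegree_of_ne_zero (coeff_gradeHom_ne_zero r v D hD)
    have h3 := Polynomial.le_natDegree_of_ne_zero (coeff_gradeHom_ne_zero r g d hd)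
    omega
  refine ⟨hle, le_antisymm (hle n) ?_⟩
  -- All terms of the product have the same total degree, so the lowest total degree is known as
  -- well; its additivity bounds the total degree of `d` from below.
  have h1 : psum n (D + E) ≤ (gradeHom n (v * g)).natTrailingDegree := by
    refine Polynomial.le_natTrailingDegree
      (gradeHom_ne_zero n (mul_ne_zero hv0 hg0)) fun m hm => ?_
    ext e
    rw [coeff_coeff_gradeHom, MvPolynomial.coeff_zero]
    split_ifs with h1
    · by_contra h2
      have := (h e h2).2
      omega
    · rfl
  rw [map_mul, Polynomial.natTrailingDegree_mul (gradeHom_ne_zero n hv0) (gradeHom_ne_zero n hg0),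
    psum_add] at h1
  have h2 := Polynomial.natTrailingDegree_le_of_ne_zero (coeff_gradeHom_ne_zero n v D hD)
  have h3 := Polynomial.natTrailingDegree_le_of_ne_zero (coeff_gradeHom_ne_zero n g d hd)
  omega

/-- The substitution `X_i ↦ u X_i`. -/
noncomputable def varScale (u : k) (i : Fin n) : MvPolynomial (Fin n) k →ₐ[k] MvPolynomial (Fin n) k :=
  MvPolynomial.aeval (Function.update MvPolynomial.X i (MvPolynomial.C u * MvPolynomial.X i))

theorem coeff_varScale (u : k) (i : Fin n) (p : MvPolynomial (Fin n) k) (d : Fin n →₀ ℕ) :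
    (varScale u i p).coeff d = u ^ d i * p.coeff d := by
  induction p using MvPolynomial.induction_on' with
  | monomial e c =>
    have h : varScale u i (MvPolynomial.monomial e c) = MvPolynomial.monomial e (u ^ e i * c) := by
      rw [varScale, MvPolynomial.aeval_monomial, MvPolynomial.monomial_eq,
        Finsupp.prod_fintype _ _ fun _ => pow_zero _, Finsupp.prod_fintype _ _ fun _ => pow_zero _,
        ← Finset.mul_prod_erase _ _ (Finset.mem_univ i),
        ← Finset.mul_prod_erase _ (fun j => (MvPolynomial.X j : MvPolynomial (Fin n) k) ^ e j)
          (Finset.mem_univ i), Function.update_self, mul_pow, map_mul, map_pow]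
      have : ∏ j ∈ Finset.univ.erase i, Function.update
          (MvPolynomial.X : Fin n → MvPolynomial (Fin n) k) i
          (MvPolynomial.C u * MvPolynomial.X i) j ^ e j =
          ∏ j ∈ Finset.univ.erase i, MvPolynomial.X j ^ e j :=
        Finset.prod_congr rfl fun j hj => by
          rw [Function.update_of_ne (Finset.mem_erase.mp hj).1]
      rw [this, MvPolynomial.algebraMap_eq]
      ring
    rw [h, MvPolynomial.coeff_monomial, MvPolynomial.coeff_monomial]
    split_ifs with h'
    · rw [h']
    · simp
  | add p p' hp hp' => rw [map_add, MvPolynomial.coeff_add, hp, hp', MvPolynomial.coeff_add, mul_add]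

theorem Bounded.varScale {p : MvPolynomial (Fin n) k} {D : Fin n →₀ ℕ} (h : Bounded p D) (u : k)
    (i : Fin n) : Bounded (varScale u i p) D := by
  intro d hd
  rw [coeff_varScale] at hd
  exact h d (right_ne_zero_of_mul hd)

/-! ### The Vandermonde determinant -/

variable (k n) in
/-- The Vandermonde polynomial. -/
noncomputable def vand : MvPolynomial (Fin n) k :=
  (Matrix.vandermonde (MvPolynomial.X : Fin n → MvPolynomial (Fin n) k)).det

variable (n) in
/-- The exponent `(n-1, …, 1, 0)`. -/
noncomputable def staircase : Fin n →₀ ℕ :=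
  Finsupp.equivFunOnFinite.symm fun i => (i.rev : ℕ)

theorem vand_eq_sum : vand n k = ∑ g : Equiv.Perm (Fin n),
    MvPolynomial.monomial (Finsupp.equivFunOnFinite.symm fun i => (g i : ℕ))
      ((Equiv.Perm.sign g : ℤ) : k) := by
  rw [vand, ← Matrix.det_transpose, Matrix.det_apply]
  refine Finset.sum_congr rfl fun g _ => ?_
  rw [MvPolynomial.monomial_eq, Finsupp.prod_fintype _ _ fun _ => pow_zero _]
  simp [Matrix.vandermonde_apply, Units.smul_def, zsmul_eq_mul]

/-- The exponents are the rearrangements of the staircase, and a decreasing arrangement has the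
largest partial sums. -/
theorem bounded_vand : Bounded (vand n k) (staircase n) := by
  rw [vand_eq_sum]
  refine Bounded.sum _ fun g _ => ?_
  intro d hd
  rw [MvPolynomial.coeff_monomial] at hd
  have hd' : (Finsupp.equivFunOnFinite.symm fun i => (g i : ℕ)) = d := by
    by_contra h
    exact hd (if_neg h)
  subst hd'
  let f : ℕ → ℕ := fun i => n - 1 - i
  have hf : Antitone f := fun i j h => by simp only [f]; omega
  have h1 : ∀ r, psum r (staircase n) = ∑ i ∈ Finset.range (min r n), f i := fun r =>
    psum_eq_sum_range _ f (fun i => by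
      simp only [staircase, Finsupp.equivFunOnFinite_symm_apply_apply, f, Fin.val_rev]; omega) r
  have h2 : ∀ r, psum r (Finsupp.equivFunOnFinite.symm fun i => (g i : ℕ)) =
      ∑ i ∈ (Finset.univ.filter fun i : Fin n => (i : ℕ) < r).map
        ⟨fun i => ((g i).rev : ℕ), fun a b h => g.injective (Fin.rev_injective (Fin.ext h))⟩, f i := by
    intro r
    rw [psum, Finset.sum_map, Finset.sum_filter]
    refine Finset.sum_congr rfl fun i _ => ?_
    simp only [Finsupp.equivFunOnFinite_symm_apply_apply, Function.Embedding.coeFn_mk, f,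
      Fin.val_rev]
    have := (g i).2
    split_ifs <;> omega
  refine ⟨fun r => ?_, ?_⟩
  · rw [h1, h2]
    refine sum_le_sum_range_of_antitone hf _ ?_
    rw [Finset.card_map]
    refine le_min ?_ ((Finset.card_le_univ _).trans (by simp))
    have h3 : (Finset.univ.filter fun i : Fin n => (i : ℕ) < r).map Fin.valEmbedding ⊆
        Finset.range r := by
      intro j hj
      simp only [Finset.mem_map, Finset.mem_filter] at hj
      obtain ⟨i, hi, rfl⟩ := hj
      exact Finset.mem_range.mpr hi.2
    simpa using Finset.card_le_card h3
  · rw [psum, psum]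
    simp only [Fin.is_lt, if_true, staircase, Finsupp.equivFunOnFinite_symm_apply_apply]
    rw [Equiv.sum_comp g (fun i => (i : ℕ)), ← Equiv.sum_comp Fin.revPerm (fun i => (i : ℕ))]
    rfl

theorem coeff_vand_staircase : (vand n k).coeff (staircase n) ≠ 0 := by
  rw [vand_eq_sum, MvPolynomial.coeff_sum, Finset.sum_eq_single Fin.revPerm]
  · rw [MvPolynomial.coeff_monomial, if_pos (by ext i; simp [staircase])]
    rcases Int.units_eq_one_or (Equiv.Perm.sign (Fin.revPerm : Equiv.Perm (Fin n))) with h | h <;>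
      rw [h] <;> simp
  · intro g _ hg
    rw [MvPolynomial.coeff_monomial, if_neg]
    intro h
    refine hg (Equiv.ext fun i => Fin.ext ?_)
    exact DFunLike.congr_fun h i
  · simp

/-- Scaling `x_i` by `t` changes only the Vandermonde factors involving `i`, each by the ratio `(t
x_i - x_j)/(x_i - x_j)`. -/
theorem macCoeff_mul_vand {K : Type*} [Field K] [Algebra k K] (t : k) (x : Fin n → K)
    (hx : Function.Injective x) (i : Fin n) :
    macCoeff (algebraMap k K t) x i * MvPolynomial.aeval x (vand n k) =
      MvPolynomial.aeval x (varScale t i (vand n k)) := by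
  have hv : ∀ y : Fin n → K, MvPolynomial.aeval y (vand n k) =
      ∏ a : Fin n, ∏ b ∈ Finset.Ioi a, (y b - y a) := by
    intro y
    rw [vand, Matrix.det_vandermonde, map_prod]
    refine Finset.prod_congr rfl fun a _ => ?_
    rw [map_prod]
    exact Finset.prod_congr rfl fun b _ => by simp
  set T := algebraMap k K t
  let y := Function.update x i (T * x i)
  have h1 : MvPolynomial.aeval x (varScale t i (vand n k)) = MvPolynomial.aeval y (vand n k) := by
    rw [varScale, ← AlgHom.comp_apply]
    congr 1
    refine MvPolynomial.algHom_ext fun j => ?_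
    rw [AlgHom.comp_apply, MvPolynomial.aeval_X, MvPolynomial.aeval_X]
    by_cases h : j = i
    · subst h
      simp [y, T, ← MvPolynomial.algebraMap_eq]
    · simp [y, h]
  rw [h1, hv, hv]
  let ρ : Fin n → K := fun j => (T * x i - x j) / (x i - x j)
  have h2 : ∀ a : Fin n, ∀ b ∈ Finset.Ioi a, y b - y a =
      ((if a = i then ρ b else 1) * (if b = i then ρ a else 1)) * (x b - x a) := by
    intro a b hab
    rw [Finset.mem_Ioi] at hab
    have hne : x b - x a ≠ 0 := sub_ne_zero.mpr fun h => hab.ne' (hx h)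
    by_cases ha : a = i
    · subst ha
      have hba : b ≠ a := hab.ne'
      have hne' : x a - x b ≠ 0 := sub_ne_zero.mpr fun h => hab.ne (hx h)
      simp only [y, Function.update_self, Function.update_of_ne hba, if_true, if_neg hba, ρ]
      field_simp
      ring
    · by_cases hb : b = i
      · subst hb
        simp only [y, Function.update_self, Function.update_of_ne ha, if_true, if_neg ha, ρ]
        field_simp
      · simp [y, ha, hb]
  have h3 : ∏ a : Fin n, ∏ b ∈ Finset.Ioi a, (y b - y a) =
      (∏ a : Fin n, ∏ b ∈ Finset.Ioi a, if a = i then ρ b else 1) *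
      (∏ a : Fin n, ∏ b ∈ Finset.Ioi a, if b = i then ρ a else 1) *
      ∏ a : Fin n, ∏ b ∈ Finset.Ioi a, (x b - x a) := by
    rw [← Finset.prod_mul_distrib, ← Finset.prod_mul_distrib]
    refine Finset.prod_congr rfl fun a _ => ?_
    rw [← Finset.prod_mul_distrib, ← Finset.prod_mul_distrib]
    exact Finset.prod_congr rfl (h2 a)
  rw [h3]
  congr 1
  have h4 : ∏ a : Fin n, ∏ b ∈ Finset.Ioi a, (if a = i then ρ b else 1) =
      ∏ b ∈ Finset.Ioi i, ρ b := by
    rw [Finset.prod_eq_single i]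
    · simp
    · intro a _ ha
      exact Finset.prod_eq_one fun b _ => if_neg ha
    · simp
  have h5 : ∏ a : Fin n, ∏ b ∈ Finset.Ioi a, (if b = i then ρ a else 1) =
      ∏ a ∈ Finset.Iio i, ρ a := by
    rw [← Finset.prod_subset (Finset.subset_univ (Finset.Iio i))]
    · refine Finset.prod_congr rfl fun a ha => ?_
      rw [Finset.prod_ite_eq', if_pos]
      simpa using ha
    · intro a _ ha
      rw [Finset.prod_ite_eq', if_neg]
      simpa using ha
  rw [h4, h5, macCoeff, ← Finset.prod_union]
  · refine Finset.prod_congr ?_ fun _ _ => rfl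
    ext j
    simp only [Finset.mem_erase, Finset.mem_univ, and_true, Finset.mem_union, Finset.mem_Ioi,
      Finset.mem_Iio]
    exact ⟨fun h => (lt_or_gt_of_ne h).symm, fun h => h.elim (fun h => h.ne') fun h => h.ne⟩
  · exact Finset.disjoint_left.mpr fun j h1 h2 => by
      simp only [Finset.mem_Ioi, Finset.mem_Iio] at h1 h2
      exact lt_asymm h1 h2

end

end Macdonald


/-! ### Construction of the Macdonald functions as triangular eigenfunctions -/

namespace Macdonald

/-! ### Triangularity of the Macdonald operator -/

theorem sum_range_rowLen_min (lam : YoungDiagram) {n : ℕ} (hn : lam.colLen 0 ≤ n) (r : ℕ) :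
    ∑ i ∈ Finset.range (min r n), lam.rowLen i = ∑ i ∈ Finset.range r, lam.rowLen i := by
  refine Finset.sum_subset (Finset.range_subset_range.mpr (min_le_left _ _)) fun i hi hi' => ?_
  rw [Finset.mem_range] at hi hi'
  rw [rowLen_eq_zero_iff]
  omega

/-- The first `n` row lengths of a diagram. -/
noncomputable def finRow (n : ℕ) (lam : YoungDiagram) : Fin n →₀ ℕ :=
  Finsupp.equivFunOnFinite.symm fun i => lam.rowLen i

theorem finRow_apply (n : ℕ) (lam : YoungDiagram) (i : Fin n) : finRow n lam i = lam.rowLen i := rfl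

theorem embDomain_finRow {n : ℕ} {lam : YoungDiagram} (hn : lam.colLen 0 ≤ n) :
    (finRow n lam).embDomain Fin.valEmbedding = expo lam := (expo_eq_finExp lam hn).symm

theorem psum_finRow {n : ℕ} {lam : YoungDiagram} (hn : lam.colLen 0 ≤ n) (r : ℕ) :
    psum r (finRow n lam) = ∑ i ∈ Finset.range r, lam.rowLen i := by
  rw [psum_eq_sum_range _ lam.rowLen fun _ => rfl, sum_range_rowLen_min lam hn]

theorem psum_finRow_self {n : ℕ} {lam : YoungDiagram} (hn : lam.colLen 0 ≤ n) :
    psum n (finRow n lam) = lam.card := by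
  rw [psum_finRow hn, sum_range_rowLen lam hn]

theorem psum_self {n : ℕ} (d : Fin n →₀ ℕ) : psum n d = d.degree := by
  rw [Finsupp.degree_eq_sum, psum]
  simp

/-- A rearrangement has partial sums at most those of the decreasing arrangement. -/
theorem psum_le_of_parts {n : ℕ} {d : Fin n →₀ ℕ} {nu : YoungDiagram}
    (h : parts (expo nu) = parts (d.embDomain Fin.valEmbedding)) (r : ℕ) :
    psum r d ≤ ∑ i ∈ Finset.range r, nu.rowLen i := by
  obtain ⟨g, hg⟩ := exists_perm_of_parts_eq h
  have hd : ∀ i : Fin n, d i = nu.rowLen (g.symm i) := by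
    intro i
    have h1 := Finsupp.embDomain_apply_self Fin.valEmbedding d i
    rw [hg] at h1
    rw [← h1, ← expo_apply, ← Finsupp.embDomain_apply_self g.toEmbedding (expo nu) (g.symm i)]
    simp
  rw [psum_eq_sum_range d (fun i => nu.rowLen (g.symm i)) hd]
  have h2 : ∑ i ∈ Finset.range (min r n), nu.rowLen (g.symm i) =
      ∑ i ∈ (Finset.range (min r n)).map g.symm.toEmbedding, nu.rowLen i := by
    rw [Finset.sum_map]; rfl
  rw [h2]
  exact sum_le_sum_range_of_antitone (antitone_rowLen nu) _ (by simp)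

section

variable {k : Type*} [Field k] [CharZero k]

variable (k) in
/-- The monomial symmetric functions, in terms of power sums. -/
noncomputable def mono (lam : YoungDiagram) : Fock k := (toSymFun k).symm (monomialSymm lam)

/-- The coefficient of a monomial symmetric function. -/
noncomputable def mcoeff (mu : YoungDiagram) : Fock k →ₗ[k] k :=
  scoeff (expo mu) ∘ₗ (toSymFun k).toLinearMap

theorem mcoeff_apply (mu : YoungDiagram) (f : Fock k) :
    mcoeff mu f = scoeff (expo mu) (toSymFun k f) := rfl

theorem toSymFun_mono (lam : YoungDiagram) : toSymFun k (mono k lam) = monomialSymm lam :=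
  AlgEquiv.apply_symm_apply _ _

theorem mcoeff_mono (lam mu : YoungDiagram) :
    mcoeff lam (mono k mu) = if lam = mu then 1 else 0 := by
  rw [mcoeff_apply, toSymFun_mono, scoeff_expo_monomialSymm]

theorem fock_ext {f g : Fock k} (h : ∀ mu, mcoeff mu f = mcoeff mu g) : f = g :=
  (toSymFun k).injective (symFun_ext h)

theorem eq_sum_mono (f : Fock k) (s : Finset YoungDiagram) (h : ∀ mu, mcoeff mu f ≠ 0 → mu ∈ s) :
    f = ∑ mu ∈ s, mcoeff mu f • mono k mu := by
  refine fock_ext fun nu => ?_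
  rw [map_sum]
  simp only [map_smul, mcoeff_mono, smul_eq_mul, mul_ite, mul_one, mul_zero]
  rw [Finset.sum_ite_eq]
  split_ifs with h1
  · rfl
  · by_contra h2
    exact h1 (h nu h2)

/-- All monomials of `f` are dominated by `lam`. -/
def Triangular (f : Fock k) (lam : YoungDiagram) : Prop :=
  ∀ mu, mcoeff mu f ≠ 0 → Dominates lam mu

/-- All monomials of `f` are strictly dominated by `lam`. -/
def StrictTriangular (f : Fock k) (lam : YoungDiagram) : Prop :=
  ∀ mu, mcoeff mu f ≠ 0 → Dominates lam mu ∧ mu ≠ lam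

theorem triangular_mono (lam : YoungDiagram) : Triangular (mono k lam) lam := by
  intro mu h
  rw [mcoeff_mono] at h
  have : mu = lam := by by_contra hc; exact h (if_neg hc)
  rw [this]
  exact Dominates.refl _

theorem coeff_restr_finRow {n : ℕ} (f : Fock k) {lam : YoungDiagram} (hn : lam.colLen 0 ≤ n) :
    (restr k n f).coeff (finRow n lam) = mcoeff lam f := by
  rw [coeff_restr, embDomain_finRow hn]
  rfl

theorem exists_coeff_restr {n : ℕ} (f : Fock k) (d : Fin n →₀ ℕ) : ∃ nu : YoungDiagram,
    parts (expo nu) = parts (d.embDomain Fin.valEmbedding) ∧ nu.colLen 0 ≤ n ∧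
      (restr k n f).coeff d = mcoeff nu f := by
  obtain ⟨nu, hnu⟩ := exists_diagram_of_parts (d.embDomain Fin.valEmbedding)
  refine ⟨nu, hnu, ?_, ?_⟩
  · have h1 := congrArg Multiset.card hnu
    rw [parts_embDomain, parts_expo, Multiset.coe_card, YoungDiagram.length_rowLens] at h1
    rw [h1, parts, Multiset.card_map]
    exact (Finset.card_le_univ _).trans (by simp)
  · rw [coeff_restr, scoeff_eq_of_parts hnu.symm]
    rfl

theorem Triangular.bounded {f : Fock k} {lam : YoungDiagram} (h : Triangular f lam) {n : ℕ}
    (hn : lam.colLen 0 ≤ n) : Bounded (restr k n f) (finRow n lam) := by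
  intro d hd
  obtain ⟨nu, hnu, -, hc⟩ := exists_coeff_restr f d
  rw [hc] at hd
  have h1 := h nu hd
  refine ⟨fun r => ?_, ?_⟩
  · rw [psum_finRow hn]
    exact (psum_le_of_parts hnu r).trans (h1.2 r)
  · rw [psum_finRow_self hn, psum_self, ← sum_parts, ← parts_embDomain Fin.valEmbedding, ← hnu,
      sum_parts, degree_expo, h1.1]

/-- A given monomial function is visible as soon as the number of variables reaches its number of
parts, so bounds in all large numbers of variables suffice. -/
theorem triangular_of_bounded {f : Fock k} {lam : YoungDiagram} (N : ℕ)
    (h : ∀ n, N ≤ n → lam.colLen 0 ≤ n → Bounded (restr k n f) (finRow n lam)) :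
    Triangular f lam := by
  intro mu hmu
  let n := max N (max (lam.colLen 0) (mu.colLen 0))
  have h1 : lam.colLen 0 ≤ n := (le_max_left _ _).trans (le_max_right _ _)
  have h2 : mu.colLen 0 ≤ n := (le_max_right _ _).trans (le_max_right _ _)
  rw [← coeff_restr_finRow f h2] at hmu
  have h3 := h n (le_max_left _ _) h1 _ hmu
  refine ⟨?_, fun r => ?_⟩
  · rw [← psum_finRow_self h1, ← psum_finRow_self h2, h3.2]
  · have := h3.1 r
    rwa [psum_finRow h1, psum_finRow h2] at this

/-- The formula for the operator in `n` variables at the generic point, cleared of denominators: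
both sides are polynomials, and the fraction field of the polynomial ring detects their equality. -/
theorem vand_mul_opE {q t : k} (ht0 : t ≠ 0) (n : ℕ) (f : Fock k) :
    vand n k * (t ^ n • restr k n (opE q t f) - restr k n f) =
      (t - 1) • ∑ i, varScale t i (vand n k) * varScale q i (restr k n f) := by
  let K := FractionRing (MvPolynomial (Fin n) k)
  let ι : MvPolynomial (Fin n) k →ₐ[k] K := IsScalarTower.toAlgHom k _ K
  have hι : Function.Injective ι := IsFractionRing.injective (MvPolynomial (Fin n) k) K
  let x : Fin n → K := fun i => ι (MvPolynomial.X i)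
  have hx : Function.Injective x := fun i j h => MvPolynomial.X_injective (hι h)
  have hx0 : ∀ i, x i ≠ 0 := fun i h => MvPolynomial.X_ne_zero i (hι (h.trans (map_zero ι).symm))
  have haeval : ∀ p : MvPolynomial (Fin n) k, MvPolynomial.aeval x p = ι p := by
    intro p
    have : (MvPolynomial.aeval x : _ →ₐ[k] K) = ι :=
      MvPolynomial.algHom_ext fun i => MvPolynomial.aeval_X _ _
    rw [this]
  have hev : ∀ g : Fock k, ev x g = ι (restr k n g) := fun g => by
    rw [ev_eq_aeval, haeval]
  have hupd : ∀ (i : Fin n) (g : Fock k), ev (Function.update x i (algebraMap k K q * x i)) g =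
      ι (varScale q i (restr k n g)) := by
    intro i g
    rw [ev_eq_aeval]
    have : (MvPolynomial.aeval (Function.update x i (algebraMap k K q * x i)) : _ →ₐ[k] K) =
        ι.comp (varScale q i) := by
      refine MvPolynomial.algHom_ext fun j => ?_
      rw [MvPolynomial.aeval_X, AlgHom.comp_apply, varScale, MvPolynomial.aeval_X]
      by_cases h : j = i
      · subst h
        rw [Function.update_self, Function.update_self, map_mul]
        congr 1
      · rw [Function.update_of_ne h, Function.update_of_ne h]
    rw [this]
    rfl
  refine hι ?_
  have h1 := ev_opE q t ht0 x hx hx0 f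
  rw [hev, hev] at h1
  rw [map_mul, map_sub, map_smul, map_smul, map_sum, Algebra.smul_def, Algebra.smul_def, map_pow,
    h1, add_sub_cancel_left, map_sub, map_one, mul_left_comm, Finset.mul_sum]
  congr 1
  refine Finset.sum_congr rfl fun i _ => ?_
  rw [hupd, map_mul, ← haeval (varScale t i _), ← macCoeff_mul_vand t x hx i, haeval]
  ring

/-- The eigenvalues of the Macdonald operator in `n` variables. -/
noncomputable def macEigen (q t : k) (n : ℕ) (lam : YoungDiagram) : k :=
  ∑ i : Fin n, t ^ (i.rev : ℕ) * q ^ lam.rowLen i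

/-- After multiplication by the Vandermonde polynomial every term is bounded by staircase plus
`lam`; dividing by a polynomial whose leading exponent is the staircase leaves the bound `lam`. -/
theorem opE_triangular {q t : k} (ht0 : t ≠ 0) {f : Fock k} {lam : YoungDiagram}
    (h : Triangular f lam) : Triangular (opE q t f) lam := by
  refine triangular_of_bounded 0 fun n _ hn => ?_
  have hb := h.bounded hn
  have h1 : Bounded (t ^ n • restr k n (opE q t f) - restr k n f) (finRow n lam) := by
    refine Bounded.of_mul (coeff_vand_staircase (k := k)) ?_
    rw [vand_mul_opE ht0]
    exact (Bounded.sum _ fun i _ => (bounded_vand.varScale t i).mul (hb.varScale q i)).smul _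
  have h2 : restr k n (opE q t f) = (t ^ n)⁻¹ •
      ((t ^ n • restr k n (opE q t f) - restr k n f) + restr k n f) := by
    rw [sub_add_cancel, smul_smul, inv_mul_cancel₀ (pow_ne_zero _ ht0), one_smul]
  rw [h2]
  exact (h1.add hb).smul _

/-- Compare the coefficients of the extreme exponent staircase plus `lam`: in the `i`-th term the
two scalings contribute `t^(n-1-i)` and `q^(lam_i)`. -/
theorem mcoeff_opE {q t : k} (ht0 : t ≠ 0) {f : Fock k} {lam : YoungDiagram}
    (h : Triangular f lam) {n : ℕ} (hn : lam.colLen 0 ≤ n) :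
    t ^ n * mcoeff lam (opE q t f) = (1 + (t - 1) * macEigen q t n lam) * mcoeff lam f := by
  have hb := h.bounded hn
  have hb' := (opE_triangular (q := q) ht0 h).bounded hn
  have h1 := congrArg (MvPolynomial.coeff (staircase n + finRow n lam)) (vand_mul_opE (q := q) ht0 n f)
  rw [mul_sub, MvPolynomial.coeff_sub, mul_smul_comm, MvPolynomial.coeff_smul,
    bounded_vand.coeff_mul hb', bounded_vand.coeff_mul hb, MvPolynomial.coeff_smul,
    MvPolynomial.coeff_sum] at h1
  simp only [(bounded_vand.varScale t _).coeff_mul (hb.varScale q _), coeff_varScale,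
    coeff_restr_finRow _ hn, smul_eq_mul] at h1
  have h2 : ∑ i : Fin n, t ^ (staircase n i) * (vand n k).coeff (staircase n) *
      (q ^ finRow n lam i * mcoeff lam f) =
      (vand n k).coeff (staircase n) * (macEigen q t n lam * mcoeff lam f) := by
    rw [macEigen, Finset.sum_mul, Finset.mul_sum]
    refine Finset.sum_congr rfl fun i _ => ?_
    simp only [staircase, Finsupp.equivFunOnFinite_symm_apply_apply, finRow_apply]
    ring
  rw [h2] at h1
  refine mul_left_cancel₀ (coeff_vand_staircase (n := n) (k := k)) ?_
  linear_combination h1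

/-! ### Orthogonalization -/

/-- The diagrams strictly dominated by `lam`. -/
noncomputable def below (lam : YoungDiagram) : Finset YoungDiagram :=
  (finite_dominates lam).toFinset.erase lam

theorem mem_below {lam mu : YoungDiagram} : mu ∈ below lam ↔ Dominates lam mu ∧ mu ≠ lam := by
  rw [below, Finset.mem_erase, Set.Finite.mem_toFinset, and_comm]
  rfl

/-- The Gram matrix of the monomial symmetric functions below `lam`. -/
noncomputable def gram (q t : k) (lam : YoungDiagram) : Matrix (below lam) (below lam) k :=
  Matrix.of fun mu nu => pairing (zetaQT q t) (mono k mu) (mono k nu)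

/-- The coefficients of a Macdonald function. -/
noncomputable def macVec (q t : k) (lam : YoungDiagram) : below lam → k :=
  -((gram q t lam)⁻¹.mulVec fun mu => pairing (zetaQT q t) (mono k mu) (mono k lam))

/-- `m_lam` minus its orthogonal projection to the span of the lower monomial functions. -/
noncomputable def macFun (q t : k) (lam : YoungDiagram) : Fock k :=
  mono k lam + ∑ mu, macVec q t lam mu • mono k (mu : YoungDiagram)

/-- The scalar product is nondegenerate on the relevant spaces. -/
def Nondeg (q t : k) : Prop := ∀ lam, (gram q t lam).det ≠ 0

theorem mcoeff_macFun (q t : k) (lam nu : YoungDiagram) : mcoeff nu (macFun q t lam) =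
    if nu = lam then 1 else if h : nu ∈ below lam then macVec q t lam ⟨nu, h⟩ else 0 := by
  rw [macFun, map_add, mcoeff_mono, map_sum]
  simp only [map_smul, mcoeff_mono, smul_eq_mul, mul_ite, mul_one, mul_zero]
  split_ifs with h1 h2
  · subst h1
    rw [Finset.sum_eq_zero, add_zero]
    rintro ⟨mu, hmu⟩ -
    rw [if_neg]
    exact (mem_below.mp hmu).2.symm
  · rw [Finset.sum_eq_single ⟨nu, h2⟩, if_pos rfl, zero_add]
    · rintro ⟨mu, hmu⟩ - hne
      rw [if_neg]
      intro h
      exact hne (Subtype.ext h.symm)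
    · simp
  · rw [Finset.sum_eq_zero, add_zero]
    rintro ⟨mu, hmu⟩ -
    rw [if_neg]
    rintro rfl
    exact h2 hmu

theorem triangular_macFun (q t : k) (lam : YoungDiagram) : Triangular (macFun q t lam) lam := by
  intro nu h
  rw [mcoeff_macFun] at h
  split_ifs at h with h1 h2
  · rw [h1]; exact Dominates.refl _
  · exact (mem_below.mp h2).1
  · exact absurd rfl h

theorem mcoeff_macFun_self (q t : k) (lam : YoungDiagram) : mcoeff lam (macFun q t lam) = 1 := by
  rw [mcoeff_macFun, if_pos rfl]

theorem StrictTriangular.eq_sum {g : Fock k} {lam : YoungDiagram} (h : StrictTriangular g lam) :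
    g = ∑ mu : below lam, mcoeff (mu : YoungDiagram) g • mono k (mu : YoungDiagram) := by
  conv_lhs => rw [eq_sum_mono g (below lam) fun mu hmu => mem_below.mpr (h mu hmu)]
  rw [← Finset.sum_coe_sort]

variable {q t : k}

/-- The coefficient vector was chosen as the solution of this linear system for the Gram matrix. -/
theorem pairing_mono_macFun (hnd : Nondeg q t) {lam mu : YoungDiagram} (h : Dominates lam mu)
    (hne : mu ≠ lam) : pairing (zetaQT q t) (mono k mu) (macFun q t lam) = 0 := by
  have h1 : (gram q t lam).mulVec (macVec q t lam) =
      -fun mu : below lam => pairing (zetaQT q t) (mono k mu) (mono k lam) := by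
    rw [macVec, Matrix.mulVec_neg, Matrix.mulVec_mulVec,
      Matrix.mul_nonsing_inv _ (isUnit_iff_ne_zero.mpr (hnd lam)), Matrix.one_mulVec]
  have h2 := congrFun h1 ⟨mu, mem_below.mpr ⟨h, hne⟩⟩
  rw [macFun, map_add, map_sum]
  simp only [map_smul, smul_eq_mul]
  rw [Matrix.mulVec, dotProduct] at h2
  simp only [gram, Matrix.of_apply, Pi.neg_apply] at h2
  simp only [mul_comm (macVec q t lam _)]
  rw [h2, add_neg_cancel]

theorem pairing_strictTriangular {f g : Fock k} {lam : YoungDiagram} (hg : StrictTriangular g lam)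
    (hf : ∀ mu, Dominates lam mu → mu ≠ lam → pairing (zetaQT q t) (mono k mu) f = 0) :
    pairing (zetaQT q t) g f = 0 := by
  rw [hg.eq_sum, map_sum, LinearMap.sum_apply]
  refine Finset.sum_eq_zero fun mu _ => ?_
  have := mem_below.mp mu.2
  rw [LinearMap.map_smul₂, hf _ this.1 this.2, smul_zero]

theorem eq_zero_of_strictTriangular (hnd : Nondeg q t) {g : Fock k} {lam : YoungDiagram}
    (hg : StrictTriangular g lam)
    (h : ∀ mu, Dominates lam mu → mu ≠ lam → pairing (zetaQT q t) (mono k mu) g = 0) : g = 0 := by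
  have h1 : (gram q t lam).mulVec (fun mu => mcoeff (mu : YoungDiagram) g) = 0 := by
    funext mu
    have h2 := mem_below.mp mu.2
    have h3 := h mu h2.1 h2.2
    rw [hg.eq_sum, map_sum] at h3
    simp only [map_smul, smul_eq_mul] at h3
    rw [Matrix.mulVec, dotProduct, Pi.zero_apply, ← h3]
    exact Finset.sum_congr rfl fun nu _ => mul_comm _ _
  have h2 := Matrix.eq_zero_of_mulVec_eq_zero (hnd lam) h1
  rw [hg.eq_sum]
  exact Finset.sum_eq_zero fun mu _ => by rw [congrFun h2 mu, Pi.zero_apply, zero_smul]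

theorem strictTriangular_sub {f g : Fock k} {lam : YoungDiagram} (hf : Triangular f lam)
    (hg : Triangular g lam) (h : mcoeff lam f = mcoeff lam g) : StrictTriangular (f - g) lam := by
  intro mu hmu
  rw [map_sub] at hmu
  refine ⟨?_, ?_⟩
  · by_cases h0 : mcoeff mu f = 0
    · refine hg mu fun h1 => hmu ?_
      rw [h0, h1, sub_zero]
    · exact hf mu h0
  · rintro rfl
    exact hmu (by rw [h, sub_self])

/-- The difference of two such functions lies strictly below `lam` and is orthogonal to everything
strictly below `lam`; nondegeneracy makes it zero. -/
theorem eq_macFun (hnd : Nondeg q t) {f : Fock k} {lam : YoungDiagram} (hf : Triangular f lam)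
    (h1 : mcoeff lam f = 1)
    (h : ∀ mu, Dominates lam mu → mu ≠ lam → pairing (zetaQT q t) (mono k mu) f = 0) :
    f = macFun q t lam := by
  rw [← sub_eq_zero]
  refine eq_zero_of_strictTriangular hnd (strictTriangular_sub hf (triangular_macFun q t lam)
    (h1.trans (mcoeff_macFun_self q t lam).symm)) fun mu hmu hne => ?_
  rw [map_sub, h mu hmu hne, pairing_mono_macFun hnd hmu hne, sub_zero]

/-- The Macdonald functions are eigenfunctions of the Macdonald operator. -/
theorem opE_macFun (ht0 : t ≠ 0) (hq : ∀ n, 0 < n → q ^ n ≠ 1)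
    (ht : ∀ n, 0 < n → t ^ n ≠ 1) (hnd : Nondeg q t) (lam : YoungDiagram) :
    opE q t (macFun q t lam) = mcoeff lam (opE q t (macFun q t lam)) • macFun q t lam := by
  rw [← sub_eq_zero]
  refine eq_zero_of_strictTriangular hnd (strictTriangular_sub
    (opE_triangular ht0 (triangular_macFun q t lam)) (fun mu hmu => ?_) ?_) fun mu hmu hne => ?_
  · rw [map_smul] at hmu
    exact triangular_macFun q t lam mu (right_ne_zero_of_mul hmu)
  · rw [map_smul, mcoeff_macFun_self, smul_eq_mul, mul_one]
  -- By self-adjointness, `⟨m_mu, E P_lam⟩ = ⟨E m_mu, P_lam⟩`, and `E m_mu` again involves only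
  -- monomials strictly below `lam`.
  · rw [map_sub, map_smul, pairing_mono_macFun hnd hmu hne, smul_zero, sub_zero,
      ← pairing_opE q t ht0 hq ht]
    refine pairing_strictTriangular (lam := lam) (fun nu hnu => ?_) fun nu h h' =>
      pairing_mono_macFun hnd h h'
    have h1 := opE_triangular ht0 (triangular_mono mu) nu hnu
    refine ⟨hmu.trans h1, ?_⟩
    rintro rfl
    exact hne (h1.antisymm hmu)

/-- Eigenvectors of a self-adjoint operator with different eigenvalues are orthogonal; the
eigenvalue is an affine function of `macEigen` with slope a nonzero multiple of `t - 1`. -/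
theorem pairing_macFun_of_eigen (ht0 : t ≠ 0) (hq : ∀ n, 0 < n → q ^ n ≠ 1)
    (ht : ∀ n, 0 < n → t ^ n ≠ 1) (hnd : Nondeg q t) {lam mu : YoungDiagram} {n : ℕ}
    (hl : lam.colLen 0 ≤ n) (hm : mu.colLen 0 ≤ n) (h : macEigen q t n lam ≠ macEigen q t n mu) :
    pairing (zetaQT q t) (macFun q t lam) (macFun q t mu) = 0 := by
  have h1 := pairing_opE q t ht0 hq ht (macFun q t lam) (macFun q t mu)
  rw [opE_macFun ht0 hq ht hnd, opE_macFun ht0 hq ht hnd mu, LinearMap.map_smul₂, map_smul,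
    smul_eq_mul, smul_eq_mul] at h1
  have e1 := mcoeff_opE (q := q) ht0 (triangular_macFun q t lam) hl
  have e2 := mcoeff_opE (q := q) ht0 (triangular_macFun q t mu) hm
  rw [mcoeff_macFun_self] at e1 e2
  have ht1 : t - 1 ≠ 0 := by
    have := ht 1 one_pos
    rw [pow_one] at this
    exact sub_ne_zero.mpr this
  have h2 : (t - 1) * (macEigen q t n lam - macEigen q t n mu) *
      pairing (zetaQT q t) (macFun q t lam) (macFun q t mu) = 0 := by
    linear_combination t ^ n * h1 -
      pairing (zetaQT q t) (macFun q t lam) (macFun q t mu) * (e1 - e2)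
  exact (mul_eq_zero.mp h2).resolve_left (mul_ne_zero ht1 (sub_ne_zero.mpr h))

theorem isMacdonaldFamily_macFun
    (h : ∀ lam mu, lam ≠ mu → pairing (zetaQT q t) (macFun q t lam) (macFun q t mu) = 0) :
    IsMacdonaldFamily q t fun lam => toSymFun k (macFun q t lam) := by
  refine ⟨fun lam => ?_, fun lam mu hne => ?_⟩
  · change toSymFun k (macFun q t lam) - _ ∈ _
    rw [macFun, map_add, toSymFun_mono, add_sub_cancel_left, map_sum]
    refine Submodule.sum_mem _ fun mu _ => ?_
    rw [map_smul, toSymFun_mono]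
    exact Submodule.smul_mem _ _ (Submodule.subset_span ⟨mu, mem_below.mp mu.2, rfl⟩)
  · rw [scalarProduct_toSymFun]
    exact h lam mu hne

/-- Uniqueness. The lower `m_mu` are combinations of the lower members of the family, so `P lam` is
orthogonal to them, and this together with its leading term determines it. -/
theorem eq_macFun_of_isMacdonaldFamily (hnd : Nondeg q t) {P : YoungDiagram → SymFun k}
    (hP : IsMacdonaldFamily q t P) (lam : YoungDiagram) : P lam = toSymFun k (macFun q t lam) := by
  let f : YoungDiagram → Fock k := fun lam => (toSymFun k).symm (P lam)
  have hs : ∀ lam, StrictTriangular (f lam - mono k lam) lam := by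
    intro lam mu hmu
    by_contra hc
    refine hmu ?_
    have h1 : ∀ g ∈ Submodule.span k (monomialSymm (k := k) '' {mu | Dominates lam mu ∧ mu ≠ lam}),
        scoeff (expo mu) g = 0 := by
      intro g hg
      induction hg using Submodule.span_induction with
      | mem g hg =>
        obtain ⟨nu, hnu, rfl⟩ := hg
        rw [scoeff_expo_monomialSymm, if_neg]
        rintro rfl
        exact hc hnu
      | zero => exact map_zero _
      | add g g' _ _ h h' => rw [map_add, h, h', add_zero]
      | smul c g _ h => rw [map_smul, h, smul_zero]
    have h2 := h1 _ (hP.1 lam)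
    rw [mcoeff_apply, map_sub, toSymFun_mono, AlgEquiv.apply_symm_apply]
    exact h2
  -- Induction on `mu` for all `lam` at once: `m_mu` differs from the member of index `mu` by
  -- monomials strictly below `mu`, which are still strictly below `lam`.
  have horth : ∀ mu, ∀ lam, Dominates lam mu → mu ≠ lam →
      pairing (zetaQT q t) (mono k mu) (f lam) = 0 := by
    intro mu
    induction mu using dominates_induction with
    | h mu ih =>
      intro lam hl hne
      have h1 : pairing (zetaQT q t) (f mu) (f lam) = 0 := by
        rw [← scalarProduct_eq]
        exact hP.2 mu lam hne
      have h2 : pairing (zetaQT q t) (f mu - mono k mu) (f lam) = 0 := by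
        refine pairing_strictTriangular (hs mu) fun nu hnu hne' => ih nu hnu hne' lam (hl.trans hnu) ?_
        rintro rfl
        exact hne (hnu.antisymm hl)
      rw [map_sub, LinearMap.sub_apply, h1, zero_sub, neg_eq_zero] at h2
      exact h2
  have hc : ∀ mu, mcoeff mu (f lam) = mcoeff mu (f lam - mono k lam) + mcoeff mu (mono k lam) := by
    intro mu
    rw [map_sub, sub_add_cancel]
  have h3 : f lam = macFun q t lam := by
    refine eq_macFun hnd (fun mu hmu => ?_) ?_ fun mu hmu hne => horth mu lam hmu hne
    · by_cases h0 : mcoeff mu (f lam - mono k lam) = 0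
      · rw [hc, h0, zero_add] at hmu
        exact triangular_mono lam mu hmu
      · exact (hs lam mu h0).1
    · rw [hc, mcoeff_mono, if_pos rfl]
      have : mcoeff lam (f lam - mono k lam) = 0 := by
        by_contra h0
        exact (hs lam lam h0).2 rfl
      rw [this, zero_add]
  rw [← h3]
  exact (AlgEquiv.apply_symm_apply _ _).symm

theorem macdonaldP_eq (hnd : Nondeg q t)
    (h : ∀ lam mu, lam ≠ mu → pairing (zetaQT q t) (macFun q t lam) (macFun q t mu) = 0)
    (lam : YoungDiagram) : macdonaldP q t lam = toSymFun k (macFun q t lam) :=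
  eq_macFun_of_isMacdonaldFamily hnd
    (Classical.epsilon_spec (p := IsMacdonaldFamily q t) ⟨_, isMacdonaldFamily_macFun h⟩) lam

end

end Macdonald


/-! ### Specialization from generic to real parameters -/

namespace Macdonald

/-! ### Values of rational functions -/

/-- The rational function `f` is regular at `(q,t)`, with value `v`. -/
def HasRealValueAt (q t : ℝ) (f : Qqt) (v : ℝ) : Prop :=
  ∃ num den : MvPolynomial (Fin 2) ℚ, MvPolynomial.aeval ![q, t] den ≠ 0 ∧
    f = algebraMap _ Qqt num / algebraMap _ Qqt den ∧
    v = MvPolynomial.aeval ![q, t] num / MvPolynomial.aeval ![q, t] den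

theorem algebraMap_Qqt_ne_zero {q t : ℝ} {p : MvPolynomial (Fin 2) ℚ}
    (h : MvPolynomial.aeval ![q, t] p ≠ 0) : algebraMap _ Qqt p ≠ 0 := by
  intro h0
  refine h ?_
  rw [(map_eq_zero_iff _ (IsFractionRing.injective (MvPolynomial (Fin 2) ℚ) Qqt)).mp h0, map_zero]

namespace HasRealValueAt

variable {q t : ℝ} {f g : Qqt} {v w : ℝ}

theorem of_polynomial (q t : ℝ) (p : MvPolynomial (Fin 2) ℚ) :
    HasRealValueAt q t (algebraMap _ Qqt p) (MvPolynomial.aeval ![q, t] p) :=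
  ⟨p, 1, by simp, by simp, by simp⟩

theorem qInd (q t : ℝ) : HasRealValueAt q t Macdonald.qInd q := by
  simpa [Macdonald.qInd] using of_polynomial q t (MvPolynomial.X 0)

theorem tInd (q t : ℝ) : HasRealValueAt q t Macdonald.tInd t := by
  simpa [Macdonald.tInd] using of_polynomial q t (MvPolynomial.X 1)

theorem ratCast (q t : ℝ) (c : ℚ) : HasRealValueAt q t (c : Qqt) (c : ℝ) := by
  have h := of_polynomial q t (MvPolynomial.C c)
  have h1 : (algebraMap (MvPolynomial (Fin 2) ℚ) Qqt) (MvPolynomial.C c) = (c : Qqt) := by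
    rw [← MvPolynomial.algebraMap_eq, ← IsScalarTower.algebraMap_apply]
    exact eq_ratCast _ _
  rw [h1] at h
  simpa using h

theorem one (q t : ℝ) : HasRealValueAt q t 1 1 := by simpa using ratCast q t 1

theorem zero (q t : ℝ) : HasRealValueAt q t 0 0 := by simpa using ratCast q t 0

theorem natCast (q t : ℝ) (c : ℕ) : HasRealValueAt q t (c : Qqt) (c : ℝ) := by
  simpa using ratCast q t c

theorem intCast (q t : ℝ) (c : ℤ) : HasRealValueAt q t (c : Qqt) (c : ℝ) := by
  simpa using ratCast q t c

theorem add (hf : HasRealValueAt q t f v) (hg : HasRealValueAt q t g w) :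
    HasRealValueAt q t (f + g) (v + w) := by
  obtain ⟨a, b, hb, rfl, rfl⟩ := hf
  obtain ⟨c, d, hd, rfl, rfl⟩ := hg
  refine ⟨a * d + b * c, b * d, ?_, ?_, ?_⟩
  · rw [map_mul]; exact mul_ne_zero hb hd
  · rw [div_add_div _ _ (algebraMap_Qqt_ne_zero hb) (algebraMap_Qqt_ne_zero hd)]
    simp only [map_add, map_mul]
  · rw [div_add_div _ _ hb hd]
    simp only [map_add, map_mul]

theorem mul (hf : HasRealValueAt q t f v) (hg : HasRealValueAt q t g w) :
    HasRealValueAt q t (f * g) (v * w) := by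
  obtain ⟨a, b, hb, rfl, rfl⟩ := hf
  obtain ⟨c, d, hd, rfl, rfl⟩ := hg
  refine ⟨a * c, b * d, ?_, ?_, ?_⟩
  · rw [map_mul]; exact mul_ne_zero hb hd
  · rw [div_mul_div_comm]
    simp only [map_mul]
  · rw [div_mul_div_comm]
    simp only [map_mul]

theorem neg (hf : HasRealValueAt q t f v) : HasRealValueAt q t (-f) (-v) := by
  have h := (intCast q t (-1)).mul hf
  simpa using h

theorem sub (hf : HasRealValueAt q t f v) (hg : HasRealValueAt q t g w) :
    HasRealValueAt q t (f - g) (v - w) := by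
  rw [sub_eq_add_neg, sub_eq_add_neg]
  exact hf.add hg.neg

theorem inv (hf : HasRealValueAt q t f v) (hv : v ≠ 0) : HasRealValueAt q t f⁻¹ v⁻¹ := by
  obtain ⟨a, b, hb, rfl, rfl⟩ := hf
  exact ⟨b, a, fun h => hv (by rw [h, zero_div]), by rw [inv_div], by rw [inv_div]⟩

theorem div (hf : HasRealValueAt q t f v) (hg : HasRealValueAt q t g w) (hw : w ≠ 0) :
    HasRealValueAt q t (f / g) (v / w) := by
  rw [div_eq_mul_inv, div_eq_mul_inv]
  exact hf.mul (hg.inv hw)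

theorem sum {ι : Type*} (s : Finset ι) {f : ι → Qqt} {v : ι → ℝ}
    (h : ∀ i ∈ s, HasRealValueAt q t (f i) (v i)) :
    HasRealValueAt q t (∑ i ∈ s, f i) (∑ i ∈ s, v i) := by
  induction s using Finset.induction_on with
  | empty => exact zero q t
  | insert i s hi ih =>
    rw [Finset.sum_insert hi, Finset.sum_insert hi]
    exact (h i (Finset.mem_insert_self _ _)).add
      (ih fun j hj => h j (Finset.mem_insert_of_mem hj))

theorem prod {ι : Type*} (s : Finset ι) {f : ι → Qqt} {v : ι → ℝ}
    (h : ∀ i ∈ s, HasRealValueAt q t (f i) (v i)) :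
    HasRealValueAt q t (∏ i ∈ s, f i) (∏ i ∈ s, v i) := by
  induction s using Finset.induction_on with
  | empty => exact one q t
  | insert i s hi ih =>
    rw [Finset.prod_insert hi, Finset.prod_insert hi]
    exact (h i (Finset.mem_insert_self _ _)).mul
      (ih fun j hj => h j (Finset.mem_insert_of_mem hj))

theorem pow (hf : HasRealValueAt q t f v) (n : ℕ) : HasRealValueAt q t (f ^ n) (v ^ n) := by
  have := prod (Finset.range n) fun _ _ => hf
  simpa using this

theorem det {ι : Type*} [Fintype ι] [DecidableEq ι] {A : Matrix ι ι Qqt} {B : Matrix ι ι ℝ}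
    (h : ∀ i j, HasRealValueAt q t (A i j) (B i j)) : HasRealValueAt q t A.det B.det := by
  rw [Matrix.det_apply', Matrix.det_apply']
  exact sum _ fun g _ => (intCast q t _).mul (prod _ fun i _ => h _ _)

/-- Cross-multiply: equal fractions give a polynomial identity, which survives evaluation.
Uniqueness is what transfers identities from the generic field to real parameters. -/
theorem unique (hf : HasRealValueAt q t f v) (hf' : HasRealValueAt q t f w) : v = w := by
  obtain ⟨a, b, hb, rfl, rfl⟩ := hf
  obtain ⟨c, d, hd, h, rfl⟩ := hf'
  rw [div_eq_div_iff (algebraMap_Qqt_ne_zero hb) (algebraMap_Qqt_ne_zero hd), ← map_mul,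
    ← map_mul] at h
  have h1 := IsFractionRing.injective (MvPolynomial (Fin 2) ℚ) Qqt h
  rw [div_eq_div_iff hb hd, ← map_mul, ← map_mul, h1]

theorem hasValueAt (hf : HasRealValueAt q t f v) : HasValueAt f q t v := by
  obtain ⟨a, b, hb, hf, rfl⟩ := hf
  have h : ∀ p : MvPolynomial (Fin 2) ℚ, MvPolynomial.aeval ![(q : ℂ), (t : ℂ)] p =
      ((MvPolynomial.aeval ![q, t] p : ℝ) : ℂ) := by
    intro p
    have h1 : (MvPolynomial.aeval ![(q : ℂ), (t : ℂ)] : MvPolynomial (Fin 2) ℚ →ₐ[ℚ] ℂ) =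
        (Complex.ofRealAm.restrictScalars ℚ).comp (MvPolynomial.aeval ![q, t]) := by
      refine MvPolynomial.algHom_ext fun i => ?_
      fin_cases i <;> simp
    rw [h1]
    rfl
  refine ⟨a, b, ?_, hf, ?_⟩
  · rw [h]
    exact_mod_cast hb
  · rw [h, h]
    push_cast
    rfl

end HasRealValueAt

/-! ### Specialization of Macdonald functions -/

section

variable {k : Type*} [Field k] [CharZero k]

/-- Two ring homomorphisms that agree on power sums; on constants they agree because `ℚ` has at most
one homomorphism to any ring. -/
theorem coe_toSymFun_map (f : Fock ℚ) :
    (toSymFun k (MvPolynomial.map (Rat.castHom k) f) : MvPowerSeries ℕ k) =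
      MvPowerSeries.map (Rat.castHom k) (toSymFun ℚ f : MvPowerSeries ℕ ℚ) := by
  let φ : Fock ℚ →+* MvPowerSeries ℕ k := ((SymFun k).val.toRingHom.comp
    (toSymFun k).toRingEquiv.toRingHom).comp (MvPolynomial.map (Rat.castHom k))
  let ψ : Fock ℚ →+* MvPowerSeries ℕ k := (MvPowerSeries.map (Rat.castHom k)).comp
    ((SymFun ℚ).val.toRingHom.comp (toSymFun ℚ).toRingEquiv.toRingHom)
  have h : φ = ψ := by
    refine MvPolynomial.ringHom_ext (fun c => ?_) fun r => ?_
    · have : ∀ χ χ' : ℚ →+* MvPowerSeries ℕ k, χ c = χ' c := fun χ χ' => by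
        rw [Subsingleton.elim χ χ']
      exact this (φ.comp MvPolynomial.C) (ψ.comp MvPolynomial.C)
    · change (toSymFun k (MvPolynomial.map (Rat.castHom k) (MvPolynomial.X r)) : MvPowerSeries ℕ k) =
        MvPowerSeries.map (Rat.castHom k) (toSymFun ℚ (MvPolynomial.X r) : MvPowerSeries ℕ ℚ)
      rw [MvPolynomial.map_X, toSymFun_X, toSymFun_X]
      ext d
      rw [MvPowerSeries.coeff_map]
      change (if ∃ i, d = Finsupp.single i (r : ℕ) then (1 : k) else 0) =
        Rat.castHom k (if ∃ i, d = Finsupp.single i (r : ℕ) then (1 : ℚ) else 0)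
      split_ifs <;> simp
  exact RingHom.congr_fun h f

/-- The monomial functions have rational coefficients in the power sums, independent of the field,
hence specialize without denominators in `q` and `t`. -/
theorem mono_eq_map (lam : YoungDiagram) :
    mono k lam = MvPolynomial.map (Rat.castHom k) (mono ℚ lam) := by
  refine fock_ext fun mu => ?_
  have h : mcoeff mu (MvPolynomial.map (Rat.castHom k) (mono ℚ lam)) =
      Rat.castHom k (mcoeff mu (mono ℚ lam)) := by
    change MvPowerSeries.coeff (expo mu) (toSymFun k _ : MvPowerSeries ℕ k) = _
    rw [coe_toSymFun_map, MvPowerSeries.coeff_map]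
    rfl
  rw [h, mcoeff_mono, mcoeff_mono]
  split_ifs <;> simp

theorem schurPoly_one_eq_map (lam : YoungDiagram) :
    schurPoly (1 : ℕ → k) lam = MvPolynomial.map (Rat.castHom k) (schurPoly 1 lam) := by
  refine (toSymFun k).injective ?_
  rw [toSymFun_schurPoly_one]
  apply Subtype.ext
  rw [coe_toSymFun_map, toSymFun_schurPoly_one]
  have hc : ∀ r : ℤ, (MvPowerSeries.map (Rat.castHom k)) (completeSymm r : SymFun ℚ).1 =
      (completeSymm r : SymFun k).1 := by
    intro r
    ext d
    rw [MvPowerSeries.coeff_map]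
    change Rat.castHom k (if (d.degree : ℤ) = r then (1 : ℚ) else 0) =
      if (d.degree : ℤ) = r then (1 : k) else 0
    split_ifs <;> simp
  change (SymFun k).val (schur lam) = (MvPowerSeries.map (Rat.castHom k)) ((SymFun ℚ).val (schur lam))
  rw [schur, schur, AlgHom.map_det, AlgHom.map_det, RingHom.map_det]
  congr 1
  refine Matrix.ext fun i j => ?_
  exact (hc _).symm

end

/-- Coefficientwise specialization of symmetric functions. -/
def Specializes (q t : ℝ) (f : Fock Qqt) (g : Fock ℝ) : Prop :=
  ∀ d, HasRealValueAt q t (f.coeff d) (g.coeff d)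

section

variable {q t : ℝ}

theorem specializes_map (q t : ℝ) (f : Fock ℚ) : Specializes q t
    (MvPolynomial.map (Rat.castHom Qqt) f) (MvPolynomial.map (Rat.castHom ℝ) f) := by
  intro d
  rw [MvPolynomial.coeff_map, MvPolynomial.coeff_map]
  exact HasRealValueAt.ratCast q t _

theorem specializes_mono (q t : ℝ) (lam : YoungDiagram) :
    Specializes q t (mono Qqt lam) (mono ℝ lam) := by
  rw [mono_eq_map, mono_eq_map (k := ℝ)]
  exact specializes_map q t _

theorem hasRealValueAt_pairing {zeta : ℕ → Qqt} {zeta' : ℕ → ℝ}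
    (hz : ∀ n, 0 < n → HasRealValueAt q t (zeta n) (zeta' n)) {f g : Fock Qqt} {f' g' : Fock ℝ}
    (hf : Specializes q t f f') (hg : Specializes q t g g') :
    HasRealValueAt q t (pairing zeta f g) (pairing zeta' f' g') := by
  rw [pairing_eq_sum zeta f g (f.support ∪ f'.support) Finset.subset_union_left,
    pairing_eq_sum zeta' f' g' (f.support ∪ f'.support) Finset.subset_union_right]
  refine HasRealValueAt.sum _ fun d _ => HasRealValueAt.mul ?_ ((hf d).mul (hg d))
  exact HasRealValueAt.prod _ fun n _ => ((((HasRealValueAt.natCast q t _).mul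
    (hz n n.pos)).pow _).mul (HasRealValueAt.natCast q t _))

theorem pow_ne_one_of_lt_one {x : ℝ} (h0 : 0 < x) (h1 : x < 1) (n : ℕ) (hn : 0 < n) : x ^ n ≠ 1 :=
  (pow_lt_one₀ h0.le h1 hn.ne').ne

theorem zetaQT_pos (hq0 : 0 < q) (hq1 : q < 1) (ht0 : 0 < t) (ht1 : t < 1) (n : ℕ) (hn : 0 < n) :
    0 < zetaQT q t n :=
  div_pos (sub_pos.mpr (pow_lt_one₀ hq0.le hq1 hn.ne')) (sub_pos.mpr (pow_lt_one₀ ht0.le ht1 hn.ne'))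

theorem zWeight_pos {zeta : ℕ → ℝ} (hz : ∀ n, 0 < n → 0 < zeta n) (d : ℕ+ →₀ ℕ) :
    0 < zWeight zeta d :=
  Finset.prod_pos fun n _ => mul_pos (pow_pos (mul_pos (Nat.cast_pos.mpr n.pos) (hz n n.pos)) _)
    (Nat.cast_pos.mpr (Nat.factorial_pos _))

theorem pairing_self_pos {zeta : ℕ → ℝ} (hz : ∀ n, 0 < n → 0 < zeta n) {f : Fock ℝ} (hf : f ≠ 0) :
    0 < pairing zeta f f := by
  rw [pairing_eq_sum zeta f f f.support subset_rfl]
  obtain ⟨d, hd⟩ := MvPolynomial.ne_zero_iff.mp hf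
  refine Finset.sum_pos' (fun e _ => mul_nonneg (zWeight_pos hz e).le (mul_self_nonneg _))
    ⟨d, MvPolynomial.mem_support_iff.mpr hd, mul_pos (zWeight_pos hz d) ?_⟩
  exact lt_of_le_of_ne (mul_self_nonneg _) (mul_self_ne_zero.mpr hd).symm

/-- For `0 < q, t < 1` all weights are positive, so the form is positive definite; a kernel vector
of the Gram matrix would give a null vector. -/
theorem nondeg_real (hq0 : 0 < q) (hq1 : q < 1) (ht0 : 0 < t) (ht1 : t < 1) : Nondeg q t := by
  intro lam hdet
  obtain ⟨v, hv, h⟩ := Matrix.exists_mulVec_eq_zero_iff.mpr hdet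
  let g : Fock ℝ := ∑ mu, v mu • mono ℝ (mu : YoungDiagram)
  have hc : ∀ nu : below lam, mcoeff (nu : YoungDiagram) g = v nu := by
    intro nu
    simp only [g, map_sum, map_smul, mcoeff_mono, smul_eq_mul, mul_ite, mul_one, mul_zero]
    rw [Finset.sum_eq_single nu, if_pos rfl]
    · intro mu _ hne
      rw [if_neg fun h => hne (Subtype.ext h.symm)]
    · simp
  have h1 : pairing (zetaQT q t) g g = 0 := by
    have h2 : ∀ mu : below lam, pairing (zetaQT q t) (mono ℝ (mu : YoungDiagram)) g = 0 := by
      intro mu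
      have := congrFun h mu
      simp only [g, map_sum, map_smul, smul_eq_mul]
      rw [Matrix.mulVec, dotProduct, Pi.zero_apply] at this
      rw [← this]
      exact Finset.sum_congr rfl fun nu _ => mul_comm _ _
    conv_lhs => enter [1]; rw [show g = ∑ mu, v mu • mono ℝ (mu : YoungDiagram) from rfl, map_sum]
    rw [LinearMap.sum_apply]
    exact Finset.sum_eq_zero fun mu _ => by rw [LinearMap.map_smul₂, h2, smul_zero]
  have hg : g = 0 := by
    by_contra hne
    exact (pairing_self_pos (zetaQT_pos hq0 hq1 ht0 ht1) hne).ne' h1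
  refine hv (funext fun mu => ?_)
  rw [← hc mu, hg, map_zero]
  rfl

theorem hasRealValueAt_zetaQT (q : ℝ) (ht0 : 0 < t) (ht1 : t < 1) (n : ℕ) (hn : 0 < n) :
    HasRealValueAt q t (zetaQT qInd tInd n) (zetaQT q t n) :=
  ((HasRealValueAt.one q t).sub ((HasRealValueAt.qInd q t).pow n)).div
    ((HasRealValueAt.one q t).sub ((HasRealValueAt.tInd q t).pow n))
    (sub_ne_zero.mpr (pow_ne_one_of_lt_one ht0 ht1 n hn).symm)

theorem hasRealValueAt_gram (q : ℝ) (ht0 : 0 < t) (ht1 : t < 1) (lam : YoungDiagram)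
    (mu nu : below lam) :
    HasRealValueAt q t (gram qInd tInd lam mu nu) (gram q t lam mu nu) :=
  hasRealValueAt_pairing (hasRealValueAt_zetaQT q ht0 ht1) (specializes_mono q t _)
    (specializes_mono q t _)

/-- A determinant vanishing identically would vanish at `q = t = 1/2`, where the form is positive
definite. -/
theorem nondeg_generic : Nondeg qInd tInd := by
  intro lam h
  have h1 := HasRealValueAt.det
    (hasRealValueAt_gram (1 / 2) (t := 1 / 2) (by norm_num) (by norm_num) lam)
  rw [h] at h1
  exact nondeg_real (by norm_num) (by norm_num) (by norm_num) (by norm_num) lam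
    (h1.unique (HasRealValueAt.zero _ _))

/-- Cramer's rule: the only denominator beyond those of the weights is the Gram determinant, which
is nonzero at these parameters. -/
theorem hasRealValueAt_macVec (hq0 : 0 < q) (hq1 : q < 1) (ht0 : 0 < t) (ht1 : t < 1)
    (lam : YoungDiagram) (mu : below lam) :
    HasRealValueAt q t (macVec qInd tInd lam mu) (macVec q t lam mu) := by
  refine HasRealValueAt.neg ?_
  rw [Matrix.mulVec, Matrix.mulVec, dotProduct, dotProduct]
  refine HasRealValueAt.sum _ fun nu _ => HasRealValueAt.mul ?_
    (hasRealValueAt_pairing (hasRealValueAt_zetaQT q ht0 ht1) (specializes_mono q t _)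
      (specializes_mono q t _))
  rw [Matrix.inv_def, Matrix.inv_def, Matrix.smul_apply, Matrix.smul_apply, Ring.inverse_eq_inv',
    Ring.inverse_eq_inv', smul_eq_mul, smul_eq_mul, Matrix.adjugate_apply, Matrix.adjugate_apply]
  have hg := hasRealValueAt_gram q ht0 ht1 lam
  refine ((HasRealValueAt.det hg).inv (nondeg_real hq0 hq1 ht0 ht1 lam)).mul
    (HasRealValueAt.det fun i j => ?_)
  rw [Matrix.updateRow_apply, Matrix.updateRow_apply]
  split_ifs
  · rw [Pi.single_apply, Pi.single_apply]
    split_ifs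
    · exact HasRealValueAt.one q t
    · exact HasRealValueAt.zero q t
  · exact hg i j

theorem specializes_macFun (hq0 : 0 < q) (hq1 : q < 1) (ht0 : 0 < t) (ht1 : t < 1)
    (lam : YoungDiagram) : Specializes q t (macFun qInd tInd lam) (macFun q t lam) := by
  intro d
  rw [macFun, macFun, MvPolynomial.coeff_add, MvPolynomial.coeff_add, MvPolynomial.coeff_sum,
    MvPolynomial.coeff_sum]
  refine (specializes_mono q t lam d).add (HasRealValueAt.sum _ fun mu _ => ?_)
  rw [MvPolynomial.coeff_smul, MvPolynomial.coeff_smul]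
  exact (hasRealValueAt_macVec hq0 hq1 ht0 ht1 lam mu).mul (specializes_mono q t mu d)

/-- In `∑ t^(n-1-i) q^(lam_i)` the power of `t` identifies the row and the power of `q` its length.
-/
theorem macEigen_generic_injective {n : ℕ} {lam mu : YoungDiagram} (hl : lam.colLen 0 ≤ n)
    (hm : mu.colLen 0 ≤ n) (h : macEigen qInd tInd n lam = macEigen qInd tInd n mu) : lam = mu := by
  let e : YoungDiagram → Fin n → Fin 2 →₀ ℕ := fun nu i =>
    Finsupp.single 1 (i.rev : ℕ) + Finsupp.single 0 (nu.rowLen i)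
  have h1 : ∀ nu, macEigen qInd tInd n nu = algebraMap (MvPolynomial (Fin 2) ℚ) Qqt
      (∑ i : Fin n, MvPolynomial.monomial (e nu i) 1) := by
    intro nu
    rw [macEigen, map_sum]
    refine Finset.sum_congr rfl fun i _ => ?_
    rw [qInd, tInd, ← map_pow, ← map_pow, ← map_mul, MvPolynomial.X_pow_eq_monomial,
      MvPolynomial.X_pow_eq_monomial, MvPolynomial.monomial_mul, one_mul]
  rw [h1, h1] at h
  have h2 := IsFractionRing.injective (MvPolynomial (Fin 2) ℚ) Qqt h
  have h0 : ∀ nu i, e nu i 1 = (i.rev : ℕ) := fun nu i => by simp [e]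
  have h0' : ∀ nu i, e nu i 0 = nu.rowLen i := fun nu i => by simp [e]
  refine diagram_ext fun i => ?_
  rcases lt_or_ge i n with hi | hi
  · have h3 := congrArg (MvPolynomial.coeff (e lam ⟨i, hi⟩)) h2
    rw [MvPolynomial.coeff_sum, MvPolynomial.coeff_sum] at h3
    simp only [MvPolynomial.coeff_monomial] at h3
    have h4 : ∀ (nu : YoungDiagram) (j : Fin n), j ≠ ⟨i, hi⟩ → ¬ e nu j = e lam ⟨i, hi⟩ := by
      intro nu j hj he
      have := DFunLike.congr_fun he 1
      rw [h0, h0] at this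
      exact hj (Fin.rev_injective (Fin.ext this))
    rw [Finset.sum_eq_single ⟨i, hi⟩ (fun j _ hj => if_neg (h4 lam j hj)) (by simp), if_pos rfl,
      Finset.sum_eq_single ⟨i, hi⟩ (fun j _ hj => if_neg (h4 mu j hj)) (by simp)] at h3
    have h5 : e mu ⟨i, hi⟩ = e lam ⟨i, hi⟩ := by
      by_contra hc
      rw [if_neg hc] at h3
      exact one_ne_zero h3
    have := DFunLike.congr_fun h5 0
    rw [h0', h0'] at this
    exact this.symm
  · rw [(rowLen_eq_zero_iff lam i).mpr (hl.trans hi), (rowLen_eq_zero_iff mu i).mpr (hm.trans hi)]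

theorem qInd_pow_ne_one (n : ℕ) (hn : 0 < n) : qInd ^ n ≠ 1 := algebraicIndependent_generic 0 n hn

theorem tInd_pow_ne_one (n : ℕ) (hn : 0 < n) : tInd ^ n ≠ 1 := algebraicIndependent_generic 1 n hn

theorem pairing_macFun_generic {lam mu : YoungDiagram} (h : lam ≠ mu) :
    pairing (zetaQT qInd tInd) (macFun qInd tInd lam) (macFun qInd tInd mu) = 0 := by
  have ht0 : tInd ≠ 0 := fun h => by
    have := (HasRealValueAt.tInd 1 1)
    rw [h] at this
    exact zero_ne_one ((HasRealValueAt.zero 1 1).unique this)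
  refine pairing_macFun_of_eigen ht0 qInd_pow_ne_one tInd_pow_ne_one nondeg_generic
    (n := max (lam.colLen 0) (mu.colLen 0)) (le_max_left _ _) (le_max_right _ _) fun he => h ?_
  exact macEigen_generic_injective (le_max_left _ _) (le_max_right _ _) he

/-- Particular real parameters may give two partitions the same eigenvalue, so the eigenvalue
argument can fail; the generic identity is specialized instead. -/
theorem pairing_macFun_real (hq0 : 0 < q) (hq1 : q < 1) (ht0 : 0 < t) (ht1 : t < 1)
    {lam mu : YoungDiagram} (h : lam ≠ mu) :
    pairing (zetaQT q t) (macFun q t lam) (macFun q t mu) = 0 := by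
  have h1 := hasRealValueAt_pairing (hasRealValueAt_zetaQT q ht0 ht1)
    (specializes_macFun hq0 hq1 ht0 ht1 lam) (specializes_macFun hq0 hq1 ht0 ht1 mu)
  rw [pairing_macFun_generic h] at h1
  exact h1.unique (HasRealValueAt.zero _ _)

theorem macdonaldP_real (hq0 : 0 < q) (hq1 : q < 1) (ht0 : 0 < t) (ht1 : t < 1)
    (lam : YoungDiagram) : macdonaldP q t lam = toSymFun ℝ (macFun q t lam) :=
  macdonaldP_eq (nondeg_real hq0 hq1 ht0 ht1)
    (fun _ _ h => pairing_macFun_real hq0 hq1 ht0 ht1 h) lam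

theorem hasRealValueAt_hookFactor (q t : ℝ) (mu : YoungDiagram) :
    HasRealValueAt q t (hookFactor qInd tInd mu) (hookFactor q t mu) :=
  HasRealValueAt.prod _ fun _ _ => (HasRealValueAt.one q t).sub
    (((HasRealValueAt.qInd q t).pow _).mul ((HasRealValueAt.tInd q t).pow _))

/-- The value of a Kostka function at real parameters. -/
theorem hasRealValueAt_kostka (hq0 : 0 < q) (hq1 : q < 1) (ht0 : 0 < t) (ht1 : t < 1)
    (lam mu : YoungDiagram) :
    HasRealValueAt q t (kostka qInd tInd lam mu) (hookFactor q t mu *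
      schurFunctional lam (toSymFun ℝ (scale (zetaT t) (macFun q t mu)))) := by
  have hz : ∀ n, 0 < n → zetaT t n ≠ 0 := fun n hn =>
    inv_ne_zero (sub_ne_zero.mpr (pow_ne_one_of_lt_one ht0 ht1 n hn).symm)
  rw [kostka_eq_scalarProduct tInd_pow_ne_one, macdonaldM, LinearMap.map_smul₂, smul_eq_mul,
    macdonaldP_eq nondeg_generic (fun _ _ h => pairing_macFun_generic h),
    ← toSymFun_schurPoly_one, scalarProduct_toSymFun,
    pairing_congr (zeta' := zetaT tInd) (fun n hn => zetaQT_zero tInd hn), pairing_comm]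
  have h1 := pairing_schurPoly (zetaT t) 1 hz lam (macFun q t mu)
  rw [mul_one] at h1
  rw [← h1]
  refine (hasRealValueAt_hookFactor q t mu).mul (hasRealValueAt_pairing (fun n hn => ?_) ?_
    (specializes_macFun hq0 hq1 ht0 ht1 mu))
  · exact ((HasRealValueAt.one q t).sub ((HasRealValueAt.tInd q t).pow n)).inv
      (sub_ne_zero.mpr (pow_ne_one_of_lt_one ht0 ht1 n hn).symm)
  · rw [schurPoly_one_eq_map, schurPoly_one_eq_map (k := ℝ)]
    exact specializes_map q t _

end

end Macdonald


/-! ### Duality of Macdonald functions, and multiplication by full columns -/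

namespace Macdonald

/-! ### Conjugation and dominance -/

theorem rowLen_transpose (lam : YoungDiagram) (j : ℕ) : lam.transpose.rowLen j = lam.colLen j := by
  rw [YoungDiagram.rowLen_transpose]

theorem colLen_eq_sum (lam : YoungDiagram) {n : ℕ} (hn : lam.colLen 0 ≤ n) (j : ℕ) :
    lam.colLen j = ∑ i ∈ Finset.range n, if j < lam.rowLen i then 1 else 0 := by
  have h : ∀ i, j < lam.rowLen i ↔ i < lam.colLen j := fun i => by
    rw [← YoungDiagram.mem_iff_lt_rowLen, YoungDiagram.mem_iff_lt_colLen]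
  simp only [h]
  rw [← Finset.sum_filter, Finset.sum_const, smul_eq_mul, mul_one]
  have h2 := lam.colLen_anti 0 j (Nat.zero_le _)
  have : (Finset.range n).filter (fun i => i < lam.colLen j) = Finset.range (lam.colLen j) := by
    ext i
    simp only [Finset.mem_filter, Finset.mem_range]
    omega
  rw [this, Finset.card_range]

/-- The cells in the first `c` columns and the cells beyond column `c`; the subtraction is
truncated. -/
theorem sum_colLen_add (lam : YoungDiagram) {n : ℕ} (hn : lam.colLen 0 ≤ n) (c : ℕ) :
    ∑ j ∈ Finset.range c, lam.colLen j + ∑ i ∈ Finset.range n, (lam.rowLen i - c) = lam.card := by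
  have h1 : ∑ j ∈ Finset.range c, lam.colLen j = ∑ i ∈ Finset.range n, min c (lam.rowLen i) := by
    simp only [colLen_eq_sum lam hn]
    rw [Finset.sum_comm]
    refine Finset.sum_congr rfl fun i _ => ?_
    rw [← Finset.sum_filter, Finset.sum_const, smul_eq_mul, mul_one]
    have : (Finset.range c).filter (fun j => j < lam.rowLen i) =
        Finset.range (min c (lam.rowLen i)) := by
      ext j
      simp only [Finset.mem_filter, Finset.mem_range]
      omega
    rw [this, Finset.card_range]
  rw [h1, ← Finset.sum_add_distrib, ← sum_range_rowLen lam hn]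
  exact Finset.sum_congr rfl fun i _ => by omega

/-- The sum of the first `c` columns is `|lam| - ∑ max(lam_i - c, 0)`, so one has to compare the
sums of truncated differences. -/
theorem Dominates.transpose {lam mu : YoungDiagram} (h : Dominates lam mu) :
    Dominates mu.transpose lam.transpose := by
  refine ⟨by rw [card_transpose, card_transpose, h.1], fun c => ?_⟩
  simp only [rowLen_transpose]
  have h1 := sum_colLen_add lam h.colLen_le c
  have h2 := sum_colLen_add mu le_rfl c
  rw [h.1] at h1
  suffices ∑ i ∈ Finset.range (mu.colLen 0), (mu.rowLen i - c) ≤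
      ∑ i ∈ Finset.range (mu.colLen 0), (lam.rowLen i - c) by omega
  -- `r` is the number of rows of `mu` longer than `c`. On those rows the truncated differences of
  -- `mu` are true differences, and there the dominance inequality for `r` rows applies.
  set r := mu.colLen c
  have hr : r ≤ mu.colLen 0 := mu.colLen_anti 0 c (Nat.zero_le _)
  have h3 : ∀ i, c < mu.rowLen i ↔ i < r := fun i => by
    rw [← YoungDiagram.mem_iff_lt_rowLen, YoungDiagram.mem_iff_lt_colLen]
  have h4 : ∑ i ∈ Finset.range (mu.colLen 0), (mu.rowLen i - c) =
      ∑ i ∈ Finset.range r, (mu.rowLen i - c) := by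
    refine (Finset.sum_subset (Finset.range_subset_range.mpr hr) fun i _ hi => ?_).symm
    rw [Finset.mem_range, ← h3] at hi
    omega
  have h5 : ∑ i ∈ Finset.range r, (mu.rowLen i - c) + ∑ _i ∈ Finset.range r, c =
      ∑ i ∈ Finset.range r, mu.rowLen i := by
    rw [← Finset.sum_add_distrib]
    refine Finset.sum_congr rfl fun i hi => ?_
    rw [Finset.mem_range, ← h3] at hi
    omega
  have h6 : ∑ i ∈ Finset.range r, lam.rowLen i ≤
      ∑ i ∈ Finset.range r, (lam.rowLen i - c) + ∑ _i ∈ Finset.range r, c := by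
    rw [← Finset.sum_add_distrib]
    exact Finset.sum_le_sum fun i _ => by omega
  have h7 : ∑ i ∈ Finset.range r, (lam.rowLen i - c) ≤
      ∑ i ∈ Finset.range (mu.colLen 0), (lam.rowLen i - c) :=
    Finset.sum_le_sum_of_subset (Finset.range_subset_range.mpr hr)
  have h8 := h.2 r
  omega

/-! ### Unitriangular families -/

section

variable {k : Type*} [Field k] [CharZero k]

theorem Triangular.strict {f : Fock k} {lam mu : YoungDiagram} (h : Triangular f mu)
    (h' : Dominates lam mu) (hne : mu ≠ lam) : StrictTriangular f lam := fun nu hnu => by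
  refine ⟨h'.trans (h nu hnu), ?_⟩
  rintro rfl
  exact hne ((h nu hnu).antisymm h')

theorem map_strictTriangular {M : Type*} [AddCommGroup M] [Module k M] {g : Fock k}
    {lam : YoungDiagram} (hg : StrictTriangular g lam) (φ : Fock k →ₗ[k] M)
    (h : ∀ mu, Dominates lam mu → mu ≠ lam → φ (mono k mu) = 0) : φ g = 0 := by
  rw [hg.eq_sum, map_sum]
  refine Finset.sum_eq_zero fun mu _ => ?_
  have := mem_below.mp mu.2
  rw [map_smul, h _ this.1 this.2, smul_zero]

/-- By induction `φ` kills every monomial function strictly below `lam`, so it sees only the leading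
coefficient of `f`. -/
theorem map_triangular {M : Type*} [AddCommGroup M] [Module k M] {B : YoungDiagram → Fock k}
    (hB : ∀ lam, Triangular (B lam) lam) (hB1 : ∀ lam, mcoeff lam (B lam) = 1)
    (φ : Fock k →ₗ[k] M) (lam : YoungDiagram)
    (h : ∀ mu, Dominates lam mu → mu ≠ lam → φ (B mu) = 0) {f : Fock k} (hf : Triangular f lam) :
    φ f = mcoeff lam f • φ (B lam) := by
  induction lam using dominates_induction generalizing f with
  | h lam ih =>
    have h1 : ∀ mu, Dominates lam mu → mu ≠ lam → φ (mono k mu) = 0 := by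
      intro mu hmu hne
      rw [ih mu hmu hne (fun nu hnu hne' => h nu (hmu.trans hnu) fun he => hne' ?_)
        (triangular_mono mu), h mu hmu hne, smul_zero]
      subst he
      exact hnu.antisymm hmu |>.symm
    rw [← sub_eq_zero, ← map_smul, ← map_sub]
    refine map_strictTriangular (strictTriangular_sub hf (fun mu hmu => ?_) ?_) φ h1
    · rw [map_smul] at hmu
      exact hB lam mu (right_ne_zero_of_mul hmu)
    · rw [map_smul, hB1, smul_eq_mul, mul_one]

theorem map_strictTriangular_of_family {M : Type*} [AddCommGroup M] [Module k M]
    {B : YoungDiagram → Fock k}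
    (hB : ∀ lam, Triangular (B lam) lam) (hB1 : ∀ lam, mcoeff lam (B lam) = 1)
    (φ : Fock k →ₗ[k] M) (lam : YoungDiagram)
    (h : ∀ mu, Dominates lam mu → mu ≠ lam → φ (B mu) = 0) {g : Fock k}
    (hg : StrictTriangular g lam) : φ g = 0 := by
  refine map_strictTriangular hg φ fun mu hmu hne => ?_
  rw [map_triangular hB hB1 φ mu (fun nu hnu hne' => h nu (hmu.trans hnu) fun he => hne' ?_)
    (triangular_mono mu), h mu hmu hne, smul_zero]
  subst he
  exact hnu.antisymm hmu |>.symm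

theorem triangular_of_coeff {f : Fock k} {lam : YoungDiagram} {c : k}
    (h : ∀ n, lam.colLen 0 ≤ n → Bounded (restr k n f) (finRow n lam) ∧
      (restr k n f).coeff (finRow n lam) = c) : Triangular f lam ∧ mcoeff lam f = c := by
  refine ⟨triangular_of_bounded 0 fun n _ hn => (h n hn).1, ?_⟩
  rw [← coeff_restr_finRow f le_rfl, (h _ le_rfl).2]

/-! ### Elementary symmetric functions -/

/-- The weights of the generating function `∏ (1 + x_i z)`. -/
def elemWeight (k : Type*) [Field k] : ℕ → k := qWeight 0 (-1) 0

theorem elemWeight_apply {n : ℕ} (hn : 0 < n) : elemWeight k n = -(-1) ^ n := by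
  simp [elemWeight, qWeight, zero_pow hn.ne']

theorem elemWeight_mul_self {n : ℕ} (hn : 0 < n) : elemWeight k n * elemWeight k n = 1 := by
  rw [elemWeight_apply hn, neg_mul_neg, ← mul_pow]
  simp

theorem qBinom_elem (m : ℕ) : qBinom (0 : k) (-1) 0 m = if m ≤ 1 then 1 else 0 := by
  rcases m with _ | _ | m
  · simp [qBinom]
  · simp [qBinom]
  · rw [if_neg (by omega), qBinom]
    refine Finset.prod_eq_zero (i := 1) (by simp) ?_
    simp

theorem elem_newton (m : ℕ) : (m : k) * qBinom (0 : k) (-1) 0 m =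
    ∑ r ∈ Finset.range m, elemWeight k (r + 1) * qBinom (0 : k) (-1) 0 (m - (r + 1)) :=
  qBinom_newton 0 (-1) 0 (fun m => by simp) m

/-- The exponent with `m` ones. -/
noncomputable def colExp (n m : ℕ) : Fin n →₀ ℕ :=
  Finsupp.equivFunOnFinite.symm fun i => if (i : ℕ) < m then 1 else 0

theorem psum_colExp (n m r : ℕ) : psum r (colExp n m) = min (min r n) m := by
  rw [psum_eq_sum_range (colExp n m) (fun i => if i < m then 1 else 0) (fun _ => rfl),
    ← Finset.sum_filter, Finset.sum_const, smul_eq_mul, mul_one]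
  have : (Finset.range (min r n)).filter (fun i => i < m) = Finset.range (min (min r n) m) := by
    ext i
    simp only [Finset.mem_filter, Finset.mem_range]
    omega
  rw [this, Finset.card_range]

theorem psum_le_degree {n : ℕ} (d : Fin n →₀ ℕ) (r : ℕ) : psum r d ≤ psum n d := by
  refine Finset.sum_le_sum fun i _ => ?_
  rw [if_pos i.2]
  split_ifs <;> simp

theorem coeff_restr_elem {n : ℕ} (m : ℕ) (d : Fin n →₀ ℕ) :
    (restr k n (expFam (elemWeight k) m)).coeff d =
      if psum n d = m then ∏ i, (if d i ≤ 1 then 1 else 0) else 0 := by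
  rw [coeff_restr, scoeff_expFam _ _ (qBinom_zero 0 (-1) 0) elem_newton, psum_self, ← sum_parts,
    parts_embDomain, sum_parts, Finsupp.prod_embDomain,
    Finsupp.prod_fintype _ _ fun _ => qBinom_zero 0 (-1) 0]
  simp only [qBinom_elem]

/-- The exponents of `e_m` are the vectors of zeros and ones with sum `m`, and the ones placed first
give the largest partial sums. -/
theorem bounded_elem {n m : ℕ} (hm : m ≤ n) :
    Bounded (restr k n (expFam (elemWeight k) m)) (colExp n m) ∧
      (restr k n (expFam (elemWeight k) m)).coeff (colExp n m) = 1 := by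
  refine ⟨fun d hd => ?_, ?_⟩
  · rw [coeff_restr_elem] at hd
    by_cases h : psum n d = m
    · rw [if_pos h, Finset.prod_ne_zero_iff] at hd
      have hd1 : ∀ i, d i ≤ 1 := fun i => by
        by_contra hc
        exact hd i (Finset.mem_univ i) (if_neg hc)
      refine ⟨fun r => ?_, by rw [psum_colExp, h]; omega⟩
      rw [psum_colExp]
      refine le_min ?_ ((psum_le_degree d r).trans h.le)
      have h2 : psum r d ≤ psum r (colExp n n) := Finset.sum_le_sum fun i _ => by
        have : colExp n n i = 1 := if_pos i.2
        rw [this]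
        split_ifs
        · exact hd1 i
        · exact le_rfl
      rw [psum_colExp] at h2
      omega
    · exact absurd (if_neg h) hd
  · rw [coeff_restr_elem, psum_colExp, if_pos (by omega)]
    refine Finset.prod_eq_one fun i _ => if_pos ?_
    change (if (i : ℕ) < m then 1 else 0) ≤ 1
    split_ifs <;> omega

variable (k) in
/-- The product of the elementary symmetric functions indexed by the columns of a diagram. -/
noncomputable def elemProd (lam : YoungDiagram) : Fock k :=
  expProd (elemWeight k) (expo lam.transpose)

theorem elemProd_eq (lam : YoungDiagram) :
    elemProd k lam = ∏ j ∈ Finset.range (lam.rowLen 0), expFam (elemWeight k) (lam.colLen j) := by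
  rw [elemProd, expProd_eq _ _ (Finset.range (lam.rowLen 0))]
  · refine Finset.prod_congr rfl fun j _ => ?_
    rw [expo_apply, rowLen_transpose]
  · rw [support_expo, YoungDiagram.colLen_transpose]

/-- The leading exponent of a product is the sum of the leading exponents; columns of ones of the
lengths of the columns of `lam` add up to its rows. -/
theorem elemProd_spec (lam : YoungDiagram) :
    Triangular (elemProd k lam) lam ∧ mcoeff lam (elemProd k lam) = 1 := by
  refine triangular_of_coeff fun n hn => ?_
  have hcol : ∀ j, lam.colLen j ≤ n := fun j => (lam.colLen_anti 0 j (Nat.zero_le _)).trans hn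
  have h := Bounded.prod (k := k) (Finset.range (lam.rowLen 0))
    (p := fun j => restr k n (expFam (elemWeight k) (lam.colLen j)))
    (D := fun j => colExp n (lam.colLen j)) fun j _ => (bounded_elem (hcol j)).1
  have hD : ∑ j ∈ Finset.range (lam.rowLen 0), colExp n (lam.colLen j) = finRow n lam := by
    ext i
    rw [Finsupp.finsetSum_apply, finRow_apply]
    change ∑ j ∈ Finset.range (lam.rowLen 0), (if (i : ℕ) < lam.colLen j then 1 else 0) = _
    have h2 := colLen_eq_sum lam.transpose (n := lam.rowLen 0)
      (by rw [YoungDiagram.colLen_transpose]) i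
    rw [YoungDiagram.colLen_transpose] at h2
    rw [h2]
    exact Finset.sum_congr rfl fun j _ => by rw [rowLen_transpose]
  rw [hD] at h
  rw [elemProd_eq, map_prod]
  refine ⟨h.1, h.2.trans (Finset.prod_eq_one fun j _ => (bounded_elem (hcol j)).2)⟩

theorem scale_expFam (u w : ℕ → k) (m : ℕ) : scale u (expFam w m) = expFam (u * w) m := by
  ext d
  rw [coeff_scale, coeff_expFam, coeff_expFam, mul_ite, mul_zero]
  refine if_congr Iff.rfl ?_ rfl
  rw [expCoeff, expCoeff, Finsupp.prod, Finsupp.prod, Finsupp.prod, ← Finset.prod_mul_distrib]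
  refine Finset.prod_congr rfl fun n _ => ?_
  rw [Pi.mul_apply, mul_div_assoc (u n), mul_pow, mul_div_assoc]

theorem expFam_congr {w w' : ℕ → k} (h : ∀ n, 0 < n → w n = w' n) (m : ℕ) :
    expFam w m = expFam w' m := by
  ext d
  rw [coeff_expFam, coeff_expFam]
  refine if_congr Iff.rfl ?_ rfl
  exact Finset.prod_congr rfl fun n _ => by simp only [h n n.pos]

theorem scale_elemProd (lam : YoungDiagram) :
    scale (elemWeight k) (elemProd k lam) = expProd 1 (expo lam.transpose) := by
  rw [elemProd, expProd, expProd, Finsupp.prod, Finsupp.prod, map_prod]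
  refine Finset.prod_congr rfl fun j _ => ?_
  rw [scale_expFam]
  exact expFam_congr (fun n hn => elemWeight_mul_self hn) _

/-- The weights `(-1)^(n-1)` turn elementary into complete functions, and for the form with all
weights `1` the products of complete functions are dual to the monomial functions. -/
theorem pairing_elemWeight_elemProd (lam : YoungDiagram) (g : Fock k) :
    pairing (elemWeight k) (elemProd k lam) g = mcoeff lam.transpose g := by
  have h1 := pairing_scale (1 : ℕ → k) (elemWeight k) (elemProd k lam) g
  rw [one_mul] at h1
  rw [← h1, scale_elemProd, pairing_expProd _ _ (fun n _ => by simp), one_mul]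
  rw [scale_one]
  rfl

end

/-! ### Duality -/

section

variable {q t : ℝ}

/-- The weights of the duality map from parameters `(t, q)` to parameters `(q, t)`. -/
noncomputable def dualWeight (q t : ℝ) : ℕ → ℝ := elemWeight ℝ * zetaQT t q

theorem zetaQT_mul_swap (hq0 : 0 < q) (hq1 : q < 1) (ht0 : 0 < t) (ht1 : t < 1) {n : ℕ}
    (hn : 0 < n) : zetaQT q t n * zetaQT t q n = 1 := by
  have h1 := sub_ne_zero.mpr (pow_ne_one_of_lt_one hq0 hq1 n hn).symm
  have h2 := sub_ne_zero.mpr (pow_ne_one_of_lt_one ht0 ht1 n hn).symm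
  rw [zetaQT, zetaQT]
  field_simp

/-- The weights `(1-q^n)/(1-t^n)` and `(1-t^n)/(1-q^n)` cancel, leaving a form independent of `q`
and `t`. -/
theorem pairing_scale_dualWeight (hq0 : 0 < q) (hq1 : q < 1) (ht0 : 0 < t) (ht1 : t < 1)
    (f g : Fock ℝ) :
    pairing (zetaQT q t) (scale (dualWeight q t) f) g = pairing (elemWeight ℝ) f g := by
  rw [pairing_scale]
  refine pairing_congr (fun n hn => ?_) f g
  have := zetaQT_mul_swap hq0 hq1 ht0 ht1 hn
  simp only [Pi.mul_apply, dualWeight]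
  linear_combination elemWeight ℝ n * this

theorem pairing_scale_dualWeight_scale (hq0 : 0 < q) (hq1 : q < 1) (ht0 : 0 < t) (ht1 : t < 1)
    (f g : Fock ℝ) : pairing (zetaQT q t) (scale (dualWeight q t) f) (scale (dualWeight q t) g) =
      pairing (zetaQT t q) f g := by
  rw [pairing_scale_dualWeight hq0 hq1 ht0 ht1, pairing_comm, pairing_scale, pairing_comm]
  refine pairing_congr (fun n hn => ?_) f g
  have := elemWeight_mul_self (k := ℝ) hn
  simp only [Pi.mul_apply, dualWeight]
  linear_combination zetaQT t q n * this

/-- Expand the first function in products of elementary functions indexed by `nu ≤ mu`. Each of them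
extracts the coefficient of `nu'` in the second function, and `nu' ≥ mu'` because transposition
reverses dominance. -/
theorem dominates_of_pairing_ne_zero {lam mu : YoungDiagram}
    (h : pairing (elemWeight ℝ) (macFun t q mu) (macFun q t lam) ≠ 0) :
    Dominates lam mu.transpose := by
  by_contra hc
  refine h ?_
  have h1 : ∀ nu, Dominates mu nu → pairing (elemWeight ℝ) (elemProd ℝ nu) (macFun q t lam) = 0 := by
    intro nu hnu
    rw [pairing_elemWeight_elemProd]
    by_contra h0
    exact hc ((triangular_macFun q t lam _ h0).trans hnu.transpose)
  have h2 := map_triangular (fun lam => (elemProd_spec (k := ℝ) lam).1)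
    (fun lam => (elemProd_spec lam).2) (LinearMap.flip (pairing (elemWeight ℝ)) (macFun q t lam)) mu
    (fun nu hnu _ => h1 nu hnu) (triangular_macFun t q mu)
  rw [LinearMap.flip_apply, LinearMap.flip_apply, h1 mu (Dominates.refl _), smul_zero] at h2
  exact h2

/-- In the same expansion only the leading term meets the leading term; both coefficients are `1`.
-/
theorem pairing_elemWeight_macFun (mu : YoungDiagram) :
    pairing (elemWeight ℝ) (macFun t q mu) (macFun q t mu.transpose) = 1 := by
  have h2 := map_triangular (fun lam => (elemProd_spec (k := ℝ) lam).1)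
    (fun lam => (elemProd_spec lam).2)
    (LinearMap.flip (pairing (elemWeight ℝ)) (macFun q t mu.transpose)) mu
    (fun nu hnu hne => ?_) (triangular_macFun t q mu)
  · rw [LinearMap.flip_apply, LinearMap.flip_apply, pairing_elemWeight_elemProd,
      mcoeff_macFun_self, mcoeff_macFun_self, one_smul] at h2
    exact h2
  · rw [LinearMap.flip_apply, pairing_elemWeight_elemProd]
    by_contra h0
    have h1 := (triangular_macFun q t _ _ h0).antisymm hnu.transpose
    exact hne (YoungDiagram.transpose_eq_iff.mp h1).symm

/-- The norm of a Macdonald function. -/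
noncomputable def macNorm (q t : ℝ) (lam : YoungDiagram) : ℝ :=
  pairing (zetaQT q t) (macFun q t lam) (macFun q t lam)

theorem macFun_ne_zero (q t : ℝ) (lam : YoungDiagram) : macFun q t lam ≠ 0 := by
  intro h
  have := mcoeff_macFun_self q t lam
  rw [h, map_zero] at this
  exact zero_ne_one this

theorem macNorm_pos (hq0 : 0 < q) (hq1 : q < 1) (ht0 : 0 < t) (ht1 : t < 1) (lam : YoungDiagram) :
    0 < macNorm q t lam :=
  pairing_self_pos (zetaQT_pos hq0 hq1 ht0 ht1) (macFun_ne_zero q t lam)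

theorem eq_zero_of_pairing_macFun (hq0 : 0 < q) (hq1 : q < 1) (ht0 : 0 < t) (ht1 : t < 1)
    {g : Fock ℝ} (h : ∀ lam, pairing (zetaQT q t) g (macFun q t lam) = 0) : g = 0 := by
  have h1 : ∀ lam, pairing (zetaQT q t) g (mono ℝ lam) = 0 := by
    intro lam
    rw [map_triangular (triangular_macFun q t) (mcoeff_macFun_self q t) (pairing (zetaQT q t) g) lam
      (fun mu _ _ => h mu) (triangular_mono lam), h, smul_zero]
  by_contra hne
  refine (pairing_self_pos (zetaQT_pos hq0 hq1 ht0 ht1) hne).ne' ?_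
  let s : Finset YoungDiagram := (scoeff_expo_finite (toSymFun ℝ g)).toFinset
  have hs := eq_sum_mono g s fun mu hmu => by
    rw [Set.Finite.mem_toFinset]
    exact hmu
  conv_lhs => enter [2]; rw [hs]
  rw [map_sum]
  exact Finset.sum_eq_zero fun mu _ => by rw [map_smul, h1, smul_zero]

/-- Duality of Macdonald functions. -/
theorem scale_dualWeight_macFun (hq0 : 0 < q) (hq1 : q < 1) (ht0 : 0 < t) (ht1 : t < 1)
    (mu : YoungDiagram) : scale (dualWeight q t) (macFun t q mu) =
      macNorm t q mu • macFun q t mu.transpose := by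
  induction mu using dominates_induction with
  | h mu ih =>
    set g := scale (dualWeight q t) (macFun t q mu) with hg
    -- A nonzero pairing forces `lam'` to lie strictly below `mu`. There the inductive hypothesis
    -- identifies `P_lam(q,t)`, up to its norm, with the image of `P_{lam'}(t,q)`, which is
    -- orthogonal to `g` because the duality map is an isometry.
    have horth : ∀ lam, lam ≠ mu.transpose → pairing (zetaQT q t) g (macFun q t lam) = 0 := by
      intro lam hne
      by_contra h0
      have h1 : Dominates lam mu.transpose := by
        rw [hg, pairing_scale_dualWeight hq0 hq1 ht0 ht1] at h0
        exact dominates_of_pairing_ne_zero h0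
      have h2 := h1.transpose
      rw [YoungDiagram.transpose_transpose] at h2
      have hne' : lam.transpose ≠ mu := by
        rintro rfl
        exact hne (YoungDiagram.transpose_transpose lam).symm
      have h3 := ih lam.transpose h2 hne'
      rw [YoungDiagram.transpose_transpose] at h3
      have h4 : pairing (zetaQT q t) g (scale (dualWeight q t) (macFun t q lam.transpose)) = 0 := by
        rw [hg, pairing_scale_dualWeight_scale hq0 hq1 ht0 ht1,
          pairing_macFun_real ht0 ht1 hq0 hq1 hne'.symm]
      rw [h3, map_smul, smul_eq_mul] at h4
      exact h0 ((mul_eq_zero.mp h4).resolve_left (macNorm_pos ht0 ht1 hq0 hq1 _).ne')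
    have h1 : pairing (zetaQT q t) g (macFun q t mu.transpose) = 1 := by
      rw [hg, pairing_scale_dualWeight hq0 hq1 ht0 ht1, pairing_elemWeight_macFun]
    have hN := macNorm_pos hq0 hq1 ht0 ht1 mu.transpose
    have h2 : g = (macNorm q t mu.transpose)⁻¹ • macFun q t mu.transpose := by
      rw [← sub_eq_zero]
      refine eq_zero_of_pairing_macFun hq0 hq1 ht0 ht1 fun lam => ?_
      rw [map_sub, LinearMap.sub_apply, LinearMap.map_smul₂]
      by_cases h : lam = mu.transpose
      · subst h
        rw [h1, smul_eq_mul, ← macNorm, inv_mul_cancel₀ hN.ne', sub_self]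
      · rw [horth lam h, pairing_macFun_real hq0 hq1 ht0 ht1 (Ne.symm h), smul_zero, sub_zero]
    -- The isometry computes `⟨g, g⟩` on both sides, which shows that the two norms are inverse to
    -- each other.
    have h3 : macNorm t q mu = (macNorm q t mu.transpose)⁻¹ := by
      rw [macNorm, ← pairing_scale_dualWeight_scale hq0 hq1 ht0 ht1, ← hg]
      conv_lhs => enter [2]; rw [h2]
      rw [map_smul, h1, smul_eq_mul, mul_one]
    rw [h3, h2]

/-- The weights of `(-x z;t)_∞` are `(-1)^(n-1) / (1 - t^n)`, so this rescaling is the duality map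
followed by `p_n ↦ p_n / (1 - t^n)`. -/
theorem scale_neg_macFun (hq0 : 0 < q) (hq1 : q < 1) (ht0 : 0 < t) (ht1 : t < 1)
    (mu : YoungDiagram) :
    scale (fun n => qWeight 0 (-1) t n * zetaQT t q n) (macFun t q mu) =
      macNorm t q mu • scale (zetaT t) (macFun q t mu.transpose) := by
  rw [← map_smul, ← scale_dualWeight_macFun hq0 hq1 ht0 ht1, scale_scale]
  refine scale_congr (fun n hn => ?_) _
  rw [Pi.mul_apply, dualWeight, Pi.mul_apply, elemWeight_apply hn, zetaT, qWeight,
    zero_pow hn.ne', zero_sub]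
  ring

end

/-! ### Adding full columns -/

section

variable {k : Type*} [Field k] [CharZero k]

/-- The top coefficient of `∏ (1 + x_j z)`. -/
theorem restr_elem_eq (n : ℕ) : restr k n (expFam (elemWeight k) n) = ∏ i, MvPolynomial.X i := by
  rw [restr, ev_expFam _ _ (qBinom_zero 0 (-1) 0) elem_newton]
  have h : ∀ j : Fin n, (PowerSeries.mk fun a => algebraMap k (MvPolynomial (Fin n) k)
      (qBinom 0 (-1) 0 a) * MvPolynomial.X j ^ a) =
      1 + PowerSeries.X * PowerSeries.C (MvPolynomial.X j) := by
    intro j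
    ext a : 1
    rw [PowerSeries.coeff_mk, qBinom_elem]
    rcases a with _ | _ | a
    · simp
    · simp
    · rw [if_neg (by omega), map_add, PowerSeries.coeff_succ_X_mul, PowerSeries.coeff_C,
        if_neg (by omega), PowerSeries.coeff_one, if_neg (by omega)]
      simp
  simp only [h]
  have key : ∀ s : Finset (Fin n), PowerSeries.coeff s.card
      (∏ j ∈ s, (1 + PowerSeries.X * PowerSeries.C (MvPolynomial.X j)) :
        PowerSeries (MvPolynomial (Fin n) k)) = ∏ j ∈ s, MvPolynomial.X j ∧
      ∀ m, s.card < m → PowerSeries.coeff m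
      (∏ j ∈ s, (1 + PowerSeries.X * PowerSeries.C (MvPolynomial.X j)) :
        PowerSeries (MvPolynomial (Fin n) k)) = 0 := by
    intro s
    induction s using Finset.induction_on with
    | empty =>
      refine ⟨by simp, fun m hm => ?_⟩
      rw [Finset.prod_empty, PowerSeries.coeff_one, if_neg]
      simp at hm; omega
    | insert i s hi ih =>
      rw [Finset.prod_insert hi, Finset.card_insert_of_notMem hi, Finset.prod_insert hi, add_mul,
        one_mul, mul_assoc]
      refine ⟨?_, fun m hm => ?_⟩
      · rw [map_add, ih.2 _ (Nat.lt_succ_self _), PowerSeries.coeff_succ_X_mul,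
          PowerSeries.coeff_C_mul, ih.1, zero_add]
      · obtain ⟨m, rfl⟩ : ∃ m', m = m' + 1 := ⟨m - 1, by omega⟩
        rw [map_add, ih.2 _ (by omega), PowerSeries.coeff_succ_X_mul, PowerSeries.coeff_C_mul,
          ih.2 _ (by omega), mul_zero, zero_add]
  have := (key Finset.univ).1
  rwa [Finset.card_univ, Fintype.card_fin] at this

theorem ev_elem {S : Type*} [CommRing S] [Algebra k S] {n : ℕ} (x : Fin n → S) :
    ev x (expFam (elemWeight k) n) = ∏ i, x i := by
  rw [ev_eq_aeval, restr_elem_eq, map_prod]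
  simp

/-- Each factor `e_n` has leading exponent one in the first `n` variables, and leading exponents add
under multiplication. -/
theorem elem_pow_mul_triangular {n s : ℕ} {f : Fock k} {lam mu : YoungDiagram}
    (hmu : ∀ i, mu.rowLen i = lam.rowLen i + if i < n then s else 0) (hf : Triangular f lam) :
    Triangular (expFam (elemWeight k) n ^ s * f) mu ∧
      mcoeff mu (expFam (elemWeight k) n ^ s * f) = mcoeff lam f := by
  refine triangular_of_coeff fun N hN => ?_
  have hle : ∀ i, lam.rowLen i ≤ mu.rowLen i := fun i => by rw [hmu]; omega
  have hl : lam.colLen 0 ≤ N := by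
    rw [← rowLen_eq_zero_iff] at hN ⊢
    exact Nat.le_zero.mp (hN ▸ hle N)
  rcases Nat.eq_zero_or_pos s with rfl | hs
  · have : mu = lam := diagram_ext fun i => by simp [hmu]
    subst this
    rw [pow_zero, one_mul]
    exact ⟨hf.bounded hN, coeff_restr_finRow f hN⟩
  have hnN : n ≤ N := by
    by_contra hc
    have := (rowLen_eq_zero_iff mu N).mpr hN
    rw [hmu, if_pos (by omega)] at this
    omega
  have h1 := Bounded.prod (k := k) (Finset.range s)
    (p := fun _ => restr k N (expFam (elemWeight k) n)) (D := fun _ => colExp N n)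
    fun _ _ => (bounded_elem hnN).1
  simp only [Finset.prod_const, (bounded_elem hnN).2, one_pow, Finset.card_range,
    Finset.sum_const] at h1
  have hD : finRow N mu = s • colExp N n + finRow N lam := by
    ext i
    rw [Finsupp.add_apply, Finsupp.smul_apply, finRow_apply, finRow_apply, hmu, add_comm]
    congr 1
    change _ = s • (if (i : ℕ) < n then 1 else 0)
    split_ifs <;> simp
  rw [map_mul, map_pow, hD]
  refine ⟨h1.1.mul (hf.bounded hl), ?_⟩
  rw [h1.1.coeff_mul (hf.bounded hl), h1.2, one_mul, coeff_restr_finRow f hl]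

theorem restr_mono_eq_zero {n : ℕ} {lam : YoungDiagram} (h : n < lam.colLen 0) :
    restr k n (mono k lam) = 0 := by
  ext d
  obtain ⟨nu, -, hnu, hc⟩ := exists_coeff_restr (mono k lam) d
  rw [hc, mcoeff_mono, if_neg, MvPolynomial.coeff_zero]
  rintro rfl
  omega

theorem restr_eq_zero_of_triangular {n : ℕ} {f : Fock k} {lam : YoungDiagram}
    (hf : Triangular f lam) (h : n < lam.colLen 0) : restr k n f = 0 := by
  ext d
  obtain ⟨nu, -, hnu, hc⟩ := exists_coeff_restr f d
  rw [hc, MvPolynomial.coeff_zero]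
  by_contra h0
  have := (hf nu h0).colLen_le
  omega

end

end Macdonald


/-! ### Infinite products, the `q`-binomial theorem, and averages over tori -/

namespace Macdonald

/-! ### Infinite products -/

section

open Filter Topology

variable {q : ℂ}

theorem summable_norm_mul_pow (hq : ‖q‖ < 1) (a : ℂ) : Summable fun m : ℕ => ‖-(a * q ^ m)‖ := by
  have h := (summable_geometric_of_lt_one (norm_nonneg q) hq).mul_left ‖a‖
  simpa using h

theorem multipliable_qPoch (hq : ‖q‖ < 1) (a : ℂ) : Multipliable fun m : ℕ => 1 - a * q ^ m := by
  simpa [sub_eq_add_neg] using multipliable_one_add_of_summable (summable_norm_mul_pow hq a)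

theorem tendsto_qPoch (hq : ‖q‖ < 1) (a : ℂ) :
    Tendsto (fun N => ∏ m ∈ Finset.range N, (1 - a * q ^ m)) atTop (𝓝 (qPoch a q)) :=
  (multipliable_qPoch hq a).hasProd.tendsto_prod_nat

theorem qPoch_eq (hq : ‖q‖ < 1) (a : ℂ) : qPoch a q = (1 - a) * qPoch (a * q) q := by
  have h1 := (tendsto_qPoch hq (a * q)).const_mul (1 - a)
  refine tendsto_nhds_unique (((tendsto_qPoch hq a).comp (tendsto_add_atTop_nat 1))) (h1.congr ?_)
  intro N
  rw [Function.comp_apply, Finset.prod_range_succ', mul_comm]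
  congr 1
  · exact Finset.prod_congr rfl fun m _ => by rw [pow_succ']; ring
  · simp

theorem qPoch_ne_zero (hq : ‖q‖ < 1) {a : ℂ} (ha : ∀ m : ℕ, a * q ^ m ≠ 1) : qPoch a q ≠ 0 := by
  have h := tprod_one_add_ne_zero_of_summable (f := fun m : ℕ => -(a * q ^ m))
    (fun m => by rw [← sub_eq_add_neg]; exact sub_ne_zero.mpr (ha m).symm)
    (summable_norm_mul_pow hq a)
  simpa [qPoch, sub_eq_add_neg] using h

theorem qPoch_ne_zero_of_norm_lt (hq : ‖q‖ < 1) {a : ℂ} (ha : ‖a‖ < 1) : qPoch a q ≠ 0 := by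
  refine qPoch_ne_zero hq fun m h => ?_
  have h1 := congrArg norm h
  rw [norm_mul, norm_pow, norm_one] at h1
  have h2 : ‖q‖ ^ m ≤ 1 := pow_le_one₀ (norm_nonneg _) hq.le
  have h3 : ‖a‖ * ‖q‖ ^ m ≤ ‖a‖ * 1 := mul_le_mul_of_nonneg_left h2 (norm_nonneg _)
  linarith

theorem qPoch_zero (q : ℂ) : qPoch 0 q = 1 := by simp [qPoch]

theorem qPoch_one (hq : ‖q‖ < 1) : qPoch 1 q = 0 := by rw [qPoch_eq hq]; simp

/-- The partial products converge locally uniformly, being dominated on each ball by a geometric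
series. -/
theorem differentiable_qPoch (hq : ‖q‖ < 1) : Differentiable ℂ fun a => qPoch a q := by
  intro a
  have hu := (summable_geometric_of_lt_one (norm_nonneg q) hq).mul_left (‖a‖ + 1)
  have h := hu.hasProdLocallyUniformlyOn_nat_one_add (f := fun m z => -(z * q ^ m))
    (K := Metric.ball (0 : ℂ) (‖a‖ + 1)) Metric.isOpen_ball
    (Filter.Eventually.of_forall fun m z hz => by
      rw [norm_neg, norm_mul, norm_pow]
      refine mul_le_mul_of_nonneg_right ?_ (pow_nonneg (norm_nonneg _) _)
      simpa using (mem_ball_zero_iff.mp hz).le)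
    (fun m => by fun_prop)
  have h2 := h.differentiableOn (.of_forall fun _ => by
    simpa [Finset.prod_fn] using DifferentiableOn.finsetProd (fun _ _ => by fun_prop))
    Metric.isOpen_ball
  have h3 : (fun z => ∏' m : ℕ, (1 + -(z * q ^ m))) = fun z => qPoch z q := by
    funext z
    simp [qPoch, sub_eq_add_neg]
  rw [h3] at h2
  exact h2.differentiableAt (Metric.isOpen_ball.mem_nhds (by simp))

theorem continuous_qPoch (hq : ‖q‖ < 1) : Continuous fun a => qPoch a q :=
  (differentiable_qPoch hq).continuous

theorem qPoch_conj {q : ℝ} (hq : ‖(q : ℂ)‖ < 1) (a : ℂ) :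
    qPoch (starRingEnd ℂ a) q = starRingEnd ℂ (qPoch a q) := by
  refine tendsto_nhds_unique (tendsto_qPoch hq _)
    (((Complex.continuous_conj.tendsto _).comp (tendsto_qPoch hq a)).congr fun N => ?_)
  simp

end

/-! ### The `q`-binomial theorem -/

section

open Filter Topology

variable {a b q : ℂ}

theorem qBinom_succ_eq (m : ℕ) :
    qBinom a b q (m + 1) = qBinom a b q m * ((a - b * q ^ m) / (1 - q ^ (m + 1))) :=
  Finset.prod_range_succ _ _

theorem pow_succ_ne_one_of_norm_lt (hq : ‖q‖ < 1) (m : ℕ) : q ^ (m + 1) ≠ 1 := by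
  intro h
  have h1 := congrArg norm h
  rw [norm_pow, norm_one] at h1
  exact (pow_lt_one₀ (norm_nonneg q) hq (Nat.succ_ne_zero m)).ne h1

/-- Consecutive terms have ratio `(a - b q^m) z / (1 - q^(m+1))`, which tends to `a z`. -/
theorem summable_norm_qBinom (hq : ‖q‖ < 1) {z : ℂ} (hz : ‖a * z‖ < 1) :
    Summable fun m => ‖qBinom a b q m * z ^ m‖ := by
  obtain ⟨r, hr1, hr2⟩ := exists_between hz
  have hqt : Tendsto (fun m : ℕ => q ^ m) atTop (𝓝 0) := tendsto_pow_atTop_nhds_zero_of_norm_lt_one hq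
  have h1 : Tendsto (fun m : ℕ => ‖(a - b * q ^ m) / (1 - q ^ (m + 1)) * z‖) atTop (𝓝 ‖a * z‖) := by
    have h2 : Tendsto (fun m : ℕ => (a - b * q ^ m) / (1 - q ^ (m + 1)) * z) atTop
        (𝓝 ((a - b * 0) / (1 - 0) * z)) :=
      ((tendsto_const_nhds.sub (hqt.const_mul b)).div
        (tendsto_const_nhds.sub (hqt.comp (tendsto_add_atTop_nat 1))) (by simp)).mul_const z
    simpa using h2.norm
  refine summable_of_ratio_norm_eventually_le hr2 ?_
  filter_upwards [h1.eventually_lt_const hr1] with m hm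
  rw [norm_norm, norm_norm, qBinom_succ_eq, pow_succ z]
  have : qBinom a b q m * ((a - b * q ^ m) / (1 - q ^ (m + 1))) * (z ^ m * z) =
      (a - b * q ^ m) / (1 - q ^ (m + 1)) * z * (qBinom a b q m * z ^ m) := by ring
  rw [this, norm_mul]
  exact mul_le_mul_of_nonneg_right hm.le (norm_nonneg _)

/-- The sum satisfies `(1 - az) F(z) = (1 - bz) F(qz)`. Iterating gives finite products on both
sides, and `F(q^N z) → 1` by dominated convergence. -/
theorem hasSum_qBinom (hq : ‖q‖ < 1) {z : ℂ} (hz : ‖a * z‖ < 1) :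
    HasSum (fun m => qBinom a b q m * z ^ m) (qPoch (b * z) q / qPoch (a * z) q) := by
  let F : ℂ → ℂ := fun w => ∑' m, qBinom a b q m * w ^ m
  have hsum : ∀ w, ‖a * w‖ < 1 → Summable fun m => qBinom a b q m * w ^ m := fun w hw =>
    (summable_norm_qBinom hq hw).of_norm
  have hqw : ∀ w, ‖a * w‖ < 1 → ‖a * (w * q)‖ < 1 := by
    intro w hw
    rw [← mul_assoc, norm_mul]
    exact mul_lt_one_of_nonneg_of_lt_one_left (norm_nonneg _) hw hq.le
  have hF : ∀ w, ‖a * w‖ < 1 → (1 - a * w) * F w = (1 - b * w) * F (w * q) := by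
    intro w hw
    have s1 := hsum w hw
    have s2 := hsum (w * q) (hqw w hw)
    have e1 : F w - F (w * q) = a * w * F w - b * w * F (w * q) := by
      have t1 := s1.hasSum.sub s2.hasSum
      have t2 := (s1.hasSum.mul_left (a * w)).sub (s2.hasSum.mul_left (b * w))
      have t3 := (hasSum_nat_add_iff' 1).mpr t1
      simp only [Finset.sum_range_one, pow_zero, sub_self, sub_zero] at t3
      refine t3.unique (t2.congr_fun ?_)
      intro m
      have h := qBinom_succ a b q m (pow_succ_ne_one_of_norm_lt hq m)
      have h2 : qBinom a b q (m + 1) * w ^ (m + 1) - qBinom a b q (m + 1) * (w * q) ^ (m + 1) =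
        (qBinom a b q (m + 1) * (1 - q ^ (m + 1))) * w ^ (m + 1) := by
        rw [mul_pow]; ring
      rw [h2, h, mul_pow, pow_succ]
      ring
    linear_combination e1
  have hiter : ∀ N : ℕ, (∏ m ∈ Finset.range N, (1 - a * z * q ^ m)) * F z =
      (∏ m ∈ Finset.range N, (1 - b * z * q ^ m)) * F (z * q ^ N) := by
    intro N
    induction N with
    | zero => simp
    | succ N ih =>
      have hw : ‖a * (z * q ^ N)‖ < 1 := by
        rw [← mul_assoc, norm_mul, norm_pow]
        exact mul_lt_one_of_nonneg_of_lt_one_left (norm_nonneg _) hz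
          (pow_le_one₀ (norm_nonneg _) hq.le)
      have h := hF _ hw
      rw [Finset.prod_range_succ, Finset.prod_range_succ, pow_succ]
      have e1 : z * (q ^ N * q) = z * q ^ N * q := by ring
      rw [e1]
      linear_combination (1 - a * z * q ^ N) * ih +
        (∏ m ∈ Finset.range N, (1 - b * z * q ^ m)) * h
  have hlim : Tendsto (fun N : ℕ => F (z * q ^ N)) atTop (𝓝 1) := by
    have h1 := tendsto_tsum_of_dominated_convergence (𝓕 := atTop)
      (f := fun (N : ℕ) (m : ℕ) => qBinom a b q m * (z * q ^ N) ^ m)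
      (g := fun m => if m = 0 then 1 else 0) (summable_norm_qBinom (b := b) hq hz) (fun m => ?_)
      (Filter.Eventually.of_forall fun N m => ?_)
    · rw [tsum_ite_eq] at h1
      exact h1
    · rcases m with _ | m
      · simp [qBinom_zero]
      · rw [if_neg (Nat.succ_ne_zero m)]
        have h2 : Tendsto (fun N : ℕ => q ^ N) atTop (𝓝 0) :=
          tendsto_pow_atTop_nhds_zero_of_norm_lt_one hq
        have h3 := (((h2.const_mul z).pow (m + 1)).const_mul (qBinom a b q (m + 1)))
        simpa using h3
    · rw [mul_pow, norm_mul, norm_mul, norm_mul]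
      refine mul_le_mul_of_nonneg_left ?_ (norm_nonneg _)
      refine mul_le_of_le_one_right (norm_nonneg _) ?_
      rw [norm_pow, norm_pow]
      exact pow_le_one₀ (pow_nonneg (norm_nonneg _) _) (pow_le_one₀ (norm_nonneg _) hq.le)
  have hmain : qPoch (a * z) q * F z = qPoch (b * z) q * 1 :=
    tendsto_nhds_unique ((tendsto_qPoch hq (a * z)).mul_const (F z))
      (((tendsto_qPoch hq (b * z)).mul hlim).congr fun N => (hiter N).symm)
  have hFz : F z = qPoch (b * z) q / qPoch (a * z) q := by
    rw [eq_div_iff (qPoch_ne_zero_of_norm_lt hq hz)]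
    linear_combination hmain
  rw [← hFz]
  exact (hsum z hz).hasSum

theorem ofReal_qBinom (a b q : ℝ) (m : ℕ) :
    ((qBinom a b q m : ℝ) : ℂ) = qBinom (a : ℂ) b q m := by
  simp [qBinom]

end

/-! ### Torus means -/

section

open MeasureTheory Set

variable {n : ℕ}

/-- The cube of angles. -/
abbrev cube (n : ℕ) : Set (Fin n → ℝ) := Icc 0 fun _ => 2 * Real.pi

theorem torusMap_zero_apply (R : Fin n → ℝ) (θ : Fin n → ℝ) (i : Fin n) :
    torusMap 0 R θ i = R i * Complex.exp (θ i * Complex.I) := by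
  simp [torusMap]

theorem norm_torusMap (R : Fin n → ℝ) (hR : ∀ i, 0 < R i) (θ : Fin n → ℝ) (i : Fin n) :
    ‖torusMap 0 R θ i‖ = R i := by
  rw [torusMap_zero_apply, norm_mul, Complex.norm_exp_ofReal_mul_I, mul_one, Complex.norm_real,
    Real.norm_eq_abs, abs_of_pos (hR i)]

theorem continuous_torusMap (R : Fin n → ℝ) : Continuous (torusMap 0 R) := by
  unfold torusMap
  fun_prop

/-- The factors `dx/(2πi x)` become `dθ/(2π)`, so the contour integral is an average over angles. -/
theorem torusMean_eq {R : ℝ} (hR : 0 < R) (f : (Fin n → ℂ) → ℂ) :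
    torusMean n R f = ((2 * Real.pi : ℂ) ^ n)⁻¹ *
      ∫ θ in cube n, f (torusMap 0 (fun _ => R) θ) := by
  rw [torusMean, torusIntegral, ← integral_const_mul]
  congr 1
  funext θ
  rw [smul_eq_mul, ← mul_assoc, ← Finset.prod_mul_distrib]
  congr 1
  have h : ∀ i ∈ Finset.univ, ((R : ℂ) * Complex.exp (θ i * Complex.I) * Complex.I) *
      (1 / (2 * (Real.pi : ℂ) * Complex.I * torusMap 0 (fun _ => R) θ i)) =
      (2 * Real.pi : ℂ)⁻¹ := by
    intro i _
    rw [torusMap_zero_apply]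
    have h1 : (R : ℂ) ≠ 0 := by exact_mod_cast hR.ne'
    have h2 := Complex.exp_ne_zero (θ i * Complex.I)
    have h3 := Complex.I_ne_zero
    have h4 : (Real.pi : ℂ) ≠ 0 := by exact_mod_cast Real.pi_ne_zero
    field_simp
  rw [Finset.prod_congr rfl h, Finset.prod_const, Finset.card_univ, Fintype.card_fin, inv_pow]

/-- The torus of radius `R`. -/
def torus (n : ℕ) (R : ℝ) : Set (Fin n → ℂ) := {x | ∀ i, ‖x i‖ = R}

theorem torusMap_mem {R : ℝ} (hR : 0 < R) (θ : Fin n → ℝ) :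
    torusMap 0 (fun _ => R) θ ∈ torus n R := fun i => norm_torusMap _ (fun _ => hR) θ i

theorem continuous_comp_torusMap {R : ℝ} (hR : 0 < R) {f : (Fin n → ℂ) → ℂ}
    (hf : ContinuousOn f (torus n R)) : Continuous fun θ => f (torusMap 0 (fun _ => R) θ) :=
  hf.comp_continuous (continuous_torusMap _) (torusMap_mem hR)

theorem integrableOn_torusMap {R : ℝ} (hR : 0 < R) {f : (Fin n → ℂ) → ℂ}
    (hf : ContinuousOn f (torus n R)) :
    IntegrableOn (fun θ => f (torusMap 0 (fun _ => R) θ)) (cube n) :=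
  (continuous_comp_torusMap hR hf).continuousOn.integrableOn_compact isCompact_Icc

theorem torusMean_congr {R : ℝ} (hR : 0 < R) {f g : (Fin n → ℂ) → ℂ}
    (h : ∀ x ∈ torus n R, f x = g x) : torusMean n R f = torusMean n R g := by
  rw [torusMean_eq hR, torusMean_eq hR]
  congr 2
  funext θ
  exact h _ (torusMap_mem hR θ)

theorem torusMean_const_mul (R : ℝ) (c : ℂ) (f : (Fin n → ℂ) → ℂ) :
    torusMean n R (fun x => c * f x) = c * torusMean n R f := by
  rw [torusMean, torusMean, ← torusIntegral_const_mul]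
  congr 1
  funext x
  ring

theorem torusMean_add {R : ℝ} (hR : 0 < R) {f g : (Fin n → ℂ) → ℂ}
    (hf : ContinuousOn f (torus n R)) (hg : ContinuousOn g (torus n R)) :
    torusMean n R (fun x => f x + g x) = torusMean n R f + torusMean n R g := by
  rw [torusMean_eq hR, torusMean_eq hR, torusMean_eq hR, ← mul_add,
    integral_add (integrableOn_torusMap hR hf) (integrableOn_torusMap hR hg)]

theorem torusMean_sum {R : ℝ} (hR : 0 < R) {ι : Type*} (s : Finset ι) {f : ι → (Fin n → ℂ) → ℂ}
    (hf : ∀ i ∈ s, ContinuousOn (f i) (torus n R)) :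
    torusMean n R (fun x => ∑ i ∈ s, f i x) = ∑ i ∈ s, torusMean n R (f i) := by
  simp only [torusMean_eq hR]
  rw [integral_finsetSum _ fun i hi => integrableOn_torusMap hR (hf i hi), Finset.mul_sum]

theorem torusMean_scale {R : ℝ} (hR : 0 < R) (f : (Fin n → ℂ) → ℂ) :
    torusMean n R f = torusMean n 1 fun x => f fun i => R * x i := by
  rw [torusMean_eq hR, torusMean_eq one_pos]
  congr 2
  funext θ
  congr 1
  funext i
  rw [torusMap_zero_apply, torusMap_zero_apply]
  push_cast
  ring

/-- The integral factors over the variables, and a nontrivial character has mean zero on its circle.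
-/
theorem torusMean_monomial {R : ℝ} (hR : 0 < R) (d : Fin n → ℤ) :
    torusMean n R (fun x => ∏ i, x i ^ d i) = if d = 0 then 1 else 0 := by
  have h1 : ∀ θ : Fin n → ℝ, (∏ i, torusMap 0 (fun _ => R) θ i ^ d i) =
      (∏ i, (R : ℂ) ^ d i) * ∏ i, Complex.exp (d i * (θ i * Complex.I)) := by
    intro θ
    rw [← Finset.prod_mul_distrib]
    refine Finset.prod_congr rfl fun i _ => ?_
    rw [torusMap_zero_apply, mul_zpow, ← Complex.exp_int_mul]
  rw [torusMean_eq hR]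
  simp only [h1]
  have hcube : cube n = Set.pi Set.univ fun _ => Icc 0 (2 * Real.pi) := by
    rw [Set.pi_univ_Icc]; rfl
  have h2 : ∫ θ in cube n, (∏ i, (R : ℂ) ^ d i) * ∏ i, Complex.exp (d i * (θ i * Complex.I)) =
      (∏ i, (R : ℂ) ^ d i) * ∏ i, ∫ s in Icc 0 (2 * Real.pi), Complex.exp (d i * (s * Complex.I)) := by
    rw [integral_const_mul, hcube, volume_pi, Measure.restrict_pi_pi]
    congr 1
    exact integral_fintype_prod_eq_prod (μ := fun _ => volume.restrict (Icc 0 (2 * Real.pi)))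
      (fun i (s : ℝ) => Complex.exp (d i * (s * Complex.I)))
  have h3 : ∀ m : ℤ, ∫ s in Icc 0 (2 * Real.pi), Complex.exp (m * (s * Complex.I)) =
      if m = 0 then 2 * Real.pi else 0 := by
    intro m
    rw [integral_Icc_eq_integral_Ioc, ← intervalIntegral.integral_of_le (by positivity)]
    split_ifs with hm
    · subst hm
      simp
    · have hc : (m * Complex.I : ℂ) ≠ 0 :=
        mul_ne_zero (Int.cast_ne_zero.mpr hm) Complex.I_ne_zero
      have h4 : ∀ s : ℝ, Complex.exp (m * (s * Complex.I)) = Complex.exp (m * Complex.I * s) :=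
        fun s => by ring_nf
      simp only [h4]
      rw [integral_exp_mul_complex hc]
      have h5 : Complex.exp (m * Complex.I * ((2 * Real.pi : ℝ) : ℂ)) = 1 := by
        rw [← Complex.exp_int_mul_two_pi_mul_I m]
        congr 1
        push_cast
        ring
      rw [h5]
      simp
  rw [h2]
  simp only [h3]
  have hpi : (2 * Real.pi : ℂ) ^ n ≠ 0 := by
    refine pow_ne_zero _ ?_
    exact_mod_cast (by positivity : (2 * Real.pi : ℝ) ≠ 0)
  split_ifs with hd
  · subst hd
    simp only [Pi.zero_apply, zpow_zero, Finset.prod_const_one, one_mul, if_true,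
      Finset.prod_const, Finset.card_univ, Fintype.card_fin]
    push_cast
    exact inv_mul_cancel₀ hpi
  · obtain ⟨i, hi⟩ := Function.ne_iff.mp hd
    exact mul_eq_zero_of_right _ (mul_eq_zero_of_right _
      (Finset.prod_eq_zero (Finset.mem_univ i) (by rw [if_neg (show ¬ d i = 0 from hi)]; simp)))

end

end Macdonald


/-! ### Contour shifts, and the weight function on the torus -/

namespace Macdonald

/-! ### Moving the contour of one variable -/

section

open MeasureTheory Set

theorem integral_cube_succAbove {m : ℕ} (i : Fin (m + 1)) {G : (Fin (m + 1) → ℝ) → ℂ}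
    (hG : Continuous G) : ∫ θ in cube (m + 1), G θ =
      ∫ y in cube m, ∫ s in Icc 0 (2 * Real.pi), G (i.insertNth s y) := by
  set e : ℝ × (Fin m → ℝ) ≃ᵐ (Fin (m + 1) → ℝ) :=
    (MeasurableEquiv.piFinSuccAbove (fun _ => ℝ) i).symm
  have hem : MeasurePreserving e :=
    (volume_preserving_piFinSuccAbove (fun _ : Fin (m + 1) => ℝ) i).symm _
  have heπ : (e ⁻¹' cube (m + 1)) = Icc 0 (2 * Real.pi) ×ˢ cube m :=
    ((Fin.insertNthOrderIso (fun _ => ℝ) i).preimage_Icc _ _).trans (Icc_prod_eq _ _)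
  have hint : IntegrableOn (fun p => G (e p)) (Icc 0 (2 * Real.pi) ×ˢ cube m)
      ((volume : Measure ℝ).prod (volume : Measure (Fin m → ℝ))) := by
    have h1 : IntegrableOn G (cube (m + 1)) := hG.continuousOn.integrableOn_compact isCompact_Icc
    rw [← hem.integrableOn_comp_preimage e.measurableEmbedding, heπ] at h1
    exact h1
  rw [← hem.map_eq, setIntegral_map_equiv, heπ, Measure.volume_eq_prod, ← Measure.prod_restrict,
    integral_prod_symm]
  · rfl
  · rw [Measure.prod_restrict]
    exact hint

/-- Cauchy's theorem on the annulus for `h(z)/z`. -/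
theorem integral_circle_shift {c : ℝ} (hc : 1 ≤ c) {h : ℂ → ℂ}
    (hcont : ContinuousOn h {z | 1 ≤ ‖z‖ ∧ ‖z‖ ≤ c})
    (hd : ∀ z : ℂ, 1 < ‖z‖ → ‖z‖ < c → DifferentiableAt ℂ h z) :
    ∫ s in Icc 0 (2 * Real.pi), h (Complex.exp ((s : ℝ) * Complex.I)) =
      ∫ s in Icc 0 (2 * Real.pi), h (c * Complex.exp ((s : ℝ) * Complex.I)) := by
  have h1 := Complex.circleIntegral_sub_center_inv_smul_eq_of_differentiable_on_annulus_off_countable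
    (c := 0) (f := h) one_pos hc Set.countable_empty
    (hcont.mono fun z hz => by
      simp only [Set.mem_sdiff, Metric.mem_closedBall, dist_zero_right, Metric.mem_ball,
        not_lt] at hz
      exact ⟨hz.2, hz.1⟩)
    (fun z hz => by
      simp only [Set.sdiff_empty, Set.mem_sdiff, Metric.mem_ball, dist_zero_right,
        Metric.mem_closedBall, not_le] at hz
      exact hd z hz.2 hz.1)
  rw [circleIntegral_def_Icc, circleIntegral_def_Icc] at h1
  have h2 : ∀ R : ℝ, 0 < R → ∀ s : ℝ, deriv (circleMap 0 R) s •
      ((circleMap 0 R s - 0)⁻¹ • h (circleMap 0 R s)) =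
      Complex.I * h (R * Complex.exp (s * Complex.I)) := by
    intro R hR s
    rw [deriv_circleMap, smul_eq_mul, smul_eq_mul, sub_zero, ← mul_assoc]
    have h3 : circleMap 0 R s ≠ 0 := circleMap_ne_center hR.ne'
    have h4 : circleMap 0 R s = R * Complex.exp (s * Complex.I) := by simp [circleMap]
    rw [mul_comm (circleMap 0 R s), mul_inv_cancel_right₀ h3, h4]
  simp only [h2 _ one_pos, h2 _ (lt_of_lt_of_le one_pos hc)] at h1
  rw [integral_const_mul, integral_const_mul] at h1
  have h5 := mul_left_cancel₀ Complex.I_ne_zero h1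
  rw [h5]
  simp

variable {n : ℕ}

/-- Fubini isolates the angle of `x_i`; with the other coordinates fixed on the unit circle, the
contour of `x_i` is expanded to radius `c`. -/
theorem torusMean_shift (i : Fin n) {c : ℝ} (hc : 1 ≤ c) {g : (Fin n → ℂ) → ℂ}
    (hcont : ContinuousOn g {x | (∀ j, j ≠ i → ‖x j‖ = 1) ∧ 1 ≤ ‖x i‖ ∧ ‖x i‖ ≤ c})
    (hd : ∀ x : Fin n → ℂ, (∀ j, j ≠ i → ‖x j‖ = 1) → 1 < ‖x i‖ → ‖x i‖ < c →
      DifferentiableAt ℂ (fun z => g (Function.update x i z)) (x i)) :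
    torusMean n 1 g = torusMean n 1 fun x => g (Function.update x i (c * x i)) := by
  obtain ⟨m, rfl⟩ : ∃ m, n = m + 1 := ⟨n - 1, by have := i.2; omega⟩
  have hc0 : 0 < c := lt_of_lt_of_le one_pos hc
  rw [torusMean_eq one_pos, torusMean_eq one_pos]
  congr 1
  have hnorm : ∀ (x : Fin (m + 1) → ℂ) (w : ℂ) (j : Fin (m + 1)), j ≠ i →
      Function.update x i w j = x j := fun x w j hj => Function.update_of_ne hj _ _
  have hcn : ‖(c : ℂ)‖ = c := by rw [Complex.norm_real, Real.norm_eq_abs, abs_of_pos hc0]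
  have c1 : Continuous fun θ : Fin (m + 1) → ℝ => g (torusMap 0 (fun _ => 1) θ) :=
    hcont.comp_continuous (continuous_torusMap _) fun θ => by
      have := fun j => norm_torusMap (fun _ => (1 : ℝ)) (fun _ => one_pos) θ j
      exact ⟨fun j _ => this j, (this i).ge, (this i).le.trans hc⟩
  have c2 : Continuous fun θ : Fin (m + 1) → ℝ =>
      g (Function.update (torusMap 0 (fun _ => 1) θ) i (c * torusMap 0 (fun _ => 1) θ i)) := by
    have h1 : Continuous fun θ : Fin (m + 1) → ℝ => torusMap 0 (fun _ => (1 : ℝ)) θ i :=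
      continuous_pi_iff.mp (continuous_torusMap fun _ => (1 : ℝ)) i
    refine hcont.comp_continuous ((continuous_torusMap _).update i
      (continuous_const.mul h1)) fun θ => ?_
    have := fun j => norm_torusMap (fun _ => (1 : ℝ)) (fun _ => one_pos) θ j
    refine ⟨fun j hj => ?_, ?_, ?_⟩
    · rw [hnorm _ _ _ hj, this]
    · rw [Function.update_self, norm_mul, hcn, this, mul_one]; exact hc
    · rw [Function.update_self, norm_mul, hcn, this, mul_one]
  rw [integral_cube_succAbove i c1, integral_cube_succAbove i c2]
  congr 1
  funext y
  let Y := torusMap 0 (fun _ => (1 : ℝ)) y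
  have hY : ∀ j, ‖Y j‖ = 1 := fun j => norm_torusMap (fun _ => (1 : ℝ)) (fun _ => one_pos) y j
  have hT : ∀ s : ℝ, torusMap 0 (fun _ => (1 : ℝ)) (i.insertNth (α := fun _ => ℝ) s y) =
      i.insertNth (α := fun _ => ℂ) (Complex.exp (s * Complex.I)) Y := by
    intro s
    funext j
    refine Fin.succAboveCases i ?_ (fun j => ?_) j
    · rw [torusMap_zero_apply, Fin.insertNth_apply_same, Fin.insertNth_apply_same]; simp
    · rw [torusMap_zero_apply, Fin.insertNth_apply_succAbove, Fin.insertNth_apply_succAbove]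
      simp [Y, torusMap]
  simp only [hT, Fin.insertNth_apply_same, Fin.update_insertNth]
  have hins : ∀ (z : ℂ) (j : Fin (m + 1)), j ≠ i →
      ‖i.insertNth (α := fun _ => ℂ) z Y j‖ = 1 := by
    intro z j hj
    obtain ⟨k, rfl⟩ := Fin.exists_succAbove_eq hj
    rw [Fin.insertNth_apply_succAbove, hY]
  refine integral_circle_shift hc (h := fun z => g (i.insertNth (α := fun _ => ℂ) z Y)) ?_ ?_
  · refine hcont.comp (Continuous.continuousOn ?_) fun z hz => ⟨hins z, ?_⟩
    · exact Continuous.finInsertNth i continuous_id continuous_const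
    · rw [Fin.insertNth_apply_same]; exact hz
  · intro z h1 h2
    have h3 := hd (i.insertNth (α := fun _ => ℂ) z Y) (hins z)
      (by rwa [Fin.insertNth_apply_same]) (by rwa [Fin.insertNth_apply_same])
    simpa only [Fin.insertNth_apply_same, Fin.update_insertNth] using h3

end

/-! ### The weight function -/

section

variable {n : ℕ} {q t : ℝ}

theorem continuous_ev (f : Fock ℝ) : Continuous fun x : Fin n → ℂ => ev x f := by
  induction f using MvPolynomial.induction_on with
  | C c =>
    have : (fun x : Fin n → ℂ => ev x (MvPolynomial.C c : Fock ℝ)) = fun _ => (c : ℂ) := by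
      funext x
      exact (ev x).commutes c
    rw [this]
    exact continuous_const
  | add f g hf hg =>
    simp only [map_add]
    exact hf.add hg
  | mul_X f r hf =>
    simp only [map_mul, ev_X]
    fun_prop

theorem differentiable_ev (f : Fock ℝ) : Differentiable ℂ fun x : Fin n → ℂ => ev x f := by
  induction f using MvPolynomial.induction_on with
  | C c =>
    have : (fun x : Fin n → ℂ => ev x (MvPolynomial.C c : Fock ℝ)) = fun _ => (c : ℂ) := by
      funext x
      exact (ev x).commutes c
    rw [this]
    exact differentiable_const _
  | add f g hf hg =>
    simp only [map_add]
    exact hf.add hg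
  | mul_X f r hf =>
    simp only [map_mul, ev_X]
    fun_prop

/-- The factor of the weight function belonging to an ordered pair of variables. -/
noncomputable def pairWeight (q t : ℝ) (z : ℂ) : ℂ := qPoch z q / qPoch (t * z) q

theorem weight_eq (q t : ℝ) (x : Fin n → ℂ) : weight (q : ℂ) t x =
    ∏ i, ∏ j ∈ Finset.univ.filter (fun j => j ≠ i), pairWeight q t (x i / x j) := by
  simp only [weight, pairWeight, mul_div_assoc]

theorem norm_ofReal_lt (hq0 : 0 < q) (hq1 : q < 1) : ‖(q : ℂ)‖ < 1 := by
  rwa [Complex.norm_real, Real.norm_eq_abs, abs_of_pos hq0]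

theorem norm_ofReal_mul (hq0 : 0 < q) (z : ℂ) : ‖(q : ℂ) * z‖ = q * ‖z‖ := by
  rw [norm_mul, Complex.norm_real, Real.norm_eq_abs, abs_of_pos hq0]

theorem qPoch_mul_ne_zero (hq0 : 0 < q) (hq1 : q < 1) (ht0 : 0 < t) {z : ℂ} (hz : t * ‖z‖ < 1) :
    qPoch (t * z) q ≠ 0 :=
  qPoch_ne_zero_of_norm_lt (norm_ofReal_lt hq0 hq1) (by rwa [norm_ofReal_mul ht0])

theorem differentiableAt_pairWeight (hq0 : 0 < q) (hq1 : q < 1) (ht0 : 0 < t) {z : ℂ}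
    (hz : t * ‖z‖ < 1) : DifferentiableAt ℂ (pairWeight q t) z :=
  ((differentiable_qPoch (norm_ofReal_lt hq0 hq1)) z).div
    (((differentiable_qPoch (norm_ofReal_lt hq0 hq1)) _).comp z (by fun_prop))
    (qPoch_mul_ne_zero hq0 hq1 ht0 hz)

theorem pairWeight_one (hq0 : 0 < q) (hq1 : q < 1) : pairWeight q t 1 = 0 := by
  rw [pairWeight, qPoch_one (norm_ofReal_lt hq0 hq1), zero_div]

theorem norm_div_torus {R : ℝ} (hR : 0 < R) {x : Fin n → ℂ} (hx : x ∈ torus n R) (i j : Fin n) :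
    ‖x i / x j‖ = 1 := by
  rw [norm_div, hx i, hx j, div_self hR.ne']

theorem torus_ne_zero {R : ℝ} (hR : 0 < R) {x : Fin n → ℂ} (hx : x ∈ torus n R) (i : Fin n) :
    x i ≠ 0 := by
  rw [← norm_pos_iff, hx i]
  exact hR

theorem continuousOn_weight (hq0 : 0 < q) (hq1 : q < 1) (ht0 : 0 < t) (ht1 : t < 1) {R : ℝ}
    (hR : 0 < R) : ContinuousOn (fun x : Fin n → ℂ => weight (q : ℂ) t x) (torus n R) := by
  simp only [weight_eq]
  refine continuousOn_finsetProd _ fun i _ => continuousOn_finsetProd _ fun j _ => ?_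
  intro x hx
  refine ContinuousAt.continuousWithinAt (ContinuousAt.comp (g := pairWeight q t) ?_
    (ContinuousAt.div (continuousAt_apply i x) (continuousAt_apply j x) (torus_ne_zero hR hx j)))
  refine (differentiableAt_pairWeight hq0 hq1 ht0 ?_).continuousAt
  rw [norm_div_torus hR hx, mul_one]
  exact ht1

theorem weight_smul (c : ℂ) (hc : c ≠ 0) (x : Fin n → ℂ) :
    weight (q : ℂ) t (fun i => c * x i) = weight (q : ℂ) t x := by
  simp only [weight_eq, mul_div_mul_left _ _ hc]

/-- The part of the weight function that does not involve `x_i`. -/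
noncomputable def restWeight (q t : ℝ) (i : Fin n) (x : Fin n → ℂ) : ℂ :=
  ∏ a ∈ Finset.univ.erase i, ∏ b ∈ (Finset.univ.erase i).erase a, pairWeight q t (x a / x b)

/-- The weight function multiplied by a coefficient of the Macdonald operator. -/
noncomputable def opWeight (q t : ℝ) (i : Fin n) (x : Fin n → ℂ) : ℂ :=
  (∏ j ∈ Finset.univ.erase i, qPoch (q * (x i / x j)) q / qPoch (t * (q * (x i / x j))) q *
    pairWeight q t (x j / x i)) * restWeight q t i x

theorem weight_eq_restWeight (i : Fin n) (x : Fin n → ℂ) : weight (q : ℂ) t x =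
    (∏ j ∈ Finset.univ.erase i, pairWeight q t (x i / x j) * pairWeight q t (x j / x i)) *
      restWeight q t i x := by
  have hf : ∀ a : Fin n, Finset.univ.filter (fun j => j ≠ a) = Finset.univ.erase a := fun a => by
    ext; simp
  rw [weight_eq]
  simp only [hf]
  rw [← Finset.mul_prod_erase _ _ (Finset.mem_univ i), Finset.prod_mul_distrib, mul_assoc]
  congr 1
  rw [restWeight, ← Finset.prod_mul_distrib]
  refine Finset.prod_congr rfl fun a ha => ?_
  have hia : i ∈ Finset.univ.erase a :=
    Finset.mem_erase.mpr ⟨(Finset.mem_erase.mp ha).1.symm, Finset.mem_univ _⟩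
  rw [← Finset.mul_prod_erase _ _ hia, Finset.erase_right_comm]

/-- With `z = x_i/x_j` the coefficient is `(1 - tz)/(1 - z)`, which cancels the first factors of
`(z;q)_∞ / (tz;q)_∞` and leaves `(qz;q)_∞ / (tqz;q)_∞`. The product thus has no pole on the diagonal
and stays regular further out in `x_i`. -/
theorem macCoeff_mul_weight (hq0 : 0 < q) (hq1 : q < 1) (ht0 : 0 < t) (ht1 : t < 1) (i : Fin n)
    {x : Fin n → ℂ} (hx : x ∈ torus n 1) (hinj : Function.Injective x) :
    macCoeff (t : ℂ) x i * weight (q : ℂ) t x = opWeight q t i x := by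
  have hq := norm_ofReal_lt hq0 hq1
  rw [weight_eq_restWeight i, macCoeff, opWeight, ← mul_assoc, ← Finset.prod_mul_distrib]
  congr 1
  refine Finset.prod_congr rfl fun j hj => ?_
  rw [← mul_assoc]
  congr 1
  have hj0 := torus_ne_zero one_pos hx j
  set z := x i / x j with hz
  have hzn : ‖z‖ = 1 := norm_div_torus one_pos hx i j
  have hz1 : 1 - z ≠ 0 := by
    rw [sub_ne_zero]
    intro h
    rw [hz, eq_div_iff hj0, one_mul] at h
    exact (Finset.mem_erase.mp hj).1 (hinj h)
  have h1 : (t * x i - x j) / (x i - x j) = (1 - t * z) / (1 - z) := by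
    have hxi : x i = z * x j := (div_mul_cancel₀ _ hj0).symm
    rw [hxi, show (t : ℂ) * (z * x j) - x j = (1 - t * z) * (-x j) by ring,
      show z * x j - x j = (1 - z) * (-x j) by ring, mul_div_mul_right _ _ (neg_ne_zero.mpr hj0)]
  have ht2 : (1 : ℂ) - t * z ≠ 0 := by
    rw [sub_ne_zero]
    intro h
    have := congrArg norm h
    rw [norm_one, norm_ofReal_mul ht0, hzn, mul_one] at this
    exact ht1.ne this.symm
  have hne : qPoch (t * (q * z)) q ≠ 0 := by
    refine qPoch_mul_ne_zero hq0 hq1 ht0 ?_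
    rw [norm_ofReal_mul hq0, hzn, mul_one]
    exact mul_lt_one_of_nonneg_of_lt_one_left ht0.le ht1 hq1.le
  rw [h1, pairWeight, qPoch_eq hq z, qPoch_eq hq (t * z), mul_assoc (t : ℂ), mul_comm z (q : ℂ)]
  field_simp

theorem weight_eq_zero (hq0 : 0 < q) (hq1 : q < 1) {x : Fin n → ℂ} (hx : x ∈ torus n 1)
    (hinj : ¬ Function.Injective x) : weight (q : ℂ) t x = 0 := by
  rw [Function.Injective] at hinj
  push Not at hinj
  obtain ⟨a, b, hab, hne⟩ := hinj
  rw [weight_eq]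
  refine Finset.prod_eq_zero (Finset.mem_univ a)
    (Finset.prod_eq_zero (i := b) (by simpa using hne.symm) ?_)
  rw [hab, div_self (torus_ne_zero one_pos hx b), pairWeight_one hq0 hq1]

theorem opWeight_eq_zero (hq0 : 0 < q) (hq1 : q < 1) {x : Fin n → ℂ} (hx : x ∈ torus n 1)
    (hinj : ¬ Function.Injective x) (i : Fin n) : opWeight q t i x = 0 := by
  rw [Function.Injective] at hinj
  push Not at hinj
  obtain ⟨a, b, hab, hne⟩ := hinj
  have key : ∀ a b : Fin n, x a = x b → pairWeight q t (x a / x b) = 0 := fun a b h => by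
    rw [h, div_self (torus_ne_zero one_pos hx b), pairWeight_one hq0 hq1]
  have hcase : ∀ b : Fin n, b ≠ i → x b = x i → opWeight q t i x = 0 := by
    intro b hb h
    refine mul_eq_zero_of_left (Finset.prod_eq_zero (i := b) (by simpa using hb) ?_) _
    rw [key b i h, mul_zero]
  by_cases ha : a = i
  · subst ha
    exact hcase b hne.symm hab.symm
  by_cases hb : b = i
  · subst hb
    exact hcase a ha hab
  refine mul_eq_zero_of_right _ (Finset.prod_eq_zero (i := a) (by simpa using ha)
    (Finset.prod_eq_zero (i := b) ?_ (key a b hab)))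
  simp [hb, hne.symm]

/-- The Macdonald operator on the torus. -/
theorem weight_mul_opE (hq0 : 0 < q) (hq1 : q < 1) (ht0 : 0 < t) (ht1 : t < 1) (f : Fock ℝ)
    {x : Fin n → ℂ} (hx : x ∈ torus n 1) :
    weight (q : ℂ) t x * ((t : ℂ) ^ n * ev x (opE q t f) - ev x f) =
      (t - 1) * ∑ i, opWeight q t i x * ev (Function.update x i (q * x i)) f := by
  -- The coefficients of the operator have denominators `x_i - x_j`. Where coordinates coincide the
  -- weight and all regularized products vanish, so the identity holds there trivially.
  by_cases hinj : Function.Injective x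
  · have h := ev_opE (K := ℂ) q t ht0.ne' x hinj (torus_ne_zero one_pos hx) f
    have h1 : (t : ℂ) ^ n * ev x (opE q t f) = ev x f + ((t : ℂ) - 1) *
      ∑ i, macCoeff (t : ℂ) x i * ev (Function.update x i (q * x i)) f := h
    rw [h1, add_sub_cancel_left, mul_left_comm, Finset.mul_sum]
    congr 1
    refine Finset.sum_congr rfl fun i _ => ?_
    rw [← macCoeff_mul_weight hq0 hq1 ht0 ht1 i hx hinj]
    ring
  · rw [weight_eq_zero hq0 hq1 hx hinj, zero_mul, Finset.sum_eq_zero, mul_zero]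
    intro i _
    rw [opWeight_eq_zero hq0 hq1 hx hinj, zero_mul]

/-- The product runs over ordered pairs, and inversion exchanges the two orders. -/
theorem restWeight_inv (i : Fin n) (x : Fin n → ℂ) :
    restWeight q t i x⁻¹ = restWeight q t i x := by
  have h : ∀ y : Fin n → ℂ, restWeight q t i y = ∏ a : Fin n, ∏ b : Fin n,
      if a ≠ i ∧ b ≠ i ∧ b ≠ a then pairWeight q t (y a / y b) else 1 := by
    intro y
    rw [restWeight, ← Finset.prod_subset (Finset.subset_univ (Finset.univ.erase i))]
    · refine Finset.prod_congr rfl fun a ha => ?_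
      rw [← Finset.prod_subset (Finset.subset_univ ((Finset.univ.erase i).erase a))]
      · refine Finset.prod_congr rfl fun b hb => ?_
        simp only [Finset.mem_erase, Finset.mem_univ, and_true] at ha hb
        rw [if_pos ⟨ha, hb.2, hb.1⟩]
      · intro b _ hb
        simp only [Finset.mem_erase, Finset.mem_univ, and_true] at hb
        rw [if_neg]
        tauto
    · intro a _ ha
      simp only [Finset.mem_erase, Finset.mem_univ, and_true, not_not] at ha
      exact Finset.prod_eq_one fun b _ => if_neg fun h => h.1 ha
  rw [h, h, Finset.prod_comm]
  refine Finset.prod_congr rfl fun a _ => Finset.prod_congr rfl fun b _ => ?_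
  rw [Pi.inv_apply, Pi.inv_apply, inv_div_inv]
  refine if_congr ?_ rfl rfl
  constructor <;> rintro ⟨h1, h2, h3⟩ <;> exact ⟨h2, h1, h3.symm⟩

theorem weight_inv (x : Fin n → ℂ) : weight (q : ℂ) t x⁻¹ = weight (q : ℂ) t x := by
  rw [weight_eq, weight_eq, Finset.prod_comm']
  · refine Finset.prod_congr rfl fun a _ => Finset.prod_congr rfl fun b _ => ?_
    rw [Pi.inv_apply, Pi.inv_apply, inv_div_inv]
  · intro a b
    simp only [Finset.mem_univ, true_and, Finset.mem_filter, and_true]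
    exact ne_comm

/-- Dividing `x_i` by `q` moves the factor `q` from the argument `x_i/x_j` to `x_j/x_i`, which is
the effect of inverting all variables. -/
theorem opWeight_shift (hq0 : 0 < q) (i : Fin n) (x : Fin n → ℂ) :
    opWeight q t i (Function.update x i (((q⁻¹ : ℝ) : ℂ) * x i)) = opWeight q t i x⁻¹ := by
  have hq : (q : ℂ) ≠ 0 := by exact_mod_cast hq0.ne'
  rw [opWeight, opWeight, restWeight_inv]
  congr 1
  · refine Finset.prod_congr rfl fun j hj => ?_
    have hne := (Finset.mem_erase.mp hj).1
    rw [Function.update_self, Function.update_of_ne hne, Pi.inv_apply, Pi.inv_apply, inv_div_inv,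
      inv_div_inv, mul_comm]
    have h1 : (q : ℂ) * (((q⁻¹ : ℝ) : ℂ) * x i / x j) = x i / x j := by
      push_cast
      field_simp
    have h2 : x j / (((q⁻¹ : ℝ) : ℂ) * x i) = q * (x j / x i) := by
      push_cast
      rw [inv_mul_eq_div, div_div_eq_mul_div]
      ring
    rw [h1, h2]
    rfl
  · refine Finset.prod_congr rfl fun a ha => Finset.prod_congr rfl fun b hb => ?_
    rw [Function.update_of_ne (Finset.mem_erase.mp ha).1,
      Function.update_of_ne (Finset.mem_erase.mp (Finset.mem_erase.mp hb).2).1]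

end

end Macdonald


/-! ### Self-adjointness of the Macdonald operator for the torus product -/

namespace Macdonald

/-! ### The scalar product on the torus -/

section

open MeasureTheory Set

variable {n : ℕ} {q t : ℝ}

theorem inv_mem_torus {x : Fin n → ℂ} (hx : x ∈ torus n 1) : x⁻¹ ∈ torus n 1 := fun i => by
  rw [Pi.inv_apply, norm_inv, hx i, inv_one]

theorem continuousOn_ev_inv {R : ℝ} (hR : 0 < R) (f : Fock ℝ) :
    ContinuousOn (fun x : Fin n → ℂ => ev x⁻¹ f) (torus n R) := by
  refine (continuous_ev f).comp_continuousOn (continuousOn_pi.mpr fun i => ?_)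
  exact (continuous_apply i).continuousOn.inv₀ fun x hx => torus_ne_zero hR hx i

/-- The scalar product in `n` variables, up to the factor `1 / n!`. -/
noncomputable def torusProduct (n : ℕ) (q t : ℝ) (f g : Fock ℝ) : ℂ :=
  torusMean n 1 fun x => ev x⁻¹ f * ev x g * weight (q : ℂ) t x

theorem continuousOn_torusProduct (hq0 : 0 < q) (hq1 : q < 1) (ht0 : 0 < t) (ht1 : t < 1)
    (f g : Fock ℝ) : ContinuousOn (fun x : Fin n → ℂ => ev x⁻¹ f * ev x g * weight (q : ℂ) t x)
      (torus n 1) :=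
  ((continuousOn_ev_inv one_pos f).mul (continuous_ev g).continuousOn).mul
    (continuousOn_weight hq0 hq1 ht0 ht1 one_pos)

/-- The scalar product in `n` variables as a bilinear map. -/
noncomputable def torusForm (n : ℕ) (hq0 : 0 < q) (hq1 : q < 1) (ht0 : 0 < t) (ht1 : t < 1) :
    Fock ℝ →ₗ[ℝ] Fock ℝ →ₗ[ℝ] ℂ :=
  LinearMap.mk₂ ℝ (torusProduct n q t)
    (fun f f' g => by
      rw [torusProduct, torusProduct, torusProduct, ← torusMean_add one_pos
        (continuousOn_torusProduct hq0 hq1 ht0 ht1 f g)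
        (continuousOn_torusProduct hq0 hq1 ht0 ht1 f' g)]
      congr 1
      funext x
      rw [map_add]
      ring)
    (fun c f g => by
      rw [torusProduct, torusProduct, Complex.real_smul, ← torusMean_const_mul]
      congr 1
      funext x
      rw [map_smul, Complex.real_smul]
      ring)
    (fun f g g' => by
      rw [torusProduct, torusProduct, torusProduct, ← torusMean_add one_pos
        (continuousOn_torusProduct hq0 hq1 ht0 ht1 f g)
        (continuousOn_torusProduct hq0 hq1 ht0 ht1 f g')]
      congr 1
      funext x
      rw [map_add]
      ring)
    (fun c f g => by
      rw [torusProduct, torusProduct, Complex.real_smul, ← torusMean_const_mul]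
      congr 1
      funext x
      rw [map_smul, Complex.real_smul]
      ring)

theorem torusForm_apply (hq0 : 0 < q) (hq1 : q < 1) (ht0 : 0 < t) (ht1 : t < 1) (f g : Fock ℝ) :
    torusForm n hq0 hq1 ht0 ht1 f g = torusProduct n q t f g := rfl

theorem differentiableAt_ev_inv (f : Fock ℝ) {x : Fin n → ℂ} (hx : ∀ i, x i ≠ 0) :
    DifferentiableAt ℂ (fun x : Fin n → ℂ => ev x⁻¹ f) x := by
  refine DifferentiableAt.comp (g := fun x : Fin n → ℂ => ev x f) x (differentiable_ev f _) ?_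
  exact differentiableAt_pi.mpr fun i => (differentiableAt_apply i x).inv (hx i)

theorem differentiableAt_div_pi {f g : (Fin n → ℂ) → ℂ} {x : Fin n → ℂ}
    (hf : DifferentiableAt ℂ f x) (hg : DifferentiableAt ℂ g x) (h0 : g x ≠ 0) :
    DifferentiableAt ℂ (fun y => f y / g y) x := by
  simp only [div_eq_mul_inv]
  exact hf.mul (hg.inv h0)

theorem differentiableAt_prod_pi {ι : Type*} (s : Finset ι) {f : ι → (Fin n → ℂ) → ℂ}
    {x : Fin n → ℂ} (hf : ∀ i ∈ s, DifferentiableAt ℂ (f i) x) :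
    DifferentiableAt ℂ (fun y => ∏ i ∈ s, f i y) x := by
  induction s using Finset.induction_on with
  | empty =>
    simp only [Finset.prod_empty]
    exact differentiableAt_const _
  | insert i s hi ih =>
    simp only [Finset.prod_insert hi]
    exact (hf i (Finset.mem_insert_self _ _)).fun_mul
      (ih fun j hj => hf j (Finset.mem_insert_of_mem hj))

/-- For `1 ≤ |x_i| ≤ 1/q` one has `t q |x_i/x_j| ≤ t < 1` and `t |x_j/x_i| ≤ t < 1`, so no
denominator vanishes. -/
theorem differentiableAt_opWeight (hq0 : 0 < q) (hq1 : q < 1) (ht0 : 0 < t) (ht1 : t < 1)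
    (i : Fin n) {x : Fin n → ℂ} (hx : ∀ j, j ≠ i → ‖x j‖ = 1) (h1 : 1 ≤ ‖x i‖)
    (h2 : ‖x i‖ ≤ q⁻¹) : DifferentiableAt ℂ (opWeight q t i) x := by
  have h0 : ∀ j, x j ≠ 0 := fun j => by
    rw [← norm_pos_iff]
    by_cases hj : j = i
    · rw [hj]; linarith
    · rw [hx j hj]; exact one_pos
  have hdiv : ∀ a b, DifferentiableAt ℂ (fun y : Fin n → ℂ => y a / y b) x := fun a b =>
    differentiableAt_div_pi (differentiableAt_apply a x) (differentiableAt_apply b x) (h0 b)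
  have hpair : ∀ a b, ‖x a / x b‖ ≤ 1 →
      DifferentiableAt ℂ (fun y : Fin n → ℂ => pairWeight q t (y a / y b)) x := fun a b hab =>
    DifferentiableAt.comp (g := pairWeight q t) x (differentiableAt_pairWeight hq0 hq1 ht0
      (mul_lt_one_of_nonneg_of_lt_one_left ht0.le ht1 hab)) (hdiv a b)
  suffices h : DifferentiableAt ℂ (fun y => opWeight q t i y) x from h
  simp only [opWeight, restWeight]
  refine DifferentiableAt.fun_mul ?_ ?_
  · refine differentiableAt_prod_pi _ fun j hj => ?_
    have hj1 := hx j (Finset.mem_erase.mp hj).1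
    refine DifferentiableAt.fun_mul (differentiableAt_div_pi ?_ ?_ ?_) (hpair _ _ ?_)
    · exact DifferentiableAt.comp (g := fun a => qPoch a (q : ℂ)) x
        (differentiable_qPoch (norm_ofReal_lt hq0 hq1) _) ((hdiv i j).const_mul _)
    · exact DifferentiableAt.comp (g := fun a => qPoch a (q : ℂ)) x
        (differentiable_qPoch (norm_ofReal_lt hq0 hq1) _) (((hdiv i j).const_mul _).const_mul _)
    · refine qPoch_mul_ne_zero hq0 hq1 ht0
        (mul_lt_one_of_nonneg_of_lt_one_left ht0.le ht1 ?_)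
      rw [norm_ofReal_mul hq0, norm_div, hj1, div_one]
      calc q * ‖x i‖ ≤ q * q⁻¹ := by gcongr
        _ = 1 := mul_inv_cancel₀ hq0.ne'
    · rw [norm_div, hj1]
      exact div_le_one_of_le₀ h1 (norm_nonneg _)
  · refine differentiableAt_prod_pi _ fun a ha => differentiableAt_prod_pi _ fun b hb =>
      hpair _ _ ?_
    rw [norm_div, hx a (Finset.mem_erase.mp ha).1,
      hx b (Finset.mem_erase.mp (Finset.mem_erase.mp hb).2).1, div_one]

/-- Substituting `x_i ↦ x_i/q`, which is a move of the contour from radius `1` to `1/q` through a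
region without poles, transfers the `q`-shift from `g` to `f`. -/
theorem torusMean_opWeight (hq0 : 0 < q) (hq1 : q < 1) (ht0 : 0 < t) (ht1 : t < 1)
    (f g : Fock ℝ) (i : Fin n) :
    torusMean n 1 (fun x => ev x⁻¹ f *
      (opWeight q t i x * ev (Function.update x i (q * x i)) g)) =
    torusMean n 1 fun x => opWeight q t i x⁻¹ * ev (Function.update x⁻¹ i (q * x⁻¹ i)) f *
      ev x g := by
  have hq : (q : ℂ) ≠ 0 := by exact_mod_cast hq0.ne'
  have hdiff : ∀ x : Fin n → ℂ, (∀ j, j ≠ i → ‖x j‖ = 1) → 1 ≤ ‖x i‖ → ‖x i‖ ≤ q⁻¹ →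
      DifferentiableAt ℂ (fun x => ev x⁻¹ f *
        (opWeight q t i x * ev (Function.update x i (q * x i)) g)) x := by
    intro x hx h1 h2
    refine (differentiableAt_ev_inv f fun j => ?_).mul
      ((differentiableAt_opWeight hq0 hq1 ht0 ht1 i hx h1 h2).mul ?_)
    · rw [← norm_pos_iff]
      by_cases hj : j = i
      · rw [hj]; linarith
      · rw [hx j hj]; exact one_pos
    · refine DifferentiableAt.comp (g := fun x : Fin n → ℂ => ev x g) x (differentiable_ev g _) ?_
      refine differentiableAt_pi.mpr fun j => ?_
      by_cases hj : j = i
      · subst hj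
        simp only [Function.update_self]
        exact (differentiableAt_apply j x).const_mul _
      · simp only [Function.update_of_ne hj]
        exact differentiableAt_apply j x
  rw [torusMean_shift i (c := q⁻¹) ((one_le_inv₀ hq0).mpr hq1.le)]
  · congr 1
    funext x
    rw [opWeight_shift hq0, Function.update_idem, Function.update_self]
    have h1 : (q : ℂ) * (((q⁻¹ : ℝ) : ℂ) * x i) = x i := by
      push_cast
      rw [mul_inv_cancel_left₀ hq]
    have h2 : (Function.update x i (((q⁻¹ : ℝ) : ℂ) * x i))⁻¹ =
        Function.update x⁻¹ i (q * x⁻¹ i) := by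
      funext j
      by_cases hj : j = i
      · subst hj
        simp only [Pi.inv_apply, Function.update_self, Complex.ofReal_inv, mul_inv, inv_inv]
      · simp [hj]
    rw [h1, h2, Function.update_eq_self]
    ring
  · exact fun x hx => (hdiff x hx.1 hx.2.1 hx.2.2).continuousAt.continuousWithinAt
  · intro x hx h1 h2
    have h3 := hdiff x hx h1.le h2.le
    refine DifferentiableAt.comp (x i) (f := Function.update x i) (g := fun x => ev x⁻¹ f *
      (opWeight q t i x * ev (Function.update x i (q * x i)) g)) ?_
      (hasDerivAt_update x i (x i)).differentiableAt
    rwa [Function.update_eq_self]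

/-- Written with the regularized weights, each side is a sum over `i` of integrals with one
`q`-shift, acting on `g` or on `f` at the inverted variables; the contour shift identifies them term
by term. -/
theorem torusForm_opE (hq0 : 0 < q) (hq1 : q < 1) (ht0 : 0 < t) (ht1 : t < 1) (f g : Fock ℝ) :
    torusProduct n q t (opE q t f) g = torusProduct n q t f (opE q t g) := by
  let B := torusForm n hq0 hq1 ht0 ht1
  have hc : ∀ i : Fin n, ContinuousOn (fun x : Fin n → ℂ => opWeight q t i x *
      ev (Function.update x i (q * x i)) g) (torus n 1) := by
    intro i
    refine ContinuousOn.mul (fun x hx => ?_) ?_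
    · exact (differentiableAt_opWeight hq0 hq1 ht0 ht1 i (fun j _ => hx j) (hx i).ge
        ((hx i).le.trans ((one_le_inv₀ hq0).mpr hq1.le))).continuousAt.continuousWithinAt
    · exact ((continuous_ev g).comp (continuous_id.update i
        (continuous_const.mul (continuous_apply i)))).continuousOn
  have hc' : ∀ i : Fin n, ContinuousOn (fun x : Fin n → ℂ => opWeight q t i x *
      ev (Function.update x i (q * x i)) f) (torus n 1) := by
    intro i
    refine ContinuousOn.mul (fun x hx => ?_) ?_
    · exact (differentiableAt_opWeight hq0 hq1 ht0 ht1 i (fun j _ => hx j) (hx i).ge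
        ((hx i).le.trans ((one_le_inv₀ hq0).mpr hq1.le))).continuousAt.continuousWithinAt
    · exact ((continuous_ev f).comp (continuous_id.update i
        (continuous_const.mul (continuous_apply i)))).continuousOn
  have hinv : ContinuousOn (fun x : Fin n → ℂ => x⁻¹) (torus n 1) :=
    continuousOn_pi.mpr fun i =>
      (continuous_apply i).continuousOn.inv₀ fun x hx => torus_ne_zero one_pos hx i
  have h1 : (t : ℂ) ^ n * torusProduct n q t f (opE q t g) - torusProduct n q t f g =
      (t - 1) * ∑ i, torusMean n 1 (fun x => ev x⁻¹ f *
      (opWeight q t i x * ev (Function.update x i (q * x i)) g)) := by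
    rw [← torusMean_sum one_pos, ← torusMean_const_mul, ← Complex.ofReal_pow, ← Complex.real_smul,
      ← torusForm_apply hq0 hq1 ht0 ht1, ← torusForm_apply hq0 hq1 ht0 ht1, ← map_smul, ← map_sub,
      torusForm_apply]
    · refine torusMean_congr one_pos fun x hx => ?_
      rw [← Finset.mul_sum, mul_left_comm, ← weight_mul_opE hq0 hq1 ht0 ht1 g hx, map_sub,
        map_smul, Complex.real_smul]
      push_cast
      ring
    · exact fun i _ => (continuousOn_ev_inv one_pos f).mul (hc i)
  -- Here the operator is evaluated at the inverted point, which again lies on the unit torus and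
  -- has the same weight.
  have h2 : (t : ℂ) ^ n * torusProduct n q t (opE q t f) g - torusProduct n q t f g =
      (t - 1) * ∑ i, torusMean n 1 fun x => opWeight q t i x⁻¹ *
        ev (Function.update x⁻¹ i (q * x⁻¹ i)) f * ev x g := by
    rw [← torusMean_sum one_pos, ← torusMean_const_mul, ← Complex.ofReal_pow, ← Complex.real_smul,
      ← torusForm_apply hq0 hq1 ht0 ht1, ← torusForm_apply hq0 hq1 ht0 ht1,
      ← LinearMap.map_smul₂, ← LinearMap.map_sub₂, torusForm_apply]
    · refine torusMean_congr one_pos fun x hx => ?_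
      rw [← Finset.sum_mul, ← mul_assoc, ← weight_mul_opE hq0 hq1 ht0 ht1 f (inv_mem_torus hx),
        map_sub, map_smul, Complex.real_smul, weight_inv]
      push_cast
      ring
    · exact fun i _ => ((hc' i).comp hinv fun x hx => inv_mem_torus hx).mul
        (continuous_ev g).continuousOn
  have ht : (t : ℂ) ^ n ≠ 0 := pow_ne_zero _ (by exact_mod_cast ht0.ne')
  simp only [torusMean_opWeight hq0 hq1 ht0 ht1] at h1
  rw [← h2] at h1
  exact (mul_left_cancel₀ ht (sub_left_injective h1)).symm

end

end Macdonald


/-! ### Positivity of the torus product and orthogonality of Macdonald functions -/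

namespace Macdonald

section

open MeasureTheory Set

variable {n : ℕ} {q t : ℝ}

/-! ### Positivity -/

theorem inv_eq_conj_of_mem_torus {x : Fin n → ℂ} (hx : x ∈ torus n 1) (i : Fin n) :
    (x i)⁻¹ = starRingEnd ℂ (x i) := by
  rw [Complex.inv_def, Complex.normSq_eq_norm_sq, hx i]
  simp

theorem ev_inv_eq_conj {x : Fin n → ℂ} (hx : x ∈ torus n 1) (f : Fock ℝ) :
    ev x⁻¹ f = starRingEnd ℂ (ev x f) := by
  have h := ev_map Complex.conjAe.toAlgHom x f
  refine Eq.trans ?_ h.symm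
  congr 2
  funext i
  exact inv_eq_conj_of_mem_torus hx i

theorem pairWeight_conj (hq0 : 0 < q) (hq1 : q < 1) (z : ℂ) :
    pairWeight q t (starRingEnd ℂ z) = starRingEnd ℂ (pairWeight q t z) := by
  rw [pairWeight, pairWeight, map_div₀, ← qPoch_conj (norm_ofReal_lt hq0 hq1),
    ← qPoch_conj (norm_ofReal_lt hq0 hq1), map_mul, Complex.conj_ofReal]

/-- On the unit torus the factors for `(i,j)` and `(j,i)` are complex conjugates, so each unordered
pair contributes a squared modulus. -/
theorem weight_eq_ofReal (hq0 : 0 < q) (hq1 : q < 1) {x : Fin n → ℂ} (hx : x ∈ torus n 1) :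
    weight (q : ℂ) t x = ((∏ i, ∏ j ∈ Finset.Ioi i,
      Complex.normSq (pairWeight q t (x i / x j)) : ℝ) : ℂ) := by
  have hf : ∀ a : Fin n, Finset.univ.filter (fun j => j ≠ a) = {a}ᶜ := fun a => by
    ext; simp
  rw [weight_eq]
  simp only [hf]
  rw [← Finset.prod_prod_Ioi_mul_eq_prod_prod_off_diag
    (fun j i => pairWeight q t (x i / x j))]
  push_cast
  refine Finset.prod_congr rfl fun i _ => Finset.prod_congr rfl fun j _ => ?_
  rw [Complex.normSq_eq_conj_mul_self, ← pairWeight_conj hq0 hq1, map_div₀,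
    ← inv_eq_conj_of_mem_torus hx, ← inv_eq_conj_of_mem_torus hx, inv_div_inv, mul_comm]

theorem pairWeight_ne_zero (hq0 : 0 < q) (hq1 : q < 1) (ht0 : 0 < t) (ht1 : t < 1) {z : ℂ}
    (hz : ‖z‖ = 1) (hz1 : z ≠ 1) : pairWeight q t z ≠ 0 := by
  refine div_ne_zero (qPoch_ne_zero (norm_ofReal_lt hq0 hq1) fun m h => ?_)
    (qPoch_mul_ne_zero hq0 hq1 ht0 (by rwa [hz, mul_one]))
  rcases Nat.eq_zero_or_pos m with rfl | hm
  · rw [pow_zero, mul_one] at h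
    exact hz1 h
  · have h1 := congrArg norm h
    rw [norm_mul, hz, norm_pow, norm_one, one_mul] at h1
    exact (pow_lt_one₀ (norm_nonneg _) (norm_ofReal_lt hq0 hq1) hm.ne').ne h1

/-- The integrand of the norm. -/
noncomputable def torusDensity (q t : ℝ) (f : Fock ℝ) (x : Fin n → ℂ) : ℝ :=
  Complex.normSq (ev x f) * ∏ i, ∏ j ∈ Finset.Ioi i, Complex.normSq (pairWeight q t (x i / x j))

theorem torusDensity_nonneg (f : Fock ℝ) (x : Fin n → ℂ) : 0 ≤ torusDensity q t f x :=
  mul_nonneg (Complex.normSq_nonneg _)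
    (Finset.prod_nonneg fun _ _ => Finset.prod_nonneg fun _ _ => Complex.normSq_nonneg _)

theorem ofReal_torusDensity (hq0 : 0 < q) (hq1 : q < 1) (f : Fock ℝ) {x : Fin n → ℂ}
    (hx : x ∈ torus n 1) :
    ((torusDensity q t f x : ℝ) : ℂ) = ev x⁻¹ f * ev x f * weight (q : ℂ) t x := by
  rw [torusDensity, Complex.ofReal_mul, ← weight_eq_ofReal hq0 hq1 hx,
    Complex.normSq_eq_conj_mul_self, ev_inv_eq_conj hx]

/-- The norm is the integral of a continuous nonnegative density, so its vanishing makes the density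
zero on the open cube. Where the coordinates are distinct the weight is nonzero and `f` vanishes;
hence `f` times the Vandermonde polynomial vanishes on a product of infinite sets, and is zero as a
polynomial. -/
theorem restr_eq_zero_of_torusProduct (hq0 : 0 < q) (hq1 : q < 1) (ht0 : 0 < t) (ht1 : t < 1)
    {f : Fock ℝ} (h : torusProduct n q t f f = 0) : restr ℝ n f = 0 := by
  let D : (Fin n → ℝ) → ℝ := fun θ => torusDensity q t f (torusMap 0 (fun _ => (1 : ℝ)) θ)
  have hD : ∀ θ, ((D θ : ℝ) : ℂ) = (fun x : Fin n → ℂ => ev x⁻¹ f * ev x f * weight (q : ℂ) t x)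
      (torusMap 0 (fun _ => (1 : ℝ)) θ) := fun θ =>
    ofReal_torusDensity hq0 hq1 f (torusMap_mem one_pos θ)
  have hDc : Continuous D := by
    have h1 := continuous_comp_torusMap one_pos
      (continuousOn_torusProduct (n := n) hq0 hq1 ht0 ht1 f f)
    simp only [← hD] at h1
    exact Complex.continuous_re.comp h1
  have hint : ∫ θ in cube n, D θ = 0 := by
    rw [torusProduct, torusMean_eq one_pos] at h
    have h2 : ((2 * Real.pi : ℂ) ^ n)⁻¹ ≠ 0 := inv_ne_zero (pow_ne_zero _ (by
      simp [Real.pi_ne_zero]))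
    have h3 := (mul_eq_zero.mp h).resolve_left h2
    rw [← setIntegral_congr_fun measurableSet_Icc fun θ _ => hD θ] at h3
    have h4 : ((∫ θ in cube n, D θ : ℝ) : ℂ) = 0 := (integral_ofReal (𝕜 := ℂ)).symm.trans h3
    exact_mod_cast h4
  let U : Set (Fin n → ℝ) := Set.pi univ fun _ => Ioo 0 (2 * Real.pi)
  have hU : IsOpen U := isOpen_set_pi finite_univ fun _ _ => isOpen_Ioo
  have hUc : U ⊆ cube n := fun θ hθ =>
    ⟨fun i => (hθ i (mem_univ i)).1.le, fun i => (hθ i (mem_univ i)).2.le⟩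
  have hzero : EqOn D 0 U := by
    have h1 := (setIntegral_eq_zero_iff_of_nonneg_ae
      (Filter.Eventually.of_forall fun θ => torusDensity_nonneg f _)
      (hDc.continuousOn.integrableOn_compact isCompact_Icc)).mp hint
    exact Measure.eqOn_open_of_ae_eq (ae_restrict_of_ae_restrict_of_subset hUc h1) hU
      hDc.continuousOn continuousOn_const
  -- The unit circle without the point `1`: the density is known to vanish only at angles in the
  -- open cube, and an infinite set suffices.
  let S : Set ℂ := (fun s : ℝ => Complex.exp (s * Complex.I)) '' Ioo 0 (2 * Real.pi)
  have hS : S.Infinite := by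
    refine Set.Infinite.image (fun a ha b hb hab => ?_) (Ioo_infinite Real.two_pi_pos)
    have h1 := Complex.exp_eq_exp_iff_exists_int.mp hab
    obtain ⟨m, hm⟩ := h1
    have h2 : a = b + m * (2 * Real.pi) := by
      have h3 := congrArg Complex.im hm
      simpa using h3
    have hm0 : m = 0 := by
      have hp := Real.two_pi_pos
      have h4 : (m : ℝ) < 1 := by
        by_contra hcon
        push Not at hcon
        nlinarith [ha.2, hb.1]
      have h5 : (-1 : ℝ) < m := by
        by_contra hcon
        push Not at hcon
        nlinarith [ha.1, hb.2]
      have h6 : m < 1 := by exact_mod_cast h4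
      have h7 : -1 < m := by exact_mod_cast h5
      omega
    rw [hm0] at h2
    simpa using h2
  let P : MvPolynomial (Fin n) ℂ := MvPolynomial.map (algebraMap ℝ ℂ) (restr ℝ n f)
  have hP : ∀ x, MvPolynomial.eval x P = ev x f := fun x => by
    rw [ev_eq_aeval, MvPolynomial.aeval_def, MvPolynomial.eval_map]
  have hPV : P * vand n ℂ = 0 := by
    refine MvPolynomial.funext_set (fun _ => S) (fun _ => hS) fun x hx => ?_
    have hx' : ∀ i, ∃ s ∈ Ioo 0 (2 * Real.pi), Complex.exp ((s : ℝ) * Complex.I) = x i := fun i =>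
      hx i (mem_univ i)
    choose θ hθ hθx using hx'
    have hxθ : torusMap 0 (fun _ => (1 : ℝ)) θ = x := by
      funext i
      rw [torusMap_zero_apply, ← hθx i, Complex.ofReal_one, one_mul]
    have h1 : torusDensity q t f x = 0 := by
      rw [← hxθ]
      exact hzero fun i _ => hθ i
    have hxT : x ∈ torus n 1 := hxθ ▸ torusMap_mem one_pos θ
    rw [map_mul, map_zero, hP]
    by_cases hinj : Function.Injective x
    · rcases mul_eq_zero.mp h1 with h2 | h2
      · rw [Complex.normSq_eq_zero.mp h2, zero_mul]
      · exfalso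
        obtain ⟨i, _, hi⟩ := Finset.prod_eq_zero_iff.mp h2
        obtain ⟨j, hj, hij⟩ := Finset.prod_eq_zero_iff.mp hi
        refine pairWeight_ne_zero hq0 hq1 ht0 ht1 (norm_div_torus one_pos hxT i j) (fun h3 => ?_)
          (Complex.normSq_eq_zero.mp hij)
        rw [div_eq_one_iff_eq (torus_ne_zero one_pos hxT j)] at h3
        exact (Finset.mem_Ioi.mp hj).ne (hinj h3)
    · have h2 : MvPolynomial.eval x (vand n ℂ) = (Matrix.vandermonde x).det := by
        rw [vand, RingHom.map_det]
        congr 1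
        ext i j
        simp [Matrix.vandermonde_apply]
      rw [h2, Matrix.det_vandermonde_eq_zero_iff.mpr, mul_zero]
      rw [Function.Injective] at hinj
      push Not at hinj
      exact hinj
  have hV : vand n ℂ ≠ 0 := by
    intro h0
    have h1 : (Matrix.vandermonde fun i : Fin n => ((i : ℕ) : ℂ)).det = 0 := by
      have h2 := congrArg (MvPolynomial.eval fun i : Fin n => ((i : ℕ) : ℂ)) h0
      rw [vand, RingHom.map_det, map_zero] at h2
      rw [← h2]
      congr 1
      ext i j
      simp [Matrix.vandermonde_apply]
    refine Matrix.det_vandermonde_ne_zero_iff.mpr (fun i j hij => ?_) h1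
    exact Fin.ext (by exact_mod_cast hij)
  have hP0 := (mul_eq_zero.mp hPV).resolve_right hV
  exact MvPolynomial.map_injective _ (algebraMap ℝ ℂ).injective (hP0.trans (map_zero _).symm)

/-! ### Orthogonality -/

/-- Self-adjointness separates eigenfunctions with different eigenvalues, as for the other scalar
product. -/
theorem torusProduct_macFun_of_eigen (hq0 : 0 < q) (hq1 : q < 1) (ht0 : 0 < t) (ht1 : t < 1)
    {lam mu : YoungDiagram} (hl : lam.colLen 0 ≤ n) (hm : mu.colLen 0 ≤ n)
    (h : macEigen q t n lam ≠ macEigen q t n mu) :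
    torusProduct n q t (macFun q t lam) (macFun q t mu) = 0 := by
  have hnd := nondeg_real hq0 hq1 ht0 ht1
  have hq := pow_ne_one_of_lt_one hq0 hq1
  have ht := pow_ne_one_of_lt_one ht0 ht1
  have key := torusForm_opE (n := n) hq0 hq1 ht0 ht1 (macFun q t lam) (macFun q t mu)
  rw [opE_macFun ht0.ne' hq ht hnd lam, opE_macFun ht0.ne' hq ht hnd mu,
    ← torusForm_apply hq0 hq1 ht0 ht1, ← torusForm_apply hq0 hq1 ht0 ht1,
    LinearMap.map_smul₂, map_smul] at key
  rw [← torusForm_apply hq0 hq1 ht0 ht1]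
  by_contra h0
  have h1 := smul_left_injective ℝ h0 key
  have h2 := mcoeff_opE (q := q) ht0.ne' (triangular_macFun q t lam) hl
  have h3 := mcoeff_opE (q := q) ht0.ne' (triangular_macFun q t mu) hm
  rw [mcoeff_macFun_self, mul_one] at h2 h3
  rw [h1, h3] at h2
  refine h (mul_left_cancel₀ (sub_ne_zero.mpr ht1.ne) (add_left_cancel h2)).symm

theorem continuous_torusProduct (hq0 : 0 < q) (hq1 : q < 1) (f g : Fock ℝ) :
    Continuous fun t : Ioo (0 : ℝ) 1 => torusProduct n q t f g := by
  have : LocallyCompactSpace (Ioo (0 : ℝ) 1) := isOpen_Ioo.locallyCompactSpace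
  simp only [torusProduct, torusMean_eq one_pos]
  refine continuous_const.mul ?_
  refine continuous_parametric_integral_of_continuous (f := fun (t : Ioo (0 : ℝ) 1) θ =>
    ev (torusMap 0 (fun _ => (1 : ℝ)) θ)⁻¹ f * ev (torusMap 0 (fun _ => (1 : ℝ)) θ) g *
      weight (q : ℂ) (t : ℝ) (torusMap 0 (fun _ => (1 : ℝ)) θ)) ?_ isCompact_Icc
  have h1 : Continuous fun p : Ioo (0 : ℝ) 1 × (Fin n → ℝ) =>
      torusMap 0 (fun _ => (1 : ℝ)) p.2 := (continuous_torusMap _).comp continuous_snd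
  have h0 : ∀ θ : Fin n → ℝ, torusMap 0 (fun _ => (1 : ℝ)) θ ∈ torus n 1 := torusMap_mem one_pos
  refine Continuous.mul (Continuous.mul ?_ ?_) ?_
  · exact (continuousOn_ev_inv one_pos f).comp_continuous h1 fun p => h0 p.2
  · exact (continuous_ev g).comp h1
  · simp only [weight_eq, pairWeight]
    have h2 : ∀ i j, Continuous fun p : Ioo (0 : ℝ) 1 × (Fin n → ℝ) =>
        torusMap 0 (fun _ => (1 : ℝ)) p.2 i / torusMap 0 (fun _ => (1 : ℝ)) p.2 j := fun i j =>
      (continuous_pi_iff.mp h1 i).div (continuous_pi_iff.mp h1 j)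
        fun p => torus_ne_zero one_pos (h0 p.2) j
    refine continuous_finsetProd _ fun i _ => continuous_finsetProd _ fun j _ => ?_
    refine Continuous.div ((continuous_qPoch (norm_ofReal_lt hq0 hq1)).comp (h2 i j))
      ((continuous_qPoch (norm_ofReal_lt hq0 hq1)).comp (Continuous.mul ?_ (h2 i j))) fun p => ?_
    · exact Complex.continuous_ofReal.comp (continuous_subtype_val.comp continuous_fst)
    · refine qPoch_mul_ne_zero hq0 hq1 p.1.2.1 ?_
      rw [norm_div_torus one_pos (h0 p.2), mul_one]
      exact p.1.2.2

theorem continuous_pairing (f g : Fock ℝ) :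
    Continuous fun t : Ioo (0 : ℝ) 1 => pairing (zetaQT q (t : ℝ)) f g := by
  simp only [pairing_eq_sum _ f g f.support subset_rfl, zWeight, Finsupp.prod]
  refine continuous_finsetSum _ fun d _ => Continuous.mul (continuous_finsetProd _ fun m _ => ?_)
    continuous_const
  have h : Continuous fun t : Ioo (0 : ℝ) 1 => zetaQT q (t : ℝ) m := by
    refine continuous_const.div (by fun_prop) fun t => sub_ne_zero.mpr ?_
    exact (pow_ne_one_of_lt_one t.2.1 t.2.2 m m.pos).symm
  fun_prop

/-- The Gram matrix depends continuously on `t` and stays invertible on the whole interval. -/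
theorem continuous_macVec (hq0 : 0 < q) (hq1 : q < 1) (lam : YoungDiagram) (mu : below lam) :
    Continuous fun t : Ioo (0 : ℝ) 1 => macVec q (t : ℝ) lam mu := by
  have hgram : Continuous fun t : Ioo (0 : ℝ) 1 => gram q (t : ℝ) lam :=
    continuous_matrix fun i j => continuous_pairing _ _
  have hinv : Continuous fun t : Ioo (0 : ℝ) 1 => (gram q (t : ℝ) lam)⁻¹ := by
    simp only [Matrix.inv_def, Ring.inverse_eq_inv']
    exact (hgram.matrix_det.inv₀ fun t => nondeg_real hq0 hq1 t.2.1 t.2.2 lam).smul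
      hgram.matrix_adjugate
  have h : Continuous fun t : Ioo (0 : ℝ) 1 => macVec q (t : ℝ) lam := by
    unfold macVec
    exact (hinv.matrix_mulVec (continuous_pi fun _ => continuous_pairing _ _)).neg
  exact continuous_pi_iff.mp h mu

theorem continuous_torusProduct_macFun (hq0 : 0 < q) (hq1 : q < 1) (lam mu : YoungDiagram) :
    Continuous fun t : Ioo (0 : ℝ) 1 =>
      torusProduct n q t (macFun q (t : ℝ) lam) (macFun q (t : ℝ) mu) := by
  have h : ∀ t : Ioo (0 : ℝ) 1, torusProduct n q t (macFun q (t : ℝ) lam) (macFun q (t : ℝ) mu) =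
      torusProduct n q t (mono ℝ lam) (mono ℝ mu) +
      ∑ a, ((macVec q (t : ℝ) lam a : ℝ) : ℂ) *
        torusProduct n q t (mono ℝ (a : YoungDiagram)) (mono ℝ mu) +
      ∑ b, ((macVec q (t : ℝ) mu b : ℝ) : ℂ) *
        (torusProduct n q t (mono ℝ lam) (mono ℝ (b : YoungDiagram)) +
        ∑ a, ((macVec q (t : ℝ) lam a : ℝ) : ℂ) *
        torusProduct n q t (mono ℝ (a : YoungDiagram)) (mono ℝ (b : YoungDiagram))) := by
    intro t
    simp only [← torusForm_apply hq0 hq1 t.2.1 t.2.2, macFun, map_add, LinearMap.add_apply,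
      map_sum, LinearMap.sum_apply, map_smul, LinearMap.smul_apply, Complex.real_smul]
  simp only [h]
  have h1 : ∀ f g : Fock ℝ, Continuous fun t : Ioo (0 : ℝ) 1 => torusProduct n q t f g :=
    continuous_torusProduct hq0 hq1
  have h2 : ∀ (nu : YoungDiagram) (a : below nu),
      Continuous fun t : Ioo (0 : ℝ) 1 => ((macVec q (t : ℝ) nu a : ℝ) : ℂ) := fun nu a =>
    Complex.continuous_ofReal.comp (continuous_macVec hq0 hq1 nu a)
  fun_prop

/-- The difference of the eigenvalues is a polynomial in `t` whose coefficients are the differences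
`q^(lam_i) - q^(mu_i)`; one of them is nonzero. -/
theorem finite_macEigen_eq (hq0 : 0 < q) (hq1 : q < 1) {lam mu : YoungDiagram}
    (hl : lam.colLen 0 ≤ n) (hm : mu.colLen 0 ≤ n) (hne : lam ≠ mu) :
    {t : ℝ | macEigen q t n lam = macEigen q t n mu}.Finite := by
  let p : Polynomial ℝ := ∑ i : Fin n,
    Polynomial.monomial (i.rev : ℕ) (q ^ lam.rowLen i - q ^ mu.rowLen i)
  have hp : p ≠ 0 := by
    obtain ⟨i, hi⟩ : ∃ i : Fin n, lam.rowLen i ≠ mu.rowLen i := by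
      by_contra hcon
      push Not at hcon
      refine hne (diagram_ext fun i => ?_)
      by_cases hin : i < n
      · exact hcon ⟨i, hin⟩
      · rw [(rowLen_eq_zero_iff _ _).mpr (by omega), (rowLen_eq_zero_iff _ _).mpr (by omega)]
    intro h0
    have h1 := congrArg (fun p => p.coeff (i.rev : ℕ)) h0
    simp only [p, Polynomial.finsetSum_coeff, Polynomial.coeff_monomial, Polynomial.coeff_zero] at h1
    rw [Finset.sum_eq_single i (fun j _ hj => if_neg fun h => hj (Fin.rev_injective (Fin.ext h)))
      (fun h => absurd (Finset.mem_univ i) h), if_pos rfl, sub_eq_zero] at h1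
    exact hi (pow_right_injective₀ hq0 hq1.ne h1)
  refine (p.roots.toFinset.finite_toSet).subset fun t ht => ?_
  rw [Finset.mem_coe, Multiset.mem_toFinset, Polynomial.mem_roots hp, Polynomial.IsRoot.def]
  have h2 : p.eval t = macEigen q t n lam - macEigen q t n mu := by
    simp only [p, Polynomial.eval_finsetSum, Polynomial.eval_monomial, macEigen,
      ← Finset.sum_sub_distrib]
    exact Finset.sum_congr rfl fun i _ => by ring
  rw [h2, sub_eq_zero]
  exact ht

/-- For fixed `q` the eigenvalues coincide for finitely many `t` only; continuity in `t` fills in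
these values. -/
theorem torusProduct_macFun (hq0 : 0 < q) (hq1 : q < 1) (ht0 : 0 < t) (ht1 : t < 1)
    {lam mu : YoungDiagram} (hl : lam.colLen 0 ≤ n) (hm : mu.colLen 0 ≤ n) (hne : lam ≠ mu) :
    torusProduct n q t (macFun q t lam) (macFun q t mu) = 0 := by
  have hbad := finite_macEigen_eq hq0 hq1 hl hm hne
  let F : Ioo (0 : ℝ) 1 → ℂ := fun t =>
    torusProduct n q t (macFun q (t : ℝ) lam) (macFun q (t : ℝ) mu)
  have hF : Continuous F := continuous_torusProduct_macFun hq0 hq1 lam mu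
  have hdense : Dense {s : Ioo (0 : ℝ) 1 | macEigen q (s : ℝ) n lam = macEigen q (s : ℝ) n mu}ᶜ :=
    Dense.preimage (s := {s : ℝ | macEigen q s n lam = macEigen q s n mu}ᶜ)
      (hbad.countable.dense_compl ℝ) isOpen_Ioo.isOpenMap_subtype_val
  have h0 : F = fun _ => 0 := by
    refine Continuous.ext_on hdense hF continuous_const fun s hs => ?_
    exact torusProduct_macFun_of_eigen hq0 hq1 s.2.1 s.2.2 hl hm hs
  exact congrFun h0 ⟨t, ht0, ht1⟩

end

end Macdonald


/-! ### Macdonald functions in finitely many variables, and comparison of the two scalar products -/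

namespace Macdonald

section

variable {n : ℕ} {q t : ℝ}

theorem ev_eq_zero_of_restr {f : Fock ℝ} (h : restr ℝ n f = 0) (x : Fin n → ℂ) : ev x f = 0 := by
  rw [ev_eq_aeval, h, map_zero]

theorem torusMean_zero (R : ℝ) : torusMean n R (fun _ => 0) = 0 := by
  have := torusMean_const_mul (n := n) R 0 fun _ => 0
  simpa using this

theorem torusProduct_eq_zero_left {f : Fock ℝ} (h : restr ℝ n f = 0) (g : Fock ℝ) :
    torusProduct n q t f g = 0 := by
  simp only [torusProduct, ev_eq_zero_of_restr h, zero_mul, torusMean_zero]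

theorem torusProduct_eq_zero_right {g : Fock ℝ} (h : restr ℝ n g = 0) (f : Fock ℝ) :
    torusProduct n q t f g = 0 := by
  simp only [torusProduct, ev_eq_zero_of_restr h, mul_zero, zero_mul, torusMean_zero]

/-- A Macdonald function whose partition has more than `n` parts restricts to zero in `n` variables,
so no bound on the lengths is needed. -/
theorem torusProduct_macFun_of_ne (hq0 : 0 < q) (hq1 : q < 1) (ht0 : 0 < t) (ht1 : t < 1)
    {lam mu : YoungDiagram} (hne : lam ≠ mu) :
    torusProduct n q t (macFun q t lam) (macFun q t mu) = 0 := by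
  rcases lt_or_ge n (lam.colLen 0) with hl | hl
  · exact torusProduct_eq_zero_left (restr_eq_zero_of_triangular (triangular_macFun q t lam) hl) _
  rcases lt_or_ge n (mu.colLen 0) with hm | hm
  · exact torusProduct_eq_zero_right (restr_eq_zero_of_triangular (triangular_macFun q t mu) hm) _
  exact torusProduct_macFun hq0 hq1 ht0 ht1 hl hm hne

theorem torusProduct_strictTriangular (hq0 : 0 < q) (hq1 : q < 1) (ht0 : 0 < t) (ht1 : t < 1)
    {g : Fock ℝ} {lam : YoungDiagram} (hg : StrictTriangular g lam) :
    torusProduct n q t g (macFun q t lam) = 0 :=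
  map_strictTriangular_of_family (triangular_macFun q t) (mcoeff_macFun_self q t)
    ((torusForm n hq0 hq1 ht0 ht1).flip (macFun q t lam)) lam
    (fun _ _ hne => torusProduct_macFun_of_ne hq0 hq1 ht0 ht1 hne) hg

/-- In `n` variables `e_n = x_1 ⋯ x_n`, and its values at `x` and at the inverted point multiply to
`1`. -/
theorem torusProduct_elem_pow (s : ℕ) (f g : Fock ℝ) :
    torusProduct n q t (expFam (elemWeight ℝ) n ^ s * f) (expFam (elemWeight ℝ) n ^ s * g) =
      torusProduct n q t f g := by
  refine torusMean_congr one_pos fun x hx => ?_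
  rw [map_mul, map_mul, map_pow, map_pow, ev_elem, ev_elem]
  have h : (∏ i, x⁻¹ i) ^ s * (∏ i, x i) ^ s = 1 := by
    rw [← mul_pow, ← Finset.prod_mul_distrib, Finset.prod_eq_one, one_pow]
    intro i _
    exact inv_mul_cancel₀ (torus_ne_zero one_pos hx i)
  linear_combination ev x⁻¹ f * ev x g * weight (q : ℂ) t x * h

/-! ### Adding columns of full length -/

theorem exists_remove_columns {lam : YoungDiagram} {s : ℕ} (hl : lam.colLen 0 ≤ n)
    (h : ∀ i < n, s ≤ lam.rowLen i) :
    ∃ nu : YoungDiagram, ∀ i, lam.rowLen i = nu.rowLen i + if i < n then s else 0 := by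
  let nu : YoungDiagram :=
    { cells := lam.cells.filter fun c => (c.1, c.2 + s) ∈ lam
      isLowerSet := by
        intro a b hab ha
        rw [Finset.mem_coe, Finset.mem_filter] at ha ⊢
        exact ⟨lam.isLowerSet hab ha.1,
          lam.isLowerSet (show (b.1, b.2 + s) ≤ (a.1, a.2 + s) from
            ⟨hab.1, Nat.add_le_add_right hab.2 s⟩) ha.2⟩ }
  have hmem : ∀ i j, (i, j) ∈ nu ↔ (i, j + s) ∈ lam := by
    intro i j
    rw [← YoungDiagram.mem_cells, Finset.mem_filter]
    exact ⟨fun h => h.2, fun h => ⟨lam.isLowerSet (show (i, j) ≤ (i, j + s) from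
      ⟨le_rfl, Nat.le_add_right _ _⟩) h, h⟩⟩
  have hrow : ∀ i, nu.rowLen i = lam.rowLen i - s := by
    intro i
    refine eq_of_forall_lt_iff fun j => ?_
    rw [← YoungDiagram.mem_iff_lt_rowLen, hmem, YoungDiagram.mem_iff_lt_rowLen]
    omega
  refine ⟨nu, fun i => ?_⟩
  rw [hrow]
  split_ifs with hi
  · have := h i hi
    omega
  · have := (rowLen_eq_zero_iff lam i).mpr (by omega)
    omega

/-- The totals agree and the first `n - 1` rows of `nu` sum to at most those of `mu`, so the last
row of `nu` is at least that of `mu`; the other rows are longer still. -/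
theorem le_rowLen_of_dominates {mu nu : YoungDiagram} {s : ℕ} (hm : mu.colLen 0 ≤ n)
    (h : ∀ i < n, s ≤ mu.rowLen i) (hd : Dominates mu nu) (hn : nu.colLen 0 ≤ n) (i : ℕ)
    (hi : i < n) : s ≤ nu.rowLen i := by
  obtain ⟨m, rfl⟩ : ∃ m, n = m + 1 := ⟨n - 1, by omega⟩
  refine le_trans ?_ (nu.rowLen_anti i m (Nat.lt_succ_iff.mp hi))
  have h1 := hd.2 m
  have h2 := sum_range_rowLen mu hm
  have h3 := sum_range_rowLen nu hn
  rw [Finset.sum_range_succ] at h2 h3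
  have h4 := h m (Nat.lt_succ_self m)
  have h5 := hd.1
  omega

theorem dominates_of_add {lam mu nu kap : YoungDiagram} {s : ℕ}
    (h1 : ∀ i, mu.rowLen i = lam.rowLen i + if i < n then s else 0)
    (h2 : ∀ i, nu.rowLen i = kap.rowLen i + if i < n then s else 0) (hd : Dominates mu nu) :
    Dominates lam kap := by
  have hsum : ∀ r, ∑ i ∈ Finset.range r, kap.rowLen i ≤ ∑ i ∈ Finset.range r, lam.rowLen i := by
    intro r
    have h := hd.2 r
    simp only [h1, h2, Finset.sum_add_distrib] at h
    omega
  refine ⟨?_, hsum⟩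
  let N := max n (max (max (lam.colLen 0) (mu.colLen 0)) (max (nu.colLen 0) (kap.colLen 0)))
  have e1 := sum_range_rowLen lam (show lam.colLen 0 ≤ N by omega)
  have e2 := sum_range_rowLen mu (show mu.colLen 0 ≤ N by omega)
  have e3 := sum_range_rowLen nu (show nu.colLen 0 ≤ N by omega)
  have e4 := sum_range_rowLen kap (show kap.colLen 0 ≤ N by omega)
  simp only [h1, Finset.sum_add_distrib] at e2
  simp only [h2, Finset.sum_add_distrib] at e3
  have := hd.1
  omega

/-- The restriction of a Macdonald function to `n` variables is multiplied by `(x_1 ⋯ x_n)^s` when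
`s` columns of length `n` are added to the partition. -/
theorem ev_macFun_add_columns (hq0 : 0 < q) (hq1 : q < 1) (ht0 : 0 < t) (ht1 : t < 1)
    {lam mu : YoungDiagram} {s : ℕ} (hl : lam.colLen 0 ≤ n)
    (hmu : ∀ i, mu.rowLen i = lam.rowLen i + if i < n then s else 0) (x : Fin n → ℂ) :
    ev x (macFun q t mu) = (∏ i, x i) ^ s * ev x (macFun q t lam) := by
  have hm : mu.colLen 0 ≤ n := by
    rw [← rowLen_eq_zero_iff] at hl ⊢
    rw [hmu, hl, if_neg (lt_irrefl n)]
  have hms : ∀ i < n, s ≤ mu.rowLen i := fun i hi => by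
    rw [hmu, if_pos hi]
    omega
  let E : Fock ℝ := expFam (elemWeight ℝ) n ^ s
  -- The aim is to show that `G` has norm zero in `n` variables. Both terms have leading term
  -- `m_mu`, so `G` lies strictly below `mu`.
  let G : Fock ℝ := macFun q t mu - E * macFun q t lam
  have hE := elem_pow_mul_triangular hmu (triangular_macFun q t lam)
  have hG : StrictTriangular G mu := by
    refine strictTriangular_sub (triangular_macFun q t mu) hE.1 ?_
    rw [hE.2, mcoeff_macFun_self, mcoeff_macFun_self]
  let p : YoungDiagram → YoungDiagram → Prop := fun nu kap =>
    ∀ i, nu.rowLen i = kap.rowLen i + if i < n then s else 0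
  -- A unitriangular family adapted to the problem: where `s` full columns can be removed from `nu`,
  -- the monomial function is replaced by `e_n^s` times the one with the columns removed.
  let B : YoungDiagram → Fock ℝ := fun nu =>
    if h : ∃ kap, p nu kap then E * mono ℝ h.choose else mono ℝ nu
  have hB : ∀ nu, Triangular (B nu) nu ∧ mcoeff nu (B nu) = 1 := by
    intro nu
    by_cases h : ∃ kap, p nu kap
    · have h1 := elem_pow_mul_triangular h.choose_spec (triangular_mono (k := ℝ) h.choose)
      simp only [B, dif_pos h]
      rwa [mcoeff_mono, if_pos rfl] at h1
    · simp only [B, dif_neg h]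
      exact ⟨triangular_mono nu, by rw [mcoeff_mono, if_pos rfl]⟩
  have hmono : ∀ nu, Dominates mu nu → nu ≠ mu → torusProduct n q t (B nu) G = 0 := by
    intro nu hd hne
    have h1 : torusProduct n q t (B nu) (macFun q t mu) = 0 :=
      torusProduct_strictTriangular hq0 hq1 ht0 ht1 ((hB nu).1.strict hd hne)
    -- If `nu` has the full columns, the factors `e_n^s` cancel on the torus and orthogonality for
    -- `lam` applies. Otherwise, being dominated by `mu`, it must have more than `n` rows, and
    -- `m_nu` vanishes in `n` variables.
    have h2 : torusProduct n q t (B nu) (E * macFun q t lam) = 0 := by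
      by_cases h : ∃ kap, p nu kap
      · simp only [B, dif_pos h]
        have hk := h.choose_spec
        rw [torusProduct_elem_pow]
        refine torusProduct_strictTriangular hq0 hq1 ht0 ht1
          ((triangular_mono _).strict (dominates_of_add hmu hk hd) fun he => hne ?_)
        refine diagram_ext fun i => ?_
        rw [hmu, hk i, he]
      · simp only [B, dif_neg h]
        refine torusProduct_eq_zero_left (restr_mono_eq_zero ?_) _
        by_contra hcon
        push Not at hcon
        exact h (exists_remove_columns hcon (le_rowLen_of_dominates hm hms hd hcon))
    rw [← torusForm_apply hq0 hq1 ht0 ht1, map_sub, torusForm_apply, torusForm_apply, h1, h2,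
      sub_zero]
  have hGG : torusProduct n q t G G = 0 :=
    map_strictTriangular_of_family (fun nu => (hB nu).1) (fun nu => (hB nu).2)
      ((torusForm n hq0 hq1 ht0 ht1).flip G) mu hmono hG
  have h0 := ev_eq_zero_of_restr (restr_eq_zero_of_torusProduct hq0 hq1 ht0 ht1 hGG) x
  rw [map_sub, sub_eq_zero] at h0
  rw [h0, map_mul, map_pow, ev_elem]

/-! ### Comparison of the two scalar products -/

theorem eq_zero_of_macFun {M : Type*} [AddCommGroup M] [Module ℝ M] (φ : Fock ℝ →ₗ[ℝ] M)
    (h : ∀ lam, φ (macFun q t lam) = 0) (f : Fock ℝ) : φ f = 0 := by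
  have h1 : ∀ lam, φ (mono ℝ lam) = 0 := fun lam => by
    rw [map_triangular (triangular_macFun q t) (mcoeff_macFun_self q t) φ lam
      (fun mu _ _ => h mu) (triangular_mono lam), h, smul_zero]
  rw [eq_sum_mono f (scoeff_expo_finite (toSymFun ℝ f)).toFinset fun mu hmu => by
    rw [Set.Finite.mem_toFinset]
    exact hmu, map_sum]
  exact Finset.sum_eq_zero fun mu _ => by rw [map_smul, h1, smul_zero]

/-- Both functionals of `f` vanish on every `P_mu` with `mu ≠ lam`, and the `P_mu` span; so they are
proportional, with the factor fixed at `P_lam`. -/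
theorem torusProduct_macFun_right (hq0 : 0 < q) (hq1 : q < 1) (ht0 : 0 < t) (ht1 : t < 1)
    (f : Fock ℝ) (lam : YoungDiagram) : torusProduct n q t f (macFun q t lam) =
      torusProduct n q t (macFun q t lam) (macFun q t lam) / macNorm q t lam *
        (pairing (zetaQT q t) f (macFun q t lam) : ℝ) := by
  have hN : ((macNorm q t lam : ℝ) : ℂ) ≠ 0 := by
    exact_mod_cast (macNorm_pos hq0 hq1 ht0 ht1 lam).ne'
  let φ : Fock ℝ →ₗ[ℝ] ℂ := (torusForm n hq0 hq1 ht0 ht1).flip (macFun q t lam) -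
    (LinearMap.toSpanSingleton ℝ ℂ
      (torusProduct n q t (macFun q t lam) (macFun q t lam) / macNorm q t lam)) ∘ₗ
      (pairing (zetaQT q t)).flip (macFun q t lam)
  have hφ : ∀ f, φ f = torusProduct n q t f (macFun q t lam) -
      (pairing (zetaQT q t) f (macFun q t lam) : ℝ) *
      (torusProduct n q t (macFun q t lam) (macFun q t lam) / macNorm q t lam) := fun f => rfl
  have h0 := eq_zero_of_macFun (q := q) (t := t) φ (fun mu => ?_) f
  · rw [hφ, sub_eq_zero] at h0
    rw [h0, mul_comm]
  · rw [hφ]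
    by_cases hne : mu = lam
    · subst hne
      rw [← macNorm, mul_div_cancel₀ _ hN, sub_self]
    · rw [torusProduct_macFun_of_ne hq0 hq1 ht0 ht1 hne,
        pairing_macFun_real hq0 hq1 ht0 ht1 hne, Complex.ofReal_zero, zero_mul, sub_zero]

end

end Macdonald


/-! ### Cauchy kernels as generating series, and integration against them -/

namespace Macdonald

/-! ### Products of absolutely convergent series -/

section

variable {𝕜 : Type*} [NormedField 𝕜] [CompleteSpace 𝕜]

/-- Cauchy products of absolutely convergent series, one factor at a time; absolute convergence is
carried along in the induction. -/
theorem hasSum_coeff_prod {ι : Type*} (s : Finset ι) {F : ι → PowerSeries 𝕜} {z : 𝕜} {v : ι → 𝕜}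
    (hs : ∀ j ∈ s, Summable fun m => ‖PowerSeries.coeff m (F j) * z ^ m‖)
    (hv : ∀ j ∈ s, HasSum (fun m => PowerSeries.coeff m (F j) * z ^ m) (v j)) :
    (Summable fun m => ‖PowerSeries.coeff m (∏ j ∈ s, F j) * z ^ m‖) ∧
      HasSum (fun m => PowerSeries.coeff m (∏ j ∈ s, F j) * z ^ m) (∏ j ∈ s, v j) := by
  induction s using Finset.induction_on with
  | empty =>
    have h : ∀ m, m ≠ 0 → PowerSeries.coeff m (1 : PowerSeries 𝕜) * z ^ m = 0 := fun m hm => by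
      rw [PowerSeries.coeff_one, if_neg hm, zero_mul]
    simp only [Finset.prod_empty]
    constructor
    · exact summable_of_ne_finset_zero (s := {0}) fun m hm => by
        rw [h m (by simpa using hm), norm_zero]
    · have := hasSum_single (f := fun m => PowerSeries.coeff m (1 : PowerSeries 𝕜) * z ^ m) 0 h
      simpa using this
  | insert i s hi ih =>
    obtain ⟨h1, h2⟩ := ih (fun j hj => hs j (Finset.mem_insert_of_mem hj))
      fun j hj => hv j (Finset.mem_insert_of_mem hj)
    have h3 := hs i (Finset.mem_insert_self _ _)
    have h4 := hv i (Finset.mem_insert_self _ _)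
    have hc : ∀ m, PowerSeries.coeff m (∏ j ∈ insert i s, F j) * z ^ m =
        ∑ p ∈ Finset.HasAntidiagonal.antidiagonal m, (PowerSeries.coeff p.1 (F i) * z ^ p.1) *
          (PowerSeries.coeff p.2 (∏ j ∈ s, F j) * z ^ p.2) := by
      intro m
      rw [Finset.prod_insert hi, PowerSeries.coeff_mul, Finset.sum_mul]
      refine Finset.sum_congr rfl fun p hp => ?_
      rw [← Finset.HasAntidiagonal.mem_antidiagonal.mp hp, pow_add]
      ring
    simp only [hc]
    have h5 := summable_norm_sum_mul_antidiagonal_of_summable_norm h3 h1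
    refine ⟨h5, ?_⟩
    rw [Finset.prod_insert hi, ← h4.tsum_eq, ← h2.tsum_eq,
      tsum_mul_tsum_eq_tsum_sum_antidiagonal_of_summable_norm h3 h1]
    exact h5.of_norm.hasSum

/-- Absolutely convergent series may be multiplied out over all tuples of indices; the first
coordinate is split off inductively. -/
theorem hasSum_pi_prod {m : ℕ} {g : Fin m → ℕ → 𝕜} {v : Fin m → 𝕜}
    (hs : ∀ i, Summable fun k => ‖g i k‖) (hv : ∀ i, HasSum (g i) (v i)) :
    (Summable fun a : Fin m → ℕ => ‖∏ i, g i (a i)‖) ∧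
      HasSum (fun a : Fin m → ℕ => ∏ i, g i (a i)) (∏ i, v i) := by
  induction m with
  | zero =>
    simp only [Finset.univ_eq_empty, Finset.prod_empty]
    refine ⟨(hasSum_fintype _).summable, ?_⟩
    simp
  | succ m ih =>
    obtain ⟨h1, h2⟩ := ih (g := fun i => g i.succ) (v := fun i => v i.succ) (fun i => hs _)
      fun i => hv _
    let e : ℕ × (Fin m → ℕ) ≃ (Fin (m + 1) → ℕ) := Fin.consEquiv fun _ => ℕ
    have he : ∀ p, (∏ i, g i (e p i)) = g 0 p.1 * ∏ i : Fin m, g i.succ (p.2 i) := fun p => by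
      rw [Fin.prod_univ_succ]
      rfl
    constructor
    · rw [← e.summable_iff]
      refine ((hs 0).mul_norm h1).congr fun p => ?_
      rw [Function.comp_apply, he]
    · rw [← e.hasSum_iff, Fin.prod_univ_succ]
      have h3 : HasSum (fun p : ℕ × (Fin m → ℕ) => g 0 p.1 * ∏ i : Fin m, g i.succ (p.2 i))
          (v 0 * ∏ i : Fin m, v i.succ) := by
        rw [← (hv 0).tsum_eq, ← h2.tsum_eq, tsum_mul_tsum_of_summable_norm (hs 0) h1]
        exact (summable_mul_of_summable_norm (hs 0) h1).hasSum
      have h5 : (fun a : Fin (m + 1) → ℕ => ∏ i, g i (a i)) ∘ e =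
          fun p => g 0 p.1 * ∏ i : Fin m, g i.succ (p.2 i) := funext he
      rw [h5]
      exact h3

end

/-- Majorant series multiply. -/
theorem norm_coeff_prod_le {𝕜 : Type*} [NormedField 𝕜] {ι : Type*} (s : Finset ι)
    {F : ι → PowerSeries 𝕜} {C : ℕ → ℝ}
    (h : ∀ j ∈ s, ∀ m, ‖PowerSeries.coeff m (F j)‖ ≤ C m) (m : ℕ) :
    ‖PowerSeries.coeff m (∏ j ∈ s, F j)‖ ≤
      PowerSeries.coeff m (∏ _j ∈ s, PowerSeries.mk C) := by
  induction s using Finset.induction_on generalizing m with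
  | empty =>
    simp only [Finset.prod_empty, PowerSeries.coeff_one]
    split_ifs <;> simp
  | insert i s hi ih =>
    rw [Finset.prod_insert hi, Finset.prod_insert hi, PowerSeries.coeff_mul, PowerSeries.coeff_mul]
    refine (norm_sum_le _ _).trans (Finset.sum_le_sum fun p _ => ?_)
    rw [norm_mul, PowerSeries.coeff_mk]
    have h1 := h i (Finset.mem_insert_self _ _) p.1
    exact mul_le_mul h1 (ih (fun j hj => h j (Finset.mem_insert_of_mem hj)) p.2) (norm_nonneg _)
      ((norm_nonneg _).trans h1)

section

open MeasureTheory

variable {n m : ℕ} {q t : ℝ}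

theorem isCompact_torus (n : ℕ) (R : ℝ) : IsCompact (torus n R) := by
  have h : torus n R = Set.pi Set.univ fun _ => Metric.sphere (0 : ℂ) R := by
    ext x
    simp [torus]
  rw [h]
  exact isCompact_univ_pi fun _ => isCompact_sphere _ _

theorem hasSum_torusMean {R : ℝ} (hR : 0 < R) {ι : Type*} [Countable ι]
    {f : ι → (Fin n → ℂ) → ℂ} {g : (Fin n → ℂ) → ℂ} {D : ι → ℝ}
    (hf : ∀ i, ContinuousOn (f i) (torus n R)) (hD : ∀ i, ∀ x ∈ torus n R, ‖f i x‖ ≤ D i)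
    (hs : Summable D) (hg : ∀ x ∈ torus n R, HasSum (fun i => f i x) (g x)) :
    HasSum (fun i => torusMean n R (f i)) (torusMean n R g) := by
  simp only [torusMean_eq hR]
  refine HasSum.mul_left _ ?_
  refine hasSum_integral_of_dominated_convergence (fun i _ => D i) (fun i => ?_) (fun i => ?_) ?_ ?_
    ?_
  · exact (continuous_comp_torusMap hR (hf i)).aestronglyMeasurable
  · exact Filter.Eventually.of_forall fun θ => hD i _ (torusMap_mem hR θ)
  · exact Filter.Eventually.of_forall fun θ => hs
  · exact integrableOn_const isCompact_Icc.measure_ne_top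
  · exact Filter.Eventually.of_forall fun θ => hg _ (torusMap_mem hR θ)

/-- The generating function of an exponential family of symmetric functions. -/
theorem hasSum_ev_expFam (hq0 : 0 < q) (hq1 : q < 1) (a b : ℝ) {z : ℂ} (hz : |a| * ‖z‖ < 1)
    {y : Fin n → ℂ} (hy : y ∈ torus n 1) :
    HasSum (fun k => z ^ k * ev y⁻¹ (expFam (qWeight a b q) k))
      (∏ j, qPoch (b * z / y j) q / qPoch (a * z / y j) q) := by
  have hq := norm_ofReal_lt hq0 hq1
  have hz' : ∀ j, ‖(a : ℂ) * (z * (y j)⁻¹)‖ < 1 := fun j => by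
    rwa [norm_mul, norm_mul, norm_inv, hy j, inv_one, mul_one, Complex.norm_real]
  have hcoeff : ∀ (j : Fin n) (k : ℕ), PowerSeries.coeff k
      (PowerSeries.mk fun i => algebraMap ℝ ℂ (qBinom a b q i) * y⁻¹ j ^ i) * z ^ k =
      qBinom (a : ℂ) b q k * (z * (y j)⁻¹) ^ k := fun j k => by
    rw [PowerSeries.coeff_mk, mul_pow, ← ofReal_qBinom]
    change ((qBinom a b q k : ℝ) : ℂ) * (y j)⁻¹ ^ k * z ^ k = _
    ring
  have h := (hasSum_coeff_prod Finset.univ (z := z)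
    (F := fun j => PowerSeries.mk fun i => algebraMap ℝ ℂ (qBinom a b q i) * y⁻¹ j ^ i)
    (v := fun j => qPoch (b * z / y j) q / qPoch (a * z / y j) q) (fun j _ => ?_)
    fun j _ => ?_).2
  · have h1 : (fun k => z ^ k * ev y⁻¹ (expFam (qWeight a b q) k)) = fun k => PowerSeries.coeff k
        (∏ j, PowerSeries.mk fun i => algebraMap ℝ ℂ (qBinom a b q i) * y⁻¹ j ^ i) * z ^ k := by
      funext k
      rw [ev_expFam (qWeight a b q) (qBinom a b q) rfl (qBinom_newton a b q fun i =>
        pow_ne_one_of_lt_one hq0 hq1 _ (Nat.succ_pos i)), mul_comm]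
    rw [h1]
    exact h
  · simp only [hcoeff]
    exact summable_norm_qBinom hq (hz' j)
  · simp only [hcoeff, mul_div_assoc, div_eq_mul_inv (z : ℂ)]
    exact hasSum_qBinom hq (hz' j)

/-- Since `|y_j| = 1`, replacing all coefficients by their absolute values gives a convergent
majorant independent of `y`. -/
theorem exists_bound_ev_expFam (hq0 : 0 < q) (hq1 : q < 1) (n : ℕ) (a b : ℝ) {z : ℂ}
    (hz : |a| * ‖z‖ < 1) : ∃ D : ℕ → ℝ, Summable D ∧ (∀ k, 0 ≤ D k) ∧
      ∀ y ∈ torus n 1, ∀ k, ‖z ^ k * ev y⁻¹ (expFam (qWeight a b q) k)‖ ≤ D k := by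
  let C : ℕ → ℝ := fun k => |qBinom a b q k|
  have hCs : Summable fun k => ‖PowerSeries.coeff k (PowerSeries.mk C) * ‖z‖ ^ k‖ := by
    have h1 := summable_norm_qBinom (a := (a : ℂ)) (b := b) (norm_ofReal_lt hq0 hq1) (z := z)
      (by rwa [norm_mul, Complex.norm_real])
    refine h1.congr fun k => ?_
    rw [PowerSeries.coeff_mk, ← ofReal_qBinom, norm_mul, norm_mul, Complex.norm_real, norm_pow,
      norm_pow, norm_norm, Real.norm_eq_abs, Real.norm_eq_abs, abs_abs]
  have h := (hasSum_coeff_prod (Finset.univ : Finset (Fin n)) (z := ‖z‖)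
    (F := fun _ => PowerSeries.mk C) (fun _ _ => hCs)
    fun _ _ => hCs.of_norm.hasSum).1
  refine ⟨_, h, fun k => norm_nonneg _, fun y hy k => ?_⟩
  rw [norm_mul, norm_pow, ev_expFam (qWeight a b q) (qBinom a b q) rfl (qBinom_newton a b q fun i =>
      pow_ne_one_of_lt_one hq0 hq1 _ (Nat.succ_pos i)), mul_comm]
  refine le_trans ?_ (le_abs_self _)
  refine mul_le_mul_of_nonneg_right (norm_coeff_prod_le _ (fun j _ i => ?_) k)
    (pow_nonneg (norm_nonneg _) _)
  rw [PowerSeries.coeff_mk, norm_mul, norm_pow, Pi.inv_apply, norm_inv, hy j, inv_one, one_pow,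
    mul_one]
  exact (Complex.norm_real _).le

/-- Only finitely many terms are nonzero; the form as a sum over all tuples matches the expansion of
a kernel. -/
theorem hasSum_ev (f : Fock ℝ) (x : Fin m → ℂ) :
    HasSum (fun a : Fin m → ℕ => (∏ i, x i ^ a i) * ((scoeff (finExp a) (toSymFun ℝ f) : ℝ) : ℂ))
      (ev x f) := by
  let e : (Fin m →₀ ℕ) ≃ (Fin m → ℕ) := Finsupp.equivFunOnFinite
  rw [← e.hasSum_iff, ev_eq_aeval, MvPolynomial.aeval_def, MvPolynomial.eval₂_eq]
  have h : ∀ d : Fin m →₀ ℕ, scoeff (finExp (e d)) (toSymFun ℝ f) = (restr ℝ m f).coeff d := by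
    intro d
    rw [coeff_restr, finExp]
    exact congrArg (fun d : Fin m →₀ ℕ => scoeff (d.embDomain Fin.valEmbedding) (toSymFun ℝ f))
      (e.symm_apply_apply d)
  have h1 : ∀ d : Fin m →₀ ℕ, algebraMap ℝ ℂ ((restr ℝ m f).coeff d) * ∏ i ∈ d.support, x i ^ d i =
      (∏ i, x i ^ e d i) * ((scoeff (finExp (e d)) (toSymFun ℝ f) : ℝ) : ℂ) := by
    intro d
    rw [h, mul_comm]
    congr 1
    exact (Finset.prod_subset (Finset.subset_univ _) fun i _ hi => by
      rw [Finsupp.notMem_support_iff.mp hi, pow_zero])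
  rw [Finset.sum_congr rfl fun d _ => h1 d]
  refine hasSum_sum_of_ne_finset_zero fun d hd => ?_
  rw [Function.comp_apply, h, MvPolynomial.notMem_support_iff.mp hd, Complex.ofReal_zero, mul_zero]

/-- Integration of a Macdonald function against a Cauchy kernel over the unit torus. -/
theorem torusMean_kernel_one (hq0 : 0 < q) (hq1 : q < 1) (ht0 : 0 < t) (ht1 : t < 1) (a b : ℝ)
    (lam : YoungDiagram) {x : Fin m → ℂ} (hx : ∀ i, |a| * ‖x i‖ < 1) :
    torusMean n 1 (fun y => (∏ i, ∏ j, qPoch (b * x i / y j) q / qPoch (a * x i / y j) q) *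
      (weight (q : ℂ) t y * ev y (macFun q t lam))) =
    torusProduct n q t (macFun q t lam) (macFun q t lam) / macNorm q t lam *
      ev x (scale (fun r => qWeight a b q r * zetaQT q t r) (macFun q t lam)) := by
  choose D hDs hD0 hD using fun i => exists_bound_ev_expFam hq0 hq1 n a b (hx i)
  obtain ⟨K, hK⟩ := (isCompact_torus n 1).exists_bound_of_continuousOn
    ((continuousOn_weight hq0 hq1 ht0 ht1 one_pos).mul
      (continuous_ev (macFun q t lam)).continuousOn)
  -- The term of multidegree `α` in `x` of the kernel, expanded by the `q`-binomial theorem, times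
  -- the remaining integrand.
  let f : (Fin m → ℕ) → (Fin n → ℂ) → ℂ := fun α y =>
    (∏ i, x i ^ α i * ev y⁻¹ (expFam (qWeight a b q) (α i))) *
      (weight (q : ℂ) t y * ev y (macFun q t lam))
  have h1 : HasSum (fun α => torusMean n 1 (f α)) (torusMean n 1 fun y =>
      (∏ i, ∏ j, qPoch (b * x i / y j) q / qPoch (a * x i / y j) q) *
      (weight (q : ℂ) t y * ev y (macFun q t lam))) := by
    refine hasSum_torusMean one_pos (D := fun α => (∏ i, D i (α i)) * K) (fun α => ?_)
      (fun α y hy => ?_) ?_ fun y hy => ?_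
    · refine ContinuousOn.mul (continuousOn_finsetProd _ fun i _ =>
        continuousOn_const.mul (continuousOn_ev_inv one_pos _))
        ((continuousOn_weight hq0 hq1 ht0 ht1 one_pos).mul (continuous_ev _).continuousOn)
    · rw [norm_mul, norm_prod]
      refine mul_le_mul (Finset.prod_le_prod (fun _ _ => norm_nonneg _) fun i _ => hD i y hy _)
        (hK y hy) (norm_nonneg _) (Finset.prod_nonneg fun i _ => hD0 i _)
    · refine Summable.mul_right _ ?_
      have := (hasSum_pi_prod (g := D) (fun i => (hDs i).norm) fun i => (hDs i).hasSum).1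
      exact this.of_norm
    · refine HasSum.mul_right _ ?_
      have h2 := fun i => hasSum_ev_expFam hq0 hq1 a b (hx i) hy
      exact (hasSum_pi_prod (fun i => (hDs i).of_nonneg_of_le (fun _ => norm_nonneg _)
        (hD i y hy)) h2).2
  -- The integral is a torus product of a product in an exponential family with `P_lam`. It is
  -- converted to the other scalar product, where the reproducing property turns it into a
  -- coefficient of the rescaled `P_lam`.
  have h2 : ∀ α, torusMean n 1 (f α) =
      torusProduct n q t (macFun q t lam) (macFun q t lam) / macNorm q t lam *
        ((∏ i, x i ^ α i) * ((scoeff (finExp α) (toSymFun ℝ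
          (scale (fun r => qWeight a b q r * zetaQT q t r) (macFun q t lam))) : ℝ) : ℂ)) := by
    intro α
    have h3 : f α = fun y => (∏ i, x i ^ α i) * (ev y⁻¹ (expProd (qWeight a b q) (finExp α)) *
        ev y (macFun q t lam) * weight (q : ℂ) t y) := by
      funext y
      rw [expProd_finExp, map_prod]
      simp only [f, Finset.prod_mul_distrib]
      ring
    rw [h3, torusMean_const_mul, ← torusProduct, torusProduct_macFun_right hq0 hq1 ht0 ht1,
      pairing_expProd _ _ fun r hr => (zetaQT_pos hq0 hq1 ht0 ht1 r hr).ne',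
      show (zetaQT q t * qWeight a b q) = fun r => qWeight a b q r * zetaQT q t r from
        mul_comm _ _]
    ring
  simp only [h2] at h1
  exact h1.unique ((hasSum_ev _ x).mul_left _)

/-! ### Homogeneity -/

theorem ev_mul_left {S : Type*} [CommRing S] [Algebra ℝ S] (c : ℝ) (x : Fin n → S) (f : Fock ℝ) :
    ev (fun i => algebraMap ℝ S c * x i) f = ev x (scale (fun r => c ^ r) f) := by
  have h : ev (k := ℝ) (fun i => algebraMap ℝ S c * x i) = (ev x).comp (scale fun r => c ^ r) := by
    refine MvPolynomial.algHom_ext fun r => ?_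
    rw [AlgHom.comp_apply, ev_X, scale_X, map_smul, ev_X, Finset.smul_sum]
    refine Finset.sum_congr rfl fun i _ => ?_
    rw [mul_pow, Algebra.smul_def, map_pow]
  rw [h, AlgHom.comp_apply]

theorem mcoeff_scale_pow (c : ℝ) (f : Fock ℝ) (mu : YoungDiagram) :
    mcoeff mu (scale (fun r => c ^ r) f) = c ^ mu.card * mcoeff mu f := by
  let N := mu.colLen 0
  rw [← coeff_restr_finRow _ (le_refl N), ← coeff_restr_finRow _ (le_refl N), restr, ← ev_mul_left,
    ev_eq_aeval, restr]
  have h : ∀ (p : MvPolynomial (Fin N) ℝ) (d : Fin N →₀ ℕ), (MvPolynomial.aeval (R := ℝ)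
      (fun i => algebraMap ℝ (MvPolynomial (Fin N) ℝ) c * MvPolynomial.X i) p).coeff d =
      c ^ d.degree * p.coeff d := by
    intro p d
    induction p using MvPolynomial.induction_on' with
    | monomial e r =>
      have h1 : MvPolynomial.aeval (R := ℝ)
          (fun i => algebraMap ℝ (MvPolynomial (Fin N) ℝ) c * MvPolynomial.X i)
          (MvPolynomial.monomial e r) = MvPolynomial.monomial e (c ^ e.degree * r) := by
        rw [MvPolynomial.aeval_monomial, MvPolynomial.monomial_eq, Finsupp.prod, Finsupp.prod]
        simp only [mul_pow, Finset.prod_mul_distrib, Finset.prod_pow_eq_pow_sum]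
        rw [Finsupp.degree_apply, map_mul, map_pow]
        simp only [MvPolynomial.algebraMap_eq]
        ring
      rw [h1, MvPolynomial.coeff_monomial, MvPolynomial.coeff_monomial]
      split_ifs with he
      · rw [he]
      · rw [mul_zero]
    | add p p' hp hp' =>
      rw [map_add, MvPolynomial.coeff_add, hp, hp', MvPolynomial.coeff_add, mul_add]
  rw [h]
  congr 2
  rw [← psum_self, psum_finRow_self le_rfl]

/-- A Macdonald function is homogeneous: dominance preserves the number of cells. -/
theorem scale_pow_macFun (c : ℝ) (lam : YoungDiagram) :
    scale (fun r => c ^ r) (macFun q t lam) = c ^ lam.card • macFun q t lam := by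
  refine fock_ext fun mu => ?_
  rw [mcoeff_scale_pow, map_smul, smul_eq_mul]
  by_cases h : mcoeff mu (macFun q t lam) = 0
  · rw [h, mul_zero, mul_zero]
  · rw [(triangular_macFun q t lam mu h).1]

/-- Integration of a Macdonald function against a Cauchy kernel. -/
theorem torusMean_kernel (hq0 : 0 < q) (hq1 : q < 1) (ht0 : 0 < t) (ht1 : t < 1) (a b : ℝ)
    (lam : YoungDiagram) {R : ℝ} (hR : 0 < R) {x : Fin m → ℂ} (hx : ∀ i, |a| * ‖x i‖ < R) :
    torusMean n R (fun y => (∏ i, ∏ j, qPoch (b * x i / y j) q / qPoch (a * x i / y j) q) *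
      (weight (q : ℂ) t y * ev y (macFun q t lam))) =
    torusProduct n q t (macFun q t lam) (macFun q t lam) / macNorm q t lam *
      ev x (scale (fun r => qWeight a b q r * zetaQT q t r) (macFun q t lam)) := by
  have hR' : (R : ℂ) ≠ 0 := by exact_mod_cast hR.ne'
  -- Kernel and weight depend only on ratios of variables, so everything is rescaled to the unit
  -- torus; homogeneity produces the same power of `R` on both sides.
  let x' : Fin m → ℂ := fun i => x i / R
  have hxx' : x = fun i => algebraMap ℝ ℂ R * x' i := by
    funext i
    exact (mul_div_cancel₀ _ hR').symm
  have key := torusMean_kernel_one (n := n) hq0 hq1 ht0 ht1 a b lam (x := x') fun i => by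
    rw [norm_div, Complex.norm_real, Real.norm_eq_abs, abs_of_pos hR, ← mul_div_assoc,
      div_lt_one hR]
    exact hx i
  have e1 : ∀ y : Fin n → ℂ, ev (fun i => (R : ℂ) * y i) (macFun q t lam) =
      (R : ℂ) ^ lam.card * ev y (macFun q t lam) := fun y => by
    have := ev_mul_left R y (macFun q t lam)
    rw [scale_pow_macFun, map_smul, Complex.real_smul, Complex.ofReal_pow] at this
    exact this
  have e2 : ev x (scale (fun r => qWeight a b q r * zetaQT q t r) (macFun q t lam)) =
      (R : ℂ) ^ lam.card *
        ev x' (scale (fun r => qWeight a b q r * zetaQT q t r) (macFun q t lam)) := by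
    rw [hxx', ev_mul_left, scale_scale, mul_comm, ← scale_scale, scale_pow_macFun, map_smul,
      map_smul, Complex.real_smul, Complex.ofReal_pow]
  rw [torusMean_scale hR, e2, mul_left_comm, ← key, ← torusMean_const_mul]
  congr 1
  funext y
  rw [weight_smul _ hR', e1]
  have e3 : ∀ (c : ℝ) i j, (c : ℂ) * x i / (R * y j) = c * x' i / y j := fun c i j => by
    rw [← div_div, mul_div_assoc]
  simp only [e3]
  ring

end

end Macdonald


/-! ### The iterated integrals and the Kostka functions -/

namespace Macdonald

/-! ### Evaluation of symmetric functions -/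

section

variable {n : ℕ} {q t : ℝ}

theorem ev_eq_sum (f : Fock ℝ) (x : Fin n → ℂ) : ev x f =
    ∑ d ∈ (restr ℝ n f).support, (((restr ℝ n f).coeff d : ℝ) : ℂ) * ∏ i, x i ^ d i := by
  rw [ev_eq_aeval, MvPolynomial.aeval_def, MvPolynomial.eval₂_eq]
  refine Finset.sum_congr rfl fun d _ => congrArg _ ?_
  exact Finset.prod_subset (Finset.subset_univ _) fun i _ hi => by
    rw [Finsupp.notMem_support_iff.mp hi, pow_zero]

theorem evalFin_toSymFun (f : Fock ℝ) (x : Fin n → ℂ) : evalFin (toSymFun ℝ f) x = ev x f := by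
  rw [evalFin, ev_eq_sum]
  simp only [← coe_restr, MvPolynomial.coeff_coe]
  refine finsum_eq_sum_of_support_subset _ fun d hd => ?_
  rw [Finset.mem_coe, MvPolynomial.mem_support_iff]
  intro h
  refine hd ?_
  simp only [h, Complex.ofReal_zero, zero_mul]

theorem scalarProductFin_toSymFun (q t : ℝ) (f g : Fock ℝ) :
    scalarProductFin n q t (toSymFun ℝ f) (toSymFun ℝ g) =
      1 / (n.factorial : ℂ) * torusProduct n q t f g := by
  simp only [scalarProductFin, torusProduct, evalFin_toSymFun]
  rfl

/-! ### Extraction of Schur coefficients -/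

theorem continuousOn_monomial {R : ℝ} (hR : 0 < R) (d : Fin n → ℤ) :
    ContinuousOn (fun x : Fin n → ℂ => ∏ i, x i ^ d i) (torus n R) :=
  continuousOn_finsetProd _ fun i _ => (continuous_apply i).continuousOn.zpow₀ _ fun _ hx =>
    Or.inl (torus_ne_zero hR hx i)

/-- Integration extracts the coefficient of `x^e`; an exponent with a negative entry does not occur
in a polynomial. -/
theorem torusMean_monomial_mul_ev {R : ℝ} (hR : 0 < R) (e : Fin n → ℤ) (f : Fock ℝ) :
    torusMean n R (fun x => (∏ i, x i ^ (-e i)) * ev x f) =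
      ((if ∀ i, 0 ≤ e i then scoeff (finExp fun i => (e i).toNat) (toSymFun ℝ f) else 0 : ℝ) :
        ℂ) := by
  have h1 : torusMean n R (fun x => (∏ i, x i ^ (-e i)) * ev x f) =
      torusMean n R fun x => ∑ d ∈ (restr ℝ n f).support,
        (((restr ℝ n f).coeff d : ℝ) : ℂ) * ∏ i, x i ^ ((d i : ℤ) - e i) := by
    refine torusMean_congr hR fun x hx => ?_
    rw [ev_eq_sum, Finset.mul_sum]
    refine Finset.sum_congr rfl fun d _ => ?_
    rw [mul_left_comm, ← Finset.prod_mul_distrib]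
    refine congrArg _ (Finset.prod_congr rfl fun i _ => ?_)
    rw [← zpow_natCast, ← zpow_add₀ (torus_ne_zero hR hx i), neg_add_eq_sub]
  have hc : ∀ d ∈ (restr ℝ n f).support, ContinuousOn (fun x : Fin n → ℂ =>
      (((restr ℝ n f).coeff d : ℝ) : ℂ) * ∏ i, x i ^ ((d i : ℤ) - e i)) (torus n R) := fun d _ =>
    continuousOn_const.mul (continuousOn_monomial hR _)
  rw [h1, torusMean_sum hR _ hc]
  simp only [torusMean_const_mul, torusMean_monomial hR, mul_ite, mul_one, mul_zero]
  have h2 : ∀ d : Fin n →₀ ℕ, ((fun i => (d i : ℤ) - e i) = 0) ↔ ∀ i, (d i : ℤ) = e i := fun d => by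
    rw [funext_iff]
    exact forall_congr' fun i => sub_eq_zero
  simp only [h2]
  split_ifs with he
  · let d₀ : Fin n →₀ ℕ := Finsupp.equivFunOnFinite.symm fun i => (e i).toNat
    have h3 : ∀ d : Fin n →₀ ℕ, (∀ i, (d i : ℤ) = e i) ↔ d₀ = d := by
      intro d
      rw [Finsupp.ext_iff]
      refine forall_congr' fun i => ?_
      have := he i
      change _ ↔ (e i).toNat = d i
      omega
    simp only [h3]
    rw [Finset.sum_ite_eq, finExp, ← coeff_restr]
    split_ifs with h4
    · rfl
    · rw [MvPolynomial.notMem_support_iff.mp h4, Complex.ofReal_zero]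
  · rw [Complex.ofReal_zero]
    refine Finset.sum_eq_zero fun d _ => if_neg fun h => he fun i => ?_
    rw [← h i]
    exact Int.natCast_nonneg _

/-- Factoring `x_j` out of each `1/x_j - 1/x_i` shows that the product is `∏ x_i^i` (with `i`
counted from `0`) times the Vandermonde determinant in the inverses; the determinant is then
expanded. -/
theorem prod_one_sub_div {x : Fin n → ℂ} (hx : ∀ i, x i ≠ 0) :
    ∏ i, ∏ j ∈ Finset.univ.filter (fun j => i < j), (1 - x j / x i) =
      ∑ g : Equiv.Perm (Fin n), ((Equiv.Perm.sign g : ℤ) : ℂ) *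
        ∏ i, x i ^ ((i : ℤ) - (g i : ℤ)) := by
  have h1 : ∏ i, ∏ j ∈ Finset.univ.filter (fun j => i < j), (1 - x j / x i) =
      (∏ i : Fin n, x i ^ (i : ℕ)) * (Matrix.vandermonde x⁻¹).det := by
    have h2 : ∏ i : Fin n, x i ^ (i : ℕ) = ∏ i : Fin n, ∏ j ∈ Finset.Ioi i, x j := by
      rw [Finset.prod_comm' (t' := Finset.univ) (s' := fun j => Finset.Iio j)]
      · refine Finset.prod_congr rfl fun j _ => ?_
        rw [Finset.prod_const, Fin.card_Iio]
      · intro i j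
        simp
    rw [Matrix.det_vandermonde, h2, ← Finset.prod_mul_distrib]
    refine Finset.prod_congr rfl fun i _ => ?_
    rw [← Finset.prod_mul_distrib]
    refine Finset.prod_congr (by ext; simp) fun j _ => ?_
    rw [Pi.inv_apply, Pi.inv_apply, mul_sub, mul_inv_cancel₀ (hx j), div_eq_mul_inv]
  rw [h1, ← Matrix.det_transpose, Matrix.det_apply', Finset.mul_sum]
  refine Finset.sum_congr rfl fun g _ => ?_
  rw [mul_left_comm, ← Finset.prod_mul_distrib]
  refine congrArg _ (Finset.prod_congr rfl fun i _ => ?_)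
  rw [Matrix.transpose_apply, Matrix.vandermonde_apply, Pi.inv_apply, zpow_sub₀ (hx i),
    zpow_natCast, zpow_natCast, inv_pow, div_eq_mul_inv]

/-- Integration against the Schur kernel computes the dual coefficients. -/
theorem torusMean_schurFactor (lam : YoungDiagram) {R : ℝ} (hR : 0 < R) (f : Fock ℝ) :
    torusMean (lam.colLen 0) R (fun x => schurFactor lam x * ev x f) =
      ((schurFunctional lam (toSymFun ℝ f) : ℝ) : ℂ) := by
  have h1 : torusMean (lam.colLen 0) R (fun x => schurFactor lam x * ev x f) =
      torusMean (lam.colLen 0) R fun x => ∑ g : Equiv.Perm (Fin (lam.colLen 0)),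
        ((Equiv.Perm.sign g : ℤ) : ℂ) * ((∏ i, x i ^ (-schurExp lam g i)) * ev x f) := by
    refine torusMean_congr hR fun x hx => ?_
    have hx0 := torus_ne_zero hR hx
    rw [schurFactor, prod_one_sub_div hx0, Finset.mul_sum, Finset.sum_mul]
    refine Finset.sum_congr rfl fun g _ => ?_
    rw [mul_left_comm, mul_assoc, ← Finset.prod_mul_distrib]
    congr 3
    funext i
    rw [← zpow_add₀ (hx0 i), schurExp]
    congr 1
    ring
  have hc : ∀ g ∈ (Finset.univ : Finset (Equiv.Perm (Fin (lam.colLen 0)))), ContinuousOn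
      (fun x : Fin (lam.colLen 0) → ℂ => ((Equiv.Perm.sign g : ℤ) : ℂ) *
        ((∏ i, x i ^ (-schurExp lam g i)) * ev x f)) (torus (lam.colLen 0) R) := fun g _ =>
    continuousOn_const.mul ((continuousOn_monomial hR _).mul (continuous_ev f).continuousOn)
  rw [h1, torusMean_sum hR _ hc, schurFunctional_apply, Complex.ofReal_sum]
  refine Finset.sum_congr rfl fun g _ => ?_
  rw [torusMean_const_mul, torusMean_monomial_mul_ev hR, Units.smul_def, zsmul_eq_mul,
    Complex.ofReal_mul, Complex.ofReal_intCast]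

/-! ### The empty partition -/

theorem macFun_bot {lam : YoungDiagram} (h : lam.card = 0) : macFun q t lam = 1 := by
  have hb : ∀ mu : YoungDiagram, mu.card = 0 → mu = ⊥ := fun mu hmu => by
    apply YoungDiagram.ext
    rw [YoungDiagram.cells_bot]
    exact Finset.card_eq_zero.mp hmu
  have hexp : ∀ mu : YoungDiagram, expo mu = 0 ↔ mu = ⊥ := fun mu => by
    constructor
    · intro h0
      refine hb mu ?_
      rw [← sum_range_rowLen mu le_rfl]
      exact Finset.sum_eq_zero fun i _ => DFunLike.congr_fun h0 i
    · rintro rfl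
      ext i
      change (⊥ : YoungDiagram).rowLen i = 0
      rw [rowLen_eq_zero_iff]
      simp [YoungDiagram.colLen_eq_card, YoungDiagram.col]
  refine fock_ext fun mu => ?_
  have h1 : mcoeff mu (1 : Fock ℝ) = if mu = ⊥ then 1 else 0 := by
    rw [mcoeff_apply, map_one, scoeff_apply]
    change MvPowerSeries.coeff (expo mu) (1 : MvPowerSeries ℕ ℝ) = _
    rw [MvPowerSeries.coeff_one]
    exact if_congr (hexp mu) rfl rfl
  have hlam := hb lam h
  rw [h1]
  split_ifs with hmu
  · rw [hmu, ← hlam, mcoeff_macFun_self]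
  · by_contra hne
    exact hmu (hb mu ((triangular_macFun q t lam mu hne).1 ▸ h))

/-! ### Sums of rectangles -/

theorem rowLen_rectSum (r s : ℕ → ℕ) (a i : ℕ) :
    (rectSum r s a).rowLen i = ∑ b ∈ Finset.Icc 1 a, if i < r b then s b else 0 := by
  refine eq_of_forall_lt_iff fun j => ?_
  rw [← YoungDiagram.mem_iff_lt_rowLen, mem_rectSum]

theorem rowLen_rectSum_succ (r s : ℕ → ℕ) (a i : ℕ) : (rectSum r s (a + 1)).rowLen i =
    (rectSum r s a).rowLen i + if i < r (a + 1) then s (a + 1) else 0 := by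
  rw [rowLen_rectSum, rowLen_rectSum, Finset.sum_Icc_succ_top (by omega)]

theorem colLen_rectSum_le {M : ℕ} {r : ℕ → ℕ} (s : ℕ → ℕ) (hr : ∀ a < M, r a < r (a + 1)) {a : ℕ}
    (ha : a ≤ M) : (rectSum r s a).colLen 0 ≤ r a := by
  have hmono : ∀ b ≤ a, r b ≤ r a := by
    intro b hb
    induction a, hb using Nat.le_induction with
    | base => exact le_rfl
    | succ c hc ih => exact (ih (by omega)).trans (hr c (by omega)).le
  rw [← rowLen_eq_zero_iff, rowLen_rectSum]
  refine Finset.sum_eq_zero fun b hb => if_neg ?_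
  have := hmono b (Finset.mem_Icc.mp hb).2
  omega

theorem card_rectSum_zero (r s : ℕ → ℕ) : (rectSum r s 0).card = 0 := by
  rw [← sum_range_rowLen _ le_rfl]
  exact Finset.sum_eq_zero fun i _ => by rw [rowLen_rectSum]; rfl

/-! ### The iterated integrals -/

/-- The ratio of the norms of a Macdonald function for the two scalar products. -/
noncomputable def normRatio (q t : ℝ) (n : ℕ) (lam : YoungDiagram) : ℂ :=
  torusProduct n q t (macFun q t lam) (macFun q t lam) / macNorm q t lam

/-- With at most `n` parts the leading monomial survives in `n` variables, so positivity applies. -/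
theorem normRatio_ne_zero (hq0 : 0 < q) (hq1 : q < 1) (ht0 : 0 < t) (ht1 : t < 1)
    {lam : YoungDiagram} (hl : lam.colLen 0 ≤ n) : normRatio q t n lam ≠ 0 := by
  refine div_ne_zero (fun h => ?_) (by exact_mod_cast (macNorm_pos hq0 hq1 ht0 ht1 lam).ne')
  have h1 := restr_eq_zero_of_torusProduct hq0 hq1 ht0 ht1 h
  have h2 := coeff_restr_finRow (macFun q t lam) hl
  rw [h1, mcoeff_macFun_self, MvPolynomial.coeff_zero] at h2
  exact zero_ne_one h2

theorem normRatio_bot (hq0 : 0 < q) (hq1 : q < 1) (ht0 : 0 < t) (ht1 : t < 1)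
    {lam : YoungDiagram} (h : lam.card = 0) : normRatio q t 0 lam = 1 := by
  have h1 : torusProduct 0 q t (macFun q t lam) (macFun q t lam) = 1 := by
    rw [torusProduct, macFun_bot h]
    have := torusMean_monomial (n := 0) one_pos 0
    rw [if_pos rfl] at this
    rw [← this]
    congr 1
    funext x
    simp [weight]
  have h2 : macNorm q t lam = 1 := by
    rw [macNorm, macFun_bot h]
    have h3 := pairing_expProd (zetaQT q t) 1 (fun n hn => (zetaQT_pos hq0 hq1 ht0 ht1 n hn).ne') 0
      (1 : Fock ℝ)
    rw [map_one (scale _), map_one (toSymFun ℝ), scoeff_apply, expProd,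
      Finsupp.prod_zero_index] at h3
    change _ = MvPowerSeries.coeff 0 (1 : MvPowerSeries ℕ ℝ) at h3
    rw [MvPowerSeries.coeff_one, if_pos rfl] at h3
    exact h3
  rw [normRatio, h1, h2, Complex.ofReal_one, div_one]

/-- The `r_a!` in the constant cancels the `1/r_a!` in the scalar product, which leaves the inverse
norm ratios. -/
theorem cPlus_eq (hq0 : 0 < q) (hq1 : q < 1) (ht0 : 0 < t) (ht1 : t < 1) (r s : ℕ → ℕ) (M : ℕ) :
    cPlus q t r s M = ∏ a ∈ Finset.Icc 1 M, (normRatio q t (r a) (rectSum r s a))⁻¹ := by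
  rw [cPlus]
  refine Finset.prod_congr rfl fun a _ => ?_
  have h : ((r a).factorial : ℂ) ≠ 0 := by exact_mod_cast (r a).factorial_ne_zero
  rw [macdonaldP_real hq0 hq1 ht0 ht1, scalarProduct_toSymFun, scalarProductFin_toSymFun,
    ← mul_assoc, mul_one_div_cancel h, one_mul, normRatio, inv_div, macNorm]

/-- Induction on the layers: `∏ y_j^{s_a}` adds the next rectangle to the Macdonald function
obtained so far, and integrating against `Π` moves the result to the next set of variables at the
cost of one norm ratio. -/
theorem layers_eq (hq0 : 0 < q) (hq1 : q < 1) (ht0 : 0 < t) (ht1 : t < 1) {M : ℕ} {r : ℕ → ℕ}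
    (s : ℕ → ℕ) {R : ℕ → ℝ} (hr : ∀ a < M, r a < r (a + 1)) (hR : NestedRadii M R) {a : ℕ}
    (ha : a ≤ M) {m : ℕ} {x : Fin m → ℂ} (hx : 1 ≤ a → ∀ i, ‖x i‖ < R a) :
    layers q t r s R a x = (∏ b ∈ Finset.Icc 1 a, normRatio q t (r b) (rectSum r s b)) *
      ev x (macFun q t (rectSum r s a)) := by
  induction a generalizing m with
  | zero =>
    rw [macFun_bot (card_rectSum_zero r s), map_one]
    simp [layers]
  | succ a ih =>
    have hRa : 0 < R (a + 1) := hR.1 _ ha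
    let K : ℂ := ∏ b ∈ Finset.Icc 1 a, normRatio q t (r b) (rectSum r s b)
    have h1 : layers q t r s R (a + 1) x = torusMean (r (a + 1)) (R (a + 1)) fun y =>
        K * ((∏ i, ∏ j, qPoch ((t : ℝ) * x i / y j) q / qPoch ((1 : ℝ) * x i / y j) q) *
          (weight (q : ℂ) t y * ev y (macFun q t (rectSum r s (a + 1))))) := by
      rw [layers]
      refine torusMean_congr hRa fun y hy => ?_
      rw [ih (by omega) fun ha1 i => by rw [hy i]; exact hR.2 a ha1 (by omega),
        ev_macFun_add_columns hq0 hq1 ht0 ht1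
          ((colLen_rectSum_le s hr (by omega : a ≤ M)).trans (hr a (by omega)).le)
          (rowLen_rectSum_succ r s a), Finset.prod_pow]
      simp only [cauchyKernel, div_eq_mul_inv, Complex.ofReal_one, one_mul, K]
      ring
    rw [h1, torusMean_const_mul, torusMean_kernel hq0 hq1 ht0 ht1 1 t _ hRa fun i => by
      rw [abs_one, one_mul]; exact hx (by omega) i, Finset.prod_Icc_succ_top (by omega), ← mul_assoc]
    congr 2
    -- For `a = 1`, `b = t` the kernel weights `(1 - t^k)/(1 - q^k)` are inverse to those of the
    -- scalar product, so `Π` reproduces the function itself.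
    rw [← scale_one (macFun q t (rectSum r s (a + 1))), scale_scale]
    refine scale_congr (fun k hk => ?_) _
    have e1 := sub_ne_zero.mpr (pow_ne_one_of_lt_one hq0 hq1 k hk).symm
    have e2 := sub_ne_zero.mpr (pow_ne_one_of_lt_one ht0 ht1 k hk).symm
    rw [Pi.mul_apply, Pi.one_apply, qWeight, zetaQT, one_pow]
    field_simp

theorem prod_pow_mul_layers (hq0 : 0 < q) (hq1 : q < 1) (ht0 : 0 < t) (ht1 : t < 1) {M : ℕ}
    {r : ℕ → ℕ} (s : ℕ → ℕ) {R : ℕ → ℝ} (hr0 : r 0 = 0) (hr : ∀ a < M, r a < r (a + 1))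
    (hR : NestedRadii M R) {y : Fin (r M) → ℂ} (hy : y ∈ torus (r M) (R M)) :
    cPlus q t r s M * normRatio q t (r M) (rectSum r s M) *
      ((∏ j, y j ^ s M) * layers q t r s R (M - 1) y) = ev y (macFun q t (rectSum r s M)) := by
  rw [cPlus_eq hq0 hq1 ht0 ht1]
  -- For the empty partition `r 0 = 0`, there are no variables, and the truncated `M - 1 = 0`
  -- selects the trivial layer.
  rcases M with _ | M
  · have : IsEmpty (Fin (r 0)) := by rw [hr0]; infer_instance
    have h1 : normRatio q t (r 0) (rectSum r s 0) = 1 := by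
      rw [hr0, normRatio_bot hq0 hq1 ht0 ht1 (card_rectSum_zero r s)]
    rw [macFun_bot (card_rectSum_zero r s), map_one, h1]
    simp [layers]
  · rw [Nat.add_sub_cancel, layers_eq hq0 hq1 ht0 ht1 s hr hR (by omega) fun h1 i => by
      rw [hy i]; exact hR.2 M h1 (by omega), ev_macFun_add_columns hq0 hq1 ht0 ht1
      ((colLen_rectSum_le s hr (by omega : M ≤ M + 1)).trans (hr M (by omega)).le)
      (rowLen_rectSum_succ r s M), Finset.prod_pow, Finset.prod_Icc_succ_top (by omega),
      Finset.prod_inv_distrib]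
    have e1 := normRatio_ne_zero hq0 hq1 ht0 ht1 (colLen_rectSum_le s hr (le_refl (M + 1)))
    have e2 : ∏ b ∈ Finset.Icc 1 M, normRatio q t (r b) (rectSum r s b) ≠ 0 :=
      Finset.prod_ne_zero_iff.mpr fun b hb => normRatio_ne_zero hq0 hq1 ht0 ht1
        (colLen_rectSum_le s hr ((Finset.mem_Icc.mp hb).2.trans (Nat.le_succ M)))
    field_simp

/-- The iterated integral of the layers against a Cauchy kernel. -/
theorem torusMean_layers (hq0 : 0 < q) (hq1 : q < 1) (ht0 : 0 < t) (ht1 : t < 1) {M : ℕ}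
    {r : ℕ → ℕ} (s : ℕ → ℕ) {R : ℕ → ℝ} (hr0 : r 0 = 0) (hr : ∀ a < M, r a < r (a + 1))
    (hR : NestedRadii M R) (a b : ℝ) {x : Fin n → ℂ} (hx : ∀ i, |a| * ‖x i‖ < R M) :
    torusMean (r M) (R M) (fun y =>
      (∏ i, ∏ j, qPoch (b * x i / y j) q / qPoch (a * x i / y j) q) * FPlus q t r s R M y) =
    ev x (scale (fun k => qWeight a b q k * zetaQT q t k) (macFun q t (rectSum r s M))) := by
  have hRM := hR.1 M le_rfl
  have hκ := normRatio_ne_zero hq0 hq1 ht0 ht1 (colLen_rectSum_le s hr (le_refl M))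
  refine mul_left_cancel₀ hκ ?_
  have key := torusMean_kernel (n := r M) hq0 hq1 ht0 ht1 a b (rectSum r s M) hRM hx
  rw [← normRatio] at key
  rw [← key, ← torusMean_const_mul]
  refine torusMean_congr hRM fun y hy => ?_
  rw [← prod_pow_mul_layers hq0 hq1 ht0 ht1 s hr0 hr hR hy, FPlus]
  ring

theorem ofReal_hookFactor (q t : ℝ) (mu : YoungDiagram) :
    ((hookFactor q t mu : ℝ) : ℂ) = hookFactor (q : ℂ) t mu := by
  simp [hookFactor]

/-- The kernel `1/(x_i/y_j;q)_∞` has weights `1/(1 - q^k)`; times `(1 - q^k)/(1 - t^k)` they give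
the rescaling `p_k ↦ p_k/(1 - t^k)`, and `schurFactor` then extracts the Schur functional.
Convergence on the contours needs `ρ < R_M`. -/
theorem torusMean_FPlus (hq0 : 0 < q) (hq1 : q < 1) (ht0 : 0 < t) (ht1 : t < 1)
    (lam : YoungDiagram) {mu : YoungDiagram} {M : ℕ} {r s : ℕ → ℕ} {R : ℕ → ℝ} {ρ : ℝ}
    (hmu : IsRectDecomposition mu M r s) (hR : NestedRadii M R) (hρ0 : 0 < ρ) (hρ : ρ < R M) :
    (torusMean (lam.colLen 0) ρ fun x => torusMean (r M) (R M) fun y =>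
      schurFactor lam x * (∏ i, ∏ j, 1 / qPoch (x i / y j) q) * FPlus q t r s R M y) =
    ((schurFunctional lam (toSymFun ℝ (scale (zetaT t) (macFun q t mu))) : ℝ) : ℂ) := by
  obtain ⟨hr0, hr, -, rfl⟩ := hmu
  rw [← torusMean_schurFactor lam hρ0]
  refine torusMean_congr hρ0 fun x hx => ?_
  have key := torusMean_layers hq0 hq1 ht0 ht1 s hr0 hr hR 1 0 (x := x) fun i => by
    rw [abs_one, one_mul, hx i]
    exact hρ
  have h1 : scale (fun k => qWeight 1 0 q k * zetaQT q t k) (macFun q t (rectSum r s M)) =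
      scale (zetaT t) (macFun q t (rectSum r s M)) := by
    refine scale_congr (fun k hk => ?_) _
    have e1 := sub_ne_zero.mpr (pow_ne_one_of_lt_one hq0 hq1 k hk).symm
    have e2 := sub_ne_zero.mpr (pow_ne_one_of_lt_one ht0 ht1 k hk).symm
    rw [qWeight, zetaQT, zetaT, one_pow, zero_pow hk.ne']
    field_simp
    ring
  rw [← h1, ← key, ← torusMean_const_mul]
  congr 1
  funext y
  simp only [Complex.ofReal_zero, zero_mul, zero_div, qPoch_zero, Complex.ofReal_one, one_mul]
  ring

/-- The layers are run for `mu'` with `q` and `t` exchanged, and the duality turns the result into a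
multiple of the rescaled `P_mu(q,t)`. That multiple is the norm of `P_{mu'}(t,q)`, by which `cMinus`
differs from `cPlus`. The kernel `(-x_i/y_j;t)_∞` is entire in `x_i`, so no bound on `ρ` is needed.
-/
theorem torusMean_FMinus (hq0 : 0 < q) (hq1 : q < 1) (ht0 : 0 < t) (ht1 : t < 1)
    (lam : YoungDiagram) {mu : YoungDiagram} {M : ℕ} {r s : ℕ → ℕ} {R : ℕ → ℝ} {ρ : ℝ}
    (hmu : IsRectDecomposition mu.transpose M r s) (hR : NestedRadii M R) (hρ0 : 0 < ρ) :
    (torusMean (lam.colLen 0) ρ fun x => torusMean (r M) (R M) fun y =>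
      schurFactor lam x * (∏ i, ∏ j, qPoch (-(x i) / y j) t) * FMinus q t r s R M y) =
    ((schurFunctional lam (toSymFun ℝ (scale (zetaT t) (macFun q t mu))) : ℝ) : ℂ) := by
  obtain ⟨hr0, hr, -, hmu⟩ := hmu
  rw [← torusMean_schurFactor lam hρ0]
  refine torusMean_congr hρ0 fun x hx => ?_
  have key := torusMean_layers ht0 ht1 hq0 hq1 s hr0 hr hR 0 (-1) (x := x) fun i => by
    rw [abs_zero, zero_mul]
    exact hR.1 M le_rfl
  have hN : ((macNorm t q mu.transpose : ℝ) : ℂ) ≠ 0 := by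
    exact_mod_cast (macNorm_pos ht0 ht1 hq0 hq1 mu.transpose).ne'
  rw [← hmu, scale_neg_macFun hq0 hq1 ht0 ht1, YoungDiagram.transpose_transpose, map_smul,
    Complex.real_smul] at key
  refine mul_left_cancel₀ hN ?_
  rw [mul_left_comm, ← key, ← torusMean_const_mul, ← torusMean_const_mul]
  congr 1
  funext y
  have h1 : ((scalarProduct t q (macdonaldP t q (rectSum r s M))
      (macdonaldP t q (rectSum r s M)) : ℝ) : ℂ) = macNorm t q mu.transpose := by
    rw [macdonaldP_real ht0 ht1 hq0 hq1, scalarProduct_toSymFun, hmu, macNorm]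
  simp only [Complex.ofReal_zero, zero_mul, zero_div, qPoch_zero, Complex.ofReal_neg,
    Complex.ofReal_one, neg_mul, one_mul, div_one, FMinus, FPlus, cMinus, h1]
  field_simp

end

end Macdonald

theorem theorem3p10 (lam mu : YoungDiagram) :
    Macdonald.kostka Macdonald.qInd Macdonald.tInd lam mu =
      Macdonald.bracket Macdonald.qInd Macdonald.tInd
        (Macdonald.bigSchurQT Macdonald.qInd Macdonald.tInd lam)
        (Macdonald.macdonaldM Macdonald.qInd Macdonald.tInd mu) ∧
    ∀ q t : ℝ, 0 < q → q < 1 → 0 < t → t < 1 →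
      (∀ (M : ℕ) (r s : ℕ → ℕ) (R : ℕ → ℝ) (ρ : ℝ),
        Macdonald.IsRectDecomposition mu M r s → Macdonald.NestedRadii M R →
        0 < ρ → ρ < R M →
        Macdonald.HasValueAt (Macdonald.kostka Macdonald.qInd Macdonald.tInd lam mu) q t
          (Macdonald.hookFactor (q : ℂ) (t : ℂ) mu *
            Macdonald.torusMean (lam.colLen 0) ρ fun x =>
              Macdonald.torusMean (r M) (R M) fun y =>
                Macdonald.schurFactor lam x *
                  (∏ i, ∏ j, 1 / Macdonald.qPoch (x i / y j) q) *
                  Macdonald.FPlus q t r s R M y)) ∧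
      (∀ (M : ℕ) (r s : ℕ → ℕ) (R : ℕ → ℝ) (ρ : ℝ),
        Macdonald.IsRectDecomposition mu.transpose M r s → Macdonald.NestedRadii M R →
        0 < ρ →
        Macdonald.HasValueAt (Macdonald.kostka Macdonald.qInd Macdonald.tInd lam mu) q t
          (Macdonald.hookFactor (q : ℂ) (t : ℂ) mu *
            Macdonald.torusMean (lam.colLen 0) ρ fun x =>
              Macdonald.torusMean (r M) (R M) fun y =>
                Macdonald.schurFactor lam x *
                  (∏ i, ∏ j, Macdonald.qPoch (-(x i) / y j) t) *
                  Macdonald.FMinus q t r s R M y)) := by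
  refine ⟨Macdonald.kostka_eq_bracket Macdonald.qInd_pow_ne_one Macdonald.tInd_pow_ne_one lam mu,
    fun q t hq0 hq1 ht0 ht1 => ?_⟩
  -- Regularity and the value are settled algebraically; the two integrals only have to reproduce
  -- this value.
  have key := (Macdonald.hasRealValueAt_kostka hq0 hq1 ht0 ht1 lam mu).hasValueAt
  rw [Complex.ofReal_mul, Macdonald.ofReal_hookFactor] at key
  refine ⟨fun M r s R ρ hmu hR hρ0 hρ => ?_, fun M r s R ρ hmu hR hρ0 => ?_⟩
  · rwa [Macdonald.torusMean_FPlus hq0 hq1 ht0 ht1 lam hmu hR hρ0 hρ]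
  · rwa [Macdonald.torusMean_FMinus hq0 hq1 ht0 ht1 lam hmu hR hρ0]
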